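/- \textbf{Setting.} A directed network over time consists of a finite directed graph with node set $V$ and edge set $E$ (parallel edges allowed), capacities $u_e\in[0,\infty]$, transit times $\tau_e\ge 0$, balances $b_v\in\mathbb R$ with $\sum_v b_v=0$, and a time horizon $T\ge 0$. Put $S^+=\{v: b_v>0\}$, $S^-=\{v: b_v<0\}$ and $B=\sum_{v\in S^+}b_v$. A flow over time $f$ with horizon $T$ assigns to each edge $e$ an integrable rate function $f_e:[0,T)\to\mathbb R_{\ge 0}$ (extended by $0$) with $f_e\le u_e$ and $f_e(\theta)=0$ for $\theta\ge T-\tau_e$, such that the excess $$\mathrm{ex}_f(v,\theta)=\sum_{e\in\delta^-(v)}\int_0^{\theta-\tau_e}f_e(\xi)\,d\xi-\sum_{e\in\delta^+(v)}\int_0^{\theta}f_e(\xi)\,d\xi$$ satisfies, for all $\theta\in[0,T)$: $\mathrm{ex}_f(v,\theta)\ge 0$ and $\mathrm{ex}_f(v,T)=0$ if $b_v=0$; $0\ge \mathrm{ex}_f(v,\theta)\ge -b_v$ if $v\in S^+$; $0\le \mathrm{ex}_f(v,\theta)\le -b_v$ if $v\in S^-$. Its value is $|f|=\sum_{v\in S^-}\mathrm{ex}_f(v,T)$.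 An undirected network over time is defined likewise on an undirected graph, with finite capacities. A flow over time in it is a flow over time in the directed network that arises when each edge $e=\{v,w\}$ is replaced by two new nodes $x_e,y_e$ of balance $0$, an edge $(x_e,y_e)$ with capacity $u_e$ and transit time $\tau_e$, and edges $(v,x_e),(w,x_e),(y_e,v),(y_e,w)$ with infinite capacity and zero transit time. An orientation replaces each edge $\{v,w\}$ by exactly one of $(v,w)$, $(w,v)$, with the same capacity and transit time; the balances are kept. \textbf{Theorem.} Let $N=(G,u,b,\tau,T)$ be an undirected network over time in which $B$ units of flow can be sent within time horizon $T$, that is, there is a flow over time of value $B$ with horizon $T$ in $N$. Then there exist an orientation $\overrightarrow N$ of $N$ and a flow over time in $\overrightarrow N$ with horizon $2T$ (and with the same balances $b$) of value at least $B/2$. Moreover, such an orientation and flow over time can be computed in polynomial time. That is, there is an algorithm which, for every undirected network over time whose data $u,b,\tau,T$ are rational numbers, given as fractions of integers in binary, halts after a number of bit operations polynomial in the encoding length of the input (measured on a random access machine with logarithmic cost), and which outputs, whenever $B$ units of flow can be sent within time horizon $T$ in the given network, an orientation and a flow over time in it with horizon $2T$ and value at least $B/2$; the flow is output explicitly, each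 rate function being a finite sum of rational constants on intervals with rational end points. -/

import Mathlib

/-! ### Networks over time and their orientations -/

/-- A directed network over time with node set `V` and edge set `E` (parallel edges allowed):
capacities in `[0, ∞]`, transit times in `[0, ∞)` and balances that sum to zero.  The time
horizon is kept as a separate argument of the notions below. -/
structure DirectedNetwork (V E : Type*) [Fintype V] where
  tail : E → V
  head : E → V
  cap : E → EReal
  cap_nonneg : ∀ e, 0 ≤ cap e
  transit : E → ℝ
  transit_nonneg : ∀ e, 0 ≤ transit e
  balance : V → ℝ
  balance_sum : ∑ v, balance v = 0

/-- An undirected network over time.  The edge `e` joins `end₁ e` and `end₂ e`; the order in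
which the two endpoints are named carries no meaning. -/
structure UndirectedNetwork (V E : Type*) [Fintype V] where
  end₁ : E → V
  end₂ : E → V
  cap : E → ℝ
  cap_nonneg : ∀ e, 0 ≤ cap e
  transit : E → ℝ
  transit_nonneg : ∀ e, 0 ≤ transit e
  balance : V → ℝ
  balance_sum : ∑ v, balance v = 0

namespace DirectedNetwork

variable {V E : Type*} [Fintype V] [Fintype E]

open Classical in
/-- The excess of the node `v` at time `θ`: the amount of flow that has reached `v` by time `θ`
minus the amount of flow that has left `v` by time `θ`. -/
noncomputable def excess (D : DirectedNetwork V E) (f : E → ℝ → ℝ) (v : V) (θ : ℝ) : ℝ :=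
  (∑ e with D.head e = v, ∫ ξ in (0 : ℝ)..(θ - D.transit e), f e ξ)
    - ∑ e with D.tail e = v, ∫ ξ in (0 : ℝ)..θ, f e ξ

/-- `f` is a flow over time in `D` with time horizon `T`.  A rate function on `[0, T)` is
represented by its extension by zero to the real line. -/
structure IsFlowOverTime (D : DirectedNetwork V E) (T : ℝ) (f : E → ℝ → ℝ) : Prop where
  integrable : ∀ e, MeasureTheory.Integrable (f e)
  nonneg : ∀ e θ, 0 ≤ f e θ
  zero_outside : ∀ e θ, θ ∉ Set.Ico 0 T → f e θ = 0
  zero_late : ∀ e θ, T - D.transit e ≤ θ → f e θ = 0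
  capacity : ∀ e, ∀ θ ∈ Set.Ico 0 T, (f e θ : EReal) ≤ D.cap e
  excess_inner_final : ∀ v, D.balance v = 0 → D.excess f v T = 0
  excess_inner : ∀ v, D.balance v = 0 → ∀ θ ∈ Set.Ico 0 T, 0 ≤ D.excess f v θ
  excess_source : ∀ v, 0 < D.balance v → ∀ θ ∈ Set.Ico 0 T,
    D.excess f v θ ≤ 0 ∧ -D.balance v ≤ D.excess f v θ
  excess_sink : ∀ v, D.balance v < 0 → ∀ θ ∈ Set.Ico 0 T,
    0 ≤ D.excess f v θ ∧ D.excess f v θ ≤ -D.balance v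

/-- The value of `f`: the amount of flow that has reached the sinks by time `T`. -/
noncomputable def value (D : DirectedNetwork V E) (T : ℝ) (f : E → ℝ → ℝ) : ℝ :=
  ∑ v with D.balance v < 0, D.excess f v T

end DirectedNetwork

/-- The five directed edges that replace an undirected edge `{v, w}`, where `x` and `y` are the
two new nodes: `(v, x)`, `(w, x)`, `(x, y)`, `(y, v)` and `(y, w)`. -/
inductive ArcKind
  | enter₁ | enter₂ | cross | leave₁ | leave₂
  deriving DecidableEq

instance : Fintype ArcKind where
  elems := {.enter₁, .enter₂, .cross, .leave₁, .leave₂}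
  complete k := by cases k <;> decide

namespace UndirectedNetwork

variable {V E : Type*} [Fintype V] [Fintype E]

/-- The total supply `B`. -/
noncomputable def supply (N : UndirectedNetwork V E) : ℝ :=
  ∑ v with 0 < N.balance v, N.balance v

/-- The directed network that defines flows over time in the undirected network `N`.  Its nodes
are those of `N` and two nodes `x_e = inr (inl e)` and `y_e = inr (inr e)` for each edge `e`. The
edge `(x_e, y_e)` inherits the attributes of `e`, the four others are free. -/
noncomputable def expand (N : UndirectedNetwork V E) :
    DirectedNetwork (V ⊕ (E ⊕ E)) (E × ArcKind) where
  tail a := match a.2 with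
    | .enter₁ => .inl (N.end₁ a.1)
    | .enter₂ => .inl (N.end₂ a.1)
    | .cross => .inr (.inl a.1)
    | .leave₁ => .inr (.inr a.1)
    | .leave₂ => .inr (.inr a.1)
  head a := match a.2 with
    | .enter₁ => .inr (.inl a.1)
    | .enter₂ => .inr (.inl a.1)
    | .cross => .inr (.inr a.1)
    | .leave₁ => .inl (N.end₁ a.1)
    | .leave₂ => .inl (N.end₂ a.1)
  cap a := match a.2 with
    | .cross => (N.cap a.1 : EReal)
    | _ => ⊤
  cap_nonneg := by
    rintro ⟨e, k⟩
    cases k <;> simp [N.cap_nonneg e]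
  transit a := match a.2 with
    | .cross => N.transit a.1
    | _ => 0
  transit_nonneg := by
    rintro ⟨e, k⟩
    cases k <;> simp [N.transit_nonneg e]
  balance := Sum.elim N.balance (fun _ => 0)
  balance_sum := by simp [N.balance_sum]

/-- The orientation of `N` in which the edge `e` leads from `end₁ e` to `end₂ e` if `o e = true`
and from `end₂ e` to `end₁ e` otherwise. -/
noncomputable def orient (N : UndirectedNetwork V E) (o : E → Bool) : DirectedNetwork V E where
  tail e := if o e then N.end₁ e else N.end₂ e
  head e := if o e then N.end₂ e else N.end₁ e
  cap e := (N.cap e : EReal)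
  cap_nonneg e := by simpa using N.cap_nonneg e
  transit := N.transit
  transit_nonneg := N.transit_nonneg
  balance := N.balance
  balance_sum := N.balance_sum

/-- All supplies can be sent to the sinks within time horizon `T`: there is a flow over time of
value `B` in the undirected network `N`. -/
def SupplySendable (N : UndirectedNetwork V E) (T : ℝ) : Prop :=
  ∃ f : E × ArcKind → ℝ → ℝ,
    N.expand.IsFlowOverTime T f ∧ N.expand.value T f = N.supply

/-- The orientation `o` and the flow over time `f` in it send at least `B / 2` units of flow
within time horizon `2 * T`. -/
def SendsHalfInDouble (N : UndirectedNetwork V E) (T : ℝ) (o : E → Bool) (f : E → ℝ → ℝ) : Prop :=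
  (N.orient o).IsFlowOverTime (2 * T) f ∧ N.supply / 2 ≤ (N.orient o).value (2 * T) f

end UndirectedNetwork

/-! ### Random access machine with logarithmic cost

A program works on arrays of integers, numbered by natural numbers, with unbounded integer
entries and computed addresses.  A program mentions only finitely many arrays.  Every operation
is charged with the bit lengths of the numbers and addresses that it handles; multiplication and
division are charged with the product of the bit lengths. -/

namespace RAM

/-- The memory: `σ a i` is the content of the cell with address `i` of the array `a`. -/
abbrev Store := ℕ → ℤ → ℤ

/-- The bit length of an integer, with one bit for the sign. -/
def bits (z : ℤ) : ℕ := Nat.size z.natAbs + 1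

/-- Expressions. -/
inductive Expr
  | const (z : ℤ)
  | get (a : ℕ) (i : Expr)
  | add (x y : Expr)
  | sub (x y : Expr)
  | mul (x y : Expr)
  | div (x y : Expr)
  | lt (x y : Expr)
  | eq (x y : Expr)

/-- The value of an expression. -/
def Expr.eval (σ : Store) : Expr → ℤ
  | const z => z
  | get a i => σ a (i.eval σ)
  | add x y => x.eval σ + y.eval σ
  | sub x y => x.eval σ - y.eval σ
  | mul x y => x.eval σ * y.eval σ
  | div x y => x.eval σ / y.eval σ
  | lt x y => if x.eval σ < y.eval σ then 1 else 0
  | eq x y => if x.eval σ = y.eval σ then 1 else 0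

/-- The time needed to evaluate an expression. -/
def Expr.cost (σ : Store) : Expr → ℕ
  | const z => bits z
  | get a i => i.cost σ + bits (i.eval σ) + bits (σ a (i.eval σ))
  | add x y => x.cost σ + y.cost σ + bits (x.eval σ) + bits (y.eval σ)
  | sub x y => x.cost σ + y.cost σ + bits (x.eval σ) + bits (y.eval σ)
  | mul x y => x.cost σ + y.cost σ + bits (x.eval σ) * bits (y.eval σ)
  | div x y => x.cost σ + y.cost σ + bits (x.eval σ) * bits (y.eval σ)
  | lt x y => x.cost σ + y.cost σ + bits (x.eval σ) + bits (y.eval σ)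
  | eq x y => x.cost σ + y.cost σ + bits (x.eval σ) + bits (y.eval σ)

/-- Programs.  `set a i x` writes the value of `x` into the cell with address `i` of array `a`. A
test succeeds if the value of the expression is not zero. -/
inductive Cmd
  | skip
  | set (a : ℕ) (i x : Expr)
  | seq (c d : Cmd)
  | ite (x : Expr) (c d : Cmd)
  | while (x : Expr) (c : Cmd)

/-- The memory after writing `z` into the cell with address `i` of the array `a`. -/
def Store.write (σ : Store) (a : ℕ) (i z : ℤ) : Store :=
  fun a' i' => if a' = a ∧ i' = i then z else σ a' i'

/-- `Exec c σ t σ'`: started with memory `σ`, the program `c` halts after time `t` with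
memory `σ'`. -/
inductive Exec : Cmd → Store → ℕ → Store → Prop
  | skip (σ : Store) : Exec .skip σ 1 σ
  | set (σ : Store) (a : ℕ) (i x : Expr) :
      Exec (.set a i x) σ (i.cost σ + x.cost σ + bits (i.eval σ) + bits (x.eval σ))
        (σ.write a (i.eval σ) (x.eval σ))
  | seq {c d : Cmd} {σ₁ σ₂ σ₃ : Store} {s t : ℕ} :
      Exec c σ₁ s σ₂ → Exec d σ₂ t σ₃ → Exec (.seq c d) σ₁ (s + t) σ₃
  | ite_true {x : Expr} {c d : Cmd} {σ σ' : Store} {t : ℕ} :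
      x.eval σ ≠ 0 → Exec c σ t σ' → Exec (.ite x c d) σ (x.cost σ + 1 + t) σ'
  | ite_false {x : Expr} {c d : Cmd} {σ σ' : Store} {t : ℕ} :
      x.eval σ = 0 → Exec d σ t σ' → Exec (.ite x c d) σ (x.cost σ + 1 + t) σ'
  | while_true {x : Expr} {c : Cmd} {σ₁ σ₂ σ₃ : Store} {s t : ℕ} :
      x.eval σ₁ ≠ 0 → Exec c σ₁ s σ₂ → Exec (.while x c) σ₂ t σ₃ →
        Exec (.while x c) σ₁ (x.cost σ₁ + 1 + s + t) σ₃
  | while_false {x : Expr} {c : Cmd} {σ : Store} :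
      x.eval σ = 0 → Exec (.while x c) σ (x.cost σ + 1) σ

/-- The initial memory for the input `l`: array `0` holds the length of `l` in cell `0` and the
entries of `l` in the cells `1, 2, …`; all other cells are zero. -/
def inputStore (l : List ℤ) : Store :=
  fun a i => if a = 0 ∧ 0 ≤ i then ((l.length : ℤ) :: l).getD i.toNat 0 else 0

/-- The output `l` can be read off from `σ`: array `1` holds the length of `l` in cell `0` and
the entries of `l` in the cells `1, …, l.length`. -/
def HoldsOutput (σ : Store) (l : List ℤ) : Prop :=
  σ 1 0 = l.length ∧ ∀ (k : ℕ) (hk : k < l.length), σ 1 ((k : ℤ) + 1) = l[k]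

/-- The size of an input in binary encoding. -/
def inputSize (l : List ℤ) : ℕ := (l.map bits).sum

/-- The search problem "given `x`, find `y` with `R x y`" can be solved in polynomial time, with
instances and solutions encoded by `encIn` and `encOut`. -/
def PolyTimeSolvable {α : Type*} {β : α → Type*} (encIn : α → List ℤ)
    (encOut : ∀ x, β x → List ℤ) (R : ∀ x, β x → Prop) : Prop :=
  ∃ (c : Cmd) (p : Polynomial ℕ), ∀ x : α, ∃ (t : ℕ) (σ : Store) (y : β x),
    Exec c (inputStore (encIn x)) t σ ∧ t ≤ p.eval (inputSize (encIn x)) ∧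
      HoldsOutput σ (encOut x y) ∧ R x y

end RAM

/-! ### Instances and solutions as finite data -/

/-- A rational number written as a fraction, not necessarily in lowest terms. -/
structure Fraction where
  num : ℤ
  den : ℤ
  den_pos : 0 < den

/-- The rational number, as a real number, that a fraction stands for. -/
noncomputable def Fraction.val (q : Fraction) : ℝ := q.num / q.den

/-- The numerator and the denominator. -/
def Fraction.code (q : Fraction) : List ℤ := [q.num, q.den]

/-- An undirected network over time with a time horizon, with rational data. -/
structure RatInstance where
  n : ℕ
  m : ℕ
  end₁ : Fin m → Fin n
  end₂ : Fin m → Fin n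
  cap : Fin m → Fraction
  cap_nonneg : ∀ e, 0 ≤ (cap e).val
  transit : Fin m → Fraction
  transit_nonneg : ∀ e, 0 ≤ (transit e).val
  balance : Fin n → Fraction
  balance_sum : ∑ v, (balance v).val = 0
  horizon : Fraction
  horizon_nonneg : 0 ≤ horizon.val

namespace RatInstance

/-- The network that an instance describes. -/
noncomputable def network (I : RatInstance) : UndirectedNetwork (Fin I.n) (Fin I.m) where
  end₁ := I.end₁
  end₂ := I.end₂
  cap e := (I.cap e).val
  cap_nonneg := I.cap_nonneg
  transit e := (I.transit e).val
  transit_nonneg := I.transit_nonneg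
  balance v := (I.balance v).val
  balance_sum := I.balance_sum

/-- The encoding of an instance: the numbers of nodes and edges, the time horizon, the balances,
and for each edge its endpoints, its capacity and its transit time. -/
def code (I : RatInstance) : List ℤ :=
  [(I.n : ℤ), (I.m : ℤ)] ++ I.horizon.code
    ++ (List.ofFn fun v => (I.balance v).code).flatten
    ++ (List.ofFn fun e =>
        [((I.end₁ e : ℕ) : ℤ), ((I.end₂ e : ℕ) : ℤ)]
          ++ (I.cap e).code ++ (I.transit e).code).flatten

end RatInstance

/-- Flow at the constant rate `rate` during the time interval `[start, finish)`. -/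
structure Piece where
  start : Fraction
  finish : Fraction
  rate : Fraction

/-- The encoding of a piece. -/
def Piece.code (p : Piece) : List ℤ := p.start.code ++ p.finish.code ++ p.rate.code

/-- The rate function at time `θ` of a piece. -/
noncomputable def Piece.rateAt (p : Piece) (θ : ℝ) : ℝ :=
  (Set.Ico p.start.val p.finish.val).indicator (fun _ => p.rate.val) θ

/-- An orientation and, for each edge, a piecewise constant rate function, given explicitly as
a finite sum of pieces. -/
structure RatSolution (I : RatInstance) where
  dir : Fin I.m → Bool
  pieces : Fin I.m → List Piece

namespace RatSolution

variable {I : RatInstance}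

/-- The rate functions that a solution describes. -/
noncomputable def flow (S : RatSolution I) (e : Fin I.m) (θ : ℝ) : ℝ :=
  ((S.pieces e).map fun p => p.rateAt θ).sum

/-- The encoding of a solution: for each edge its direction, the number of its pieces, and the
pieces. -/
def code (S : RatSolution I) : List ℤ :=
  (List.ofFn fun e =>
    [if S.dir e then 1 else 0, ((S.pieces e).length : ℤ)]
      ++ ((S.pieces e).map Piece.code).flatten).flatten

end RatSolution

/-! ### Structured programs for the random access machine -/

namespace RAM

/-! Existence. Average the given flow over time: let `g e` be the net amount of flow that crosses
the edge `e` during `[0, T]`. The capacities give `|g e| ≤ u_e T`, and since all supplies are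
shipped, the net outflow of `g` at `v` is `b v`. The amount of flow in transit at any moment is
minus the sum of the excesses, hence at most `B`; integrating over `[0, T]` gives `∑ τ_e |g e| ≤ B
T` (`sum_transit_mul_le`, `SupplySendable.exists_static`). Orient each edge by the sign of `g`,
decompose `|g|` into paths `P_k` from sources to sinks that carry `δ_k` (`exists_paths`), and feed
`P_k` at rate `δ_k / (2T)` as long as the flow arrives by time `2T`. No edge uses more than half of
its capacity, and the value is `∑ δ_k max(0, 2T - τ(P_k)) / (2T) ≥ B - B T / (2T) = B / 2`.

Algorithm. Join a root to the sources, join the sinks to the root at cost `-2T`, and let each edge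
be used in both directions at cost `τ_e`. Splitting a circulation into cycles through the root gives
paths, and its cost is `-∑ δ_k (2T - τ(P_k))`. The averaged flow is a circulation of cost at most
`-B T`, so the paths of a minimum cost circulation satisfy `∑ δ_k (2T - τ(P_k)) ≥ B T`, which yields
value `B / 2` in the same way, even if not all supplies are shipped.

All data are made integral. With `D` the product of the positive input entries, flow amounts are
scaled by `D` times the denominator of `T`, and times by `K = (1 + C) D`, where `C` is the sum of
the integral capacities. In addition, each edge arc costs one unit more than its scaled time.
Positive costs have two effects: an optimal circulation uses each edge in one direction only, which
defines the orientation (`IsEncoded.not_both`), and prices increase along edge arcs with flow, so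
that all flow can be traced along cycles through the root (`IsEncoded.isSplittable`). The surcharge
is harmless: it adds at most `C` to the cost of the comparison flow, while the total time and its
desired bound are both multiples of `1 + C` (`IsEncoded.sum_time_le`).

The minimum cost circulation is found by scaling the capacities. A phase doubles flow and capacities
and then raises single capacities by one. Each raise is repaired by a primal-dual search, which
adjusts the prices until the arc is no longer attractive or a tight path closes a cycle with it
(`IsSearchTree.succ`), and by sending one unit around that cycle (`IsAugmenting.next`). Repeatedly
removing a cycle through the root at its bottleneck exhausts an arc each time, so as many rounds as
there are arcs suffice (`splits_nonpos_out`).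

Running time. Apart from the computation of the input size `S`, the program has only loops with `S`
repetitions, and one factor of each product is a constant or an entry of the input or size array.
Bit lengths then grow additively along the run, and the number of steps is a polynomial in `S` that
can be read off from the program (`Prog.exec_toCmd`). -/

instance : Add Expr := ⟨.add⟩
instance : Sub Expr := ⟨.sub⟩
instance : Mul Expr := ⟨.mul⟩
instance : Div Expr := ⟨.div⟩
instance (n : ℕ) : OfNat Expr n := ⟨.const n⟩

/-- The scalar variable that is stored in cell `0` of the array `a`. -/
def Expr.var (a : ℕ) : Expr := .get a 0

section eval

variable (σ : Store) (x y : Expr)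

@[simp] theorem eval_add : (x + y).eval σ = x.eval σ + y.eval σ := rfl
@[simp] theorem eval_sub : (x - y).eval σ = x.eval σ - y.eval σ := rfl
@[simp] theorem eval_mul : (x * y).eval σ = x.eval σ * y.eval σ := rfl
@[simp] theorem eval_div : (x / y).eval σ = x.eval σ / y.eval σ := rfl
@[simp] theorem eval_zero : (0 : Expr).eval σ = 0 := rfl
@[simp] theorem eval_one : (1 : Expr).eval σ = 1 := rfl
@[simp] theorem eval_two : (2 : Expr).eval σ = 2 := rfl
@[simp] theorem eval_three : (3 : Expr).eval σ = 3 := rfl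
@[simp] theorem eval_four : (4 : Expr).eval σ = 4 := rfl
@[simp] theorem eval_five : (5 : Expr).eval σ = 5 := rfl
@[simp] theorem eval_six : (6 : Expr).eval σ = 6 := rfl
@[simp] theorem eval_const (z : ℤ) : (Expr.const z).eval σ = z := rfl
@[simp] theorem eval_get (a : ℕ) : (Expr.get a x).eval σ = σ a (x.eval σ) := rfl
@[simp] theorem eval_var (a : ℕ) : (Expr.var a).eval σ = σ a 0 := rfl
@[simp] theorem eval_lt :
    (Expr.lt x y).eval σ = if x.eval σ < y.eval σ then 1 else 0 := rfl
@[simp] theorem eval_eq :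
    (Expr.eq x y).eval σ = if x.eval σ = y.eval σ then 1 else 0 := rfl

end eval

theorem write_apply (σ : Store) (a : ℕ) (i z : ℤ) (a' : ℕ) :
    σ.write a i z a' = if a' = a then Function.update (σ a) i z else σ a' := by
  funext j
  by_cases h : a' = a
  · subst h
    by_cases h' : j = i <;> simp [Store.write, h', Function.update]
  · simp [Store.write, h]

theorem write_self (σ : Store) (a : ℕ) (i z : ℤ) :
    σ.write a i z a = Function.update (σ a) i z := by simp [write_apply]

theorem write_of_ne (σ : Store) {a a' : ℕ} (i z : ℤ) (h : a' ≠ a) :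
    σ.write a i z a' = σ a' := by simp [write_apply, h]

/-- Programs whose only loops are repeated `S` times, where the number `S` is stored in cell `0`
of array `2`.  The loop `loop v p` counts with the variable `v`. -/
inductive Prog
  | skip
  | set (a : ℕ) (i x : Expr)
  | seq (p q : Prog)
  | ite (x : Expr) (p q : Prog)
  | loop (v : ℕ) (p : Prog)

/-- The assignment to a scalar variable. -/
def Prog.setVar (a : ℕ) (x : Expr) : Prog := .set a 0 x

/-- A conditional without alternative. -/
def Prog.when (x : Expr) (p : Prog) : Prog := .ite x p .skip

/-- The programs of a list, one after the other. -/
def Prog.block : List Prog → Prog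
  | [] => .skip
  | [p] => p
  | p :: q :: l => .seq p (Prog.block (q :: l))

/-- The memory before the `j`-th repetition of a loop with counter `v` and body `F`. -/
def loopState (F : Store → Store) (v : ℕ) (σ : Store) : ℕ → Store
  | 0 => σ
  | j + 1 => F ((loopState F v σ j).write v 0 j)

/-- The memory after running a program. -/
def Prog.run : Prog → Store → Store
  | skip, σ => σ
  | set a i x, σ => σ.write a (i.eval σ) (x.eval σ)
  | seq p q, σ => q.run (p.run σ)
  | ite x p q, σ => if x.eval σ ≠ 0 then p.run σ else q.run σ
  | loop v p, σ => (loopState p.run v σ (σ 2 0).toNat).write v 0 ((σ 2 0).toNat : ℕ)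

/-- The translation into the programs of the machine. -/
def Prog.toCmd : Prog → Cmd
  | skip => .skip
  | set a i x => .set a i x
  | seq p q => .seq p.toCmd q.toCmd
  | ite x p q => .ite x p.toCmd q.toCmd
  | loop v p => .seq (.set v (.const 0) (.const 0))
      (.while (.lt (.get v (.const 0)) (.get 2 (.const 0)))
        (.seq p.toCmd (.set v (.const 0) (.add (.get v (.const 0)) (.const 1)))))

/-- Whether a program contains an assignment to the array `a`. -/
def Prog.writesTo (a : ℕ) : Prog → Bool
  | skip => false
  | set a' _ _ => a' == a
  | seq p q => p.writesTo a || q.writesTo a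
  | ite _ p q => p.writesTo a || q.writesTo a
  | loop v p => v == a || p.writesTo a

/-- Constants and the entries of the arrays `0` and `2`. -/
def Expr.isFixed : Expr → Bool
  | const _ => true
  | get a _ => a == 0 || a == 2
  | _ => false

/-- Expressions in which the second factor of every product is fixed. -/
def Expr.tame : Expr → Bool
  | const _ => true
  | get _ i => i.tame
  | add x y => x.tame && y.tame
  | sub x y => x.tame && y.tame
  | mul x y => x.tame && (y.tame && y.isFixed)
  | div x y => x.tame && y.tame
  | lt x y => x.tame && y.tame
  | eq x y => x.tame && y.tame

/-- Programs with tame expressions that modify neither the arrays `0` and `2` nor, within a loop,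
the counter of the loop. -/
def Prog.tame : Prog → Bool
  | skip => true
  | set a i x => (a != 0 && a != 2) && (i.tame && x.tame)
  | seq p q => p.tame && q.tame
  | ite x p q => x.tame && (p.tame && q.tame)
  | loop v p => (v != 0 && v != 2) && (p.tame && !p.writesTo v)

/-- Being assigned to is a syntactic property that can be computed, so for the concrete programs
below each claim that an array is left alone is closed by `rfl`. -/
theorem Prog.run_frame {a : ℕ} : ∀ {p : Prog}, p.writesTo a = false → ∀ σ, p.run σ a = σ a
  | skip, _, σ => rfl
  | set a' i x, h, σ => by
      have h' : a ≠ a' := by rintro rfl; simp [writesTo] at h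
      exact write_of_ne _ _ _ h'
  | seq p q, h, σ => by
      simp only [writesTo, Bool.or_eq_false_iff] at h
      simp only [run]
      rw [run_frame h.2, run_frame h.1]
  | ite x p q, h, σ => by
      simp only [writesTo, Bool.or_eq_false_iff] at h
      simp only [run]
      split_ifs
      · exact run_frame h.1 σ
      · exact run_frame h.2 σ
  | loop v p, h, σ => by
      simp only [writesTo, Bool.or_eq_false_iff, beq_eq_false_iff_ne] at h
      have key : ∀ j, loopState p.run v σ j a = σ a := by
        intro j
        induction j with
        | zero => rfl
        | succ j ih =>
          simp only [loopState]
          rw [run_frame h.2, write_of_ne _ _ _ h.1.symm, ih]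
      simp only [run]
      rw [write_of_ne _ _ _ h.1.symm, key]

/-- The invariant rule for loops. -/
theorem Prog.run_loop {v : ℕ} {p : Prog} {σ : Store} {S : ℕ} (hS : σ 2 0 = S)
    (I : ℕ → Store → Prop) (Q : Store → Prop) (h0 : I 0 σ)
    (step : ∀ j < S, ∀ τ : Store, (∀ a, (loop v p).writesTo a = false → τ a = σ a) →
      I j τ → I (j + 1) (p.run (τ.write v 0 j)))
    (fin : ∀ τ : Store, (∀ a, (loop v p).writesTo a = false → τ a = σ a) →
      I S τ → Q (τ.write v 0 S)) :
    Q ((loop v p).run σ) := by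
  have frame : ∀ j, ∀ a, (loop v p).writesTo a = false → loopState p.run v σ j a = σ a := by
    intro j a ha
    simp only [writesTo, Bool.or_eq_false_iff, beq_eq_false_iff_ne] at ha
    induction j with
    | zero => rfl
    | succ j ih =>
      simp only [loopState]
      rw [run_frame ha.2, write_of_ne _ _ _ ha.1.symm, ih]
  have key : ∀ j ≤ S, I j (loopState p.run v σ j) := by
    intro j
    induction j with
    | zero => intro _; exact h0
    | succ j ih =>
      intro hj
      exact step j hj _ (frame j) (ih (by omega))
  have : (σ 2 0).toNat = S := by simp [hS]
  simp only [run, this]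
  exact fin _ (frame S) (key S le_rfl)

/-! ### Bit lengths -/

theorem bits_le_succ_iff {z : ℤ} {k : ℕ} : bits z ≤ k + 1 ↔ z.natAbs < 2 ^ k := by
  simp [bits, Nat.size_le]

theorem one_le_bits (z : ℤ) : 1 ≤ bits z := by simp [bits]

theorem natAbs_lt_two_pow_bits (z : ℤ) : z.natAbs < 2 ^ (bits z - 1) := by
  simp [bits, Nat.lt_size_self]

theorem bits_add_le (x y : ℤ) : bits (x + y) ≤ max (bits x) (bits y) + 1 := by
  obtain ⟨k, hk⟩ : ∃ k, max (bits x) (bits y) = k + 1 :=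
    ⟨max (bits x) (bits y) - 1, by have := one_le_bits x; omega⟩
  have hx : x.natAbs < 2 ^ k := bits_le_succ_iff.1 (by omega)
  have hy : y.natAbs < 2 ^ k := bits_le_succ_iff.1 (by omega)
  rw [hk, bits_le_succ_iff, pow_succ]
  omega

theorem bits_neg (x : ℤ) : bits (-x) = bits x := by simp [bits]

theorem bits_sub_le (x y : ℤ) : bits (x - y) ≤ max (bits x) (bits y) + 1 := by
  rw [sub_eq_add_neg, ← bits_neg y]
  exact bits_add_le _ _

theorem bits_mul_le (x y : ℤ) : bits (x * y) ≤ bits x + bits y := by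
  have h1 := one_le_bits x
  have h2 := one_le_bits y
  have : bits x + bits y = (bits x - 1 + (bits y - 1) + 1) + 1 := by omega
  rw [this, bits_le_succ_iff, Int.natAbs_mul, pow_succ, pow_add]
  have := Nat.mul_lt_mul'' (natAbs_lt_two_pow_bits x) (natAbs_lt_two_pow_bits y)
  omega

theorem bits_le_bits {x y : ℤ} (h : x.natAbs ≤ y.natAbs) : bits x ≤ bits y := by
  simpa [bits] using Nat.size_le_size h

theorem bits_div_le (x y : ℤ) : bits (x / y) ≤ bits x :=
  bits_le_bits (Int.natAbs_ediv_le_natAbs x y)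

theorem bits_ite_le (P : Prop) [Decidable P] : bits (if P then 1 else 0) ≤ 2 := by
  split_ifs <;> decide

/-- All cells have bit length at most `L`. -/
def Bounded (L : ℕ) (σ : Store) : Prop := ∀ a i, bits (σ a i) ≤ L

/-- The cells of the arrays `0` and `2` have bit length at most `L`. -/
def FixedBounded (L : ℕ) (σ : Store) : Prop := ∀ a, a = 0 ∨ a = 2 → ∀ i, bits (σ a i) ≤ L

/-- A bound for the growth of bit lengths in the evaluation of an expression. -/
def Expr.weight : Expr → ℕ
  | const z => bits z
  | get _ i => i.weight + 1
  | add x y => x.weight + y.weight + 2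
  | sub x y => x.weight + y.weight + 2
  | mul x y => x.weight + y.weight + 2
  | div x y => x.weight + y.weight + 2
  | lt x y => x.weight + y.weight + 2
  | eq x y => x.weight + y.weight + 2

/-- The number of operations in an expression. -/
def Expr.length : Expr → ℕ
  | const _ => 1
  | get _ i => i.length + 1
  | add x y => x.length + y.length + 1
  | sub x y => x.length + y.length + 1
  | mul x y => x.length + y.length + 1
  | div x y => x.length + y.length + 1
  | lt x y => x.length + y.length + 1
  | eq x y => x.length + y.length + 1

theorem Expr.bits_fixed_le {σ : Store} {L₀ : ℕ} (h0 : 1 ≤ L₀) (hf : FixedBounded L₀ σ) :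
    ∀ {e : Expr}, e.isFixed = true → bits (e.eval σ) ≤ e.weight * L₀
  | const z, _ => by simpa [weight] using Nat.le_mul_of_pos_right _ h0
  | get a i, h => by
      simp only [isFixed, Bool.or_eq_true, beq_iff_eq] at h
      have := hf a h (i.eval σ)
      simp only [eval_get, weight]
      nlinarith [Nat.zero_le (i.weight * L₀)]

/-- In a tame product the length of the second factor is controlled by `L₀` alone, so products add
to the bit length instead of doubling it. That `L` has coefficient one is what makes the bound
iterable over loops. -/
theorem Expr.bits_eval_le {σ : Store} {L L₀ : ℕ} (h0 : 1 ≤ L₀) (hb : Bounded L σ)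
    (hf : FixedBounded L₀ σ) :
    ∀ {e : Expr}, e.tame = true → bits (e.eval σ) ≤ L + e.weight * L₀
  | const z, _ => by
      have := Nat.le_mul_of_pos_right (bits z) h0
      simp only [eval_const, weight]; omega
  | get a i, _ => by
      have := hb a (i.eval σ)
      simp only [eval_get]; omega
  | add x y, h => by
      simp only [tame, Bool.and_eq_true] at h
      have h1 := bits_eval_le h0 hb hf h.1
      have h2 := bits_eval_le h0 hb hf h.2
      have h3 := bits_add_le (x.eval σ) (y.eval σ)
      simp only [eval, weight, add_mul]; omega
  | sub x y, h => by
      simp only [tame, Bool.and_eq_true] at h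
      have h1 := bits_eval_le h0 hb hf h.1
      have h2 := bits_eval_le h0 hb hf h.2
      have h3 := bits_sub_le (x.eval σ) (y.eval σ)
      simp only [eval, weight, add_mul]; omega
  | mul x y, h => by
      simp only [tame, Bool.and_eq_true] at h
      have h1 := bits_eval_le h0 hb hf h.1
      have h2 := bits_fixed_le h0 hf h.2.2
      have h3 := bits_mul_le (x.eval σ) (y.eval σ)
      simp only [eval, weight, add_mul]; omega
  | div x y, h => by
      simp only [tame, Bool.and_eq_true] at h
      have h1 := bits_eval_le h0 hb hf h.1
      have h3 := bits_div_le (x.eval σ) (y.eval σ)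
      simp only [eval, weight, add_mul]; omega
  | lt x y, h => by
      have h3 := bits_ite_le (x.eval σ < y.eval σ)
      simp only [eval, weight, add_mul]; omega
  | eq x y, h => by
      have h3 := bits_ite_le (x.eval σ = y.eval σ)
      simp only [eval, weight, add_mul]; omega

/-- One operation on numbers of at most `M` bits costs at most `2 * M ^ 2`. The hypothesis speaks of
all tame expressions that are no heavier, so that it passes to subexpressions. -/
theorem Expr.cost_le_of_bits_le {σ : Store} {M : ℕ} :
    ∀ {e : Expr}, (∀ e' : Expr, e'.tame = true → e'.weight ≤ e.weight → bits (e'.eval σ) ≤ M) →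
      e.tame = true → e.cost σ ≤ 2 * e.length * M ^ 2 := by
  have aux : ∀ a b : ℕ, 1 ≤ a → a ≤ M → b ≤ M → a + b ≤ 2 * M ^ 2 := by
    intro a b h h1 h2; nlinarith
  have aux' : ∀ a b : ℕ, a ≤ M → b ≤ M → a * b ≤ 2 * M ^ 2 := by
    intro a b h1 h2; nlinarith [Nat.mul_le_mul h1 h2]
  intro e
  induction e with
  | const z =>
    intro h ht
    have := h (const z) ht le_rfl
    simp only [eval_const] at this
    simp only [cost, length]
    have := one_le_bits z
    nlinarith
  | get a i ih =>
    intro h ht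
    have h1 := ih (fun e' he hw => h e' he (hw.trans (by simp [weight]))) ht
    have h2 := h (get a i) ht le_rfl
    have h3 := h i ht (by simp [weight])
    have := aux _ _ (one_le_bits _) h3 h2
    simp only [eval_get] at this
    simp only [cost, length]
    linarith
  | add x y ihx ihy =>
    intro h ht
    simp only [tame, Bool.and_eq_true] at ht
    have h1 := ihx (fun e' he hw => h e' he (hw.trans (by simp only [weight]; omega))) ht.1
    have h2 := ihy (fun e' he hw => h e' he (hw.trans (by simp only [weight]; omega))) ht.2
    have := aux _ _ (one_le_bits _) (h x ht.1 (by simp only [weight]; omega))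
      (h y ht.2 (by simp only [weight]; omega))
    simp only [cost, length]
    linarith
  | sub x y ihx ihy =>
    intro h ht
    simp only [tame, Bool.and_eq_true] at ht
    have h1 := ihx (fun e' he hw => h e' he (hw.trans (by simp only [weight]; omega))) ht.1
    have h2 := ihy (fun e' he hw => h e' he (hw.trans (by simp only [weight]; omega))) ht.2
    have := aux _ _ (one_le_bits _) (h x ht.1 (by simp only [weight]; omega))
      (h y ht.2 (by simp only [weight]; omega))
    simp only [cost, length]
    linarith
  | mul x y ihx ihy =>
    intro h ht
    simp only [tame, Bool.and_eq_true] at ht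
    have h1 := ihx (fun e' he hw => h e' he (hw.trans (by simp only [weight]; omega))) ht.1
    have h2 := ihy (fun e' he hw => h e' he (hw.trans (by simp only [weight]; omega))) ht.2.1
    have := aux' _ _ (h x ht.1 (by simp only [weight]; omega))
      (h y ht.2.1 (by simp only [weight]; omega))
    simp only [cost, length]
    linarith
  | div x y ihx ihy =>
    intro h ht
    simp only [tame, Bool.and_eq_true] at ht
    have h1 := ihx (fun e' he hw => h e' he (hw.trans (by simp only [weight]; omega))) ht.1
    have h2 := ihy (fun e' he hw => h e' he (hw.trans (by simp only [weight]; omega))) ht.2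
    have := aux' _ _ (h x ht.1 (by simp only [weight]; omega))
      (h y ht.2 (by simp only [weight]; omega))
    simp only [cost, length]
    linarith
  | lt x y ihx ihy =>
    intro h ht
    simp only [tame, Bool.and_eq_true] at ht
    have h1 := ihx (fun e' he hw => h e' he (hw.trans (by simp only [weight]; omega))) ht.1
    have h2 := ihy (fun e' he hw => h e' he (hw.trans (by simp only [weight]; omega))) ht.2
    have := aux _ _ (one_le_bits _) (h x ht.1 (by simp only [weight]; omega))
      (h y ht.2 (by simp only [weight]; omega))
    simp only [cost, length]
    linarith
  | eq x y ihx ihy =>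
    intro h ht
    simp only [tame, Bool.and_eq_true] at ht
    have h1 := ihx (fun e' he hw => h e' he (hw.trans (by simp only [weight]; omega))) ht.1
    have h2 := ihy (fun e' he hw => h e' he (hw.trans (by simp only [weight]; omega))) ht.2
    have := aux _ _ (one_le_bits _) (h x ht.1 (by simp only [weight]; omega))
      (h y ht.2 (by simp only [weight]; omega))
    simp only [cost, length]
    linarith

theorem Expr.cost_le {σ : Store} {L L₀ M : ℕ} (h0 : 1 ≤ L₀) (hb : Bounded L σ)
    (hf : FixedBounded L₀ σ) {e : Expr} (he : e.tame = true) (hM : L + e.weight * L₀ ≤ M) :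
    e.cost σ ≤ 2 * e.length * M ^ 2 :=
  cost_le_of_bits_le (fun _ he' hw => (bits_eval_le h0 hb hf he').trans
    ((Nat.add_le_add_left (Nat.mul_le_mul_right _ hw) _).trans hM)) he

theorem Bounded.mono {L L' : ℕ} {σ : Store} (h : Bounded L σ) (hL : L ≤ L') : Bounded L' σ :=
  fun a i => (h a i).trans hL

theorem Bounded.write {L : ℕ} {σ : Store} (h : Bounded L σ) {a : ℕ} {i z : ℤ}
    (hz : bits z ≤ L) : Bounded L (σ.write a i z) := by
  intro a' i'
  simp only [Store.write]
  split_ifs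
  · exact hz
  · exact h a' i'

theorem FixedBounded.congr {L : ℕ} {σ τ : Store} (h : FixedBounded L σ) (h0 : τ 0 = σ 0)
    (h2 : τ 2 = σ 2) : FixedBounded L τ := by
  rintro a (rfl | rfl) i
  · rw [h0]; exact h _ (.inl rfl) i
  · rw [h2]; exact h _ (.inr rfl) i

/-! ### Running times -/

open Polynomial in
/-- A bound for the growth of bit lengths when a program runs. -/
noncomputable def Prog.growth : Prog → Polynomial ℕ
  | skip => 0
  | set _ i x => C (i.weight + x.weight)
  | seq p q => p.growth + q.growth
  | ite x p q => C x.weight + p.growth + q.growth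
  -- The `1` pays for writing the counter in each round, the `10` for the test and the increment,
  -- whose weights are `6` and `7`.
  | loop _ p => X * (p.growth + 1) + 10

open Polynomial in
/-- A bound for the number of operations when a program runs. -/
noncomputable def Prog.steps : Prog → Polynomial ℕ
  | skip => 1
  | set _ i x => C (2 * i.length + 2 * x.length + 2)
  | seq p q => p.steps + q.steps
  | ite x p q => C (2 * x.length + 1) + p.steps + q.steps
  | loop _ p => X * (p.steps + 50) + 50

theorem Exec.set_le {σ : Store} {a : ℕ} {i x : Expr} {L L₀ M : ℕ} (h0 : 1 ≤ L₀)
    (hb : Bounded L σ) (hf : FixedBounded L₀ σ) (hi : i.tame = true) (hx : x.tame = true)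
    (hM : L + (i.weight + x.weight) * L₀ ≤ M) :
    ∃ t, Exec (.set a i x) σ t (σ.write a (i.eval σ) (x.eval σ)) ∧
      t ≤ (2 * i.length + 2 * x.length + 2) * M ^ 2 := by
  refine ⟨_, .set σ a i x, ?_⟩
  have hiM : L + i.weight * L₀ ≤ M := by rw [add_mul] at hM; omega
  have hxM : L + x.weight * L₀ ≤ M := by rw [add_mul] at hM; omega
  have h1 := i.cost_le h0 hb hf hi hiM
  have h2 := x.cost_le h0 hb hf hx hxM
  have h3 := (i.bits_eval_le h0 hb hf hi).trans hiM
  have h4 := (x.bits_eval_le h0 hb hf hx).trans hxM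
  have h5 := one_le_bits (x.eval σ)
  have h6 : M ≤ M ^ 2 := by nlinarith
  linarith

/-- A tame program runs in a time that is polynomial in the number of repetitions of its loops and
in the bit lengths of the numbers in the memory. -/
theorem Prog.exec_toCmd : ∀ {p : Prog}, p.tame = true → ∀ {σ : Store} {L L₀ S : ℕ}, 1 ≤ L₀ →
    Bounded L σ → FixedBounded L₀ σ → σ 2 0 = S →
    ∃ t, Exec p.toCmd σ t (p.run σ) ∧
      t ≤ p.steps.eval S * (L + p.growth.eval S * L₀) ^ 2 ∧
      Bounded (L + p.growth.eval S * L₀) (p.run σ) ∧ FixedBounded L₀ (p.run σ) ∧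
      p.run σ 2 0 = S
  | skip, _, σ, L, L₀, S, h0, hb, hf, hS => by
      refine ⟨1, .skip σ, ?_, ?_, hf, hS⟩
      · have := (one_le_bits _).trans (hb 0 0)
        simp only [steps, growth, Polynomial.eval_one, Polynomial.eval_zero]
        nlinarith
      · simpa [growth, run] using hb
  | set a i x, h, σ, L, L₀, S, h0, hb, hf, hS => by
      simp only [tame, Bool.and_eq_true, bne_iff_ne] at h
      obtain ⟨⟨ha0, ha2⟩, hi, hx⟩ := h
      have hg : (set a i x).growth.eval S = i.weight + x.weight := by
        simp only [growth, Polynomial.eval_C]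
      have hs : (set a i x).steps.eval S = 2 * i.length + 2 * x.length + 2 := by
        simp only [steps, Polynomial.eval_C]
      rw [hg, hs]
      obtain ⟨t, ht, hle⟩ := Exec.set_le (a := a) h0 hb hf hi hx le_rfl
      refine ⟨t, ht, hle, ?_, ?_, ?_⟩
      · refine (hb.mono (Nat.le_add_right _ _)).write ((x.bits_eval_le h0 hb hf hx).trans ?_)
        rw [add_mul]; omega
      · exact hf.congr (write_of_ne _ _ _ ha0.symm) (write_of_ne _ _ _ ha2.symm)
      · simp only [run]; rw [write_of_ne _ _ _ ha2.symm, hS]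
  | seq p q, h, σ, L, L₀, S, h0, hb, hf, hS => by
      simp only [tame, Bool.and_eq_true] at h
      obtain ⟨t₁, e₁, c₁, b₁, f₁, s₁⟩ := exec_toCmd h.1 h0 hb hf hS
      obtain ⟨t₂, e₂, c₂, b₂, f₂, s₂⟩ := exec_toCmd h.2 h0 b₁ f₁ s₁
      have hg : (seq p q).growth.eval S = p.growth.eval S + q.growth.eval S := by
        simp only [growth, Polynomial.eval_add]
      have hs : (seq p q).steps.eval S = p.steps.eval S + q.steps.eval S := by
        simp only [steps, Polynomial.eval_add]
      rw [hg, hs]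
      have e : L + (p.growth.eval S + q.growth.eval S) * L₀
          = L + p.growth.eval S * L₀ + q.growth.eval S * L₀ := by ring
      refine ⟨_, .seq e₁ e₂, ?_, ?_, f₂, s₂⟩
      · rw [e, add_mul (p.steps.eval S)]
        refine add_le_add (c₁.trans (Nat.mul_le_mul_left _ (Nat.pow_le_pow_left ?_ _))) c₂
        omega
      · rw [e]; exact b₂
  | ite x p q, h, σ, L, L₀, S, h0, hb, hf, hS => by
      simp only [tame, Bool.and_eq_true] at h
      obtain ⟨hx, hp, hq⟩ := h
      have hg : (ite x p q).growth.eval S = x.weight + p.growth.eval S + q.growth.eval S := by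
        simp only [growth, Polynomial.eval_add, Polynomial.eval_C]
      have hs : (ite x p q).steps.eval S
          = 2 * x.length + 1 + p.steps.eval S + q.steps.eval S := by
        simp only [steps, Polynomial.eval_add, Polynomial.eval_C]
      rw [hg, hs]
      set M := L + (x.weight + p.growth.eval S + q.growth.eval S) * L₀ with hM
      have hM' : M = L + x.weight * L₀ + p.growth.eval S * L₀ + q.growth.eval S * L₀ := by
        rw [hM]; ring
      have hc := x.cost_le h0 hb hf hx (M := M) (by omega)
      have hM1 : 1 ≤ M ^ 2 := Nat.one_le_pow _ _ (by have := (one_le_bits _).trans (hb 0 0); omega)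
      by_cases hv : x.eval σ = 0
      · obtain ⟨t, e, c, b, f, s⟩ := exec_toCmd hq h0 hb hf hS
        have hr : (ite x p q).run σ = q.run σ := by simp [run, hv]
        rw [hr]
        refine ⟨_, .ite_false hv e, ?_, b.mono (by omega), f, s⟩
        have c' := c.trans (Nat.mul_le_mul_left (q.steps.eval S)
          (Nat.pow_le_pow_left (show _ ≤ M by omega) 2))
        nlinarith [Nat.zero_le (p.steps.eval S * M ^ 2)]
      · obtain ⟨t, e, c, b, f, s⟩ := exec_toCmd hp h0 hb hf hS
        have hr : (ite x p q).run σ = p.run σ := by simp [run, hv]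
        rw [hr]
        refine ⟨_, .ite_true hv e, ?_, b.mono (by omega), f, s⟩
        have c' := c.trans (Nat.mul_le_mul_left (p.steps.eval S)
          (Nat.pow_le_pow_left (show _ ≤ M by omega) 2))
        nlinarith [Nat.zero_le (q.steps.eval S * M ^ 2)]
  | loop v p, h, σ, L, L₀, S, h0, hb, hf, hS => by
      simp only [tame, Bool.and_eq_true, bne_iff_ne, Bool.not_eq_true'] at h
      obtain ⟨⟨hv0, hv2⟩, hp, hw⟩ := h
      have hg : (loop v p).growth.eval S = S * (p.growth.eval S + 1) + 10 := by
        simp [growth]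
      have hs : (loop v p).steps.eval S = S * (p.steps.eval S + 50) + 50 := by
        simp [steps]
      rw [hg, hs]
      set G := p.growth.eval S
      set H := p.steps.eval S
      set M := L + (S * (G + 1) + 10) * L₀ with hM
      have hSn : (σ 2 0).toNat = S := by simp [hS]
      have hSb : bits S ≤ L₀ := by rw [← hS]; exact hf 2 (.inr rfl) 0
      -- The counter never exceeds `S`, which is itself an entry of the fixed array `2`.
      have hjb : ∀ j ≤ S, bits (j : ℤ) ≤ L₀ := fun j hj =>
        (bits_le_bits (by simpa using hj)).trans hSb
      set τ := loopState p.run v σ with hτ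
      have hwr : ∀ (ρ : Store) (z : ℤ), FixedBounded L₀ ρ → FixedBounded L₀ (ρ.write v 0 z) :=
        fun ρ z hρ => hρ.congr (write_of_ne _ _ _ hv0.symm) (write_of_ne _ _ _ hv2.symm)
      have hws : ∀ (ρ : Store) (z : ℤ), ρ 2 0 = S → ρ.write v 0 z 2 0 = S :=
        fun ρ z hρ => by rw [write_of_ne _ _ _ hv2.symm, hρ]
      have body : ∀ j ≤ S, Bounded (L + j * (G + 1) * L₀) (τ j) → FixedBounded L₀ (τ j) →
          τ j 2 0 = S → ∃ t, Exec p.toCmd ((τ j).write v 0 j) t (τ (j + 1)) ∧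
            t ≤ H * (L + j * (G + 1) * L₀ + L₀ + G * L₀) ^ 2 ∧
            Bounded (L + j * (G + 1) * L₀ + L₀ + G * L₀) (τ (j + 1)) ∧
            FixedBounded L₀ (τ (j + 1)) ∧ τ (j + 1) 2 0 = S := by
        intro j hj b f s
        exact exec_toCmd hp h0 ((b.mono (Nat.le_add_right _ L₀)).write
          ((hjb j hj).trans (Nat.le_add_left _ _))) (hwr _ _ f) (hws _ _ s)
      -- Bit lengths grow linearly with the number of rounds: each round adds at most `L₀` for the
      -- counter and `G * L₀` for the body.
      have inv : ∀ j ≤ S, Bounded (L + j * (G + 1) * L₀) (τ j) ∧ FixedBounded L₀ (τ j) ∧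
          τ j 2 0 = S := by
        intro j
        induction j with
        | zero => intro _; simpa [hτ, loopState] using ⟨hb, hf, hS⟩
        | succ j ih =>
          intro hj
          obtain ⟨b, f, s⟩ := ih (by omega)
          obtain ⟨t, -, -, b', f', s'⟩ := body j (by omega) b f s
          exact ⟨b'.mono (le_of_eq (by ring)), f', s'⟩
      have hMj : ∀ j ≤ S, L + j * (G + 1) * L₀ + 10 * L₀ ≤ M := by
        intro j hj
        have := Nat.mul_le_mul_right L₀ (Nat.mul_le_mul_right (G + 1) hj)
        rw [hM, add_mul]; omega
      have hbj : ∀ j ≤ S, Bounded (L + j * (G + 1) * L₀ + L₀) ((τ j).write v 0 j) := by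
        intro j hj
        exact (((inv j hj).1).mono (Nat.le_add_right _ L₀)).write
          ((hjb j hj).trans (Nat.le_add_left _ _))
      have cond : ∀ j ≤ S,
          (Expr.lt (.get v (.const 0)) (.get 2 (.const 0))).cost ((τ j).write v 0 j)
            ≤ 10 * M ^ 2 := by
        intro j hj
        refine (Expr.cost_le h0 (hbj j hj) (hwr _ _ (inv j hj).2.1) rfl (M := M) ?_).trans
          (le_of_eq ?_)
        · have : (Expr.lt (.get v (.const 0)) (.get 2 (.const 0))).weight = 6 := rfl
          rw [this]
          have := hMj j hj
          omega
        · rfl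
      have hM1 : 1 ≤ M ^ 2 := Nat.one_le_pow _ _ (by have := (one_le_bits _).trans (hb 0 0); omega)
      -- Induction on the number `k` of remaining rounds, since an execution of a while loop unfolds
      -- at its first round.
      have main : ∀ k ≤ S, ∃ t, Exec (.while (.lt (.get v (.const 0)) (.get 2 (.const 0)))
            (.seq p.toCmd (.set v (.const 0) (.add (.get v (.const 0)) (.const 1)))))
            ((τ (S - k)).write v 0 (S - k : ℕ)) t ((τ S).write v 0 S) ∧
            t ≤ k * ((H + 50) * M ^ 2) + 11 * M ^ 2 := by
        intro k
        induction k with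
        | zero =>
          intro _
          have hc := cond S le_rfl
          rw [Nat.sub_zero]
          refine ⟨_, .while_false ?_, by linarith⟩
          simp [write_self, write_of_ne _ _ _ hv2.symm, (inv S le_rfl).2.2]
        | succ k ih =>
          intro hk
          obtain ⟨t, e, c⟩ := ih (by omega)
          obtain ⟨j, hj⟩ : ∃ j, j = S - (k + 1) := ⟨_, rfl⟩
          have hj' : S - k = j + 1 := by omega
          rw [hj'] at e
          rw [← hj]
          have hjS : j ≤ S := by omega
          obtain ⟨b, f, s⟩ := inv j hjS
          obtain ⟨t', e', c', b', f', s'⟩ := body j hjS b f s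
          have hm := hMj j hjS
          have hGM : L + j * (G + 1) * L₀ + L₀ + G * L₀ + 9 * L₀ ≤ M := by
            have := hMj (j + 1) (by omega)
            have e : (j + 1) * (G + 1) * L₀ = j * (G + 1) * L₀ + L₀ + G * L₀ := by ring
            omega
          obtain ⟨t'', e'', c''⟩ := Exec.set_le (a := v) (i := .const 0)
            (x := .add (.get v (.const 0)) (.const 1)) (M := M) h0 b' f' rfl rfl (by
              have : (Expr.const 0).weight + (Expr.add (.get v (.const 0)) (.const 1)).weight = 7 :=
                rfl
              rw [this]; omega)
          -- Tameness forbids the body to modify its counter, so the increment still finds `j`.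
          have hval : τ (j + 1) v 0 = j := by
            have : τ (j + 1) = p.run ((τ j).write v 0 j) := rfl
            rw [this, run_frame hw, write_self]
            simp
          have hwrite : (τ (j + 1)).write v ((Expr.const 0).eval (τ (j + 1)))
              ((Expr.add (.get v (.const 0)) (.const 1)).eval (τ (j + 1)))
              = (τ (j + 1)).write v 0 ((j + 1 : ℕ) : ℤ) := by
            simp [Expr.eval, hval]
          rw [hwrite] at e''
          refine ⟨_, .while_true ?_ (.seq e' e'') e, ?_⟩
          · have : j < S := by omega
            simp [write_self, write_of_ne _ _ _ hv2.symm, s, this]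
          · have c1 : t' ≤ H * M ^ 2 :=
              c'.trans (Nat.mul_le_mul_left _ (Nat.pow_le_pow_left (by omega) 2))
            have c2 : t'' ≤ 12 * M ^ 2 := c''.trans (le_of_eq (by rfl))
            have c3 := cond j hjS
            have : (k + 1) * ((H + 50) * M ^ 2)
                = k * ((H + 50) * M ^ 2) + H * M ^ 2 + 50 * M ^ 2 := by ring
            rw [this]
            linarith
      obtain ⟨t, e, c⟩ := main S le_rfl
      obtain ⟨t₀, e₀, c₀⟩ := Exec.set_le (a := v) (i := .const 0) (x := .const 0) (M := M) h0 hb hf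
        rfl rfl (by
          have : (Expr.const 0).weight + (Expr.const 0).weight = 2 := rfl
          rw [this, hM, add_mul]; omega)
      have hr : (loop v p).run σ = (τ S).write v 0 S := by simp only [run, hSn, hτ]
      rw [hr]
      simp only [Nat.sub_self] at e
      refine ⟨_, .seq e₀ e, ?_, ?_, hwr _ _ (inv S le_rfl).2.1, hws _ _ (inv S le_rfl).2.2⟩
      · have : t₀ ≤ 6 * M ^ 2 := c₀.trans (le_of_eq (by rfl))
        have e : (S * (H + 50) + 50) * M ^ 2 = S * ((H + 50) * M ^ 2) + 50 * M ^ 2 := by ring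
        rw [e]
        linarith
      · refine (hbj S le_rfl).mono ?_
        have := hMj S le_rfl
        omega

end RAM

namespace RAM

/-! ### The size of the input -/

/-- The memory during the computation of the input size. -/
def sizeStore (l : List ℤ) (i q s : ℤ) : Store :=
  (((inputStore l).write 2 0 s).write 3 0 i).write 4 0 q

/-- Doubles the variable `4` until it exceeds the absolute value of the current entry. -/
def sizeInner : Cmd :=
  .while (.add (.lt (.get 4 (.const 0)) (.add (.get 0 (.get 3 (.const 0))) (.const 1)))
      (.lt (.get 4 (.const 0)) (.sub (.const 1) (.get 0 (.get 3 (.const 0))))))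
    (.seq (.set 4 (.const 0) (.add (.get 4 (.const 0)) (.get 4 (.const 0))))
      (.set 2 (.const 0) (.add (.get 2 (.const 0)) (.const 1))))

/-- Computes the size of the input in the variable `2`. -/
def sizeCmd : Cmd :=
  .while (.lt (.get 3 (.const 0)) (.get 0 (.const 0)))
    (.seq (.set 3 (.const 0) (.add (.get 3 (.const 0)) (.const 1)))
      (.seq (.set 4 (.const 0) (.const 1))
        (.seq (.set 2 (.const 0) (.add (.get 2 (.const 0)) (.const 1))) sizeInner)))

theorem inputStore_eq_sizeStore (l : List ℤ) : inputStore l = sizeStore l 0 0 0 := by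
  funext a i
  simp only [sizeStore, Store.write, inputStore]
  split_ifs <;> simp_all

section sizeStore

variable (l : List ℤ) (i q s z : ℤ)

theorem sizeStore_write_two : (sizeStore l i q s).write 2 0 z = sizeStore l i q z := by
  funext a j
  simp only [sizeStore, Store.write]
  split_ifs <;> simp_all

theorem sizeStore_write_three : (sizeStore l i q s).write 3 0 z = sizeStore l z q s := by
  funext a j
  simp only [sizeStore, Store.write]
  split_ifs <;> simp_all

theorem sizeStore_write_four : (sizeStore l i q s).write 4 0 z = sizeStore l i z s := by
  funext a j
  simp only [sizeStore, Store.write]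
  split_ifs <;> simp_all

theorem sizeStore_zero : sizeStore l i q s 0 = inputStore l 0 := by
  funext j; simp [sizeStore, Store.write]

@[simp] theorem sizeStore_two : sizeStore l i q s 2 0 = s := by simp [sizeStore, Store.write]
@[simp] theorem sizeStore_three : sizeStore l i q s 3 0 = i := by simp [sizeStore, Store.write]
@[simp] theorem sizeStore_four : sizeStore l i q s 4 0 = q := by simp [sizeStore, Store.write]

theorem inputStore_zero_zero : inputStore l 0 0 = l.length := by simp [inputStore]

theorem inputStore_zero_succ {k : ℕ} (hk : k < l.length) :
    inputStore l 0 ((k : ℤ) + 1) = l[k] := by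
  have h : (0 : ℤ) ≤ k + 1 := by positivity
  have h' : ((k : ℤ) + 1).toNat = k + 1 := by omega
  simp [inputStore, h, h', hk]

theorem inputStore_zero_of_length_le {k : ℕ} (hk : l.length ≤ k) :
    inputStore l 0 ((k : ℤ) + 1) = 0 := by
  have h : (0 : ℤ) ≤ k + 1 := by positivity
  have h' : ((k : ℤ) + 1).toNat = k + 1 := by omega
  simp [inputStore, h, h', hk]

end sizeStore

theorem inputSize_take_succ (l : List ℤ) {k : ℕ} (hk : k < l.length) :
    inputSize (l.take (k + 1)) = inputSize (l.take k) + bits l[k] := by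
  rw [inputSize, List.take_add_one, List.getElem?_eq_getElem hk]
  simp only [inputSize, List.map_append, List.sum_append, Option.toList_some, List.map_cons,
    List.map_nil, List.sum_cons, List.sum_nil, add_zero]

theorem inputSize_take_le (l : List ℤ) (k : ℕ) : inputSize (l.take k) ≤ inputSize l := by
  conv_rhs => rw [← List.take_append_drop k l]
  rw [inputSize, inputSize, List.map_append, List.sum_append]
  exact Nat.le_add_right _ _

theorem length_le_inputSize (l : List ℤ) : l.length ≤ inputSize l := by
  induction l with
  | nil => simp
  | cons z l ih =>
    have := one_le_bits z
    simp only [inputSize, List.map_cons, List.sum_cons, List.length_cons] at ih ⊢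
    omega

theorem bits_natCast_le (k : ℕ) : bits k ≤ k + 1 := by
  rw [bits_le_succ_iff]; simpa using Nat.lt_two_pow_self

theorem bits_two_pow (k : ℕ) : bits (2 ^ k) ≤ k + 2 := by
  rw [bits_le_succ_iff, Int.natAbs_pow]
  exact Nat.pow_lt_pow_right (by norm_num) (by omega)

theorem bits_getElem_le (l : List ℤ) {k : ℕ} (hk : k < l.length) : bits l[k] ≤ inputSize l := by
  have := inputSize_take_succ l hk
  have := inputSize_take_le l (k + 1)
  omega

theorem bits_inputStore_le (l : List ℤ) (a : ℕ) (i : ℤ) :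
    bits (inputStore l a i) ≤ inputSize l + 1 := by
  by_cases h : a = 0 ∧ 0 ≤ i
  · obtain ⟨rfl, hi⟩ := h
    obtain ⟨k, rfl⟩ := Int.eq_ofNat_of_zero_le hi
    cases k with
    | zero =>
      have := inputStore_zero_zero l
      simp only [Nat.cast_zero, this]
      have := bits_natCast_le l.length
      have := length_le_inputSize l
      omega
    | succ k =>
      rw [Nat.cast_succ]
      by_cases hk : k < l.length
      · rw [inputStore_zero_succ l hk]
        have := bits_getElem_le l hk
        omega
      · rw [inputStore_zero_of_length_le l (by omega)]
        simp [bits]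
  · simp only [inputStore, if_neg h]
    simp [bits]

theorem bounded_sizeStore (l : List ℤ) {i q s : ℤ} {L : ℕ} (hL : inputSize l + 1 ≤ L)
    (hi : bits i ≤ L) (hq : bits q ≤ L) (hs : bits s ≤ L) : Bounded L (sizeStore l i q s) :=
  ((Bounded.write (fun a j => (bits_inputStore_le l a j).trans hL) hs).write hi).write hq

/-- The loop test adds the outcomes of `q < z + 1` and `q < 1 - z`, so it succeeds exactly while `q
≤ |z|`. Powers of two pass this bound at `2 ^ size`, and each doubling counts one bit; the induction
is on the number `k` of missing bits. -/
theorem exec_sizeInner (l : List ℤ) {i : ℕ} (hi : i < l.length) (k : ℕ)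
    (hk : k ≤ l[i].natAbs.size) (s : ℕ) (hs : s + k ≤ inputSize l) :
    ∃ t, Exec sizeInner (sizeStore l (i + 1) (2 ^ (l[i].natAbs.size - k) : ℤ) s) t
        (sizeStore l (i + 1) (2 ^ l[i].natAbs.size : ℤ) (s + k : ℕ)) ∧
      t ≤ (k + 1) * (200 * (100 * (inputSize l + 1)) ^ 2) := by
  set N := inputSize l
  have hlen : l.length ≤ N := length_le_inputSize l
  have hz : bits l[i] ≤ N := bits_getElem_le l hi
  set n := l[i].natAbs.size with hn
  have hnz : bits l[i] = n + 1 := rfl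
  have bd : ∀ k s : ℕ, s ≤ N →
      Bounded (N + 1) (sizeStore l (i + 1) (2 ^ (n - k) : ℤ) s) := by
    intro k s hs
    refine bounded_sizeStore l le_rfl ?_ ((bits_two_pow _).trans (by omega))
      ((bits_natCast_le s).trans (by omega))
    have := bits_natCast_le (i + 1)
    push_cast at this
    omega
  have fbd : ∀ k s : ℕ, s ≤ N →
      FixedBounded (N + 1) (sizeStore l (i + 1) (2 ^ (n - k) : ℤ) s) :=
    fun k s hs a _ j => bd k s hs a j
  set M := 100 * (N + 1) with hM
  have hM1 : 1 ≤ M ^ 2 := Nat.one_le_pow _ _ (by omega)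
  have cond : ∀ k s : ℕ, s ≤ N →
      (Expr.add (.lt (.get 4 (.const 0)) (.add (.get 0 (.get 3 (.const 0))) (.const 1)))
      (.lt (.get 4 (.const 0)) (.sub (.const 1) (.get 0 (.get 3 (.const 0)))))).cost
        (sizeStore l (i + 1) (2 ^ (n - k) : ℤ) s) ≤ 100 * M ^ 2 := by
    intro k s hs
    refine (Expr.cost_le (by omega) (bd k s hs) (fbd k s hs) rfl (M := M) ?_).trans
      (Nat.mul_le_mul_right _ (by decide))
    have : (Expr.add (.lt (.get 4 (.const 0)) (.add (.get 0 (.get 3 (.const 0))) (.const 1)))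
        (.lt (.get 4 (.const 0)) (.sub (.const 1) (.get 0 (.get 3 (.const 0)))))).weight ≤ 50 := by
      decide
    nlinarith
  have hentry : ∀ q s : ℤ, sizeStore l (i + 1) q s 0 (i + 1) = l[i] := fun q s => by
    rw [sizeStore_zero, inputStore_zero_succ l hi]
  induction k generalizing s with
  | zero =>
    refine ⟨_, .while_false ?_, ?_⟩
    · have h1 : l[i].natAbs < 2 ^ n := Nat.lt_size_self _
      have h2 : (l[i].natAbs : ℤ) < 2 ^ n := by exact_mod_cast h1
      have h3 : ¬ ((2 : ℤ) ^ n < l[i] + 1) := by omega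
      have h4 : ¬ ((2 : ℤ) ^ n < 1 - l[i]) := by omega
      simp [Expr.eval, hentry, h3, h4]
    · have := cond 0 s (by omega)
      linarith
  | succ k ih =>
    obtain ⟨t, e, c⟩ := ih (s + 1) (by omega) (by omega)
    obtain ⟨t₁, e₁, c₁⟩ := Exec.set_le (a := 4) (i := .const 0)
      (x := .add (.get 4 (.const 0)) (.get 4 (.const 0))) (M := M) (by omega)
      (bd (k + 1) s (by omega)) (fbd (k + 1) s (by omega)) rfl rfl (by
        have : (Expr.const 0).weight + (Expr.add (.get 4 (.const 0)) (.get 4 (.const 0))).weight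
          ≤ 50 := by decide
        nlinarith)
    have hpow : (2 : ℤ) ^ (n - (k + 1)) + 2 ^ (n - (k + 1)) = 2 ^ (n - k) := by
      have : n - k = n - (k + 1) + 1 := by omega
      rw [this, pow_succ]; ring
    simp only [Expr.eval, sizeStore_four, sizeStore_write_four, hpow] at e₁
    obtain ⟨t₂, e₂, c₂⟩ := Exec.set_le (a := 2) (i := .const 0)
      (x := .add (.get 2 (.const 0)) (.const 1)) (M := M) (by omega)
      (bd k s (by omega)) (fbd k s (by omega)) rfl rfl (by
        have : (Expr.const 0).weight + (Expr.add (.get 2 (.const 0)) (.const 1)).weight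
          ≤ 50 := by decide
        nlinarith)
    simp only [Expr.eval, sizeStore_two, sizeStore_write_two] at e₂
    have hfin : s + 1 + k = s + (k + 1) := by omega
    rw [hfin] at e
    push_cast at e e₂ ⊢
    refine ⟨_, .while_true ?_ (.seq e₁ e₂) e, ?_⟩
    · have h1 : 2 ^ (n - (k + 1)) ≤ l[i].natAbs := Nat.lt_size.1 (by omega)
      have h2 : (2 : ℤ) ^ (n - (k + 1)) ≤ l[i].natAbs := by exact_mod_cast h1
      simp only [Expr.eval, sizeStore_four, sizeStore_three, hentry]
      split_ifs <;> omega
    · have c0 := cond (k + 1) s (by omega)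
      have c1' : t₁ ≤ 20 * M ^ 2 := c₁.trans (Nat.mul_le_mul_right _ (by decide))
      have c2' : t₂ ≤ 20 * M ^ 2 := c₂.trans (Nat.mul_le_mul_right _ (by decide))
      linarith

theorem exec_sizeCmd (l : List ℤ) :
    ∃ (t : ℕ) (q : ℤ), Exec sizeCmd (inputStore l) t (sizeStore l l.length q (inputSize l)) ∧
      bits q ≤ inputSize l + 2 ∧
      t ≤ (2 * inputSize l + 1) * (200 * (100 * (inputSize l + 2)) ^ 2) := by
  set N := inputSize l with hN
  have hlen : l.length ≤ N := length_le_inputSize l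
  have bd : ∀ (i s : ℕ) (q : ℤ), i ≤ l.length → s ≤ N → bits q ≤ N + 2 →
      Bounded (N + 2) (sizeStore l i q s) := by
    intro i s q hi hs hq
    exact bounded_sizeStore l (by omega) ((bits_natCast_le i).trans (by omega)) hq
      ((bits_natCast_le s).trans (by omega))
  have fbd : ∀ (i s : ℕ) (q : ℤ), i ≤ l.length → s ≤ N → bits q ≤ N + 2 →
      FixedBounded (N + 2) (sizeStore l i q s) :=
    fun i s q hi hs hq a _ j => bd i s q hi hs hq a j
  set M := 100 * (N + 2) with hM
  have hM1 : 1 ≤ M ^ 2 := Nat.one_le_pow _ _ (by omega)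
  have cond : ∀ (i s : ℕ) (q : ℤ), i ≤ l.length → s ≤ N → bits q ≤ N + 2 →
      (Expr.lt (.get 3 (.const 0)) (.get 0 (.const 0))).cost (sizeStore l i q s)
        ≤ 100 * M ^ 2 := by
    intro i s q hi hs hq
    refine (Expr.cost_le (by omega) (bd i s q hi hs hq) (fbd i s q hi hs hq) rfl (M := M) ?_).trans
      (Nat.mul_le_mul_right _ (by decide))
    have : (Expr.lt (.get 3 (.const 0)) (.get 0 (.const 0))).weight ≤ 50 := by
      decide
    nlinarith
  have hlen0 : ∀ i q s : ℤ, sizeStore l i q s 0 0 = l.length := fun i q s => by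
    rw [sizeStore_zero, inputStore_zero_zero]
  -- The time still needed is bounded by the unread entries plus the unread bits. Crediting the bits
  -- already read on the left charges each inner loop to its own entry and keeps the total linear in
  -- `N`, up to the cost of one step.
  have main : ∀ (k : ℕ) (q : ℤ), k ≤ l.length → bits q ≤ N + 2 → ∃ (t : ℕ) (q' : ℤ),
      Exec sizeCmd (sizeStore l (l.length - k : ℕ) q (inputSize (l.take (l.length - k)))) t
        (sizeStore l l.length q' N) ∧ bits q' ≤ N + 2 ∧
      t + inputSize (l.take (l.length - k)) * (200 * M ^ 2)
        ≤ (k + N + 1) * (200 * M ^ 2) := by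
    intro k
    induction k with
    | zero =>
      intro q _ hq
      simp only [Nat.sub_zero, List.take_length]
      rw [← hN]
      refine ⟨_, q, .while_false ?_, hq, ?_⟩
      · simp [Expr.eval, hlen0]
      · have := cond l.length N q le_rfl le_rfl hq
        linarith
    | succ k ih =>
      intro q hk hq
      obtain ⟨i, hi⟩ : ∃ i, i = l.length - (k + 1) := ⟨_, rfl⟩
      have hi' : l.length - k = i + 1 := by omega
      have hil : i < l.length := by omega
      rw [hi'] at ih
      rw [← hi]
      set s := inputSize (l.take i)
      have hs1 : inputSize (l.take (i + 1)) = s + bits l[i] := inputSize_take_succ l hil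
      have hs2 : inputSize (l.take (i + 1)) ≤ N := inputSize_take_le l (i + 1)
      have hb : bits l[i] = l[i].natAbs.size + 1 := rfl
      have hsz : bits ((2 : ℤ) ^ l[i].natAbs.size) ≤ N + 2 := (bits_two_pow _).trans (by omega)
      obtain ⟨t, q', e, hq', c⟩ := ih _ (by omega) hsz
      obtain ⟨t₁, e₁, c₁⟩ := Exec.set_le (a := 3) (i := .const 0)
        (x := .add (.get 3 (.const 0)) (.const 1)) (M := M) (by omega)
        (bd i s q (by omega) (by omega) hq) (fbd i s q (by omega) (by omega) hq) rfl rfl (by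
          have : (Expr.const 0).weight + (Expr.add (.get 3 (.const 0)) (.const 1)).weight
            ≤ 50 := by decide
          nlinarith)
      simp only [Expr.eval, sizeStore_three, sizeStore_write_three] at e₁
      obtain ⟨t₂, e₂, c₂⟩ := Exec.set_le (a := 4) (i := .const 0)
        (x := .const 1) (M := M) (by omega)
        (bd (i + 1) s q (by omega) (by omega) hq) (fbd (i + 1) s q (by omega) (by omega) hq)
        rfl rfl (by
          have : (Expr.const 0).weight + (Expr.const 1).weight ≤ 50 := by decide
          nlinarith)
      simp only [Expr.eval, sizeStore_write_four] at e₂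
      have hb1 : bits 1 ≤ N + 2 := by
        have : bits 1 = 2 := by decide
        omega
      obtain ⟨t₃, e₃, c₃⟩ := Exec.set_le (a := 2) (i := .const 0)
        (x := .add (.get 2 (.const 0)) (.const 1)) (M := M) (by omega)
        (bd (i + 1) s 1 (by omega) (by omega) hb1) (fbd (i + 1) s 1 (by omega) (by omega) hb1)
        rfl rfl (by
          have : (Expr.const 0).weight + (Expr.add (.get 2 (.const 0)) (.const 1)).weight
            ≤ 50 := by decide
          nlinarith)
      simp only [Expr.eval, sizeStore_two, sizeStore_write_two] at e₃
      obtain ⟨t₄, e₄, c₄⟩ := exec_sizeInner l hil l[i].natAbs.size le_rfl (s + 1) (by omega)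
      simp only [Nat.sub_self, pow_zero] at e₄
      have hfin : s + 1 + l[i].natAbs.size = inputSize (l.take (i + 1)) := by omega
      rw [hfin] at e₄
      push_cast at e e₁ e₂ e₃ e₄ ⊢
      refine ⟨_, q', .while_true ?_ (.seq e₁ (.seq e₂ (.seq e₃ e₄))) e, hq', ?_⟩
      · simp [Expr.eval, hlen0, hil]
      · have c0 := cond i s q (by omega) (by omega) hq
        have c1' : t₁ ≤ 20 * M ^ 2 := c₁.trans (Nat.mul_le_mul_right _ (by decide))
        have c2' : t₂ ≤ 20 * M ^ 2 := c₂.trans (Nat.mul_le_mul_right _ (by decide))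
        have c3' : t₃ ≤ 20 * M ^ 2 := c₃.trans (Nat.mul_le_mul_right _ (by decide))
        have c4' : t₄ ≤ (l[i].natAbs.size + 1) * (200 * M ^ 2) :=
          c₄.trans (Nat.mul_le_mul_left _ (Nat.mul_le_mul_left _
            (Nat.pow_le_pow_left (by omega) 2)))
        rw [hs1, hb] at c
        have e1 : (s + (l[i].natAbs.size + 1)) * (200 * M ^ 2)
          = s * (200 * M ^ 2) + (l[i].natAbs.size + 1) * (200 * M ^ 2) := by ring
        have e2 : (k + 1 + N + 1) * (200 * M ^ 2) = (k + N + 1) * (200 * M ^ 2) + 200 * M ^ 2 := by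
          ring
        rw [e1] at c
        rw [e2]
        linarith
  obtain ⟨t, q, e, hq, c⟩ := main l.length 0 le_rfl (by simp [bits])
  refine ⟨t, q, ?_, hq, ?_⟩
  · rw [inputStore_eq_sizeStore]
    simpa [inputSize] using e
  · have : (l.length + N + 1) * (200 * M ^ 2) ≤ (2 * N + 1) * (200 * M ^ 2) :=
      Nat.mul_le_mul_right _ (by omega)
    have h2 := Nat.zero_le (inputSize (l.take (l.length - l.length)) * (200 * M ^ 2))
    linarith

open Polynomial in
/-- A search problem can be solved in polynomial time if it is solved by a tame program that is
started with the size of the input in cell `0` of array `2`. -/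
theorem polyTimeSolvable_of_prog {α : Type*} {β : α → Type*} {encIn : α → List ℤ}
    {encOut : ∀ x, β x → List ℤ} {R : ∀ x, β x → Prop} {p : Prog} (hp : p.tame = true)
    (h : ∀ (x : α) (σ : Store), σ 0 = inputStore (encIn x) 0 → σ 2 0 = inputSize (encIn x) →
      (∀ a, a = 1 ∨ 5 ≤ a → σ a = 0) →
      ∃ y : β x, HoldsOutput (p.run σ) (encOut x y) ∧ R x y) :
    PolyTimeSolvable encIn encOut R := by
  refine ⟨.seq sizeCmd p.toCmd,
    (2 * X + 1) * (200 * (100 * (X + 2)) ^ 2) + p.steps * ((X + 2) + p.growth * (X + 2)) ^ 2,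
    fun x => ?_⟩
  obtain ⟨t, q, e, hq, c⟩ := exec_sizeCmd (encIn x)
  set l := encIn x
  set N := inputSize l with hN
  have hlen : l.length ≤ N := length_le_inputSize l
  have hb : Bounded (N + 2) (sizeStore l l.length q N) :=
    bounded_sizeStore l (by omega) ((bits_natCast_le _).trans (by omega)) hq
      ((bits_natCast_le N).trans (by omega))
  obtain ⟨t', e', c', -⟩ := Prog.exec_toCmd hp (L₀ := N + 2) (S := N) (by omega) hb
    (fun a _ i => hb a i) (by simp)
  obtain ⟨y, hy, hR⟩ := h x (sizeStore l l.length q N) (sizeStore_zero _ _ _ _)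
    (by simp [hN, l]) (by
    intro a ha
    funext i
    have h0 : a ≠ 0 := by omega
    have h2 : a ≠ 2 := by omega
    have h3 : a ≠ 3 := by omega
    have h4 : a ≠ 4 := by omega
    simp [sizeStore, Store.write, inputStore, h0, h2, h3, h4])
  refine ⟨_, _, y, .seq e e', ?_, hy, hR⟩
  simp only [Polynomial.eval_add, Polynomial.eval_mul, Polynomial.eval_pow, Polynomial.eval_ofNat,
    Polynomial.eval_X, Polynomial.eval_one]
  exact add_le_add c c'

end RAM

/-! ### Circulations on numbered arcs

The arcs and the nodes are the integers in `[0, S)`.  The arc `rv b` is the reverse of `b`, and a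
flow takes opposite values on `b` and `rv b`. -/

/-- `rv` is a reversal of the arcs with tails `tl` and heads `hd`. -/
structure IsArcSystem (S : ℤ) (tl hd rv : ℤ → ℤ) : Prop where
  tl_mem : ∀ b ∈ Finset.Ico 0 S, tl b ∈ Finset.Ico 0 S
  rv_mem : ∀ b ∈ Finset.Ico 0 S, rv b ∈ Finset.Ico 0 S
  rv_rv : ∀ b ∈ Finset.Ico 0 S, rv (rv b) = b
  tl_rv : ∀ b ∈ Finset.Ico 0 S, tl (rv b) = hd b

/-- The net amount of flow that leaves the node `u`. -/
noncomputable def netOut {M : Type*} [AddCommMonoid M] (S : ℤ) (tl : ℤ → ℤ) (f : ℤ → M) (u : ℤ) : M :=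
  ∑ b ∈ Finset.Ico 0 S with tl b = u, f b

/-- The reduced cost of an arc. -/
def reducedCost (tl hd co pi : ℤ → ℤ) (b : ℤ) : ℤ := co b + pi (tl b) - pi (hd b)

/-- The flow `f` after sending `d` additional units along the arc `b` with reverse `c`. -/
def pushFlow (f : ℤ → ℤ) (b c d : ℤ) (x : ℤ) : ℤ :=
  f x + (if x = b then d else 0) - (if x = c then d else 0)

/-- The circulation `f` obeys the capacities `cc`, and the node prices `pi` prove that it has
minimum cost. -/
structure IsOptimal (S : ℤ) (tl hd rv co f cc pi : ℤ → ℤ) : Prop where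
  anti : ∀ b ∈ Finset.Ico 0 S, f (rv b) = -f b
  le : ∀ b ∈ Finset.Ico 0 S, f b ≤ cc b
  conserve : ∀ u, netOut S tl f u = 0
  slack : ∀ b ∈ Finset.Ico 0 S, f b < cc b → 0 ≤ reducedCost tl hd co pi b

open Finset in
section

variable {S : ℤ} {tl hd rv co : ℤ → ℤ}

theorem IsArcSystem.hd_mem (hA : IsArcSystem S tl hd rv) {b : ℤ} (hb : b ∈ Ico 0 S) :
    hd b ∈ Ico 0 S := by
  rw [← hA.tl_rv b hb]; exact hA.tl_mem _ (hA.rv_mem b hb)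

theorem IsArcSystem.hd_rv (hA : IsArcSystem S tl hd rv) {b : ℤ} (hb : b ∈ Ico 0 S) :
    hd (rv b) = tl b := by
  rw [← hA.tl_rv _ (hA.rv_mem b hb), hA.rv_rv b hb]

theorem IsArcSystem.rv_eq_iff (hA : IsArcSystem S tl hd rv) {b c : ℤ} (hb : b ∈ Ico 0 S)
    (hc : c ∈ Ico 0 S) : rv b = c ↔ b = rv c := by
  constructor
  · rintro rfl; rw [hA.rv_rv b hb]
  · rintro rfl; rw [hA.rv_rv c hc]

theorem reducedCost_rv (hA : IsArcSystem S tl hd rv) (hco : ∀ b ∈ Ico 0 S, co (rv b) = -co b)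
    (pi : ℤ → ℤ) {b : ℤ} (hb : b ∈ Ico 0 S) :
    reducedCost tl hd co pi (rv b) = -reducedCost tl hd co pi b := by
  simp only [reducedCost, hco b hb, hA.tl_rv b hb, hA.hd_rv hb]; ring

theorem sum_rv {M : Type*} [AddCommMonoid M] (hA : IsArcSystem S tl hd rv) (g : ℤ → M) :
    ∑ b ∈ Ico 0 S, g (rv b) = ∑ b ∈ Ico 0 S, g b :=
  Finset.sum_nbij' rv rv hA.rv_mem hA.rv_mem hA.rv_rv hA.rv_rv (fun _ _ => rfl)

/-- Potential differences do not contribute to the cost of a circulation. -/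
theorem sum_potential_mul_eq_zero (hA : IsArcSystem S tl hd rv) (pi : ℤ → ℝ) {h : ℤ → ℝ}
    (anti : ∀ b ∈ Ico 0 S, h (rv b) = -h b) (cons : ∀ u, netOut S tl h u = 0) :
    ∑ b ∈ Ico 0 S, (pi (tl b) - pi (hd b)) * h b = 0 := by
  have h1 : ∑ b ∈ Ico 0 S, pi (tl b) * h b = 0 := by
    rw [← Finset.sum_fiberwise_of_maps_to (t := Ico 0 S) hA.tl_mem]
    refine Finset.sum_eq_zero fun u _ => ?_
    have : ∀ b ∈ (Ico 0 S).filter (fun b => tl b = u), pi (tl b) * h b = pi u * h b := by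
      intro b hb; rw [(mem_filter.1 hb).2]
    rw [Finset.sum_congr rfl this, ← Finset.mul_sum]
    have := cons u
    simp only [netOut] at this
    rw [this, mul_zero]
  -- Reversal exchanges heads and tails and changes the sign of `h`, so this is the previous sum up
  -- to sign.
  have h2 : ∑ b ∈ Ico 0 S, pi (hd b) * h b = 0 := by
    have : ∀ b ∈ Ico 0 S, pi (hd b) * h b = -(pi (tl (rv b)) * h (rv b)) := by
      intro b hb; rw [hA.tl_rv b hb, anti b hb]; ring
    rw [Finset.sum_congr rfl this, Finset.sum_neg_distrib,
      sum_rv hA (fun b => pi (tl b) * h b), h1, neg_zero]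
  simp only [sub_mul, Finset.sum_sub_distrib, h1, h2, sub_zero]

/-- An optimal circulation costs at most as much as any other one. -/
theorem IsOptimal.cost_le (hA : IsArcSystem S tl hd rv)
    (hco : ∀ b ∈ Ico 0 S, co (rv b) = -co b) {f cc pi : ℤ → ℤ}
    (hf : IsOptimal S tl hd rv co f cc pi) {g : ℤ → ℝ}
    (anti : ∀ b ∈ Ico 0 S, g (rv b) = -g b) (le : ∀ b ∈ Ico 0 S, g b ≤ cc b)
    (cons : ∀ u, netOut S tl g u = 0) :
    ∑ b ∈ Ico 0 S, (co b : ℝ) * f b ≤ ∑ b ∈ Ico 0 S, (co b : ℝ) * g b := by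
  have key := sum_potential_mul_eq_zero hA (fun u => (pi u : ℝ)) (h := fun b => g b - f b)
    (by intro b hb; simp only [anti b hb, hf.anti b hb]; push_cast; ring)
    (by
      intro u
      have h1 := cons u
      have h2 := congrArg (Int.cast : ℤ → ℝ) (hf.conserve u)
      simp only [netOut] at h1 h2 ⊢
      push_cast at h2
      rw [Finset.sum_sub_distrib, h1, h2, sub_zero])
  -- Complementary slackness: an arc of negative reduced cost is saturated by `f`, and if the
  -- reduced cost is positive the reverse arc is. Either way both factors have the same sign.
  have nonneg : 0 ≤ ∑ b ∈ Ico 0 S, (reducedCost tl hd co pi b : ℝ) * (g b - f b) := by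
    refine Finset.sum_nonneg fun b hb => ?_
    rcases lt_trichotomy (reducedCost tl hd co pi b) 0 with h | h | h
    · have h1 : f b = cc b := by
        refine le_antisymm (hf.le b hb) (not_lt.1 fun hlt => ?_)
        have := hf.slack b hb hlt; omega
      have h2 := le b hb
      have h3 : (reducedCost tl hd co pi b : ℝ) ≤ 0 := by exact_mod_cast h.le
      rw [h1]
      nlinarith
    · simp [h]
    · have hb' := hA.rv_mem b hb
      have h1 : f (rv b) = cc (rv b) := by
        refine le_antisymm (hf.le _ hb') (not_lt.1 fun hlt => ?_)
        have := hf.slack _ hb' hlt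
        rw [reducedCost_rv hA hco pi hb] at this; omega
      have h2 := le _ hb'
      have h3 : (0 : ℝ) ≤ (reducedCost tl hd co pi b : ℝ) := by exact_mod_cast h.le
      rw [← h1, anti b hb, hf.anti b hb] at h2
      push_cast at h2
      nlinarith
  have e : ∑ b ∈ Ico 0 S, (reducedCost tl hd co pi b : ℝ) * (g b - f b)
      = (∑ b ∈ Ico 0 S, (co b : ℝ) * g b - ∑ b ∈ Ico 0 S, (co b : ℝ) * f b)
        + ∑ b ∈ Ico 0 S, ((pi (tl b) : ℝ) - pi (hd b)) * (g b - f b) := by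
    rw [← Finset.sum_sub_distrib, ← Finset.sum_add_distrib]
    refine Finset.sum_congr rfl fun b _ => ?_
    simp only [reducedCost]; push_cast; ring
  rw [e, key] at nonneg
  linarith

theorem IsOptimal.congr (hA : IsArcSystem S tl hd rv) {f cc f' cc' pi : ℤ → ℤ}
    (h : IsOptimal S tl hd rv co f cc pi)
    (hf : ∀ b ∈ Ico 0 S, f' b = f b)
    (hc : ∀ b ∈ Ico 0 S, cc' b = cc b) :
    IsOptimal S tl hd rv co f' cc' pi := by
  refine ⟨fun b hb => ?_, fun b hb => ?_, fun u => ?_, fun b hb => ?_⟩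
  · rw [hf _ (hA.rv_mem b hb), hf b hb, h.anti b hb]
  · rw [hf b hb, hc b hb]; exact h.le b hb
  · rw [← h.conserve u]
    exact Finset.sum_congr rfl fun b hb => hf b (Finset.mem_filter.1 hb).1
  · rw [hf b hb, hc b hb]; exact h.slack b hb

/-- Doubling does not change which arcs are saturated, so the old prices remain a certificate. -/
theorem IsOptimal.double {f cc pi : ℤ → ℤ} (h : IsOptimal S tl hd rv co f cc pi) :
    IsOptimal S tl hd rv co (fun b => 2 * f b) (fun b => 2 * cc b) pi := by
  refine ⟨fun b hb => ?_, fun b hb => ?_, fun u => ?_, fun b hb hlt => ?_⟩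
  · simp only [h.anti b hb]; ring
  · have := h.le b hb; omega
  · have := h.conserve u
    simp only [netOut] at this ⊢
    rw [← Finset.mul_sum, this, mul_zero]
  · exact h.slack b hb (by omega)

theorem pushFlow_anti (hA : IsArcSystem S tl hd rv) {f : ℤ → ℤ}
    (anti : ∀ b ∈ Ico 0 S, f (rv b) = -f b) {c : ℤ} (hc : c ∈ Ico 0 S) (d : ℤ) :
    ∀ b ∈ Ico 0 S, pushFlow f c (rv c) d (rv b) = -pushFlow f c (rv c) d b := by
  intro b hb
  have h1 : rv b = rv c ↔ b = c := by
    rw [hA.rv_eq_iff hb (hA.rv_mem c hc), hA.rv_rv c hc]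
  simp only [pushFlow, anti b hb, h1, hA.rv_eq_iff hb hc]; ring

theorem netOut_pushFlow (hA : IsArcSystem S tl hd rv) (f : ℤ → ℤ) {c : ℤ} (hc : c ∈ Ico 0 S)
    (d u : ℤ) : netOut S tl (pushFlow f c (rv c) d) u
      = netOut S tl f u + (if tl c = u then d else 0) - (if hd c = u then d else 0) := by
  have h : ∀ c ∈ Ico 0 S, ∑ b ∈ Ico 0 S with tl b = u, (if b = c then d else 0)
      = if tl c = u then d else 0 := by
    intro c hc
    rw [Finset.sum_ite_eq']
    simp only [mem_filter, hc, true_and]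
  simp only [netOut, pushFlow, Finset.sum_sub_distrib, Finset.sum_add_distrib, h c hc,
    h _ (hA.rv_mem c hc), hA.tl_rv c hc]

/-- A stage of the search for a cheap path from the head of the arc `a` to its tail.  The nodes
with positive rank are those for which a path to the tail of `a` without reduced cost is known,
and `nx` leads along these paths. -/
structure IsSearchTree (S : ℤ) (tl hd co f cc : ℤ → ℤ) (a : ℤ) (pi rk nx : ℤ → ℤ) (k : ℤ) :
    Prop where
  slack : ∀ b ∈ Ico 0 S, f b < cc b → 0 ≤ reducedCost tl hd co pi b
  root : rk (tl a) = 1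
  nonneg : ∀ u ∈ Ico 0 S, 0 ≤ rk u
  le : ∀ u ∈ Ico 0 S, rk u ≤ k + 1
  tree : ∀ u ∈ Ico 0 S, 0 < rk u → u ≠ tl a → nx u ∈ Ico 0 S ∧ tl (nx u) = u ∧
    0 < rk (hd (nx u)) ∧ rk (hd (nx u)) < rk u ∧ f (nx u) < cc (nx u) ∧
    reducedCost tl hd co pi (nx u) = 0
  reached : 0 < rk (hd a) → reducedCost tl hd co pi a < 0
  progress : 0 ≤ reducedCost tl hd co pi a ∨ 0 < rk (hd a) ∨
    k + 1 ≤ #{u ∈ Ico 0 S | 0 < rk u}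

/-- The effect of one search step on the prices. -/
def lowerPrices (S : ℤ) (pi rk : ℤ → ℤ) (d u : ℤ) : ℤ :=
  if (0 ≤ u ∧ u < S) ∧ rk u = 0 then pi u - d else pi u

/-- Lowering the prices of the unreached nodes by `d` lowers the reduced costs of arcs from
unreached to reached nodes by `d`, raises those in the opposite direction by `d`, and keeps all
others, in particular those of tree arcs. As `d` is at most the reduced cost of any residual arc
into the reached set, slackness survives. The arc `a` itself leads from a reached to an unreached
node, so its reduced cost rises: either up to zero, if `d` was its whole deficit, or the arc `best`
becomes tight and its tail joins the tree. The new rank `k + 2` exceeds all ranks so far, so ranks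
decrease along pointers. -/
theorem IsSearchTree.succ (hA : IsArcSystem S tl hd rv) {f cc pi rk nx : ℤ → ℤ} {a k d best : ℤ}
    (ha : a ∈ Ico 0 S) (hk : 0 ≤ k) (h : IsSearchTree S tl hd co f cc a pi rk nx k)
    (hneg : reducedCost tl hd co pi a < 0) (hna : rk (hd a) = 0) (hd0 : 0 ≤ d)
    (hmin : ∀ b ∈ Ico 0 S, f b < cc b → 0 < rk (hd b) → rk (tl b) = 0 →
      d ≤ reducedCost tl hd co pi b)
    (hbest : best = -1 ∧ d = -reducedCost tl hd co pi a ∨ best ∈ Ico 0 S ∧ f best < cc best ∧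
      0 < rk (hd best) ∧ rk (tl best) = 0 ∧ reducedCost tl hd co pi best = d ∧
      d < -reducedCost tl hd co pi a) :
    IsSearchTree S tl hd co f cc a (lowerPrices S pi rk d)
      (if -1 < best then Function.update rk (tl best) (k + 2) else rk)
      (if -1 < best then Function.update nx (tl best) best else nx) (k + 1) := by
  have hin : ∀ u ∈ Ico 0 S, lowerPrices S pi rk d u = if rk u = 0 then pi u - d else pi u := by
    intro u hu
    simp [lowerPrices, mem_Ico.1 hu]
  have hrc : ∀ b ∈ Ico 0 S, reducedCost tl hd co (lowerPrices S pi rk d) b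
      = reducedCost tl hd co pi b - (if rk (tl b) = 0 then d else 0)
        + (if rk (hd b) = 0 then d else 0) := by
    intro b hb
    simp only [reducedCost, hin _ (hA.tl_mem b hb), hin _ (hA.hd_mem hb)]
    split_ifs <;> ring
  have hta : rk (tl a) ≠ 0 := by rw [h.root]; norm_num
  have hslack : ∀ b ∈ Ico 0 S, f b < cc b →
      0 ≤ reducedCost tl hd co (lowerPrices S pi rk d) b := by
    intro b hb hlt
    have h1 := h.slack b hb hlt
    have h2 := h.nonneg _ (hA.hd_mem hb)
    rw [hrc b hb]
    by_cases ht : rk (tl b) = 0 <;> by_cases hh : rk (hd b) = 0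
    · simp [ht, hh]; omega
    · have := hmin b hb hlt (by omega) ht
      simp [ht, hh]; omega
    · simp [ht, hh]; omega
    · simp [ht, hh]; omega
  have hrca : reducedCost tl hd co (lowerPrices S pi rk d) a = reducedCost tl hd co pi a + d := by
    rw [hrc a ha]; simp [hta, hna]
  rcases hbest with ⟨hb, hd'⟩ | ⟨hb, hlt, hhd, htl, hrb, hd'⟩
  · subst hb
    simp only [lt_self_iff_false, if_false]
    refine ⟨hslack, h.root, h.nonneg, fun u hu => (h.le u hu).trans (by omega), ?_, ?_, ?_⟩
    · intro u hu h0 hne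
      obtain ⟨h1, h2, h3, h4, h5, h6⟩ := h.tree u hu h0 hne
      refine ⟨h1, h2, h3, h4, h5, ?_⟩
      rw [hrc _ h1, h2, h6]
      simp [h0.ne', h3.ne']
    · intro h0; omega
    · left; rw [hrca]; omega
  · have hb0 : -1 < best := by have := mem_Ico.1 hb; omega
    simp only [hb0, if_true]
    have hta' : tl a ≠ tl best := by intro e; rw [e] at hta; exact hta htl
    have hmem := hA.tl_mem best hb
    refine ⟨hslack, ?_, ?_, ?_, ?_, ?_, ?_⟩
    · rw [Function.update_of_ne hta', h.root]
    · intro u hu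
      by_cases e : u = tl best
      · subst e; simp; omega
      · rw [Function.update_of_ne e]; exact h.nonneg u hu
    · intro u hu
      by_cases e : u = tl best
      · subst e; simp; omega
      · rw [Function.update_of_ne e]; have := h.le u hu; omega
    · intro u hu h0 hne
      by_cases e : u = tl best
      · subst e
        have hne' : hd best ≠ tl best := by intro e; rw [e] at hhd; omega
        have := h.le _ (hA.hd_mem hb)
        simp only [Function.update_self, Function.update_of_ne hne']
        refine ⟨hb, trivial, hhd, by omega, hlt, ?_⟩
        rw [hrc _ hb]; simp [htl, hhd.ne']; omega
      · rw [Function.update_of_ne e] at h0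
        simp only [Function.update_of_ne e]
        obtain ⟨h1, h2, h3, h4, h5, h6⟩ := h.tree u hu h0 hne
        have hne' : hd (nx u) ≠ tl best := by intro e; rw [e] at h3; omega
        rw [Function.update_of_ne hne']
        refine ⟨h1, h2, h3, h4, h5, ?_⟩
        rw [hrc _ h1, h2, h6]
        simp [h0.ne', h3.ne']
    · intro _; rw [hrca]; omega
    · rcases h.progress with h1 | h1 | h1
      · omega
      · omega
      · right; right
        have : insert (tl best) {u ∈ Ico 0 S | 0 < rk u}
            ⊆ {u ∈ Ico 0 S | 0 < Function.update rk (tl best) (k + 2) u} := by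
          intro u hu
          rcases mem_insert.1 hu with rfl | hu
          · simp only [mem_filter, hmem, Function.update_self, true_and]; omega
          · obtain ⟨hu1, hu2⟩ := mem_filter.1 hu
            have : u ≠ tl best := by rintro rfl; omega
            simp only [mem_filter, hu1, Function.update_of_ne this, hu2, and_self]
        have h2 := card_le_card this
        rw [card_insert_of_notMem (by simp [htl])] at h2
        have h3 : ((#{u ∈ Ico 0 S | 0 < rk u} + 1 : ℕ) : ℤ)
            ≤ #{u ∈ Ico 0 S | 0 < Function.update rk (tl best) (k + 2) u} := by exact_mod_cast h2
        push_cast at h3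
        omega

/-- An unfinished search would have reached `S + 1` nodes after `S` steps, more than there are. -/
theorem IsSearchTree.reached_of_neg {f cc pi rk nx : ℤ → ℤ} {a : ℤ} (hS : 0 ≤ S)
    (h : IsSearchTree S tl hd co f cc a pi rk nx S) (hneg : reducedCost tl hd co pi a < 0) :
    0 < rk (hd a) := by
  rcases h.progress with h1 | h1 | h1
  · omega
  · exact h1
  · have h2 : #{u ∈ Ico 0 S | 0 < rk u} ≤ #(Ico 0 S) := card_filter_le _ _
    rw [Int.card_Ico] at h2
    omega

/-- In a finished search, the pointers lead from the head of `a` to its tail. -/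
theorem IsSearchTree.exists_walk (hA : IsArcSystem S tl hd rv) {f cc pi rk nx : ℤ → ℤ} {a : ℤ}
    (ha : a ∈ Ico 0 S)
    (h : IsSearchTree S tl hd co f cc a pi rk nx S) (h0 : 0 < rk (hd a)) :
    ∃ (w : ℕ → ℤ) (L : ℕ), w 0 = hd a ∧ w L = tl a ∧ (L : ℤ) ≤ S ∧ (∀ i < L, w i ≠ tl a) ∧
      (∀ i < L, w (i + 1) = hd (nx (w i))) ∧ ∀ i ≤ L, w i ∈ Ico 0 S ∧ 0 < rk (w i) := by
  set w : ℕ → ℤ := fun i => (fun u => hd (nx u))^[i] (hd a) with hw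
  have hs : ∀ i, w (i + 1) = hd (nx (w i)) := fun i => Function.iterate_succ_apply' _ _ _
  -- Ranks start at `S + 1` at most and drop with each pointer while staying positive, which bounds
  -- the length of the walk by `S`.
  have key : ∀ k, (∀ i < k, w i ≠ tl a) →
      w k ∈ Ico 0 S ∧ 0 < rk (w k) ∧ rk (w k) + k ≤ S + 1 := by
    intro k
    induction k with
    | zero =>
      intro _
      have hm := hA.hd_mem ha
      exact ⟨hm, h0, by simpa [hw] using h.le _ hm⟩
    | succ k ih =>
      intro hk
      obtain ⟨h1, h2, h3⟩ := ih fun i hi => hk i (by omega)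
      obtain ⟨t1, t2, t3, t4, -⟩ := h.tree _ h1 h2 (hk k (by omega))
      rw [hs]
      exact ⟨hA.hd_mem t1, t3, by push_cast; omega⟩
  have hex : ∃ k, w k = tl a := by
    by_contra! hne
    obtain ⟨h1, h2, h3⟩ := key (S + 1).toNat fun i _ => hne i
    have := mem_Ico.1 h1
    omega
  classical
  refine ⟨w, Nat.find hex, rfl, Nat.find_spec hex, ?_, fun i hi => Nat.find_min hex hi,
    fun i _ => hs i, fun i hi => ?_⟩
  · obtain ⟨-, h2, h3⟩ := key (Nat.find hex) fun i hi => Nat.find_min hex hi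
    omega
  · obtain ⟨h1, h2, -⟩ := key i fun j hj => Nat.find_min hex (hj.trans_le hi)
    exact ⟨h1, h2⟩

/-- A stage of sending a unit of flow along the path that the search has found: the circulation
`f` that has excess at the node `u`. -/
structure IsAugmenting (S : ℤ) (tl hd rv co cc : ℤ → ℤ) (a : ℤ) (pi rk nx : ℤ → ℤ) (u : ℤ)
    (f : ℤ → ℤ) : Prop where
  anti : ∀ b ∈ Ico 0 S, f (rv b) = -f b
  le : ∀ b ∈ Ico 0 S, f b ≤ cc b
  slack : ∀ b ∈ Ico 0 S, f b < cc b → 0 ≤ reducedCost tl hd co pi b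
  excess : ∀ x, netOut S tl f x = (if tl a = x then 1 else 0) - (if u = x then 1 else 0)
  residual : ∀ x ∈ Ico 0 S, 0 < rk x → rk x ≤ rk u → x ≠ tl a → f (nx x) < cc (nx x)

/-- A tree arc has reduced cost zero, hence so has its reverse, the only arc that may become
residual; the prices stay valid. The tree arcs still ahead start at nodes of smaller rank, so none
of them is the arc just used, and none loses residual capacity. -/
theorem IsAugmenting.next (hA : IsArcSystem S tl hd rv) (hco : ∀ b ∈ Ico 0 S, co (rv b) = -co b)
    {f₀ cc₀ cc pi rk nx f : ℤ → ℤ} {a k u : ℤ}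
    (ht : IsSearchTree S tl hd co f₀ cc₀ a pi rk nx k) (hu : u ∈ Ico 0 S) (hu0 : 0 < rk u)
    (hua : u ≠ tl a) (h : IsAugmenting S tl hd rv co cc a pi rk nx u f) :
    IsAugmenting S tl hd rv co cc a pi rk nx (hd (nx u))
      (pushFlow f (nx u) (rv (nx u)) 1) := by
  obtain ⟨t1, t2, t3, t4, -, t6⟩ := ht.tree u hu hu0 hua
  have hres := h.residual u hu hu0 le_rfl hua
  refine ⟨pushFlow_anti hA h.anti t1 1, ?_, ?_, ?_, ?_⟩
  · intro b hb
    have := h.le b hb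
    simp only [pushFlow]
    by_cases e : b = nx u
    · subst e; split_ifs <;> omega
    · split_ifs <;> omega
  · intro b hb hlt
    simp only [pushFlow] at hlt
    by_cases e : b = rv (nx u)
    · subst e; rw [reducedCost_rv hA hco pi t1, t6]; simp
    · refine h.slack b hb ?_
      rw [if_neg e] at hlt
      split_ifs at hlt <;> omega
  · intro x
    rw [netOut_pushFlow hA f t1, h.excess, t2]
    ring
  · intro x hx hx0 hxle hxa
    have h1 := h.residual x hx hx0 (by omega) hxa
    obtain ⟨-, s2, -⟩ := ht.tree x hx hx0 hxa
    have : nx x ≠ nx u := by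
      intro e
      have : x = u := by rw [← s2, e, t2]
      subst this; omega
    simp only [pushFlow, if_neg this]
    split_ifs <;> omega

end

namespace RAM

/-! ### The programs

The arrays `TAIL`, `HEAD`, `REV`, `COST`, `TIME`, `CAPA` describe the arcs, `FLOW` is a circulation
with respect to the capacities `ROOM`, and `PRICE` holds the prices of the nodes.  The nodes that
a search has reached have positive `RANK`, and `NEXT` points to the next arc of a path. -/

notation "IN" => (0 : ℕ)
notation "OUT" => (1 : ℕ)
notation "SIZE" => (2 : ℕ)
notation "TAIL" => (10 : ℕ)
notation "HEAD" => (11 : ℕ)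
notation "REV" => (12 : ℕ)
notation "CAPA" => (13 : ℕ)
notation "COST" => (14 : ℕ)
notation "TIME" => (15 : ℕ)
notation "FLOW" => (20 : ℕ)
notation "ROOM" => (21 : ℕ)
notation "PRICE" => (22 : ℕ)
notation "RANK" => (23 : ℕ)
notation "NEXT" => (24 : ℕ)
notation "START" => (25 : ℕ)
notation "AMOUNT" => (26 : ℕ)
notation "CTRA" => (30 : ℕ)
notation "CTRB" => (31 : ℕ)
notation "CTRC" => (32 : ℕ)
notation "CTRD" => (33 : ℕ)
notation "CTRE" => (34 : ℕ)
notation "DELTA" => (40 : ℕ)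
notation "BEST" => (41 : ℕ)
notation "ARC" => (42 : ℕ)
notation "CUR" => (43 : ℕ)
notation "FIN" => (44 : ℕ)
notation "ACT" => (45 : ℕ)
notation "POW" => (46 : ℕ)
notation "DENOM" => (47 : ℕ)
notation "CAPSUM" => (48 : ℕ)
notation "TDENOM" => (49 : ℕ)
notation "PARITY" => (50 : ℕ)
notation "BASE" => (51 : ℕ)
notation "ITEM" => (52 : ℕ)
notation "VALUE" => (53 : ℕ)
notation "TOTAL" => (54 : ℕ)
notation "PREFIX" => (55 : ℕ)
notation "RDENOM" => (56 : ℕ)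

open RAM.Expr RAM.Prog

section run

variable (σ : Store) (x y : Expr) (p q : Prog)

theorem run_set (a : ℕ) : (set a x y).run σ = σ.write a (x.eval σ) (y.eval σ) := rfl

theorem run_setVar (a : ℕ) : (setVar a x).run σ = σ.write a 0 (x.eval σ) := rfl

theorem run_block_nil : (block []).run σ = σ := rfl

theorem run_block_cons (l : List Prog) : (block (p :: l)).run σ = (block l).run (p.run σ) := by
  cases l <;> rfl

theorem run_when_var (a : ℕ) :
    (when (var a) p).run σ = if σ a 0 ≠ 0 then p.run σ else σ := rfl

theorem run_when_lt :
    (when (lt x y) p).run σ = if x.eval σ < y.eval σ then p.run σ else σ := by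
  simp only [when, Prog.run, eval_lt]; split_ifs <;> simp_all

theorem run_when_eq :
    (when (eq x y) p).run σ = if x.eval σ = y.eval σ then p.run σ else σ := by
  simp only [when, Prog.run, eval_eq]; split_ifs <;> simp_all

theorem run_ite_lt :
    (ite (lt x y) p q).run σ = if x.eval σ < y.eval σ then p.run σ else q.run σ := by
  simp only [Prog.run, eval_lt]; split_ifs <;> simp_all

theorem run_ite_eq :
    (ite (eq x y) p q).run σ = if x.eval σ = y.eval σ then p.run σ else q.run σ := by
  simp only [Prog.run, eval_eq]; split_ifs <;> simp_all

theorem store_ite (c : Prop) [Decidable c] (σ τ : Store) (a : ℕ) :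
    (if c then σ else τ) a = if c then σ a else τ a := by split_ifs <;> rfl

end run

/-- The reduced cost of the arc `b`. -/
def Expr.rc (b : Expr) : Expr := get COST b + get PRICE (get TAIL b) - get PRICE (get HEAD b)

@[simp] theorem eval_rc (σ : Store) (b : Expr) :
    b.rc.eval σ = reducedCost (σ TAIL) (σ HEAD) (σ COST) (σ PRICE) (b.eval σ) := rfl

/-- Finds the cheapest arc that leads from an unreached node to a reached one. -/
def minLoop : Prog :=
  loop CTRE (when (lt (get FLOW (var CTRE)) (get ROOM (var CTRE)))
    (when (lt 0 (get RANK (get HEAD (var CTRE))))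
      (when (eq (get RANK (get TAIL (var CTRE))) 0)
        (when (lt (rc (var CTRE)) (var DELTA))
          (block [setVar DELTA (rc (var CTRE)), setVar BEST (var CTRE)])))))

/-- Lowers the prices of the unreached nodes. -/
def priceLoop : Prog :=
  loop CTRE (when (eq (get RANK (var CTRE)) 0)
    (set PRICE (var CTRE) (get PRICE (var CTRE) - var DELTA)))

/-- Adds the tail of the cheapest arc to the reached nodes. -/
def searchStep : Prog :=
  block [setVar DELTA (0 - rc (var CTRC)), setVar BEST (const (-1)), minLoop, priceLoop,
    when (lt (const (-1)) (var BEST))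
      (block [set RANK (get TAIL (var BEST)) (var CTRD + 2),
        set NEXT (get TAIL (var BEST)) (var BEST)])]

/-- Searches for a cheap path from the head of the arc `CTRC` to its tail. -/
def search : Prog :=
  block [loop CTRD (set RANK (var CTRD) 0), set RANK (get TAIL (var CTRC)) 1,
    loop CTRD (when (lt (rc (var CTRC)) 0)
      (when (eq (get RANK (get HEAD (var CTRC))) 0) searchStep))]

/-- Follows the pointers `NEXT` from `CUR` to `FIN` and runs `q` on each arc. -/
def walk (q : Prog) : Prog :=
  loop CTRD (when (var ACT)
    (block [setVar ARC (get NEXT (var CUR)), q, setVar CUR (get HEAD (var ARC)),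
      when (eq (var CUR) (var FIN)) (setVar ACT 0)]))

/-- Sends `d` units of flow along the arc `b`. -/
def push (b d : Expr) : Prog :=
  block [set FLOW b (get FLOW b + d), set FLOW (get REV b) (get FLOW (get REV b) - d)]

/-- Sends a unit of flow along the arc `CTRC` and the path that has been found. -/
def augment : Prog :=
  block [push (var CTRC) 1, setVar FIN (get TAIL (var CTRC)), setVar CUR (get HEAD (var CTRC)),
    setVar ACT (1 - eq (var CUR) (var FIN)), walk (push (var ARC) 1)]

/-- Raises the capacity of the arc `CTRC` by one and restores optimality. -/
def raiseRoom : Prog :=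
  block [when (lt (rc (var CTRC)) 0) search,
    set ROOM (var CTRC) (get ROOM (var CTRC) + 1),
    when (lt (rc (var CTRC)) 0) augment]

/-- Doubles the circulation and the capacities. -/
def doubleLoop : Prog :=
  loop CTRC (block [set FLOW (var CTRC) (get FLOW (var CTRC) + get FLOW (var CTRC)),
    set ROOM (var CTRC) (get ROOM (var CTRC) + get ROOM (var CTRC))])

/-- Adds the next bit of the capacities. -/
def raiseLoop : Prog :=
  loop CTRC (when (lt (get ROOM (var CTRC)) (get CAPA (var CTRC) / var POW)) raiseRoom)

/-- A phase of the scaling algorithm. -/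
def phase : Prog := block [setVar POW (var POW / 2), doubleLoop, raiseLoop]

/-- Computes a circulation of minimum cost. -/
def solve : Prog :=
  block [setVar POW 1, loop CTRA (loop CTRB (setVar POW (var POW + var POW))),
    loop CTRA (loop CTRB phase)]

/-- The arcs that are stored in the memory. -/
structure HasArcs (S : ℕ) (tl hd rv co : ℤ → ℤ) (σ : Store) : Prop where
  size : σ SIZE 0 = S
  tail : σ TAIL = tl
  head : σ HEAD = hd
  rev : σ REV = rv
  cost : σ COST = co

theorem HasArcs.congr {S : ℕ} {tl hd rv co : ℤ → ℤ} {σ τ : Store} (h : HasArcs S tl hd rv co σ)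
    (h2 : τ SIZE = σ SIZE) (h10 : τ TAIL = σ TAIL) (h11 : τ HEAD = σ HEAD)
    (h12 : τ REV = σ REV) (h14 : τ COST = σ COST) : HasArcs S tl hd rv co τ :=
  ⟨by rw [h2, h.size], h10.trans h.tail, h11.trans h.head, h12.trans h.rev, h14.trans h.cost⟩

theorem HasArcs.run {S : ℕ} {tl hd rv co : ℤ → ℤ} {σ : Store} (h : HasArcs S tl hd rv co σ)
    {p : Prog} (h2 : p.writesTo SIZE = false) (h10 : p.writesTo TAIL = false)
    (h11 : p.writesTo HEAD = false) (h12 : p.writesTo REV = false)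
    (h14 : p.writesTo COST = false) : HasArcs S tl hd rv co (p.run σ) :=
  h.congr (run_frame h2 _) (run_frame h10 _) (run_frame h11 _) (run_frame h12 _) (run_frame h14 _)

section

variable {S : ℕ} {tl hd rv co : ℤ → ℤ} {σ : Store}

theorem run_minLoop (h : HasArcs S tl hd rv co σ) (hd0 : 0 ≤ σ DELTA 0) (hb : σ BEST 0 = -1)
    (slack : ∀ b ∈ Finset.Ico 0 (S : ℤ), σ FLOW b < σ ROOM b →
      0 ≤ reducedCost tl hd co (σ PRICE) b) :
    0 ≤ minLoop.run σ DELTA 0 ∧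
    (∀ b ∈ Finset.Ico 0 (S : ℤ), σ FLOW b < σ ROOM b → 0 < σ RANK (hd b) → σ RANK (tl b) = 0 →
      minLoop.run σ DELTA 0 ≤ reducedCost tl hd co (σ PRICE) b) ∧
    (minLoop.run σ BEST 0 = -1 ∧ minLoop.run σ DELTA 0 = σ DELTA 0 ∨
      minLoop.run σ BEST 0 ∈ Finset.Ico 0 (S : ℤ) ∧
      σ FLOW (minLoop.run σ BEST 0) < σ ROOM (minLoop.run σ BEST 0) ∧
      0 < σ RANK (hd (minLoop.run σ BEST 0)) ∧ σ RANK (tl (minLoop.run σ BEST 0)) = 0 ∧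
      reducedCost tl hd co (σ PRICE) (minLoop.run σ BEST 0) = minLoop.run σ DELTA 0 ∧
      minLoop.run σ DELTA 0 < σ DELTA 0) := by
  let P : ℕ → Store → Prop := fun j τ => 0 ≤ τ DELTA 0 ∧
    (∀ b ∈ Finset.Ico 0 (j : ℤ), σ FLOW b < σ ROOM b → 0 < σ RANK (hd b) → σ RANK (tl b) = 0 →
      τ DELTA 0 ≤ reducedCost tl hd co (σ PRICE) b) ∧
    (τ BEST 0 = -1 ∧ τ DELTA 0 = σ DELTA 0 ∨
      τ BEST 0 ∈ Finset.Ico 0 (S : ℤ) ∧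
      σ FLOW (τ BEST 0) < σ ROOM (τ BEST 0) ∧
      0 < σ RANK (hd (τ BEST 0)) ∧ σ RANK (tl (τ BEST 0)) = 0 ∧
      reducedCost tl hd co (σ PRICE) (τ BEST 0) = τ DELTA 0 ∧
      τ DELTA 0 < σ DELTA 0)
  change P S (minLoop.run σ)
  refine run_loop h.size P (P S) ?_ ?_ ?_
  · refine ⟨hd0, fun b hb => ?_, .inl ⟨hb, rfl⟩⟩
    simp at hb
  · rintro j hj τ fr ⟨p1, p2, p3⟩
    have e1 : τ FLOW = σ FLOW := fr _ rfl
    have e2 : τ ROOM = σ ROOM := fr _ rfl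
    have e3 : τ RANK = σ RANK := fr _ rfl
    have e4 : τ PRICE = σ PRICE := fr _ rfl
    have e5 : τ TAIL = tl := (fr _ rfl).trans h.tail
    have e6 : τ HEAD = hd := (fr _ rfl).trans h.head
    have e7 : τ COST = co := (fr _ rfl).trans h.cost
    have hjm : (j : ℤ) ∈ Finset.Ico 0 (S : ℤ) := by simp; omega
    have hlast : ∀ b ∈ Finset.Ico 0 ((j + 1 : ℕ) : ℤ), b = j ∨ b ∈ Finset.Ico 0 (j : ℤ) := by
      intro b hb; simp only [Finset.mem_Ico] at hb ⊢; push_cast at hb; omega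
    simp only [run_when_lt, run_when_eq, run_block_cons, run_block_nil, run_setVar, eval_rc,
      eval_get, eval_var,
      eval_zero, write_apply, Function.update_self, e1, e2, e3, e4, e5, e6, e7, Nat.reduceEqDiff,
      if_true, if_false]
    -- Whichever of the four nested tests fails, nothing is written, and the arc `j` either does not
    -- qualify or does not beat the current minimum.
    have neg : ¬(σ FLOW j < σ ROOM j ∧ 0 < σ RANK (hd j) ∧ σ RANK (tl j) = 0 ∧
        reducedCost tl hd co (σ PRICE) j < τ DELTA 0) → P (j + 1) (τ.write CTRE 0 j) := by
      intro hn
      refine ⟨by simpa [write_apply] using p1, ?_, by simpa [write_apply] using p3⟩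
      intro b hb h1 h2 h3
      rcases hlast b hb with rfl | hb
      · simp only [write_apply, Nat.reduceEqDiff, if_false]
        by_contra hc
        exact hn ⟨h1, h2, h3, by omega⟩
      · simpa [write_apply] using p2 b hb h1 h2 h3
    split_ifs with c1 c2 c3 c4
    · refine ⟨?_, ?_, .inr ?_⟩
      · simpa [write_apply] using slack _ hjm c1
      · intro b hb h1 h2 h3
        simp only [write_apply, Nat.reduceEqDiff, if_true, if_false, Function.update_self]
        rcases hlast b hb with rfl | hb
        · exact le_rfl
        · exact c4.le.trans (p2 b hb h1 h2 h3)
      · simp only [write_apply, Nat.reduceEqDiff, if_true, if_false, Function.update_self]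
        refine ⟨hjm, c1, c2, c3, trivial, ?_⟩
        rcases p3 with p3 | p3
        · omega
        · exact c4.trans p3.2.2.2.2.2
    all_goals exact neg (by tauto)
  · rintro τ - h
    simpa [P, write_apply] using h

/-- `lowerPrices` has the number of nodes as a parameter, so it also describes the partially
processed prices and serves as the invariant. -/
theorem run_priceLoop (h : HasArcs S tl hd rv co σ) :
    priceLoop.run σ PRICE = lowerPrices S (σ PRICE) (σ RANK) (σ DELTA 0) := by
  let P : ℕ → Store → Prop := fun j τ =>
    τ PRICE = lowerPrices j (σ PRICE) (σ RANK) (σ DELTA 0)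
  refine run_loop h.size P (P S) ?_ ?_ ?_
  · funext u
    have : ¬(0 ≤ u ∧ u < 0) := by omega
    simp [lowerPrices, this]
  · intro j hj τ fr hτ
    have e1 : τ RANK = σ RANK := fr _ rfl
    have e2 : τ DELTA = σ DELTA := fr _ rfl
    simp only [P] at hτ
    simp only [run_when_eq, run_set, eval_sub, eval_get, eval_var, eval_zero, write_apply,
      Function.update_self, e1, e2, hτ, Nat.reduceEqDiff, if_true, if_false]
    split_ifs with hr
    all_goals
      funext u
      by_cases hu : u = j
      · subst hu
        simp [hr, lowerPrices, write_apply, hτ]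
      · have : u ≤ j ↔ u < j := by omega
        simp [lowerPrices, write_apply, hτ, hu, this]
  · intro τ _ hτ
    simpa [P, write_apply] using hτ

theorem run_searchStep (hA : IsArcSystem S tl hd rv) (h : HasArcs S tl hd rv co σ) {k : ℕ}
    (hk : σ CTRD 0 = k) {a : ℤ} (hc : σ CTRC 0 = a) (ha : a ∈ Finset.Ico 0 (S : ℤ))
    (ht : IsSearchTree S tl hd co (σ FLOW) (σ ROOM) a (σ PRICE) (σ RANK) (σ NEXT) k)
    (hneg : reducedCost tl hd co (σ PRICE) a < 0) (hna : σ RANK (hd a) = 0) :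
    IsSearchTree S tl hd co (σ FLOW) (σ ROOM) a (searchStep.run σ PRICE)
      (searchStep.run σ RANK) (searchStep.run σ NEXT) (k + 1) := by
  obtain ⟨σ₁, hσ₁⟩ : ∃ σ₁, σ₁ = (σ.write DELTA 0 (-reducedCost tl hd co (σ PRICE) a)).write
    BEST 0 (-1) := ⟨_, rfl⟩
  have hrun : searchStep.run σ = (when (lt (const (-1)) (var BEST))
      (block [set RANK (get TAIL (var BEST)) (var CTRD + 2),
        set NEXT (get TAIL (var BEST)) (var BEST)])).run (priceLoop.run (minLoop.run σ₁)) := by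
    simp only [searchStep, run_block_cons, run_block_nil, run_setVar, eval_sub, eval_rc, eval_var,
      eval_zero, eval_const, h.tail, h.head, h.cost, hc, hσ₁, zero_sub]
  have g1 : ∀ x, x ≠ DELTA → x ≠ BEST → σ₁ x = σ x := by
    intro x h1 h2; rw [hσ₁, write_of_ne _ _ _ h2, write_of_ne _ _ _ h1]
  have h₁ : HasArcs S tl hd rv co σ₁ := h.congr (g1 _ (by decide) (by decide))
    (g1 _ (by decide) (by decide)) (g1 _ (by decide) (by decide)) (g1 _ (by decide) (by decide))
    (g1 _ (by decide) (by decide))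
  have hD : σ₁ DELTA 0 = -reducedCost tl hd co (σ PRICE) a := by simp [hσ₁, write_apply]
  have hB : σ₁ BEST 0 = -1 := by simp [hσ₁, write_apply]
  have f1 := g1 FLOW (by decide) (by decide)
  have f2 := g1 ROOM (by decide) (by decide)
  have f3 := g1 RANK (by decide) (by decide)
  have f4 := g1 PRICE (by decide) (by decide)
  have f5 := g1 NEXT (by decide) (by decide)
  have f6 := g1 CTRD (by decide) (by decide)
  obtain ⟨m1, m2, m3⟩ := run_minLoop h₁ (by rw [hD]; omega) hB (by
    rw [f1, f2, f4]; exact ht.slack)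
  rw [f1, f2, f3, f4, hD] at m3
  rw [f1, f2, f3, f4] at m2
  set σ₂ := minLoop.run σ₁ with hσ₂
  have h₂ : HasArcs S tl hd rv co σ₂ := h₁.run rfl rfl rfl rfl rfl
  have k3 : σ₂ RANK = σ RANK := (run_frame rfl _).trans f3
  have k4 : σ₂ PRICE = σ PRICE := (run_frame rfl _).trans f4
  have k5 : σ₂ NEXT = σ NEXT := (run_frame rfl _).trans f5
  have k6 : σ₂ CTRD = σ CTRD := (run_frame rfl _).trans f6
  have hp := run_priceLoop h₂
  rw [k3, k4] at hp
  set σ₃ := priceLoop.run σ₂ with hσ₃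
  have h₃ : HasArcs S tl hd rv co σ₃ := h₂.run rfl rfl rfl rfl rfl
  have l3 : σ₃ RANK = σ RANK := (run_frame rfl _).trans k3
  have l5 : σ₃ NEXT = σ NEXT := (run_frame rfl _).trans k5
  have l6 : σ₃ CTRD = σ CTRD := (run_frame rfl _).trans k6
  have l7 : σ₃ BEST = σ₂ BEST := run_frame rfl _
  have key := ht.succ hA ha (by positivity) hneg hna m1 m2 m3
  have r1 : searchStep.run σ PRICE = lowerPrices S (σ PRICE) (σ RANK) (σ₂ DELTA 0) := by
    rw [hrun, run_frame rfl, hp]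
  have r2 : searchStep.run σ RANK = if -1 < σ₂ BEST 0 then
      Function.update (σ RANK) (tl (σ₂ BEST 0)) (k + 2) else σ RANK := by
    rw [hrun, run_when_lt, store_ite]
    simp only [run_block_cons, run_block_nil, run_set, eval_const, eval_var, eval_get, eval_add,
      eval_two, l7, l6, hk, h₃.tail, write_apply, l3, Nat.reduceEqDiff, if_true, if_false]
  have r3 : searchStep.run σ NEXT = if -1 < σ₂ BEST 0 then
      Function.update (σ NEXT) (tl (σ₂ BEST 0)) (σ₂ BEST 0) else σ NEXT := by
    rw [hrun, run_when_lt, store_ite]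
    simp only [run_block_cons, run_block_nil, run_set, eval_const, eval_var, eval_get, eval_add,
      eval_two, l7, l6, hk, h₃.tail, write_apply, l5, Nat.reduceEqDiff, if_true, if_false]
  rw [r1, r2, r3]
  exact key

/-- At stage zero only the tail of `a` is reached and the prices are the given ones; the conditional
search step then advances the stage in each round. -/
theorem run_search (hA : IsArcSystem S tl hd rv) (h : HasArcs S tl hd rv co σ)
    {a : ℤ} (hc : σ CTRC 0 = a) (ha : a ∈ Finset.Ico 0 (S : ℤ))
    (slack : ∀ b ∈ Finset.Ico 0 (S : ℤ), σ FLOW b < σ ROOM b →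
      0 ≤ reducedCost tl hd co (σ PRICE) b)
    (hneg : reducedCost tl hd co (σ PRICE) a < 0) :
    IsSearchTree S tl hd co (σ FLOW) (σ ROOM) a (search.run σ PRICE)
      (search.run σ RANK) (search.run σ NEXT) S := by
  set σ₁ := (loop CTRD (set RANK (var CTRD) 0)).run σ with hσ₁
  have h₁ : HasArcs S tl hd rv co σ₁ := h.run rfl rfl rfl rfl rfl
  have z₁ : ∀ u ∈ Finset.Ico 0 (S : ℤ), σ₁ RANK u = 0 := by
    refine run_loop h.size (fun j τ => ∀ u ∈ Finset.Ico 0 (j : ℤ), τ RANK u = 0)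
      (fun τ => ∀ u ∈ Finset.Ico 0 (S : ℤ), τ RANK u = 0) ?_ ?_ ?_
    · intro u hu; simp at hu
    · intro j hj τ _ hτ u hu
      simp only [run_set, eval_var, eval_zero, write_apply, Nat.reduceEqDiff, if_true, if_false,
        Function.update_self]
      by_cases e : u = j
      · subst e; simp
      · rw [Function.update_of_ne e]
        refine hτ u ?_
        simp only [Finset.mem_Ico] at hu ⊢; push_cast at hu; omega
    · intro τ _ hτ
      simpa [write_apply] using hτ
  set σ₂ := σ₁.write RANK (tl a) 1 with hσ₂
  have c₁ : σ₁ CTRC = σ CTRC := run_frame rfl _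
  have hrun : search.run σ = (loop CTRD (when (lt (rc (var CTRC)) 0)
      (when (eq (get RANK (get HEAD (var CTRC))) 0) searchStep))).run σ₂ := by
    simp only [search, run_block_cons, run_block_nil, run_set, eval_get, eval_var, eval_one,
      ← hσ₁, h₁.tail, c₁, hc, hσ₂]
  have g : ∀ x, x ≠ RANK → σ₂ x = σ₁ x := fun x hx => write_of_ne _ _ _ hx
  have h₂ : HasArcs S tl hd rv co σ₂ := h₁.congr (g _ (by decide)) (g _ (by decide))
    (g _ (by decide)) (g _ (by decide)) (g _ (by decide))
  have f1 : σ₂ FLOW = σ FLOW := (g _ (by decide)).trans (run_frame rfl _)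
  have f2 : σ₂ ROOM = σ ROOM := (g _ (by decide)).trans (run_frame rfl _)
  have f4 : σ₂ PRICE = σ PRICE := (g _ (by decide)).trans (run_frame rfl _)
  have f6 : σ₂ CTRC = σ CTRC := (g _ (by decide)).trans (run_frame rfl _)
  have hR : ∀ u ∈ Finset.Ico 0 (S : ℤ), σ₂ RANK u = if u = tl a then 1 else 0 := by
    intro u hu
    by_cases e : u = tl a
    · simp [hσ₂, write_apply, e]
    · simp [hσ₂, write_apply, e, z₁ u hu]
  rw [hrun]
  let P : ℕ → Store → Prop := fun j τ =>
    IsSearchTree S tl hd co (σ FLOW) (σ ROOM) a (τ PRICE) (τ RANK) (τ NEXT) j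
  refine run_loop h₂.size P (P S) ?_ ?_ ?_
  · have hta := hA.tl_mem a ha
    refine ⟨by rw [f4]; exact slack, by rw [hR _ hta]; simp, ?_, ?_, ?_, ?_, ?_⟩
    · intro u hu; rw [hR u hu]; split_ifs <;> norm_num
    · intro u hu; rw [hR u hu]; split_ifs <;> simp
    · intro u hu h0 hne; rw [hR u hu, if_neg hne] at h0; omega
    · intro _; rw [f4]; exact hneg
    · right; right
      have : tl a ∈ {u ∈ Finset.Ico 0 (S : ℤ) | 0 < σ₂ RANK u} := by
        rw [Finset.mem_filter]; exact ⟨hta, by rw [hR _ hta]; simp⟩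
      have := Finset.card_pos.2 ⟨_, this⟩
      push_cast; omega
  · intro j hj τ fr hτ
    have e1 : τ FLOW = σ FLOW := (fr _ rfl).trans f1
    have e2 : τ ROOM = σ ROOM := (fr _ rfl).trans f2
    have e6 : τ CTRC 0 = a := by rw [fr _ rfl, f6, hc]
    set τ' := τ.write CTRD 0 j with hτ'
    have g' : ∀ x, x ≠ CTRD → τ' x = τ x := fun x hx => write_of_ne _ _ _ hx
    have h' : HasArcs S tl hd rv co τ' := h₂.congr ((g' _ (by decide)).trans (fr _ rfl))
      ((g' _ (by decide)).trans (fr _ rfl)) ((g' _ (by decide)).trans (fr _ rfl))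
      ((g' _ (by decide)).trans (fr _ rfl)) ((g' _ (by decide)).trans (fr _ rfl))
    have p1 : τ' FLOW = σ FLOW := (g' _ (by decide)).trans e1
    have p2 : τ' ROOM = σ ROOM := (g' _ (by decide)).trans e2
    have p3 : τ' PRICE = τ PRICE := g' _ (by decide)
    have p4 : τ' RANK = τ RANK := g' _ (by decide)
    have p5 : τ' NEXT = τ NEXT := g' _ (by decide)
    have p6 : τ' CTRC 0 = a := by rw [g' _ (by decide), e6]
    have hP : P j τ' := by simp only [P, p3, p4, p5]; exact hτ
    -- A finished search satisfies the invariant at all later stages, so the remaining rounds may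
    -- idle.
    have stay : 0 ≤ reducedCost tl hd co (τ' PRICE) a ∨ 0 < τ' RANK (hd a) →
        P (j + 1) τ' := by
      intro hs
      refine ⟨hP.slack, hP.root, hP.nonneg, fun u hu => (hP.le u hu).trans ?_, hP.tree,
        hP.reached, ?_⟩
      · push_cast; omega
      · tauto
    simp only [run_when_lt, run_when_eq, eval_rc, eval_get, eval_var, eval_zero, h'.tail, h'.head,
      h'.cost, p6]
    split_ifs with c1 c2
    · have := run_searchStep hA h' (k := j) (by simp [hτ', write_apply]) p6 ha
        (by rw [p1, p2]; exact hP) c1 c2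
      rw [p1, p2] at this
      simp only [P]; push_cast
      exact this
    · refine stay (.inr ?_)
      have := hP.nonneg _ (hA.hd_mem ha); omega
    · exact stay (.inl (by omega))
  · intro τ _ hτ
    simpa [P, write_apply] using hτ

end

end RAM

/-! ### Following pointers and augmenting the circulation -/

namespace RAM

open RAM.Expr RAM.Prog

/-- The invariant rule for walks.  The nodes on the walk are `w 0, …, w L`. -/
theorem run_walk {S : ℕ} {σ : Store} {q : Prog} (hS : σ SIZE 0 = S) (w : ℕ → ℤ) {L : ℕ}
    (hL : L ≤ S) (hcur : σ CUR 0 = w 0) (hfin : σ FIN 0 = w L)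
    (hact : σ ACT 0 = if 0 < L then 1 else 0)
    (hw : ∀ i < L, w (i + 1) = σ HEAD (σ NEXT (w i)))
    (hne : ∀ i, 0 < i → i < L → w i ≠ w L)
    (hq : q.writesTo HEAD = false ∧ q.writesTo NEXT = false ∧ q.writesTo CUR = false ∧
      q.writesTo FIN = false ∧ q.writesTo ACT = false ∧ q.writesTo ARC = false)
    (I : ℕ → Store → Prop)
    (hI : ∀ (i : ℕ) (τ : Store) (a : ℕ) (z : ℤ), a = CTRD ∨ a = ARC ∨ a = CUR ∨ a = ACT →
      I i τ → I i (τ.write a 0 z))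
    (h0 : I 0 σ)
    (step : ∀ i < L, ∀ τ : Store, (∀ a, (walk q).writesTo a = false → τ a = σ a) →
      τ ARC 0 = σ NEXT (w i) → I i τ → I (i + 1) (q.run τ)) :
    I L ((walk q).run σ) := by
  obtain ⟨q1, q2, q3, q4, q5, q6⟩ := hq
  have fq : ∀ a, a ≠ CTRD → a ≠ ARC → a ≠ CUR → a ≠ ACT → q.writesTo a = false →
      (walk q).writesTo a = false := by
    intro a h1 h2 h3 h4 h5
    simp [walk, when, block, setVar, writesTo, h1.symm, h2.symm, h3.symm, h4.symm, h5]
  -- The loop runs `S` rounds but only the first `L` act, hence the truncation. The flag `ACT` is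
  -- needed for closed walks, where comparing `CUR` with `FIN` cannot distinguish the start from the
  -- end.
  let P : ℕ → Store → Prop := fun j τ => I (min j L) τ ∧ τ CUR 0 = w (min j L) ∧
    τ ACT 0 = if min j L < L then 1 else 0
  suffices h : P S ((walk q).run σ) by
    have := h.1
    rwa [min_eq_right hL] at this
  refine run_loop hS P (P S) ?_ ?_ ?_
  · exact ⟨by simpa using h0, by simpa using hcur, by simpa using hact⟩
  · rintro j hj τ fr ⟨p1, p2, p3⟩
    have e1 : τ HEAD = σ HEAD := fr _ (fq _ (by decide) (by decide) (by decide) (by decide) q1)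
    have e2 : τ NEXT = σ NEXT := fr _ (fq _ (by decide) (by decide) (by decide) (by decide) q2)
    have e3 : τ FIN = σ FIN := fr _ (fq _ (by decide) (by decide) (by decide) (by decide) q4)
    by_cases hjL : j < L
    · have m1 : min j L = j := min_eq_left hjL.le
      have m2 : min (j + 1) L = j + 1 := min_eq_left (by omega)
      rw [m1] at p1 p2 p3
      rw [if_pos hjL] at p3
      have p3' : (τ.write CTRD 0 j) ACT 0 ≠ 0 := by simp [write_apply, p3]
      obtain ⟨τ₁, hτ₁⟩ : ∃ τ₁, τ₁ = (τ.write CTRD 0 j).write ARC 0 (σ NEXT (w j)) := ⟨_, rfl⟩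
      have hstep := step j hjL τ₁ (by
          intro a ha
          have h1 : a ≠ CTRD := by
            rintro rfl; simp [walk, when, block, setVar, writesTo] at ha
          have h2 : a ≠ ARC := by
            rintro rfl; simp [walk, when, block, setVar, writesTo] at ha
          rw [hτ₁, write_of_ne _ _ _ h2, write_of_ne _ _ _ h1, fr a ha])
        (by simp [hτ₁, write_apply])
        (by rw [hτ₁]; exact hI _ _ _ _ (.inr (.inl rfl)) (hI _ _ _ _ (.inl rfl) p1))
      have r1 : (q.run τ₁) HEAD = σ HEAD := by
        rw [run_frame q1, hτ₁, ← e1]; simp [write_apply]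
      have r2 : (q.run τ₁) ARC 0 = σ NEXT (w j) := by
        rw [run_frame q6, hτ₁]; simp [write_apply]
      have r3 : (q.run τ₁) FIN 0 = w L := by
        rw [run_frame q4, hτ₁, ← hfin, ← e3]; simp [write_apply]
      have r4 : (q.run τ₁) ACT 0 = 1 := by
        rw [run_frame q5, hτ₁, ← p3]; simp [write_apply]
      rw [run_when_var, if_pos p3']
      simp only [run_block_cons, run_block_nil, run_setVar, run_when_eq, eval_get, eval_var,
        eval_zero]
      have harc : (τ.write CTRD 0 j) NEXT ((τ.write CTRD 0 j) CUR 0) = σ NEXT (w j) := by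
        simp [write_apply, p2, e2]
      rw [harc, ← hτ₁]
      have hcur' : (q.run τ₁) HEAD ((q.run τ₁) ARC 0) = w (j + 1) := by rw [r1, r2, hw j hjL]
      rw [hcur']
      have c1 : ((q.run τ₁).write CUR 0 (w (j + 1))) CUR 0 = w (j + 1) := by simp [write_apply]
      have c2 : ((q.run τ₁).write CUR 0 (w (j + 1))) FIN 0 = w L := by
        simpa [write_apply] using r3
      simp only [c1, c2]
      have hI1 := hI _ _ CUR (w (j + 1)) (.inr (.inr (.inl rfl))) hstep
      by_cases hlast : j + 1 = L
      · rw [if_pos (by rw [hlast])]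
        refine ⟨?_, ?_, ?_⟩
        · rw [m2]; exact hI _ _ _ _ (.inr (.inr (.inr rfl))) hI1
        · rw [m2]; simp [write_apply]
        · rw [m2, if_neg (by omega)]; simp [write_apply]
      · rw [if_neg (hne _ (by omega) (by omega))]
        refine ⟨by rw [m2]; exact hI1, by rw [m2]; exact c1, ?_⟩
        rw [m2, if_pos (by omega)]
        simpa [write_apply] using r4
    · have m1 : min j L = L := min_eq_right (by omega)
      have m2 : min (j + 1) L = L := min_eq_right (by omega)
      rw [m1] at p1 p2 p3
      rw [if_neg (lt_irrefl L)] at p3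
      have p3' : ¬ (τ.write CTRD 0 j) ACT 0 ≠ 0 := by simp [write_apply, p3]
      rw [run_when_var, if_neg p3']
      refine ⟨?_, ?_, ?_⟩
      · rw [m2]; exact hI _ _ _ _ (.inl rfl) p1
      · rw [m2]; simpa [write_apply] using p2
      · rw [m2]; simpa [write_apply] using p3
  · rintro τ - ⟨p1, p2, p3⟩
    exact ⟨hI _ _ _ _ (.inl rfl) p1, by simpa [write_apply] using p2,
      by simpa [write_apply] using p3⟩

section

variable {S : ℕ} {tl hd rv co : ℤ → ℤ} {σ : Store}

/-- The expressions `b` and `d` are evaluated again after the first write, so their values must not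
depend on `FLOW`. -/
theorem run_push (h : σ REV = rv) (b d : Expr)
    (hb : ∀ z y, b.eval (σ.write FLOW y z) = b.eval σ)
    (hd : ∀ z y, d.eval (σ.write FLOW y z) = d.eval σ) :
    (push b d).run σ FLOW = pushFlow (σ FLOW) (b.eval σ) (rv (b.eval σ)) (d.eval σ) := by
  simp only [push, run_block_cons, run_block_nil, run_set, eval_get, eval_add, eval_sub, hb, hd,
    write_apply, if_true, Nat.reduceEqDiff, if_false, h]
  funext x
  simp only [pushFlow, Function.update_apply]
  generalize rv (b.eval σ) = c
  generalize b.eval σ = e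
  by_cases h1 : x = c
  · subst h1
    by_cases h2 : x = e
    · subst h2; simp
    · simp [h2]
  · by_cases h2 : x = e
    · subst h2; simp [h1]
    · simp [h1, h2]

/-- An arc with negative reduced cost was saturated at its old capacity, so the unit sent along `a`
uses precisely the new unit of room and leaves `a` saturated. Its reverse may become residual, but
has positive reduced cost. The excess this creates at the head of `a` travels along tight tree arcs
and vanishes at the tail of `a`. -/
theorem run_augment (hA : IsArcSystem S tl hd rv)
    (hco : ∀ b ∈ Finset.Ico 0 (S : ℤ), co (rv b) = -co b) (h : HasArcs S tl hd rv co σ)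
    {a : ℤ} (hc : σ CTRC 0 = a) (ha : a ∈ Finset.Ico 0 (S : ℤ)) {cc₀ : ℤ → ℤ}
    (ht : IsSearchTree S tl hd co (σ FLOW) cc₀ a (σ PRICE) (σ RANK) (σ NEXT) S)
    (hneg : reducedCost tl hd co (σ PRICE) a < 0)
    (hopt : IsOptimal S tl hd rv co (σ FLOW) cc₀ (σ PRICE))
    (hroom : σ ROOM = Function.update cc₀ a (cc₀ a + 1)) :
    IsOptimal S tl hd rv co (augment.run σ FLOW) (σ ROOM) (σ PRICE) := by
  obtain ⟨w, L, w0, wL, hLS, wne, wnext, wmem⟩ := ht.exists_walk hA ha (ht.reached_of_neg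
    (by positivity) hneg)
  have hsat : σ FLOW a = cc₀ a := by
    refine le_antisymm (hopt.le a ha) (not_lt.1 fun hlt => ?_)
    have := hopt.slack a ha hlt; omega
  set σ₁ := (push (var CTRC) 1).run σ with hσ₁
  have hf₁ : σ₁ FLOW = pushFlow (σ FLOW) a (rv a) 1 := by
    rw [hσ₁, run_push h.rev _ _ (fun _ _ => by simp [write_apply]) (fun _ _ => by simp)]
    simp [hc]
  have h₁ : HasArcs S tl hd rv co σ₁ := h.run rfl rfl rfl rfl rfl
  have hc₁ : σ₁ CTRC 0 = a := by rw [hσ₁, run_frame rfl, hc]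
  obtain ⟨σ₂, hσ₂⟩ : ∃ σ₂, σ₂ = ((σ₁.write FIN 0 (w L)).write CUR 0 (w 0)).write ACT 0
    (if 0 < L then 1 else 0) := ⟨_, rfl⟩
  have hL0 : (if w 0 = w L then (0 : ℤ) else 1) = if 0 < L then 1 else 0 := by
    by_cases hL : 0 < L
    · rw [if_pos hL, if_neg (by rw [wL]; exact wne 0 hL)]
    · have : L = 0 := by omega
      simp [this]
  have hrun : augment.run σ = (walk (push (var ARC) 1)).run σ₂ := by
    simp only [augment, run_block_cons, run_block_nil, run_setVar, ← hσ₁, eval_get, eval_var,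
      eval_sub, eval_one, eval_eq, h₁.tail, h₁.head, write_apply, hc₁, Nat.reduceEqDiff, if_true,
      if_false, Function.update_self, hσ₂, ← w0, ← wL, ← hL0]
    congr 2
    split_ifs <;> rfl
  have g : ∀ x, x ≠ FIN → x ≠ CUR → x ≠ ACT → σ₂ x = σ₁ x := by
    intro x h1 h2 h3
    rw [hσ₂, write_of_ne _ _ _ h3, write_of_ne _ _ _ h2, write_of_ne _ _ _ h1]
  have h₂ : HasArcs S tl hd rv co σ₂ := h₁.congr (g _ (by decide) (by decide) (by decide))
    (g _ (by decide) (by decide) (by decide)) (g _ (by decide) (by decide) (by decide))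
    (g _ (by decide) (by decide) (by decide)) (g _ (by decide) (by decide) (by decide))
  have n₂ : σ₂ NEXT = σ NEXT :=
    (g _ (by decide) (by decide) (by decide)).trans (by rw [hσ₁, run_frame rfl])
  have f₂ : σ₂ FLOW = pushFlow (σ FLOW) a (rv a) 1 :=
    (g _ (by decide) (by decide) (by decide)).trans hf₁
  have hrva : reducedCost tl hd co (σ PRICE) (rv a) = -reducedCost tl hd co (σ PRICE) a :=
    reducedCost_rv hA hco _ ha
  -- An arc that is its own reverse would have reduced cost zero.
  have hne : a ≠ rv a := by
    intro e; rw [← e] at hrva; omega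
  let I : ℕ → Store → Prop := fun i τ =>
    IsAugmenting S tl hd rv co (σ ROOM) a (σ PRICE) (σ RANK) (σ NEXT) (w i) (τ FLOW)
  have key : I L (augment.run σ) := by
    rw [hrun]
    refine run_walk h₂.size w (by exact_mod_cast hLS) (by simp [hσ₂, write_apply])
      (by simp [hσ₂, write_apply]) (by simp [hσ₂, write_apply]) ?_ ?_
      ⟨rfl, rfl, rfl, rfl, rfl, rfl⟩ I ?_ ?_ ?_
    · intro i hi; rw [h₂.head, n₂]; exact wnext i hi
    · intro i _ hi; rw [wL]; exact wne i hi
    · rintro i τ x z (rfl | rfl | rfl | rfl) hi <;> simpa [I, write_apply] using hi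
    · simp only [I, f₂, w0, hroom]
      refine ⟨pushFlow_anti hA hopt.anti ha 1, ?_, ?_, ?_, ?_⟩
      · intro b hb
        have := hopt.le b hb
        simp only [pushFlow, Function.update_apply]
        by_cases e : b = a
        · subst e; rw [if_pos rfl, if_pos rfl]; split_ifs <;> omega
        · rw [if_neg e, if_neg e]; split_ifs <;> omega
      · intro b hb hlt
        simp only [pushFlow, Function.update_apply] at hlt
        by_cases e : b = a
        · subst e; rw [if_pos rfl, if_pos rfl, if_neg hne] at hlt; omega
        · rw [if_neg e, if_neg e] at hlt
          by_cases e' : b = rv a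
          · subst e'; rw [hrva]; omega
          · rw [if_neg e'] at hlt
            exact hopt.slack b hb (by omega)
      · intro x
        rw [netOut_pushFlow hA _ ha, hopt.conserve]; ring
      · intro x hx hx0 _ hxa
        obtain ⟨t1, t2, t3, t4, t5, t6⟩ := ht.tree x hx hx0 hxa
        have e : σ NEXT x ≠ a := by intro e; rw [e] at t6; omega
        simp only [pushFlow, Function.update_of_ne e, if_neg e]
        split_ifs <;> omega
    · intro i hi τ fr harc hτ
      have r : τ REV = rv := (fr _ rfl).trans h₂.rev
      have hp := run_push r (var ARC) 1 (fun _ _ => by simp [write_apply]) (fun _ _ => by simp)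
      simp only [eval_var, eval_one, harc, n₂] at hp
      simp only [I, hp]
      rw [wnext i hi]
      exact IsAugmenting.next hA hco ht (wmem i hi.le).1 (wmem i hi.le).2 (wne i hi) hτ
  simp only [I, wL] at key
  exact ⟨key.anti, key.le, fun u => by rw [key.excess]; simp, key.slack⟩

/-- Extra room on an arc of nonnegative reduced cost violates nothing. Otherwise the search, run
while the old capacities still satisfy slackness, either lifts the reduced cost of `a` to zero by
new prices or provides a tight path, and then one unit is sent around the resulting cycle. -/
theorem run_raiseRoom (hA : IsArcSystem S tl hd rv)
    (hco : ∀ b ∈ Finset.Ico 0 (S : ℤ), co (rv b) = -co b) (h : HasArcs S tl hd rv co σ)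
    {a : ℤ} (hc : σ CTRC 0 = a) (ha : a ∈ Finset.Ico 0 (S : ℤ))
    (hopt : IsOptimal S tl hd rv co (σ FLOW) (σ ROOM) (σ PRICE)) :
    IsOptimal S tl hd rv co (raiseRoom.run σ FLOW) (raiseRoom.run σ ROOM)
      (raiseRoom.run σ PRICE) ∧
    raiseRoom.run σ ROOM = Function.update (σ ROOM) a (σ ROOM a + 1) := by
  set σ₁ := (when (lt (rc (var CTRC)) 0) search).run σ with hσ₁
  have h₁ : HasArcs S tl hd rv co σ₁ := h.run rfl rfl rfl rfl rfl
  have hc₁ : σ₁ CTRC 0 = a := by rw [hσ₁, run_frame rfl, hc]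
  have f₁ : σ₁ FLOW = σ FLOW := run_frame rfl _
  have r₁ : σ₁ ROOM = σ ROOM := run_frame rfl _
  set σ₂ := σ₁.write ROOM a (σ₁ ROOM a + 1) with hσ₂
  have g : ∀ x, x ≠ ROOM → σ₂ x = σ₁ x := fun x hx => write_of_ne _ _ _ hx
  have h₂ : HasArcs S tl hd rv co σ₂ := h₁.congr (g _ (by decide)) (g _ (by decide))
    (g _ (by decide)) (g _ (by decide)) (g _ (by decide))
  have hc₂ : σ₂ CTRC 0 = a := by rw [g _ (by decide), hc₁]
  have r₂ : σ₂ ROOM = Function.update (σ ROOM) a (σ ROOM a + 1) := by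
    simp [hσ₂, write_apply, r₁]
  have f₂ : σ₂ FLOW = σ FLOW := (g _ (by decide)).trans f₁
  have hrun : raiseRoom.run σ = (when (lt (rc (var CTRC)) 0) augment).run σ₂ := by
    simp only [raiseRoom, run_block_cons, run_block_nil, run_set, ← hσ₁, eval_get, eval_var,
      eval_add, eval_one, hc₁, hσ₂]
  have hR : raiseRoom.run σ ROOM = σ₂ ROOM := by rw [hrun, run_frame rfl]
  have hP : raiseRoom.run σ PRICE = σ₂ PRICE := by rw [hrun, run_frame rfl]
  refine ⟨?_, by rw [hR, r₂]⟩
  rw [hR, hP]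
  have hsearch : reducedCost tl hd co (σ PRICE) a < 0 →
      IsSearchTree S tl hd co (σ FLOW) (σ ROOM) a (σ₂ PRICE) (σ₂ RANK) (σ₂ NEXT) S := by
    intro hneg
    have := run_search hA h hc ha hopt.slack hneg
    have e : σ₁ = search.run σ := by
      rw [hσ₁, run_when_lt]
      simp only [eval_rc, eval_var, h.tail, h.head, h.cost, hc, eval_zero, if_pos hneg]
    rw [g _ (by decide), g _ (by decide), g _ (by decide), e]
    exact this
  have hopt' : IsOptimal S tl hd rv co (σ FLOW) (σ ROOM) (σ₂ PRICE) := by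
    by_cases hneg : reducedCost tl hd co (σ PRICE) a < 0
    · exact ⟨hopt.anti, hopt.le, hopt.conserve, (hsearch hneg).slack⟩
    · have e : σ₁ = σ := by
        rw [hσ₁, run_when_lt]
        simp only [eval_rc, eval_var, h.tail, h.head, h.cost, hc, eval_zero, if_neg hneg]
      rw [g _ (by decide), e]; exact hopt
  by_cases hneg : reducedCost tl hd co (σ₂ PRICE) a < 0
  · have hneg₀ : reducedCost tl hd co (σ PRICE) a < 0 := by
      by_contra hn
      have e : σ₁ = σ := by
        rw [hσ₁, run_when_lt]
        simp only [eval_rc, eval_var, h.tail, h.head, h.cost, hc, eval_zero, if_neg hn]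
      rw [g _ (by decide), e] at hneg
      exact hn hneg
    have := run_augment hA hco h₂ hc₂ ha (cc₀ := σ ROOM) (by rw [f₂]; exact hsearch hneg₀) hneg
      (by rw [f₂]; exact hopt') r₂
    have e : raiseRoom.run σ = augment.run σ₂ := by
      rw [hrun, run_when_lt]
      simp only [eval_rc, eval_var, h₂.tail, h₂.head, h₂.cost, hc₂, eval_zero, if_pos hneg]
    rw [e]; exact this
  · have e : raiseRoom.run σ = σ₂ := by
      rw [hrun, run_when_lt]
      simp only [eval_rc, eval_var, h₂.tail, h₂.head, h₂.cost, hc₂, eval_zero, if_neg hneg]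
    rw [e, f₂, r₂]
    refine ⟨hopt.anti, fun b hb => ?_, hopt.conserve, fun b hb hlt => ?_⟩
    · have := hopt.le b hb
      by_cases e : b = a
      · subst e; simp; omega
      · rwa [Function.update_of_ne e]
    · by_cases e : b = a
      · subst e; omega
      · rw [Function.update_of_ne e] at hlt
        exact hopt'.slack b hb hlt

end

end RAM

/-! ### Capacity scaling -/

namespace RAM

open RAM.Expr RAM.Prog

section

variable {S : ℕ} {tl hd rv co : ℤ → ℤ} {σ : Store}

theorem run_doubleLoop (h : HasArcs S tl hd rv co σ) :
    ∀ b ∈ Finset.Ico 0 (S : ℤ), doubleLoop.run σ FLOW b = 2 * σ FLOW b ∧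
      doubleLoop.run σ ROOM b = 2 * σ ROOM b := by
  let P : ℕ → Store → Prop := fun j τ => ∀ b ∈ Finset.Ico 0 (S : ℤ),
    τ FLOW b = (if b < j then 2 else 1) * σ FLOW b ∧
    τ ROOM b = (if b < j then 2 else 1) * σ ROOM b
  have key : P S (doubleLoop.run σ) := by
    refine run_loop h.size P (P S) ?_ ?_ ?_
    · intro b hb
      have : ¬ b < ((0 : ℕ) : ℤ) := by simp at hb ⊢; omega
      simp only [if_neg this, one_mul, and_self]
    · intro j hj τ fr hτ b hb
      obtain ⟨h1, h2⟩ := hτ b hb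
      simp only [run_block_cons, run_block_nil, run_set, eval_var, eval_get, eval_add, write_apply,
        Nat.reduceEqDiff, if_true, if_false, Function.update_self]
      by_cases e : b = j
      · subst e
        rw [if_neg (lt_irrefl _)] at h1 h2
        rw [if_pos (by push_cast; omega), Function.update_self, Function.update_self, h1, h2]
        constructor <;> ring
      · rw [Function.update_of_ne e, Function.update_of_ne e, h1, h2]
        have : b < ((j + 1 : ℕ) : ℤ) ↔ b < j := by push_cast; omega
        simp only [this, and_self]
    · intro τ _ hτ b hb
      simpa [write_apply] using hτ b hb
  intro b hb
  have := key b hb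
  rwa [if_pos (Finset.mem_Ico.1 hb).2] at this

/-- Each capacity misses its target by at most one, so a single conditional raise per arc is enough.
-/
theorem run_raiseLoop (hA : IsArcSystem S tl hd rv)
    (hco : ∀ b ∈ Finset.Ico 0 (S : ℤ), co (rv b) = -co b) (h : HasArcs S tl hd rv co σ)
    (hopt : IsOptimal S tl hd rv co (σ FLOW) (σ ROOM) (σ PRICE))
    (hlo : ∀ b ∈ Finset.Ico 0 (S : ℤ), σ ROOM b ≤ σ CAPA b / σ POW 0)
    (hhi : ∀ b ∈ Finset.Ico 0 (S : ℤ), σ CAPA b / σ POW 0 ≤ σ ROOM b + 1) :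
    IsOptimal S tl hd rv co (raiseLoop.run σ FLOW) (raiseLoop.run σ ROOM)
      (raiseLoop.run σ PRICE) ∧
    ∀ b ∈ Finset.Ico 0 (S : ℤ), raiseLoop.run σ ROOM b = σ CAPA b / σ POW 0 := by
  let P : ℕ → Store → Prop := fun j τ =>
    IsOptimal S tl hd rv co (τ FLOW) (τ ROOM) (τ PRICE) ∧
    ∀ b ∈ Finset.Ico 0 (S : ℤ), τ ROOM b = if b < j then σ CAPA b / σ POW 0 else σ ROOM b
  have key : P S (raiseLoop.run σ) := by
    refine run_loop h.size P (P S) ?_ ?_ ?_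
    · refine ⟨hopt, fun b hb => ?_⟩
      rw [if_neg]; simp at hb ⊢; omega
    · rintro j hj τ fr ⟨p1, p2⟩
      have hjm : (j : ℤ) ∈ Finset.Ico 0 (S : ℤ) := by simp; omega
      set τ' := τ.write CTRC 0 j with hτ'
      have g : ∀ x, x ≠ CTRC → τ' x = τ x := fun x hx => write_of_ne _ _ _ hx
      have h' : HasArcs S tl hd rv co τ' := h.congr ((g _ (by decide)).trans (fr _ rfl))
        ((g _ (by decide)).trans (fr _ rfl)) ((g _ (by decide)).trans (fr _ rfl))
        ((g _ (by decide)).trans (fr _ rfl)) ((g _ (by decide)).trans (fr _ rfl))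
      have c1 : τ' CTRC 0 = j := by simp [hτ', write_apply]
      have c2 : τ' CAPA = σ CAPA := (g _ (by decide)).trans (fr _ rfl)
      have c3 : τ' POW = σ POW := (g _ (by decide)).trans (fr _ rfl)
      have c4 : τ' ROOM = τ ROOM := g _ (by decide)
      have hj0 := p2 j hjm
      rw [if_neg (lt_irrefl _)] at hj0
      have p1' : IsOptimal S tl hd rv co (τ' FLOW) (τ' ROOM) (τ' PRICE) := p1
      rw [run_when_lt]
      simp only [eval_get, eval_var, eval_div, c1, c2, c3, c4]
      split_ifs with hlt
      · obtain ⟨o1, o2⟩ := run_raiseRoom hA hco h' c1 hjm p1'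
        refine ⟨o1, fun b hb => ?_⟩
        rw [o2, c4]
        by_cases e : b = j
        · subst e
          rw [Function.update_self, if_pos (by push_cast; omega)]
          have := hhi _ hb
          omega
        · rw [Function.update_of_ne e, p2 b hb]
          have : b < ((j + 1 : ℕ) : ℤ) ↔ b < j := by push_cast; omega
          simp only [this]
      · refine ⟨p1', fun b hb => ?_⟩
        rw [c4, p2 b hb]
        by_cases e : b = j
        · subst e
          rw [if_neg (lt_irrefl _), if_pos (by push_cast; omega)]
          have := hlo _ hb
          omega
        · have : b < ((j + 1 : ℕ) : ℤ) ↔ b < j := by push_cast; omega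
          simp only [this]
    · rintro τ - ⟨p1, p2⟩
      refine ⟨by simpa [write_apply] using p1, fun b hb => ?_⟩
      simpa [write_apply] using p2 b hb
  refine ⟨key.1, fun b hb => ?_⟩
  have := key.2 b hb
  rwa [if_pos (Finset.mem_Ico.1 hb).2] at this

/-- Rounding down `c / 2 ^ k` gives twice the rounded `c / 2 ^ (k + 1)`, or one more: after
doubling, only the next bit of each capacity is missing. -/
theorem run_phase (hA : IsArcSystem S tl hd rv)
    (hco : ∀ b ∈ Finset.Ico 0 (S : ℤ), co (rv b) = -co b) (h : HasArcs S tl hd rv co σ)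
    {k : ℕ} (hpow : σ POW 0 = 2 ^ (k + 1))
    (hopt : IsOptimal S tl hd rv co (σ FLOW) (σ ROOM) (σ PRICE))
    (hroom : ∀ b ∈ Finset.Ico 0 (S : ℤ), σ ROOM b = σ CAPA b / 2 ^ (k + 1)) :
    phase.run σ POW 0 = 2 ^ k ∧
    IsOptimal S tl hd rv co (phase.run σ FLOW) (phase.run σ ROOM) (phase.run σ PRICE) ∧
    ∀ b ∈ Finset.Ico 0 (S : ℤ), phase.run σ ROOM b = σ CAPA b / 2 ^ k := by
  set σ₁ := σ.write POW 0 (2 ^ k) with hσ₁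
  have g : ∀ x, x ≠ POW → σ₁ x = σ x := fun x hx => write_of_ne _ _ _ hx
  have h₁ : HasArcs S tl hd rv co σ₁ := h.congr (g _ (by decide)) (g _ (by decide))
    (g _ (by decide)) (g _ (by decide)) (g _ (by decide))
  have hrun : phase.run σ = raiseLoop.run (doubleLoop.run σ₁) := by
    have : (2 : ℤ) ^ (k + 1) / 2 = 2 ^ k := by rw [pow_succ]; simp
    simp only [phase, run_block_cons, run_block_nil, run_setVar, eval_div, eval_var, eval_two,
      hpow, this, hσ₁]
  have hd₁ := run_doubleLoop h₁
  set σ₂ := doubleLoop.run σ₁ with hσ₂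
  have h₂ : HasArcs S tl hd rv co σ₂ := h₁.run rfl rfl rfl rfl rfl
  have hpow₂ : σ₂ POW 0 = 2 ^ k := by
    rw [hσ₂, run_frame rfl, hσ₁]; simp [write_apply]
  have hcapa : σ₂ CAPA = σ CAPA := (run_frame rfl _).trans (g _ (by decide))
  have hprice : σ₂ PRICE = σ PRICE := (run_frame rfl _).trans (g _ (by decide))
  have hflow₁ : σ₁ FLOW = σ FLOW := g _ (by decide)
  have hroom₁ : σ₁ ROOM = σ ROOM := g _ (by decide)
  rw [hflow₁, hroom₁] at hd₁
  have hopt₂ : IsOptimal S tl hd rv co (σ₂ FLOW) (σ₂ ROOM) (σ₂ PRICE) := by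
    rw [hprice]
    exact hopt.double.congr hA (fun b hb => (hd₁ b hb).1) (fun b hb => (hd₁ b hb).2)
  have hdiv : ∀ b, σ CAPA b / 2 ^ (k + 1) = σ CAPA b / 2 ^ k / 2 := fun b => by
    rw [pow_succ, Int.ediv_ediv_of_nonneg (by positivity)]
  obtain ⟨r1, r2⟩ := run_raiseLoop hA hco h₂ hopt₂
    (fun b hb => by
      rw [(hd₁ b hb).2, hroom b hb, hpow₂, hcapa, hdiv]; omega)
    (fun b hb => by
      rw [(hd₁ b hb).2, hroom b hb, hpow₂, hcapa, hdiv]; omega)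
  rw [hpow₂, hcapa] at r2
  rw [hrun]
  exact ⟨by rw [run_frame rfl, hpow₂], r1, r2⟩

/-- At scale `2 ^ (S * S)` all rounded capacities are zero, and the zero circulation is optimal with
zero prices. Each phase halves the scale, and two nested loops of length `S` bring it down to one.
-/
theorem run_solve (hA : IsArcSystem S tl hd rv)
    (hco : ∀ b ∈ Finset.Ico 0 (S : ℤ), co (rv b) = -co b) (h : HasArcs S tl hd rv co σ)
    (hflow : σ FLOW = 0) (hroom : σ ROOM = 0) (hprice : σ PRICE = 0)
    (hcap : ∀ b ∈ Finset.Ico 0 (S : ℤ), 0 ≤ σ CAPA b ∧ σ CAPA b < 2 ^ (S * S)) :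
    IsOptimal S tl hd rv co (solve.run σ FLOW) (σ CAPA) (solve.run σ PRICE) := by
  set σ₁ := σ.write POW 0 1 with hσ₁
  have g : ∀ x, x ≠ POW → σ₁ x = σ x := fun x hx => write_of_ne _ _ _ hx
  have h₁ : HasArcs S tl hd rv co σ₁ := h.congr (g _ (by decide)) (g _ (by decide))
    (g _ (by decide)) (g _ (by decide)) (g _ (by decide))
  set σ₂ := (loop CTRA (loop CTRB (setVar POW (var POW + var POW)))).run σ₁ with hσ₂
  have h₂ : HasArcs S tl hd rv co σ₂ := h₁.run rfl rfl rfl rfl rfl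
  have hrun : solve.run σ = (loop CTRA (loop CTRB phase)).run σ₂ := by
    simp only [solve, run_block_cons, run_block_nil, run_setVar, eval_one, ← hσ₁, ← hσ₂]
  have hpow : σ₂ POW 0 = 2 ^ (S * S) := by
    let P : ℕ → Store → Prop := fun i τ => τ POW 0 = 2 ^ (i * S)
    refine run_loop h₁.size P (P S) ?_ ?_ ?_
    · simp [P, hσ₁, write_apply]
    · intro i hi τ fr hτ
      let Q : ℕ → Store → Prop := fun j τ => τ POW 0 = 2 ^ (i * S + j)
      have hs : (τ.write CTRA 0 i) SIZE 0 = S := by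
        rw [write_of_ne _ _ _ (by decide), fr _ rfl, h₁.size]
      suffices hq : Q S ((loop CTRB (setVar POW (var POW + var POW))).run (τ.write CTRA 0 i)) by
        simp only [P, Q] at hq ⊢; rw [hq]; ring
      refine run_loop hs Q (Q S) ?_ ?_ ?_
      · simpa [Q, write_apply] using hτ
      · intro j hj ρ _ hρ
        simp only [Q] at hρ
        simp only [Q, run_setVar, eval_add, eval_var, write_apply, if_true, Function.update_self,
          Nat.reduceEqDiff, if_false, hρ]
        rw [← add_assoc, pow_succ]; ring
      · intro ρ _ hρ
        simpa [Q, write_apply] using hρ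
    · intro τ _ hτ
      simpa [P, write_apply] using hτ
  have e1 : σ₂ FLOW = 0 := (run_frame rfl _).trans ((g _ (by decide)).trans hflow)
  have e2 : σ₂ ROOM = 0 := (run_frame rfl _).trans ((g _ (by decide)).trans hroom)
  have e3 : σ₂ PRICE = 0 := (run_frame rfl _).trans ((g _ (by decide)).trans hprice)
  have e4 : σ₂ CAPA = σ CAPA := (run_frame rfl _).trans (g _ (by decide))
  -- After `k` phases `i` bits are left; the equation `i + k = S * S` avoids truncated subtraction.
  let R : ℕ → Store → Prop := fun k τ => ∃ i, i + k = S * S ∧ τ POW 0 = 2 ^ i ∧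
    IsOptimal S tl hd rv co (τ FLOW) (τ ROOM) (τ PRICE) ∧
    ∀ b ∈ Finset.Ico 0 (S : ℤ), τ ROOM b = σ CAPA b / 2 ^ i
  have hR : ∀ k τ a z, a ≠ POW → a ≠ FLOW → a ≠ ROOM → a ≠ PRICE → R k τ →
      R k (τ.write a 0 z) := by
    rintro k τ a z h1 h2 h3 h4 ⟨i, hi, r⟩
    refine ⟨i, hi, ?_⟩
    rw [write_of_ne _ _ _ h1.symm, write_of_ne _ _ _ h2.symm, write_of_ne _ _ _ h3.symm,
      write_of_ne _ _ _ h4.symm]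
    exact r
  have key : R (S * S) (solve.run σ) := by
    rw [hrun]
    refine run_loop h₂.size (fun i τ => R (i * S) τ) (R (S * S)) ?_ ?_ ?_
    · refine ⟨S * S, by simp, hpow, ?_, ?_⟩
      · rw [e1, e2, e3]
        refine ⟨by simp, by simp, by simp [netOut], by simp⟩
      · intro b hb
        rw [e2, Int.ediv_eq_zero_of_lt (hcap b hb).1 (hcap b hb).2]; rfl
    · intro i hi τ fr hτ
      have hf : ∀ a, a ≠ CTRA → (loop CTRB phase).writesTo a = false →
          (loop CTRA (loop CTRB phase)).writesTo a = false := by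
        intro a h1 h2; rw [writesTo, h2]; simp [h1.symm]
      have h' : HasArcs S tl hd rv co (τ.write CTRA 0 i) := h₂.congr
        (by rw [write_of_ne _ _ _ (by decide), fr _ (hf _ (by decide) rfl)])
        (by rw [write_of_ne _ _ _ (by decide), fr _ (hf _ (by decide) rfl)])
        (by rw [write_of_ne _ _ _ (by decide), fr _ (hf _ (by decide) rfl)])
        (by rw [write_of_ne _ _ _ (by decide), fr _ (hf _ (by decide) rfl)])
        (by rw [write_of_ne _ _ _ (by decide), fr _ (hf _ (by decide) rfl)])
      have hcapa : (τ.write CTRA 0 i) CAPA = σ CAPA := by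
        rw [write_of_ne _ _ _ (by decide), fr _ rfl, e4]
      have hS : (i + 1) * S = i * S + S := by ring
      rw [hS]
      refine run_loop h'.size (fun j τ => R (i * S + j) τ) (R (i * S + S)) ?_ ?_ ?_
      · exact hR _ _ _ _ (by decide) (by decide) (by decide) (by decide) hτ
      · rintro j hj ρ fr' hρ
        obtain ⟨k, hk, k1, k2, k3⟩ := hR _ _ CTRB j (by decide) (by decide) (by decide) (by decide)
          hρ
        obtain ⟨k', rfl⟩ : ∃ k', k = k' + 1 := by
          refine ⟨k - 1, ?_⟩
          have : (i + 1) * S ≤ S * S := Nat.mul_le_mul_right S hi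
          rw [hS] at this
          omega
        have h'' : HasArcs S tl hd rv co (ρ.write CTRB 0 j) := h'.congr
          (by rw [write_of_ne _ _ _ (by decide), fr' _ rfl])
          (by rw [write_of_ne _ _ _ (by decide), fr' _ rfl])
          (by rw [write_of_ne _ _ _ (by decide), fr' _ rfl])
          (by rw [write_of_ne _ _ _ (by decide), fr' _ rfl])
          (by rw [write_of_ne _ _ _ (by decide), fr' _ rfl])
        have hcapa' : (ρ.write CTRB 0 j) CAPA = σ CAPA := by
          rw [write_of_ne _ _ _ (by decide), fr' _ rfl, hcapa]
        obtain ⟨p1, p2, p3⟩ := run_phase hA hco h'' k1 k2 (by rw [hcapa']; exact k3)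
        rw [hcapa'] at p3
        exact ⟨k', by omega, p1, p2, p3⟩
      · intro ρ _ hρ
        exact hR _ _ _ _ (by decide) (by decide) (by decide) (by decide) hρ
    · intro τ _ hτ
      exact hR _ _ _ _ (by decide) (by decide) (by decide) (by decide) hτ
  obtain ⟨i, hi, -, k2, k3⟩ := key
  have : i = 0 := by omega
  subst this
  exact k2.congr hA (fun _ _ => rfl) (fun b hb => by rw [k3 b hb]; simp)

end

end RAM

/-! ### Programs that translate the instance and write the solution -/

namespace RAM

open RAM.Expr RAM.Prog

/-- Multiplies the variable `a` by all positive entries of the input. -/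
def mulLoop (a : ℕ) : Prog :=
  loop CTRA (when (lt 0 (get IN (var CTRA + 1))) (setVar a (var a * get IN (var CTRA + 1))))

/-- The parity of the current arc, and the edge or node that it belongs to. -/
def locate : Prog :=
  block [setVar PARITY (var CTRA - var CTRA / 2 * 2),
    ite (lt (var CTRA) (get IN 2 * 4))
      -- Each edge owns four arcs and each node two. In the input, cell `0` is the length and cells
      -- `1` to `4` are the numbers of nodes and edges and the horizon, so node data begin at cell
      -- `5`.
      (block [setVar ITEM (var CTRA / 4), setVar BASE (get IN 1 * 2 + var ITEM * 6 + 5)])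
      (block [setVar ITEM ((var CTRA - get IN 2 * 4) / 2), setVar BASE (var ITEM * 2 + 5)])]

/-- Sets the end points of the current arc. -/
def setEnds (t h : Expr) : Prog := block [set TAIL (var CTRA) t, set HEAD (var CTRA) h]

/-- Builds the arcs and their capacities. -/
def arcLoop : Prog :=
  loop CTRA (seq locate
    (ite (lt (var CTRA) (get IN 2 * 4))
      (block [set REV (var CTRA) (var CTRA + 1 - var PARITY * 2),
        -- Of the arcs `4e, …, 4e + 3` the middle two lead from the second end point to the first,
        -- the outer two the other way; odd arcs are the reverses of the even ones before them.
        ite (eq ((var CTRA - var ITEM * 4 + 1) / 2) 1)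
          (setEnds (get IN (var BASE + 1)) (get IN (var BASE)))
          (setEnds (get IN (var BASE)) (get IN (var BASE + 1))),
        when (eq (var PARITY) 0) (set CAPA (var CTRA)
          (var DENOM / get IN (var BASE + 3) * get IN (var BASE + 2) * get IN 3))])
      (ite (lt (var CTRA) (get IN 2 * 4 + get IN 1 * 2))
        (block [set REV (var CTRA) (var CTRA + 1 - var PARITY * 2),
          -- The first arc of a node leaves the root if the node is a source and enters it
          -- otherwise; the second one is its reverse.
          ite (eq (lt 0 (get IN (var BASE))) (1 - var PARITY))
            (setEnds (get IN 1) (var ITEM))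
            (setEnds (var ITEM) (get IN 1)),
          when (eq (var PARITY) 0)
            (block [setVar VALUE (var DENOM / get IN (var BASE + 1) * get IN (var BASE) * get IN 4),
              ite (lt 0 (get IN (var BASE)))
                (set CAPA (var CTRA) (var VALUE)) (set CAPA (var CTRA) (0 - var VALUE))])])
        (set REV (var CTRA) (var CTRA)))))

/-- Adds up the capacities. -/
def sumLoop : Prog := loop CTRA (setVar CAPSUM (var CAPSUM + get CAPA (var CTRA)))

/-- Sets the transit times and the costs of the arcs. -/
def costLoop : Prog :=
  loop CTRA (seq locate
    (ite (lt (var CTRA) (get IN 2 * 4))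
      (block [setVar VALUE (var TDENOM / get IN (var BASE + 5) * get IN (var BASE + 4)),
        ite (eq (var PARITY) 0)
          -- The surcharge of one makes every edge strictly costly, even if its transit time is
          -- zero.
          (block [set TIME (var CTRA) (var VALUE), set COST (var CTRA) (var VALUE + 1)])
          (block [set TIME (var CTRA) (0 - var VALUE), set COST (var CTRA) (0 - var VALUE - 1)])])
      (when (lt (var CTRA) (get IN 2 * 4 + get IN 1 * 2))
        -- Nodes of balance zero are treated like sinks, which is harmless because their arcs have
        -- capacity zero.
        (when (lt (get IN (var BASE)) 1)
          (block [setVar VALUE (var TDENOM / get IN 4 * get IN 3 * 2),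
            ite (eq (var PARITY) 0)
              (block [set TIME (var CTRA) (0 - var VALUE), set COST (var CTRA) (0 - var VALUE)])
              (block [set TIME (var CTRA) (var VALUE), set COST (var CTRA) (var VALUE)])])))))

/-- Translates the instance into a minimum cost circulation problem. -/
def setup : Prog :=
  block [setVar DENOM 1, mulLoop DENOM, arcLoop, setVar CAPSUM 1, sumLoop,
    setVar TDENOM (var CAPSUM), mulLoop TDENOM, costLoop]

/-- Writes the directions of the edges and the numbers of their pieces. -/
def dirLoop : Prog :=
  loop CTRB (when (lt (var CTRB) (get IN 2))
    -- Every edge receives exactly `S` pieces, many of them of rate zero, so that each occupies `2 +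
    -- 6 * S` cells at an address known in advance. The address is written so that all second
    -- factors are fixed.
    (block [setVar BASE (var CTRB * 2 + var CTRB * 6 * get SIZE 0 + 1),
      set OUT (var BASE) (lt 0 (get FLOW (var CTRB * 4))),
      set OUT (var BASE + 1) (get SIZE 0)]))

/-- Chooses for each node an arc with positive flow that leaves it. -/
def nextLoops : Prog :=
  block [loop CTRB (set NEXT (var CTRB) (const (-1))),
    loop CTRB (when (lt 0 (get FLOW (var CTRB))) (set NEXT (get TAIL (var CTRB)) (var CTRB)))]

/-- Starts a walk at the root. -/
def startWalk : Prog :=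
  block [setVar FIN (get IN 1), setVar CUR (get IN 1),
    setVar ACT (lt (const (-1)) (get NEXT (get IN 1)))]

/-- Finds the amount of flow that can be sent along the walk, and its transit time. -/
def measureWalk : Prog :=
  block [startWalk, setVar DELTA (get FLOW (get NEXT (get IN 1))), setVar TOTAL 0,
    walk (block [when (lt (get FLOW (var ARC)) (var DELTA)) (setVar DELTA (get FLOW (var ARC))),
      setVar TOTAL (var TOTAL + get TIME (var ARC))])]

/-- Removes the flow along the walk and records the edges of the walk. -/
def removeWalk : Prog :=
  block [startWalk, setVar PREFIX 0,
    walk (block [push (var ARC) (0 - var DELTA),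
      when (lt (var ARC) (get IN 2 * 4))
        (block [set START (var ARC / 4) (var PREFIX), set AMOUNT (var ARC / 4) (var DELTA)]),
      setVar PREFIX (var PREFIX + get TIME (var ARC))])]

/-- Writes a piece for every edge. -/
def pieceLoop : Prog :=
  loop CTRB (when (lt (var CTRB) (get IN 2))
    (block [setVar BASE (var CTRB * 2 + var CTRB * 6 * get SIZE 0 + 3 + var CTRA * 6),
      set OUT (var BASE) (get START (var CTRB)),
      set OUT (var BASE + 1) (var TDENOM),
      -- `TOTAL` is the transit time of the path minus `2T`, in units of `1 / TDENOM`. Hence the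
      -- window is as long as arrival by `2T` permits, and it is empty for paths that take too long.
      set OUT (var BASE + 2) (get START (var CTRB) - var TOTAL),
      set OUT (var BASE + 3) (var TDENOM),
      set OUT (var BASE + 4) (get AMOUNT (var CTRB)),
      set OUT (var BASE + 5) (var RDENOM)]))

/-- Splits a path off the circulation and writes the pieces of the flow along it. -/
def round : Prog :=
  block [nextLoops,
    loop CTRB (block [set START (var CTRB) 0, set AMOUNT (var CTRB) 0]),
    measureWalk, removeWalk, pieceLoop]

/-- Writes the orientation and the flow over time. -/
def output : Prog :=
  -- Amounts are scaled by `D` times the denominator of `T`, so dividing by `2T` gives this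
  -- denominator. It would be zero for `T = 0`, where `1` is substituted.
  block [setVar RDENOM (var DENOM * get IN 3 * 2), when (eq (var RDENOM) 0) (setVar RDENOM 1),
    set OUT 0 (get IN 2 * 2 + get IN 2 * 6 * get SIZE 0), dirLoop, loop CTRA round]

/-- The whole algorithm. -/
def main : Prog := block [setup, solve, output]

theorem main_tame : main.tame = true := by decide

end RAM

namespace RAM

open RAM.Expr RAM.Prog

/-! ### The arcs of an instance

Here `z` is the array that holds the input. -/

section arcs

variable (z : ℤ → ℤ)

/-- The product of the positive entries of the input. -/
def posProd (S : ℕ) : ℤ := ∏ j ∈ Finset.range S, if 0 < z (j + 1) then z (j + 1) else 1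

/-- The position of the data of the edge or node that the arc `b` belongs to. -/
def arcBase (b : ℤ) : ℤ :=
  if b < z 2 * 4 then z 1 * 2 + b / 4 * 6 + 5 else (b - z 2 * 4) / 2 * 2 + 5

/-- The tail of an arc. -/
def arcTail (b : ℤ) : ℤ :=
  if b < z 2 * 4 then
    if (b - b / 4 * 4 + 1) / 2 = 1 then z (arcBase z b + 1) else z (arcBase z b)
  else if b < z 2 * 4 + z 1 * 2 then
    if (if 0 < z (arcBase z b) then 1 else 0) = 1 - (b - b / 2 * 2) then z 1
    else (b - z 2 * 4) / 2
  else 0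

/-- The head of an arc. -/
def arcHead (b : ℤ) : ℤ :=
  if b < z 2 * 4 then
    if (b - b / 4 * 4 + 1) / 2 = 1 then z (arcBase z b) else z (arcBase z b + 1)
  else if b < z 2 * 4 + z 1 * 2 then
    if (if 0 < z (arcBase z b) then 1 else 0) = 1 - (b - b / 2 * 2) then (b - z 2 * 4) / 2
    else z 1
  else 0

/-- The reverse of an arc. -/
def arcRev (b : ℤ) : ℤ :=
  if b < z 2 * 4 + z 1 * 2 then b + 1 - (b - b / 2 * 2) * 2 else b

/-- The capacity of an arc. -/
def arcCap (D b : ℤ) : ℤ :=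
  if b < z 2 * 4 then
    if b - b / 2 * 2 = 0 then D / z (arcBase z b + 3) * z (arcBase z b + 2) * z 3 else 0
  else if b < z 2 * 4 + z 1 * 2 then
    if b - b / 2 * 2 = 0 then
      if 0 < z (arcBase z b) then D / z (arcBase z b + 1) * z (arcBase z b) * z 4
      else -(D / z (arcBase z b + 1) * z (arcBase z b) * z 4)
    else 0
  else 0

/-- The transit time of an arc. -/
def arcTime (K b : ℤ) : ℤ :=
  if b < z 2 * 4 then
    if b - b / 2 * 2 = 0 then K / z (arcBase z b + 5) * z (arcBase z b + 4)
    else -(K / z (arcBase z b + 5) * z (arcBase z b + 4))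
  else if b < z 2 * 4 + z 1 * 2 then
    if z (arcBase z b) < 1 then
      if b - b / 2 * 2 = 0 then -(K / z 4 * z 3 * 2) else K / z 4 * z 3 * 2
    else 0
  else 0

/-- The cost of an arc. -/
def arcCost (K b : ℤ) : ℤ :=
  arcTime z K b + if b < z 2 * 4 then if b - b / 2 * 2 = 0 then 1 else -1 else 0

end arcs

section

variable {S : ℕ} {σ : Store} {z : ℤ → ℤ}

theorem run_mulLoop (hS : σ SIZE 0 = S) (hz : σ IN = z) {a : ℕ} (ha : a ≠ CTRA) (ha' : a ≠ IN) :
    (mulLoop a).run σ a 0 = σ a 0 * posProd z S := by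
  let P : ℕ → Store → Prop := fun j τ => τ a 0 = σ a 0 * posProd z j
  have hw : (mulLoop a).writesTo IN = false := by
    simp [mulLoop, when, setVar, writesTo, ha']
  refine run_loop hS P (P S) ?_ ?_ ?_
  · simp [P, posProd]
  · intro j hj τ fr hτ
    have e1 : τ IN = z := (fr _ hw).trans hz
    simp only [P] at hτ
    have c1 : τ.write CTRA 0 j a 0 = σ a 0 * posProd z j := by rw [write_of_ne _ _ _ ha, hτ]
    have c2 : τ.write CTRA 0 j IN = z := by rw [write_of_ne _ _ _ (by decide), e1]
    have c3 : τ.write CTRA 0 j CTRA 0 = j := by simp [write_apply]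
    simp only [run_when_lt, run_setVar, eval_get, eval_add, eval_var, eval_zero, eval_one,
      eval_mul, c1, c2, c3]
    split_ifs with h
    · simp only [P, write_self, Function.update_self, posProd, Finset.prod_range_succ, if_pos h,
        mul_assoc]
    · simp only [P, c1, posProd, Finset.prod_range_succ, if_neg h, mul_one]
  · intro τ _ hτ
    simp only [P] at hτ ⊢
    rw [write_of_ne _ _ _ ha, hτ]

theorem run_locate {b : ℤ} (hz : σ IN = z) (hb : σ CTRA 0 = b) :
    ∃ c, locate.run σ =
      ((σ.write PARITY 0 (b - b / 2 * 2)).write ITEM 0 c).write BASE 0 (arcBase z b) ∧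
      c = if b < z 2 * 4 then b / 4 else (b - z 2 * 4) / 2 := by
  refine ⟨_, ?_, rfl⟩
  simp only [locate, run_block_cons, run_block_nil, run_setVar, run_ite_lt, eval_sub, eval_div,
    eval_mul, eval_two, eval_var, hb, eval_get, eval_four, write_apply, Nat.reduceEqDiff, if_false,
    hz, arcBase]
  split_ifs <;> simp [write_apply, hz]

theorem run_arcLoop (hS : σ SIZE 0 = S) (hz : σ IN = z) (hn : 0 ≤ z 1) (h10 : σ TAIL = 0) (h11 : σ HEAD = 0)
    (h13 : σ CAPA = 0) :
    ∀ b ∈ Finset.Ico 0 (S : ℤ), arcLoop.run σ TAIL b = arcTail z b ∧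
      arcLoop.run σ HEAD b = arcHead z b ∧ arcLoop.run σ REV b = arcRev z b ∧
      arcLoop.run σ CAPA b = arcCap z (σ DENOM 0) b := by
  let P : ℕ → Store → Prop := fun j τ => ∀ b : ℤ,
    (0 ≤ b ∧ b < j → τ TAIL b = arcTail z b ∧ τ HEAD b = arcHead z b ∧ τ REV b = arcRev z b ∧
      τ CAPA b = arcCap z (σ DENOM 0) b) ∧
    -- Capacities of reverse arcs and end points of unused arcs are never written, so the invariant
    -- has to remember that later cells are still zero.
    (j ≤ b → τ TAIL b = 0 ∧ τ HEAD b = 0 ∧ τ CAPA b = 0)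
  suffices h : P S (arcLoop.run σ) from fun b hb => (h b).1 (Finset.mem_Ico.1 hb)
  refine run_loop hS P (P S) ?_ ?_ ?_
  · intro b
    refine ⟨fun h => ?_, fun _ => by simp [h10, h11, h13]⟩
    have := h.2; push_cast at this; omega
  · intro j hj τ fr hτ
    have e1 : τ IN = z := (fr _ rfl).trans hz
    have e2 : τ DENOM = σ DENOM := fr _ rfl
    obtain ⟨c, hloc, hc⟩ := run_locate (σ := τ.write CTRA 0 j) (z := z) (b := j)
      (by rw [write_of_ne _ _ _ (by decide), e1]) (by simp [write_apply])
    set D := σ DENOM 0 with hD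
    obtain ⟨i1, i2, i3⟩ := (hτ j).2 le_rfl
    obtain ⟨ρ, hρ⟩ : ∃ ρ, ρ = ((((τ.write CTRA 0 j).write PARITY 0 (j - (j : ℤ) / 2 * 2)).write
      ITEM 0 c).write BASE 0 (arcBase z j)) := ⟨_, rfl⟩
    have g : ∀ a, a ≠ CTRA → a ≠ PARITY → a ≠ ITEM → a ≠ BASE → ρ a = τ a := by
      intro a h1 h2 h3 h4
      rw [hρ, write_of_ne _ _ _ h4, write_of_ne _ _ _ h3, write_of_ne _ _ _ h2,
        write_of_ne _ _ _ h1]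
    have r1 : ρ CTRA 0 = j := by simp [hρ, write_apply]
    have r2 : ρ PARITY 0 = j - (j : ℤ) / 2 * 2 := by simp [hρ, write_apply]
    have r3 : ρ ITEM 0 = c := by simp [hρ, write_apply]
    have r4 : ρ BASE 0 = arcBase z j := by simp [hρ, write_apply]
    have r5 : ρ IN = z := (g _ (by decide) (by decide) (by decide) (by decide)).trans e1
    have r6 : ρ DENOM 0 = D := by rw [g _ (by decide) (by decide) (by decide) (by decide), e2]
    have r7 : ρ TAIL = τ TAIL := g _ (by decide) (by decide) (by decide) (by decide)
    have r8 : ρ HEAD = τ HEAD := g _ (by decide) (by decide) (by decide) (by decide)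
    have r9 : ρ REV = τ REV := g _ (by decide) (by decide) (by decide) (by decide)
    have r10 : ρ CAPA = τ CAPA := g _ (by decide) (by decide) (by decide) (by decide)
    rw [← hρ] at hloc
    generalize hbody : (Prog.seq locate _).run (τ.write CTRA 0 j) = ρ'
    rw [Prog.run, hloc] at hbody
    have key : ρ' TAIL = Function.update (τ TAIL) j (arcTail z j) ∧
        ρ' HEAD = Function.update (τ HEAD) j (arcHead z j) ∧
        ρ' REV = Function.update (τ REV) j (arcRev z j) ∧
        ρ' CAPA = Function.update (τ CAPA) j (arcCap z D j) := by
      rw [← hbody]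
      by_cases h1 : (j : ℤ) < z 2 * 4
      · rw [if_pos h1] at hc
        have h6 : (j : ℤ) < z 2 * 4 + z 1 * 2 := by linarith
        by_cases h2 : ((j : ℤ) - j / 4 * 4 + 1) / 2 = 1 <;> by_cases h3 : (j : ℤ) - j / 2 * 2 = 0 <;>
        simp [run_ite_lt, run_ite_eq, run_block_cons, run_block_nil, run_set, setEnds,
          run_when_eq, write_apply, r1, r2, r3, r4, r5, r6, h1, hc, h2, h3, arcTail, arcHead,
          arcRev, arcCap, r7, r8, r9, r10, h6, i3]
      · rw [if_neg h1] at hc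
        by_cases h2 : (j : ℤ) < z 2 * 4 + z 1 * 2
        · have h4 : (j : ℤ) - j / 2 * 2 = 0 ∨ (j : ℤ) - j / 2 * 2 = 1 := by omega
          rcases h4 with h4 | h4 <;> by_cases h5 : 0 < z (arcBase z j) <;>
          simp [run_ite_lt, run_ite_eq, run_block_cons, run_block_nil, run_set, run_setVar,
            setEnds, run_when_eq, write_apply, r1, r2, r3, r4, r5, r6, h1, hc, h2, h4, h5, arcTail,
            arcHead, arcRev, arcCap, r7, r8, r9, r10, i3]
        · simp [run_ite_lt, run_set, write_apply, r1, r5, h1, h2, arcTail, arcHead, arcRev,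
            arcCap, r7, r8, r9, r10]
          exact ⟨i1, i2, i3⟩
    obtain ⟨k1, k2, k3, k4⟩ := key
    intro b
    rw [k1, k2, k3, k4]
    by_cases e : b = j
    · subst e
      simp only [Function.update_self, true_and]
      exact ⟨fun _ => rfl, fun h => by push_cast at h; omega⟩
    · simp only [Function.update_of_ne e]
      refine ⟨fun h => (hτ b).1 ⟨h.1, ?_⟩, fun h => (hτ b).2 ?_⟩ <;> push_cast at h <;> omega
  · intro τ _ hτ b
    simpa [P, write_apply] using hτ b

theorem run_sumLoop (hS : σ SIZE 0 = S) (c : ℤ → ℤ) (hc : ∀ b ∈ Finset.Ico 0 (S : ℤ), σ CAPA b = c b) :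
    sumLoop.run σ CAPSUM 0 = σ CAPSUM 0 + ∑ j ∈ Finset.range S, c j := by
  let P : ℕ → Store → Prop := fun j τ => τ CAPSUM 0 = σ CAPSUM 0 + ∑ i ∈ Finset.range j, c i
  refine run_loop hS P (P S) ?_ ?_ ?_
  · simp [P]
  · intro j hj τ fr hτ
    have e1 : τ CAPA = σ CAPA := fr _ rfl
    simp only [P] at hτ ⊢
    have := hc j (by simp; omega)
    simp [run_setVar, write_apply, e1, hτ, this, Finset.sum_range_succ, add_assoc]
  · intro τ _ hτ
    simpa [P, write_apply] using hτ

theorem run_costLoop (hS : σ SIZE 0 = S) (hz : σ IN = z) (h14 : σ COST = 0) (h15 : σ TIME = 0) :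
    ∀ b ∈ Finset.Ico 0 (S : ℤ), costLoop.run σ TIME b = arcTime z (σ TDENOM 0) b ∧
      costLoop.run σ COST b = arcCost z (σ TDENOM 0) b := by
  let P : ℕ → Store → Prop := fun j τ => ∀ b : ℤ,
    (0 ≤ b ∧ b < j → τ TIME b = arcTime z (σ TDENOM 0) b ∧ τ COST b = arcCost z (σ TDENOM 0) b) ∧
    (j ≤ b → τ TIME b = 0 ∧ τ COST b = 0)
  suffices h : P S (costLoop.run σ) from fun b hb => (h b).1 (Finset.mem_Ico.1 hb)
  refine run_loop hS P (P S) ?_ ?_ ?_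
  · intro b
    refine ⟨fun h => ?_, fun _ => by simp [h14, h15]⟩
    have := h.2; push_cast at this; omega
  · intro j hj τ fr hτ
    have e1 : τ IN = z := (fr _ rfl).trans hz
    have e2 : τ TDENOM = σ TDENOM := fr _ rfl
    obtain ⟨c, hloc, hc⟩ := run_locate (σ := τ.write CTRA 0 j) (z := z) (b := j)
      (by rw [write_of_ne _ _ _ (by decide), e1]) (by simp [write_apply])
    set K := σ TDENOM 0 with hK
    obtain ⟨i1, i2⟩ := (hτ j).2 le_rfl
    obtain ⟨ρ, hρ⟩ : ∃ ρ, ρ = ((((τ.write CTRA 0 j).write PARITY 0 (j - (j : ℤ) / 2 * 2)).write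
      ITEM 0 c).write BASE 0 (arcBase z j)) := ⟨_, rfl⟩
    have g : ∀ a, a ≠ CTRA → a ≠ PARITY → a ≠ ITEM → a ≠ BASE → ρ a = τ a := by
      intro a h1 h2 h3 h4
      rw [hρ, write_of_ne _ _ _ h4, write_of_ne _ _ _ h3, write_of_ne _ _ _ h2,
        write_of_ne _ _ _ h1]
    have r1 : ρ CTRA 0 = j := by simp [hρ, write_apply]
    have r2 : ρ PARITY 0 = j - (j : ℤ) / 2 * 2 := by simp [hρ, write_apply]
    have r4 : ρ BASE 0 = arcBase z j := by simp [hρ, write_apply]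
    have r5 : ρ IN = z := (g _ (by decide) (by decide) (by decide) (by decide)).trans e1
    have r6 : ρ TDENOM 0 = K := by rw [g _ (by decide) (by decide) (by decide) (by decide), e2]
    have r7 : ρ TIME = τ TIME := g _ (by decide) (by decide) (by decide) (by decide)
    have r8 : ρ COST = τ COST := g _ (by decide) (by decide) (by decide) (by decide)
    rw [← hρ] at hloc
    generalize hbody : (Prog.seq locate _).run (τ.write CTRA 0 j) = ρ'
    rw [Prog.run, hloc] at hbody
    have key : ρ' TIME = Function.update (τ TIME) j (arcTime z K j) ∧
        ρ' COST = Function.update (τ COST) j (arcCost z K j) := by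
      rw [← hbody]
      have h4 : (j : ℤ) - j / 2 * 2 = 0 ∨ (j : ℤ) - j / 2 * 2 = 1 := by omega
      by_cases h1 : (j : ℤ) < z 2 * 4
      · rcases h4 with h4 | h4 <;>
        simp [run_ite_lt, run_ite_eq, run_block_cons, run_block_nil, run_set, run_setVar,
          write_apply, r1, r2, r4, r5, r6, h1, h4, arcTime, arcCost, r7, r8, sub_eq_add_neg]
      · by_cases h2 : (j : ℤ) < z 2 * 4 + z 1 * 2
        · rcases h4 with h4 | h4 <;> by_cases h5 : z (arcBase z j) < 1 <;>
          simp [run_ite_lt, run_ite_eq, run_block_cons, run_block_nil, run_set, run_setVar,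
            run_when_lt, write_apply, r1, r2, r4, r5, r6, h1, h2, h4, h5, arcTime, arcCost,
            r7, r8, i1, i2]
        · simp [run_ite_lt, run_when_lt, r1, r5, h1, h2, arcTime, arcCost, r7, r8,
            i1, i2]
    obtain ⟨k1, k2⟩ := key
    intro b
    rw [k1, k2]
    by_cases e : b = j
    · subst e
      simp only [Function.update_self]
      exact ⟨fun _ => ⟨rfl, rfl⟩, fun h => by push_cast at h; omega⟩
    · simp only [Function.update_of_ne e]
      refine ⟨fun h => (hτ b).1 ⟨h.1, ?_⟩, fun h => (hτ b).2 ?_⟩ <;> push_cast at h <;> omega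
  · intro τ _ hτ b
    simpa [P, write_apply] using hτ b

/-- The common denominator of the transit times. -/
def timeDenom (z : ℤ → ℤ) (S : ℕ) : ℤ :=
  -- The first factor makes all scaled times so coarse that the surcharges on the edges cannot add
  -- up to one unit.
  (1 + ∑ j ∈ Finset.range S, arcCap z (posProd z S) j) * posProd z S

theorem run_setup (hS : σ SIZE 0 = S) (hz : σ IN = z) (hn : 0 ≤ z 1)
    (h0 : ∀ a, 5 ≤ a → σ a = 0) :
    setup.run σ DENOM 0 = posProd z S ∧ setup.run σ TDENOM 0 = timeDenom z S ∧
    ∀ b ∈ Finset.Ico 0 (S : ℤ), setup.run σ TAIL b = arcTail z b ∧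
      setup.run σ HEAD b = arcHead z b ∧ setup.run σ REV b = arcRev z b ∧
      setup.run σ CAPA b = arcCap z (posProd z S) b ∧
      setup.run σ TIME b = arcTime z (timeDenom z S) b ∧
      setup.run σ COST b = arcCost z (timeDenom z S) b := by
  simp only [setup, run_block_cons, run_block_nil]
  obtain ⟨σ₁, h₁⟩ : ∃ ρ, ρ = (setVar DENOM 1).run σ := ⟨_, rfl⟩
  obtain ⟨σ₂, h₂⟩ : ∃ ρ, ρ = (mulLoop DENOM).run σ₁ := ⟨_, rfl⟩
  obtain ⟨σ₃, h₃⟩ : ∃ ρ, ρ = arcLoop.run σ₂ := ⟨_, rfl⟩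
  obtain ⟨σ₄, h₄⟩ : ∃ ρ, ρ = (setVar CAPSUM 1).run σ₃ := ⟨_, rfl⟩
  obtain ⟨σ₅, h₅⟩ : ∃ ρ, ρ = sumLoop.run σ₄ := ⟨_, rfl⟩
  obtain ⟨σ₆, h₆⟩ : ∃ ρ, ρ = (setVar TDENOM (var CAPSUM)).run σ₅ := ⟨_, rfl⟩
  obtain ⟨σ₇, h₇⟩ : ∃ ρ, ρ = (mulLoop TDENOM).run σ₆ := ⟨_, rfl⟩
  obtain ⟨σ₈, h₈⟩ : ∃ ρ, ρ = costLoop.run σ₇ := ⟨_, rfl⟩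
  rw [← h₁, ← h₂, ← h₃, ← h₄, ← h₅, ← h₆, ← h₇, ← h₈]
  have f1 : ∀ a, _ → σ₁ a = σ a := fun a h => h₁ ▸ Prog.run_frame (p := setVar DENOM 1) (a := a) h σ
  have f2 : ∀ a, _ → σ₂ a = σ₁ a := fun a h => h₂ ▸ Prog.run_frame (p := mulLoop DENOM) (a := a) h σ₁
  have f3 : ∀ a, _ → σ₃ a = σ₂ a := fun a h => h₃ ▸ Prog.run_frame (p := arcLoop) (a := a) h σ₂
  have f4 : ∀ a, _ → σ₄ a = σ₃ a := fun a h => h₄ ▸ Prog.run_frame (p := setVar CAPSUM 1) (a := a) h σ₃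
  have f5 : ∀ a, _ → σ₅ a = σ₄ a := fun a h => h₅ ▸ Prog.run_frame (p := sumLoop) (a := a) h σ₄
  have f6 : ∀ a, _ → σ₆ a = σ₅ a :=
    fun a h => h₆ ▸ Prog.run_frame (p := setVar TDENOM (var CAPSUM)) (a := a) h σ₅
  have f7 : ∀ a, _ → σ₇ a = σ₆ a := fun a h => h₇ ▸ Prog.run_frame (p := mulLoop TDENOM) (a := a) h σ₆
  have f8 : ∀ a, _ → σ₈ a = σ₇ a := fun a h => h₈ ▸ Prog.run_frame (p := costLoop) (a := a) h σ₇
  have g2 : ∀ a, _ → _ → σ₂ a = σ a := fun a h h' => (f2 a h).trans (f1 a h')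
  have g4 : ∀ a, _ → _ → _ → _ → σ₄ a = σ a := fun a h1 h2 h3 h4 =>
    (f4 a h1).trans ((f3 a h2).trans (g2 a h3 h4))
  have g7 : ∀ a, _ → _ → _ → σ₇ a = σ₄ a := fun a h1 h2 h3 =>
    (f7 a h1).trans ((f6 a h2).trans (f5 a h3))
  have hz2 : σ₂ IN = z := (g2 _ rfl rfl).trans hz
  have hz4 : σ₄ IN = z := (g4 _ rfl rfl rfl rfl).trans hz
  have hz7 : σ₇ IN = z := (g7 _ rfl rfl rfl).trans hz4
  have hS2 : σ₂ SIZE 0 = S := by rw [g2 _ rfl rfl, hS]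
  have hS4 : σ₄ SIZE 0 = S := by rw [g4 _ rfl rfl rfl rfl, hS]
  have hS7 : σ₇ SIZE 0 = S := by rw [g7 _ rfl rfl rfl, hS4]
  have d2 : σ₂ DENOM 0 = posProd z S := by
    rw [h₂, run_mulLoop (by rw [f1 _ rfl, hS]) ((f1 _ rfl).trans hz) (by decide) (by decide), h₁]
    simp [run_setVar, write_apply]
  have a3 := run_arcLoop hS2 hz2 hn ((g2 _ rfl rfl).trans (h0 _ (by decide)))
    ((g2 _ rfl rfl).trans (h0 _ (by decide))) ((g2 _ rfl rfl).trans (h0 _ (by decide)))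
  rw [← h₃, d2] at a3
  have s5 := run_sumLoop hS4 (arcCap z (posProd z S)) fun b hb => by
    rw [f4 _ rfl]; exact (a3 b hb).2.2.2
  rw [← h₅, h₄] at s5
  simp only [run_setVar, write_apply, eval_one, if_true, Function.update_self] at s5
  have d7 : σ₇ TDENOM 0 = timeDenom z S := by
    have hz6 : σ₆ IN = z := (f6 _ rfl).trans ((f5 _ rfl).trans hz4)
    have hS6 : σ₆ SIZE 0 = S := by rw [f6 _ rfl, f5 _ rfl, hS4]
    rw [h₇, run_mulLoop hS6 hz6 (by decide) (by decide), h₆]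
    simp only [run_setVar, write_apply, eval_var, if_true, Function.update_self, timeDenom, s5]
  have a8 := run_costLoop hS7 hz7
    ((g7 _ rfl rfl rfl).trans ((g4 _ rfl rfl rfl rfl).trans (h0 _ (by decide))))
    ((g7 _ rfl rfl rfl).trans ((g4 _ rfl rfl rfl rfl).trans (h0 _ (by decide))))
  rw [← h₈, d7] at a8
  have g8 : ∀ a, _ → _ → _ → _ → _ → σ₈ a = σ₃ a := fun a h1 h2 h3 h4 h5 =>
    (f8 a h1).trans ((g7 a h2 h3 h4).trans (f4 a h5))
  refine ⟨?_, ?_, fun b hb => ?_⟩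
  · rw [g8 _ rfl rfl rfl rfl rfl, f3 _ rfl, d2]
  · rw [f8 _ rfl, d7]
  · rw [g8 TAIL rfl rfl rfl rfl rfl, g8 HEAD rfl rfl rfl rfl rfl, g8 REV rfl rfl rfl rfl rfl,
      g8 CAPA rfl rfl rfl rfl rfl]
    obtain ⟨x1, x2, x3, x4⟩ := a3 b hb
    exact ⟨x1, x2, x3, x4, a8 b hb⟩

end
end RAM

/-! ### Splitting a circulation into paths -/

/-- A circulation `f` that has positive flow on cycles through `r` only. -/
structure IsSplittable (S : ℤ) (tl hd rv : ℤ → ℤ) (r : ℤ) (pi f : ℤ → ℤ) : Prop where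
  anti : ∀ b ∈ Finset.Ico 0 S, f (rv b) = -f b
  conserve : ∀ u, netOut S tl f u = 0
  price : ∀ b ∈ Finset.Ico 0 S, 0 < f b → tl b ≠ r → hd b ≠ r → pi (tl b) < pi (hd b)

/-- The arcs `a 0, …, a (L - 1)` have positive flow and form a walk from `r` to `r`, or there
are none. -/
structure IsReturnPath (S : ℤ) (tl hd : ℤ → ℤ) (r : ℤ) (f : ℤ → ℤ) (a : ℕ → ℤ) (L : ℕ) : Prop where
  mem : ∀ i < L, a i ∈ Finset.Ico 0 S
  pos : ∀ i < L, 0 < f (a i)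
  start : 0 < L → tl (a 0) = r
  finish : 0 < L → hd (a (L - 1)) = r
  next : ∀ i, i + 1 < L → hd (a i) = tl (a (i + 1))
  inner : ∀ i, i + 1 < L → hd (a i) ≠ r
  inj : ∀ i < L, ∀ j < L, a i = a j → i = j

/-- The circulation `g` arises from `f` by removing `d` units of flow from a path. -/
structure IsSplit (S : ℤ) (tl hd rv : ℤ → ℤ) (r : ℤ) (f : ℤ → ℤ) (a : ℕ → ℤ) (L : ℕ) (d : ℤ)
    (g : ℤ → ℤ) : Prop where
  path : IsReturnPath S tl hd r f a L
  nonneg : 0 ≤ d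
  le : ∀ i < L, d ≤ f (a i)
  remove : ∀ b ∈ Finset.Ico 0 S, g b = f b - (if ∃ i < L, a i = b then d else 0) +
    (if ∃ i < L, a i = rv b then d else 0)
  progress : (∃ b ∈ Finset.Ico 0 S, tl b = r ∧ 0 < f b) → ∃ i < L, f (a i) = d

open Finset in
section

variable {S r : ℤ} {tl hd rv pi f g : ℤ → ℤ} {a : ℕ → ℤ} {L : ℕ} {d : ℤ}

/-- The reverse of `b` leaves the head of `b` with nonzero flow, and a vanishing sum with a nonzero
term has a positive term. -/
theorem exists_pos_out (hA : IsArcSystem S tl hd rv) (anti : ∀ b ∈ Ico 0 S, f (rv b) = -f b)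
    {b : ℤ} (cons : netOut S tl f (hd b) = 0) (hb : b ∈ Ico 0 S) (h : f b ≠ 0) :
    ∃ c ∈ Ico 0 S, tl c = hd b ∧ 0 < f c := by
  obtain ⟨c, hc, hc'⟩ := Finset.exists_pos_of_sum_zero_of_exists_nonzero f cons
    ⟨rv b, mem_filter.2 ⟨hA.rv_mem b hb, hA.tl_rv b hb⟩, by rw [anti b hb]; simpa using h⟩
  exact ⟨c, (mem_filter.1 hc).1, (mem_filter.1 hc).2, hc'⟩

/-- Conservation allows the walk to continue from every node it reaches. Away from `r` the prices
increase strictly along it, so no node repeats before `r` is met again. -/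
theorem IsSplittable.exists_walk {S : ℕ} (hA : IsArcSystem S tl hd rv)
    (hf : IsSplittable S tl hd rv r pi f) (hr : r ∈ Ico 0 (S : ℤ)) {nx : ℤ → ℤ}
    (hnx : ∀ b ∈ Ico 0 (S : ℤ), 0 < f b →
      nx (tl b) ∈ Ico 0 (S : ℤ) ∧ tl (nx (tl b)) = tl b ∧ 0 < f (nx (tl b)))
    (h0 : ∃ b ∈ Ico 0 (S : ℤ), tl b = r ∧ 0 < f b) :
    ∃ (w : ℕ → ℤ) (L : ℕ), w 0 = r ∧ w L = r ∧ 0 < L ∧ L ≤ S ∧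
      (∀ i, 0 < i → i < L → w i ≠ r) ∧ (∀ i, w (i + 1) = hd (nx (w i))) ∧
      IsReturnPath S tl hd r f (fun i => nx (w i)) L := by
  let w : ℕ → ℤ := fun i => (fun u => hd (nx u))^[i] r
  have ws : ∀ i, w (i + 1) = hd (nx (w i)) := fun i => Function.iterate_succ_apply' _ _ _
  have good : ∀ i, nx (w i) ∈ Ico 0 (S : ℤ) ∧ tl (nx (w i)) = w i ∧ 0 < f (nx (w i)) := by
    intro i
    suffices h : ∃ b ∈ Ico 0 (S : ℤ), tl b = w i ∧ 0 < f b by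
      obtain ⟨b, hb, hb', hb''⟩ := h
      rw [← hb']; exact hnx b hb hb''
    induction i with
    | zero => exact h0
    | succ i ih =>
      obtain ⟨b, hb, hb', hb''⟩ := ih
      have := hnx b hb hb''
      rw [hb'] at this
      rw [ws]
      exact exists_pos_out hA hf.anti (hf.conserve _) this.1 this.2.2.ne'
  have memw : ∀ i, w i ∈ Ico 0 (S : ℤ) := fun i => by
    rw [← (good i).2.1]; exact hA.tl_mem _ (good i).1
  have mono : ∀ m, (∀ i, 1 ≤ i → i ≤ m → w i ≠ r) → ∀ j ≤ m, ∀ i < j, 1 ≤ i →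
      pi (w i) < pi (w j) := by
    intro m hm j
    induction j with
    | zero => intro _ i hi; omega
    | succ j ih =>
      intro hj i hi h1
      have hstep : pi (w j) < pi (w (j + 1)) := by
        have := hf.price _ (good j).1 (good j).2.2 (by rw [(good j).2.1]; exact hm j (by omega) (by omega))
          (by rw [← ws]; exact hm _ (by omega) hj)
        rwa [(good j).2.1, ← ws] at this
      rcases (Nat.lt_succ_iff.1 hi).eq_or_lt with rfl | hlt
      · exact hstep
      · exact (ih (by omega) i hlt h1).trans hstep
  -- Otherwise the walk would visit `S` distinct nodes among the `S - 1` nodes other than `r`.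
  have hex : ∃ i, 1 ≤ i ∧ i ≤ S ∧ w i = r := by
    by_contra! hne
    have m := mono S hne
    have : (Finset.Icc 1 S).card ≤ ((Ico 0 (S : ℤ)).erase r).card := by
      refine Finset.card_le_card_of_injOn w (fun i hi => ?_) ?_
      · have := Finset.mem_Icc.1 hi
        exact Finset.mem_erase.2 ⟨hne i this.1 this.2, memw i⟩
      · intro i hi j hj e
        have hi := Finset.mem_Icc.1 (mem_coe.1 hi)
        have hj := Finset.mem_Icc.1 (mem_coe.1 hj)
        rcases lt_trichotomy i j with h | h | h
        · have := m j hj.2 i h hi.1; rw [e] at this; omega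
        · exact h
        · have := m i hi.2 j h hj.1; rw [e] at this; omega
    rw [Finset.card_erase_of_mem hr] at this
    simp at this
    have := Finset.mem_Ico.1 hr
    omega
  classical
  obtain ⟨h1, h2, h3⟩ := Nat.find_spec hex
  have hmin : ∀ i, 0 < i → i < Nat.find hex → w i ≠ r := fun i hi hlt e =>
    Nat.find_min hex hlt ⟨hi, by omega, e⟩
  set L := Nat.find hex
  refine ⟨w, L, rfl, h3, h1, h2, hmin, ws, ⟨fun i _ => (good i).1, fun i _ => (good i).2.2,
    fun _ => (good 0).2.1, fun _ => ?_, fun i _ => ?_, fun i hi => ?_, ?_⟩⟩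
  · rw [← ws, Nat.sub_add_cancel h1, h3]
  · rw [(good _).2.1, ws]
  · rw [← ws]; exact hmin _ (by omega) hi
  · have m := mono (L - 1) fun i hi hi' => hmin i hi (by omega)
    have key : ∀ i j, i < j → j < L → nx (w i) ≠ nx (w j) := by
      intro i j hij hj e
      have e' : w i = w j := by rw [← (good i).2.1, ← (good j).2.1, e]
      rcases Nat.eq_zero_or_pos i with rfl | hi
      · exact hmin j hij hj e'.symm
      · have := m j (by omega) i hij hi
        rw [e'] at this; omega
    intro i hi j hj e
    rcases lt_trichotomy i j with h | h | h
    · exact absurd e (key i j h hj)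
    · exact h
    · exact absurd e.symm (key j i h hi)

/-- Path arcs carry positive flow, so their reverses carry negative flow; the correction for
reverses is void where `f` is nonnegative. -/
theorem IsSplit.eq_of_pos (hs : IsSplit S tl hd rv r f a L d g)
    (anti : ∀ b ∈ Ico 0 S, f (rv b) = -f b) {b : ℤ} (hb : b ∈ Ico 0 S) (h : 0 ≤ f b) :
    g b = f b - if ∃ i < L, a i = b then d else 0 := by
  rw [hs.remove b hb, if_neg (c := ∃ i < L, a i = rv b), add_zero]
  rintro ⟨i, hi, e⟩
  have := hs.path.pos i hi
  rw [e, anti b hb] at this; omega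

theorem IsSplit.nonneg_of_nonneg (hs : IsSplit S tl hd rv r f a L d g)
    (anti : ∀ b ∈ Ico 0 S, f (rv b) = -f b) {b : ℤ} (hb : b ∈ Ico 0 S) (h : 0 ≤ f b) :
    0 ≤ g b ∧ g b ≤ f b := by
  rw [hs.eq_of_pos anti hb h]
  have := hs.nonneg
  split_ifs with hi
  · obtain ⟨i, hi, rfl⟩ := hi
    have := hs.le i hi; omega
  · omega

theorem IsSplit.anti (hA : IsArcSystem S tl hd rv) (hs : IsSplit S tl hd rv r f a L d g)
    (anti : ∀ b ∈ Ico 0 S, f (rv b) = -f b) {b : ℤ} (hb : b ∈ Ico 0 S) : g (rv b) = -g b := by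
  rw [hs.remove b hb, hs.remove _ (hA.rv_mem b hb), hA.rv_rv b hb, anti b hb]; ring

/-- If `f b ≤ 0`, the flow on the reverse is nonnegative and remains so, hence `g b ≤ 0`: no
positive arc is created. -/
theorem IsSplit.pos_of_pos (hA : IsArcSystem S tl hd rv) (hs : IsSplit S tl hd rv r f a L d g)
    (anti : ∀ b ∈ Ico 0 S, f (rv b) = -f b) {b : ℤ} (hb : b ∈ Ico 0 S) (h : 0 < g b) :
    0 < f b := by
  by_contra hf
  have h1 := (hs.nonneg_of_nonneg anti (hA.rv_mem b hb) (by rw [anti b hb]; omega)).1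
  rw [hs.anti hA anti hb] at h1; omega

/-- A closed walk enters every node as often as it leaves it: its heads are its tails shifted by
one. Since no arc repeats, membership in the path can be written as a sum over the path. -/
theorem IsSplit.conserve (hA : IsArcSystem S tl hd rv) (hs : IsSplit S tl hd rv r f a L d g)
    (cons : ∀ u, netOut S tl f u = 0) (u : ℤ) : netOut S tl g u = 0 := by
  have e1 : ∀ b ∈ Ico 0 S, g b = f b +
      (∑ i ∈ range L, (if a i = rv b then d else 0) - ∑ i ∈ range L, if a i = b then d else 0) := by
    have aux : ∀ c, (if ∃ i < L, a i = c then d else 0) = ∑ i ∈ range L, if a i = c then d else 0 := by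
      intro c
      split_ifs with h
      · obtain ⟨i, hi, rfl⟩ := h
        rw [Finset.sum_eq_single_of_mem i (mem_range.2 hi)]
        · simp
        · intro j hj hne
          exact if_neg fun e => hne (hs.path.inj j (mem_range.1 hj) i hi e)
      · refine (Finset.sum_eq_zero fun i hi => if_neg fun e => h ⟨i, mem_range.1 hi, e⟩).symm
    intro b hb
    rw [hs.remove b hb, aux, aux]; ring
  have e2 : netOut S tl g u = netOut S tl f u +
      (∑ i ∈ range L, (if hd (a i) = u then d else 0) - ∑ i ∈ range L, if tl (a i) = u then d else 0) := by
    simp only [netOut]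
    rw [Finset.sum_congr rfl fun b hb => e1 b (mem_filter.1 hb).1, Finset.sum_add_distrib,
      Finset.sum_sub_distrib, Finset.sum_comm, Finset.sum_comm (t := range L)]
    congr 2
    · refine Finset.sum_congr rfl fun i hi => ?_
      have hm := hs.path.mem i (mem_range.1 hi)
      rw [Finset.sum_filter, Finset.sum_eq_single_of_mem (rv (a i)) (hA.rv_mem _ hm)]
      · rw [hA.tl_rv _ hm, hA.rv_rv _ hm]; simp
      · intro b hb hne
        rw [if_neg (c := a i = rv b)]
        · simp
        · rintro e; exact hne (by rw [e, hA.rv_rv b hb])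
    · refine Finset.sum_congr rfl fun i hi => ?_
      have hm := hs.path.mem i (mem_range.1 hi)
      rw [Finset.sum_filter, Finset.sum_eq_single_of_mem (a i) hm]
      · simp
      · intro b hb hne
        rw [if_neg (c := a i = b) (Ne.symm hne)]
        simp
  rw [e2, cons, zero_add, sub_eq_zero]
  rcases Nat.eq_zero_or_pos L with rfl | hL
  · simp
  · obtain ⟨M, rfl⟩ : ∃ M, L = M + 1 := ⟨L - 1, by omega⟩
    rw [Finset.sum_range_succ, Finset.sum_range_succ' (fun i => if tl (a i) = u then d else 0)]
    have h1 := hs.path.start hL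
    have h2 := hs.path.finish hL
    rw [Nat.add_sub_cancel] at h2
    rw [h1, h2]
    congr 1
    refine Finset.sum_congr rfl fun i hi => ?_
    rw [hs.path.next i (by have := mem_range.1 hi; omega)]

theorem IsSplit.isSplittable (hA : IsArcSystem S tl hd rv) (hs : IsSplit S tl hd rv r f a L d g)
    (hf : IsSplittable S tl hd rv r pi f) : IsSplittable S tl hd rv r pi g :=
  ⟨fun _ hb => hs.anti hA hf.anti hb, hs.conserve hA hf.conserve,
    fun b hb h => hf.price b hb (hs.pos_of_pos hA hf.anti hb h)⟩

end

open Finset in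
section

variable {S : ℕ} {r : ℤ} {tl hd rv pi : ℤ → ℤ} {f : ℕ → ℤ → ℤ} {a : ℕ → ℕ → ℤ} {L : ℕ → ℕ}
  {d : ℕ → ℤ}

theorem splits_isSplittable (hA : IsArcSystem S tl hd rv) (hf : IsSplittable S tl hd rv r pi (f 0))
    (hs : ∀ k < S, IsSplit S tl hd rv r (f k) (a k) (L k) (d k) (f (k + 1))) :
    ∀ k ≤ S, IsSplittable S tl hd rv r pi (f k)
  | 0, _ => hf
  | k + 1, hk => (hs k hk).isSplittable hA (splits_isSplittable hA hf hs k (by omega))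

theorem splits_pos (hA : IsArcSystem S tl hd rv) (hf : IsSplittable S tl hd rv r pi (f 0))
    (hs : ∀ k < S, IsSplit S tl hd rv r (f k) (a k) (L k) (d k) (f (k + 1))) :
    ∀ k ≤ S, ∀ b ∈ Ico 0 (S : ℤ), 0 < f k b → 0 < f 0 b := by
  have H := splits_isSplittable hA hf hs
  intro k
  induction k with
  | zero => intro _ b _ h; exact h
  | succ k ih =>
    intro hk b hb h
    exact ih (by omega) b hb ((hs k hk).pos_of_pos hA (H k (by omega)).anti hb h)

/-- A round that still finds flow at `r` exhausts an arc of its path, and no round creates a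
positive arc. There are at most `S` of them at the beginning. -/
theorem splits_nonpos_out (hA : IsArcSystem S tl hd rv) (hf : IsSplittable S tl hd rv r pi (f 0))
    (hs : ∀ k < S, IsSplit S tl hd rv r (f k) (a k) (L k) (d k) (f (k + 1))) :
    ∀ b ∈ Ico 0 (S : ℤ), tl b = r → f S b ≤ 0 := by
  have H := splits_isSplittable hA hf hs
  let P : ℕ → Finset ℤ := fun k => (Ico 0 (S : ℤ)).filter fun b => 0 < f k b
  have sub : ∀ k < S, P (k + 1) ⊆ P k := fun k hk b hb => by
    have hb := mem_filter.1 hb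
    exact mem_filter.2 ⟨hb.1, (hs k hk).pos_of_pos hA (H k hk.le).anti hb.1 hb.2⟩
  suffices h : ∀ k ≤ S, (∀ b ∈ Ico 0 (S : ℤ), tl b = r → f k b ≤ 0) ∨ (P k).card + k ≤ S by
    rcases h S le_rfl with h | h
    · exact h
    · intro b hb _
      have h0 : P S = ∅ := Finset.card_eq_zero.1 (by omega)
      by_contra hpos
      have : b ∈ P S := mem_filter.2 ⟨hb, by omega⟩
      rw [h0] at this; simp at this
  intro k
  induction k with
  | zero =>
    intro _
    right
    have := Finset.card_filter_le (Ico 0 (S : ℤ)) fun b => 0 < f 0 b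
    simpa [P] using this
  | succ k ih =>
    intro hk
    have hsk := hs k hk
    rcases ih (by omega) with h | h
    · left
      intro b hb hr
      by_contra hpos
      have := hsk.pos_of_pos hA (H k (by omega)).anti hb (by omega)
      have := h b hb hr
      omega
    · by_cases hex : ∃ b ∈ Ico 0 (S : ℤ), tl b = r ∧ 0 < f k b
      · right
        obtain ⟨i, hi, e⟩ := hsk.progress hex
        have hm := hsk.path.mem i hi
        have h1 : a k i ∈ P k := mem_filter.2 ⟨hm, hsk.path.pos i hi⟩
        have h2 : a k i ∉ P (k + 1) := by
          intro h2
          have h2 := (mem_filter.1 h2).2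
          rw [hsk.eq_of_pos (H k (by omega)).anti hm (hsk.path.pos i hi).le,
            if_pos ⟨i, hi, rfl⟩, e] at h2
          omega
        have : (P (k + 1)).card < (P k).card :=
          Finset.card_lt_card ⟨sub k hk, fun h => h2 (h h1)⟩
        omega
      · left
        intro b hb hr
        by_contra hpos
        exact hex ⟨b, hb, hr, hsk.pos_of_pos hA (H k (by omega)).anti hb (by omega)⟩

/-- The flow on `b` stays nonnegative, so each round whose path uses `b` lowers it by exactly its
amount, and the sum telescopes. -/
theorem splits_sum (hA : IsArcSystem S tl hd rv) (hf : IsSplittable S tl hd rv r pi (f 0))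
    (hs : ∀ k < S, IsSplit S tl hd rv r (f k) (a k) (L k) (d k) (f (k + 1)))
    {b : ℤ} (hb : b ∈ Ico 0 (S : ℤ)) (h0 : 0 ≤ f 0 b) :
    ∀ k ≤ S, 0 ≤ f k b ∧
      ∑ j ∈ range k, (if ∃ i < L j, a j i = b then d j else 0) = f 0 b - f k b := by
  have H := splits_isSplittable hA hf hs
  intro k
  induction k with
  | zero => intro _; simpa using h0
  | succ k ih =>
    intro hk
    obtain ⟨h1, h2⟩ := ih (by omega)
    refine ⟨((hs k hk).nonneg_of_nonneg (H k (by omega)).anti hb h1).1, ?_⟩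
    rw [Finset.sum_range_succ, h2, (hs k hk).eq_of_pos (H k (by omega)).anti hb h1]
    ring

/-- The paths cost at most as much as the circulation. -/
theorem splits_cost_le (hA : IsArcSystem S tl hd rv) (hf : IsSplittable S tl hd rv r pi (f 0))
    (hs : ∀ k < S, IsSplit S tl hd rv r (f k) (a k) (L k) (d k) (f (k + 1))) (t : ℤ → ℤ)
    (ht : ∀ b ∈ Ico 0 (S : ℤ), 0 < f 0 b → hd b ≠ r → 0 ≤ t b) :
    ∑ k ∈ range S, d k * ∑ i ∈ range (L k), t (a k i) ≤
      ∑ b ∈ Ico 0 (S : ℤ) with 0 < f 0 b, t b * f 0 b := by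
  have H := splits_isSplittable hA hf hs
  have hpos := splits_pos hA hf hs
  have out := splits_nonpos_out hA hf hs
  -- In the end no flow leaves `r`, so by conservation none enters.
  have hin : ∀ b ∈ Ico 0 (S : ℤ), hd b = r → f S b = 0 := by
    intro b hb hr
    by_contra hne
    obtain ⟨c, hc, hc', hc''⟩ := exists_pos_out hA (H S le_rfl).anti ((H S le_rfl).conserve _) hb hne
    have := out c hc (hc'.trans hr); omega
  have e1 : ∀ k ∈ range S, d k * ∑ i ∈ range (L k), t (a k i) =
      ∑ b ∈ Ico 0 (S : ℤ) with 0 < f 0 b, t b * (if ∃ i < L k, a k i = b then d k else 0) := by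
    intro k hk
    have hk := mem_range.1 hk
    have hp := (hs k hk).path
    have : ∀ b, t b * (if ∃ i < L k, a k i = b then d k else 0) =
        ∑ i ∈ range (L k), if a k i = b then d k * t b else 0 := by
      intro c
      split_ifs with h
      · obtain ⟨i, hi, rfl⟩ := h
        rw [Finset.sum_eq_single_of_mem i (mem_range.2 hi)]
        · simp [mul_comm]
        · intro j hj hne
          exact if_neg fun e => hne (hp.inj j (mem_range.1 hj) i hi e)
      · rw [mul_zero]
        exact (Finset.sum_eq_zero fun i hi => if_neg fun e => h ⟨i, mem_range.1 hi, e⟩).symm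
    simp only [this]
    rw [Finset.sum_comm, Finset.mul_sum]
    refine Finset.sum_congr rfl fun i hi => ?_
    have hi := mem_range.1 hi
    rw [Finset.sum_eq_single_of_mem (a k i)
      (mem_filter.2 ⟨hp.mem i hi, hpos k hk.le _ (hp.mem i hi) (hp.pos i hi)⟩)]
    · simp
    · intro b _ hne; exact if_neg (Ne.symm hne)
  rw [Finset.sum_congr rfl e1, Finset.sum_comm]
  refine Finset.sum_le_sum fun b hb => ?_
  obtain ⟨hb, hfb⟩ := mem_filter.1 hb
  obtain ⟨h1, h2⟩ := splits_sum hA hf hs hb hfb.le S le_rfl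
  rw [← Finset.mul_sum, h2, mul_sub]
  -- The flow that remains after all rounds avoids `r`, where times may be negative, so dropping it
  -- cannot raise the total.
  by_cases hr : hd b = r
  · rw [hin b hb hr]; simp
  · have := mul_nonneg (ht b hb hfb hr) h1; linarith

end

/-! ### Tracing, measuring and removing a path -/

namespace RAM

open RAM.Expr RAM.Prog

section

variable {S : ℕ} {tl hd rv co pi : ℤ → ℤ} {σ : Store} {m r : ℤ}

theorem run_nextLoops (h : HasArcs S tl hd rv co σ) :
    ∀ u ∈ Finset.Ico 0 (S : ℤ),
      nextLoops.run σ NEXT u = -1 ∧ (∀ b ∈ Finset.Ico 0 (S : ℤ), tl b = u → σ FLOW b ≤ 0) ∨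
      nextLoops.run σ NEXT u ∈ Finset.Ico 0 (S : ℤ) ∧ tl (nextLoops.run σ NEXT u) = u ∧
        0 < σ FLOW (nextLoops.run σ NEXT u) := by
  simp only [nextLoops, run_block_cons, run_block_nil]
  have first : ∀ u ∈ Finset.Ico 0 (S : ℤ),
      (loop CTRB (Prog.set NEXT (var CTRB) (const (-1)))).run σ NEXT u = -1 := by
    let P : ℕ → Store → Prop := fun j τ => ∀ u ∈ Finset.Ico 0 (j : ℤ), τ NEXT u = -1
    refine run_loop h.size P (P S) ?_ ?_ ?_
    · intro u hu; simp at hu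
    · intro j hj τ fr hτ u hu
      simp only [run_set, eval_var, eval_const, write_apply, Function.update_self, if_true]
      by_cases e : u = j
      · simp [e]
      · rw [Function.update_of_ne e]
        refine hτ u ?_
        simp only [Finset.mem_Ico] at hu ⊢; push_cast at hu; omega
    · intro τ _ hτ u hu
      simpa [write_apply] using hτ u hu
  set σ₁ := (loop CTRB (Prog.set NEXT (var CTRB) (const (-1)))).run σ
  have h₁ : HasArcs S tl hd rv co σ₁ := h.run rfl rfl rfl rfl rfl
  have hf : σ₁ FLOW = σ FLOW := run_frame rfl _
  let P : ℕ → Store → Prop := fun j τ => ∀ u ∈ Finset.Ico 0 (S : ℤ),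
      τ NEXT u = -1 ∧ (∀ b ∈ Finset.Ico 0 (j : ℤ), tl b = u → σ FLOW b ≤ 0) ∨
      τ NEXT u ∈ Finset.Ico 0 (S : ℤ) ∧ tl (τ NEXT u) = u ∧ 0 < σ FLOW (τ NEXT u)
  refine run_loop h₁.size P (P S) ?_ ?_ ?_
  · intro u hu; exact .inl ⟨first u hu, fun b hb => by simp at hb⟩
  · intro j hj τ fr hτ
    have e1 : τ FLOW = σ FLOW := (fr _ rfl).trans hf
    have e2 : τ TAIL = tl := (fr _ rfl).trans h₁.tail
    have hjm : (j : ℤ) ∈ Finset.Ico 0 (S : ℤ) := by simp; omega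
    have c1 : (τ.write CTRB 0 j) FLOW ((τ.write CTRB 0 j) CTRB 0) = σ FLOW j := by
      simp [write_apply, e1]
    rw [run_when_lt]
    simp only [run_set, eval_get, eval_var, eval_zero, c1]
    split_ifs with c
    · intro u hu
      simp only [write_apply, Nat.reduceEqDiff, if_true, if_false, Function.update_self, e2]
      by_cases e : u = tl j
      · rw [e, Function.update_self]; exact .inr ⟨hjm, rfl, c⟩
      · rw [Function.update_of_ne e]
        rcases hτ u hu with ⟨h1, h2⟩ | h1
        · refine .inl ⟨h1, fun b hb hbu => ?_⟩
          by_cases eb : b = j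
          · exact absurd (by rw [← hbu, eb]) e
          · refine h2 b ?_ hbu
            simp only [Finset.mem_Ico] at hb ⊢; push_cast at hb; omega
        · exact .inr h1
    · intro u hu
      simp only [write_apply, Nat.reduceEqDiff, if_false]
      rcases hτ u hu with ⟨h1, h2⟩ | h1
      · refine .inl ⟨h1, fun b hb hbu => ?_⟩
        by_cases eb : b = j
        · rw [eb]; omega
        · refine h2 b ?_ hbu
          simp only [Finset.mem_Ico] at hb ⊢; push_cast at hb; omega
      · exact .inr h1
  · intro τ _ hτ u hu
    simpa [write_apply] using hτ u hu

/-- The pointers `NEXT` describe a walk through the nodes `w 0, …, w L`. -/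
structure IsReturnWalk (S : ℕ) (tl hd : ℤ → ℤ) (r : ℤ) (f nx : ℤ → ℤ) (w : ℕ → ℤ) (L : ℕ) :
    Prop where
  first : w 0 = r
  last : w L = r
  le : L ≤ S
  inner : ∀ i, 0 < i → i < L → w i ≠ r
  succ : ∀ i < L, w (i + 1) = hd (nx (w i))
  active : 0 < L ↔ -1 < nx r
  path : IsReturnPath S tl hd r f (fun i => nx (w i)) L
  progress : (∃ b ∈ Finset.Ico 0 (S : ℤ), tl b = r ∧ 0 < f b) → 0 < L

theorem exists_returnWalk {f nx : ℤ → ℤ} (hA : IsArcSystem S tl hd rv)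
    (hf : IsSplittable S tl hd rv r pi f) (hr : r ∈ Finset.Ico 0 (S : ℤ))
    (hnx : ∀ u ∈ Finset.Ico 0 (S : ℤ),
      nx u = -1 ∧ (∀ b ∈ Finset.Ico 0 (S : ℤ), tl b = u → f b ≤ 0) ∨
      nx u ∈ Finset.Ico 0 (S : ℤ) ∧ tl (nx u) = u ∧ 0 < f (nx u)) :
    ∃ w L, IsReturnWalk S tl hd r f nx w L := by
  rcases hnx r hr with ⟨h1, h2⟩ | ⟨h1, h2, h3⟩
  · refine ⟨fun _ => r, 0, rfl, rfl, by omega, fun i hi hi' => by omega, fun i hi => by omega,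
      by simp [h1], ⟨?_, ?_, ?_, ?_, ?_, ?_, ?_⟩, ?_⟩
    · intro i hi; omega
    · intro i hi; omega
    · intro hi; omega
    · intro hi; omega
    · intro i hi; omega
    · intro i hi; omega
    · intro i hi; omega
    · rintro ⟨b, hb, hb', hb''⟩
      have := h2 b hb hb'; omega
  · obtain ⟨w, L, w0, wL, hL, hLS, hne, hs, hp⟩ := hf.exists_walk hA hr (nx := nx) (by
      intro b hb hpos
      rcases hnx (tl b) (hA.tl_mem b hb) with ⟨_, h⟩ | h
      · have := h b hb rfl; omega
      · exact h) ⟨nx r, h1, h2, h3⟩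
    refine ⟨w, L, w0, wL, hLS, hne, fun i _ => hs i, ?_, hp, fun _ => hL⟩
    have := (Finset.mem_Ico.1 h1).1
    exact ⟨fun _ => by omega, fun _ => hL⟩

theorem run_startWalk (hr : σ IN 1 = r) :
    startWalk.run σ = ((σ.write FIN 0 r).write CUR 0 r).write ACT 0
      (if -1 < σ NEXT r then 1 else 0) := by
  simp only [startWalk, run_block_cons, run_block_nil, run_setVar, eval_get, eval_one, eval_lt,
    eval_const, write_apply, Nat.reduceEqDiff, if_false, hr]

theorem run_measureWalk (h : HasArcs S tl hd rv co σ) (hr : σ IN 1 = r) {w : ℕ → ℤ} {L : ℕ}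
    (hw : IsReturnWalk S tl hd r (σ FLOW) (σ NEXT) w L) :
    measureWalk.run σ TOTAL 0 = ∑ i ∈ Finset.range L, σ TIME (σ NEXT (w i)) ∧
    (∀ i < L, measureWalk.run σ DELTA 0 ≤ σ FLOW (σ NEXT (w i))) ∧
    (0 < L → ∃ i < L, σ FLOW (σ NEXT (w i)) = measureWalk.run σ DELTA 0) := by
  simp only [measureWalk, run_block_cons, run_block_nil, run_startWalk hr]
  obtain ⟨σ₁, hσ₁⟩ : ∃ σ₁, σ₁ = ((((σ.write FIN 0 r).write CUR 0 r).write ACT 0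
      (if -1 < σ NEXT r then 1 else 0)).write DELTA 0 (σ FLOW (σ NEXT r))).write TOTAL 0 0 :=
    ⟨_, rfl⟩
  have e : (setVar TOTAL 0).run ((setVar DELTA (get FLOW (get NEXT (get IN 1)))).run
      (((σ.write FIN 0 r).write CUR 0 r).write ACT 0 (if -1 < σ NEXT r then 1 else 0))) = σ₁ := by
    simp only [run_setVar, eval_get, eval_one, eval_zero, write_apply, Nat.reduceEqDiff, if_false,
      hr, hσ₁]
  rw [e]
  have g : ∀ x, x ≠ FIN → x ≠ CUR → x ≠ ACT → x ≠ DELTA → x ≠ TOTAL → σ₁ x = σ x := by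
    intro x h1 h2 h3 h4 h5
    rw [hσ₁, write_of_ne _ _ _ h5, write_of_ne _ _ _ h4, write_of_ne _ _ _ h3,
      write_of_ne _ _ _ h2, write_of_ne _ _ _ h1]
  have g1 : σ₁ HEAD = hd := (g _ (by decide) (by decide) (by decide) (by decide)
    (by decide)).trans h.head
  have g2 : σ₁ NEXT = σ NEXT := g _ (by decide) (by decide) (by decide) (by decide) (by decide)
  have g3 : σ₁ FLOW = σ FLOW := g _ (by decide) (by decide) (by decide) (by decide) (by decide)
  have g4 : σ₁ TIME = σ TIME := g _ (by decide) (by decide) (by decide) (by decide) (by decide)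
  have g5 : σ₁ SIZE 0 = S := by
    rw [g _ (by decide) (by decide) (by decide) (by decide) (by decide), h.size]
  -- `DELTA` starts with the flow on the first arc, so from the outset it is attained by some arc of
  -- the whole walk, not only of the part already visited.
  let I : ℕ → Store → Prop := fun i τ =>
    τ TOTAL 0 = ∑ j ∈ Finset.range i, σ TIME (σ NEXT (w j)) ∧
    (∀ j < i, τ DELTA 0 ≤ σ FLOW (σ NEXT (w j))) ∧
    (0 < L → ∃ j < L, σ FLOW (σ NEXT (w j)) = τ DELTA 0)
  change I L _
  refine run_walk g5 w hw.le (by simp [hσ₁, write_apply, hw.first])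
    (by simp [hσ₁, write_apply, hw.last])
    (by simp [hσ₁, write_apply, hw.active]) ?_ ?_ ⟨rfl, rfl, rfl, rfl, rfl, rfl⟩ I ?_ ?_ ?_
  · intro i hi; rw [g1, g2]; exact hw.succ i hi
  · intro i hi hi'; rw [hw.last]; exact hw.inner i hi hi'
  · rintro i τ a z (rfl | rfl | rfl | rfl) hi <;> simpa [I, write_apply] using hi
  · refine ⟨by simp [hσ₁, write_apply], fun j hj => by omega, fun hL => ⟨0, hL, ?_⟩⟩
    simp [hσ₁, write_apply, hw.first]
  · rintro i hi τ fr harc ⟨i1, i2, i3⟩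
    have e1 : τ FLOW = σ FLOW := (fr _ rfl).trans g3
    have e2 : τ TIME = σ TIME := (fr _ rfl).trans g4
    rw [g2] at harc
    simp only [run_block_cons, run_block_nil, run_when_lt, run_setVar, eval_get, eval_var, e1, harc]
    split_ifs with c
    · refine ⟨?_, ?_, ?_⟩
      · simp [write_apply, e2, harc, i1, Finset.sum_range_succ]
      · intro j hj
        simp only [eval_add, eval_var, eval_get, write_apply, Nat.reduceEqDiff, if_false, if_true,
          Function.update_self]
        rcases (Nat.lt_succ_iff.1 hj).eq_or_lt with rfl | hlt
        · exact le_rfl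
        · exact c.le.trans (i2 j hlt)
      · intro _
        exact ⟨i, hi, by simp [write_apply]⟩
    · refine ⟨?_, ?_, ?_⟩
      · simp [write_apply, e2, harc, i1, Finset.sum_range_succ]
      · intro j hj
        simp only [write_apply, Nat.reduceEqDiff, if_false]
        rcases (Nat.lt_succ_iff.1 hj).eq_or_lt with rfl | hlt
        · omega
        · exact i2 j hlt
      · intro hL
        simpa [write_apply] using i3 hL

/-- The records `st` and `am` of the edge `e` for the path with the arcs `a 0, …, a (L - 1)`. -/
def IsRecord (m : ℤ) (t : ℤ → ℤ) (a : ℕ → ℤ) (L : ℕ) (d e st am : ℤ) : Prop :=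
  (∃ i < L, a i < m * 4 ∧ a i / 4 = e ∧ st = ∑ j ∈ Finset.range i, t (a j) ∧ am = d) ∨
    (∀ i < L, a i < m * 4 → a i / 4 ≠ e) ∧ am = 0

/-- The walk repeats no arc, so its pushes add up to one removal per arc. `IsRecord` asks only for
some matching arc, so the argument need not exclude that a record is overwritten by another arc of
the same edge. -/
theorem run_removeWalk (hA : IsArcSystem S tl hd rv) (h : HasArcs S tl hd rv co σ)
    (hr : σ IN 1 = r) (hm : σ IN 2 = m) {w : ℕ → ℤ} {L : ℕ}
    (hw : IsReturnWalk S tl hd r (σ FLOW) (σ NEXT) w L)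
    (hmS : m ≤ S) (ham : ∀ e ∈ Finset.Ico 0 (S : ℤ), σ AMOUNT e = 0) :
    (∀ b ∈ Finset.Ico 0 (S : ℤ), removeWalk.run σ FLOW b = σ FLOW b -
      (if ∃ i < L, σ NEXT (w i) = b then σ DELTA 0 else 0) +
      (if ∃ i < L, σ NEXT (w i) = rv b then σ DELTA 0 else 0)) ∧
    ∀ e ∈ Finset.Ico 0 m, IsRecord m (σ TIME) (fun i => σ NEXT (w i)) L (σ DELTA 0) e
      (removeWalk.run σ START e) (removeWalk.run σ AMOUNT e) := by
  simp only [removeWalk, run_block_cons, run_block_nil, run_startWalk hr]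
  obtain ⟨σ₁, hσ₁⟩ : ∃ σ₁, σ₁ = (((σ.write FIN 0 r).write CUR 0 r).write ACT 0
      (if -1 < σ NEXT r then 1 else 0)).write PREFIX 0 0 := ⟨_, rfl⟩
  have e : (setVar PREFIX 0).run (((σ.write FIN 0 r).write CUR 0 r).write ACT 0
      (if -1 < σ NEXT r then 1 else 0)) = σ₁ := by
    simp only [run_setVar, eval_zero, hσ₁]
  rw [e]
  have g : ∀ x, x ≠ FIN → x ≠ CUR → x ≠ ACT → x ≠ PREFIX → σ₁ x = σ x := by
    intro x h1 h2 h3 h4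
    rw [hσ₁, write_of_ne _ _ _ h4, write_of_ne _ _ _ h3, write_of_ne _ _ _ h2,
      write_of_ne _ _ _ h1]
  have g0 : σ₁ IN = σ IN := g _ (by decide) (by decide) (by decide) (by decide)
  have g1 : σ₁ HEAD = hd := (g _ (by decide) (by decide) (by decide) (by decide)).trans h.head
  have g2 : σ₁ NEXT = σ NEXT := g _ (by decide) (by decide) (by decide) (by decide)
  have g3 : σ₁ FLOW = σ FLOW := g _ (by decide) (by decide) (by decide) (by decide)
  have g4 : σ₁ TIME = σ TIME := g _ (by decide) (by decide) (by decide) (by decide)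
  have g5 : σ₁ SIZE 0 = S := by
    rw [g _ (by decide) (by decide) (by decide) (by decide), h.size]
  have g6 : σ₁ DELTA = σ DELTA := g _ (by decide) (by decide) (by decide) (by decide)
  have g7 : σ₁ REV = rv := (g _ (by decide) (by decide) (by decide) (by decide)).trans h.rev
  have g8 : σ₁ AMOUNT = σ AMOUNT := g _ (by decide) (by decide) (by decide) (by decide)
  set d := σ DELTA 0 with hd
  set a : ℕ → ℤ := fun i => σ NEXT (w i) with ha
  let I : ℕ → Store → Prop := fun i τ =>
    τ PREFIX 0 = ∑ j ∈ Finset.range i, σ TIME (a j) ∧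
    (∀ b ∈ Finset.Ico 0 (S : ℤ), τ FLOW b = σ FLOW b - (if ∃ j < i, a j = b then d else 0) +
      (if ∃ j < i, a j = rv b then d else 0)) ∧
    ∀ e ∈ Finset.Ico 0 m, IsRecord m (σ TIME) a i d e (τ START e) (τ AMOUNT e)
  suffices key : I L _ from key.2
  refine run_walk g5 w hw.le (by simp [hσ₁, write_apply, hw.first])
    (by simp [hσ₁, write_apply, hw.last])
    (by simp [hσ₁, write_apply, hw.active]) ?_ ?_ ⟨rfl, rfl, rfl, rfl, rfl, rfl⟩ I ?_ ?_ ?_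
  · intro i hi; rw [g1, g2]; exact hw.succ i hi
  · intro i hi hi'; rw [hw.last]; exact hw.inner i hi hi'
  · rintro i τ x z (rfl | rfl | rfl | rfl) hi <;> simpa [I, write_apply] using hi
  · refine ⟨by simp [hσ₁, write_apply], fun b hb => by simp [g3], fun e he => .inr ⟨?_, ?_⟩⟩
    · intro i hi; omega
    · rw [g8]; refine ham e ?_
      simp only [Finset.mem_Ico] at he ⊢; omega
  · rintro i hi τ fr harc ⟨i1, i2, i3⟩
    have e0 : τ IN = σ IN := (fr _ rfl).trans g0
    have e2 : τ TIME = σ TIME := (fr _ rfl).trans g4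
    have e3 : τ DELTA = σ DELTA := (fr _ rfl).trans g6
    have e4 : τ REV = rv := (fr _ rfl).trans g7
    rw [g2] at harc
    change τ ARC 0 = a i at harc
    have hai := hw.path.mem i hi
    have hapos := hw.path.pos i hi
    have hpush := run_push e4 (var ARC) (0 - var DELTA) (fun _ _ => by simp [write_apply])
      (fun _ _ => by simp [write_apply])
    simp only [eval_var, eval_sub, eval_zero, harc, e3, zero_sub] at hpush
    simp only [run_block_cons, run_block_nil]
    obtain ⟨τ₁, hτ₁⟩ : ∃ τ₁, τ₁ = (push (var ARC) (0 - var DELTA)).run τ := ⟨_, rfl⟩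
    rw [← hτ₁] at hpush ⊢
    have k : ∀ x, x ≠ FLOW → τ₁ x = τ x := by
      intro x hx
      rw [hτ₁]
      refine run_frame ?_ _
      simp [push, block, writesTo, hx.symm]
    have k1 : τ₁ IN 2 = m := by rw [k _ (by decide), e0, hm]
    have k2 : τ₁ ARC 0 = a i := by rw [k _ (by decide), harc]
    have hflow : ∀ b ∈ Finset.Ico 0 (S : ℤ), τ₁ FLOW b = σ FLOW b -
        (if ∃ j < i + 1, a j = b then d else 0) + (if ∃ j < i + 1, a j = rv b then d else 0) := by
      intro b hb
      have aux : ∀ c, (if ∃ j < i + 1, a j = c then d else 0) =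
          (if ∃ j < i, a j = c then d else 0) + if c = a i then d else 0 := by
        intro c
        by_cases hc : c = a i
        · have h1 : ∃ j < i + 1, a j = c := ⟨i, by omega, hc.symm⟩
          have h2 : ¬ ∃ j < i, a j = c := by
            rintro ⟨j, hj, e⟩
            have := hw.path.inj j (by omega) i hi (e.trans hc)
            omega
          rw [if_pos h1, if_neg h2, if_pos hc, zero_add]
        · rw [if_neg hc, add_zero]
          congr 1
          refine propext ⟨?_, ?_⟩
          · rintro ⟨j, hj, e⟩
            refine ⟨j, ?_, e⟩
            rcases (Nat.lt_succ_iff.1 hj).eq_or_lt with rfl | hlt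
            · exact absurd e.symm hc
            · exact hlt
          · rintro ⟨j, hj, e⟩
            exact ⟨j, by omega, e⟩
      have hrv : rv b = a i ↔ b = rv (a i) := hA.rv_eq_iff hb hai
      rw [hpush, aux b, aux (rv b)]
      simp only [pushFlow, i2 b hb, hrv]
      split_ifs <;> ring
    have hrec : ∀ e ∈ Finset.Ico 0 m,
        IsRecord m (σ TIME) a (i + 1) d e
          (if a i < m * 4 ∧ a i / 4 = e then ∑ j ∈ Finset.range i, σ TIME (a j) else τ START e)
          (if a i < m * 4 ∧ a i / 4 = e then d else τ AMOUNT e) := by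
      intro e he
      split_ifs with c
      · exact .inl ⟨i, by omega, c.1, c.2, rfl, rfl⟩
      · rcases i3 e he with ⟨j, hj, h1, h2, h3, h4⟩ | ⟨h1, h2⟩
        · exact .inl ⟨j, by omega, h1, h2, h3, h4⟩
        · refine .inr ⟨fun j hj hj' => ?_, h2⟩
          rcases (Nat.lt_succ_iff.1 hj).eq_or_lt with rfl | hlt
          · exact fun e => c ⟨hj', e⟩
          · exact h1 j hlt hj'
    simp only [run_when_lt, eval_var, eval_mul, eval_get, eval_two, eval_four, k1, k2, run_setVar]
    split_ifs with c
    · refine ⟨?_, fun b hb => ?_, fun e he => ?_⟩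
      · simp [run_block_cons, run_block_nil, run_set, write_apply, k, e2, harc, i1,
          Finset.sum_range_succ]
      · rw [← hflow b hb]; simp [run_block_cons, run_block_nil, run_set, write_apply]
      · have := hrec e he
        simp only [c, true_and] at this
        simp only [run_block_cons, run_block_nil, run_set, write_apply, eval_var, eval_div,
          eval_four, eval_add, eval_get, Nat.reduceEqDiff, if_true, if_false, k2, k START (by decide),
          k PREFIX (by decide), k AMOUNT (by decide), k DELTA (by decide), i1, e3,
          Function.update_apply]
        simpa only [eq_comm (a := e)] using this
    · refine ⟨?_, fun b hb => ?_, fun e he => ?_⟩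
      · simp [write_apply, k, e2, harc, i1, Finset.sum_range_succ]
      · rw [← hflow b hb]; simp [write_apply]
      · have := hrec e he
        simp only [c, false_and, if_false] at this
        simpa [write_apply, k] using this

end
end RAM

/-! ### Layout of the output and the rounds of the decomposition -/

namespace RAM

open RAM.Expr RAM.Prog

/-- The address of the `i`-th cell of the output for the edge `e`. -/
def edgeCell (S : ℕ) (e i : ℤ) : ℤ := e * 2 + e * 6 * S + 1 + i

theorem edgeCell_lt {S : ℕ} {e e' i i' : ℤ} (h : e < e') (hi : i < 2 + 6 * S) (hi' : 0 ≤ i') :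
    edgeCell S e i < edgeCell S e' i' := by
  have : 0 ≤ (e' - e - 1) * (2 + 6 * S) := mul_nonneg (by omega) (by omega)
  simp only [edgeCell]; nlinarith

theorem edgeCell_ne {S : ℕ} {e e' i i' : ℤ} (h : e ≠ e') (h0 : 0 ≤ i) (hi : i < 2 + 6 * S)
    (h0' : 0 ≤ i') (hi' : i' < 2 + 6 * S) : edgeCell S e i ≠ edgeCell S e' i' := by
  rcases lt_or_gt_of_ne h with h | h
  · exact (edgeCell_lt h hi h0').ne
  · exact (edgeCell_lt h hi' h0).ne'

theorem edgeCell_inj {S : ℕ} {e i i' : ℤ} (h : i ≠ i') : edgeCell S e i ≠ edgeCell S e i' := by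
  simp only [edgeCell]; omega

/-- The output for the edge `e` contains a piece as its `k`-th piece. -/
def HoldsPiece (S : ℕ) (out : ℤ → ℤ) (e k : ℤ) (l : Fin 6 → ℤ) : Prop :=
  ∀ i : Fin 6, out (edgeCell S e (2 + 6 * k + i)) = l i

section

variable {S : ℕ} {tl hd rv co pi : ℤ → ℤ} {σ : Store} {m r : ℤ}

theorem run_pieceLoop (hS : σ SIZE 0 = S) (hm : σ IN 2 = m) (hmS : m ≤ S)
    {k : ℕ} (hk : σ CTRA 0 = k) (hkS : k < S) :
    (∀ e ∈ Finset.Ico 0 m, HoldsPiece S (pieceLoop.run σ OUT) e k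
      ![σ START e, σ TDENOM 0, σ START e - σ TOTAL 0, σ TDENOM 0, σ AMOUNT e, σ RDENOM 0]) ∧
    ∀ x, (∀ e ∈ Finset.Ico 0 m, ∀ i : Fin 6, x ≠ edgeCell S e (2 + 6 * k + i)) →
      pieceLoop.run σ OUT x = σ OUT x := by
  let P : ℕ → Store → Prop := fun j τ =>
    (∀ e ∈ Finset.Ico 0 m, e < j → HoldsPiece S (τ OUT) e k
      ![σ START e, σ TDENOM 0, σ START e - σ TOTAL 0, σ TDENOM 0, σ AMOUNT e, σ RDENOM 0]) ∧
    ∀ x, (∀ e ∈ Finset.Ico 0 m, ∀ i : Fin 6, x ≠ edgeCell S e (2 + 6 * k + i)) → τ OUT x = σ OUT x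
  suffices h : P S (pieceLoop.run σ) from
    ⟨fun e he => h.1 e he (by have := (Finset.mem_Ico.1 he).2; omega), h.2⟩
  refine run_loop hS P (P S) ?_ ?_ ?_
  · refine ⟨fun e he h => ?_, fun x _ => rfl⟩
    have := (Finset.mem_Ico.1 he).1; push_cast at h; omega
  · rintro j hj τ fr ⟨h1, h2⟩
    have e1 : τ IN = σ IN := fr _ rfl
    have e2 : τ SIZE = σ SIZE := fr _ rfl
    have e3 : τ CTRA = σ CTRA := fr _ rfl
    have e4 : τ START = σ START := fr _ rfl
    have e5 : τ AMOUNT = σ AMOUNT := fr _ rfl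
    have e6 : τ TOTAL = σ TOTAL := fr _ rfl
    have e7 : τ TDENOM = σ TDENOM := fr _ rfl
    have e8 : τ RDENOM = σ RDENOM := fr _ rfl
    have c1 : (τ.write CTRB 0 j) CTRB 0 = j := by simp [write_apply]
    have c2 : (τ.write CTRB 0 j) IN 2 = m := by simp [write_apply, e1, hm]
    rw [run_when_lt]
    simp only [eval_var, eval_get, eval_two, c1, c2]
    split_ifs with c
    · have hjm : (j : ℤ) ∈ Finset.Ico 0 m := by simp; omega
      obtain ⟨ρ, hρ⟩ : ∃ ρ, ρ = (block [setVar BASE (var CTRB * 2 + var CTRB * 6 * get SIZE 0 + 3 + var CTRA * 6),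
        set OUT (var BASE) (get START (var CTRB)),
        set OUT (var BASE + 1) (var TDENOM),
        set OUT (var BASE + 2) (get START (var CTRB) - var TOTAL),
        set OUT (var BASE + 3) (var TDENOM),
        set OUT (var BASE + 4) (get AMOUNT (var CTRB)),
        set OUT (var BASE + 5) (var RDENOM)]).run (τ.write CTRB 0 j) := ⟨_, rfl⟩
      rw [← hρ]
      have hout : ρ OUT = Function.update (Function.update (Function.update (Function.update
          (Function.update (Function.update (τ OUT) (edgeCell S j (2 + 6 * k)) (σ START j))
          (edgeCell S j (2 + 6 * k) + 1) (σ TDENOM 0))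
          (edgeCell S j (2 + 6 * k) + 2) (σ START j - σ TOTAL 0))
          (edgeCell S j (2 + 6 * k) + 3) (σ TDENOM 0))
          (edgeCell S j (2 + 6 * k) + 4) (σ AMOUNT j))
          (edgeCell S j (2 + 6 * k) + 5) (σ RDENOM 0) := by
        have : edgeCell S j (2 + 6 * k) = j * 2 + j * 6 * S + 3 + k * 6 := by
          simp only [edgeCell]; ring
        rw [this, hρ]
        simp [run_block_cons, run_block_nil, run_set, run_setVar, write_apply, e2, e3,
          e4, e5, e6, e7, e8, hS, hk]
      have hx : ∀ x, (∀ i : Fin 6, x ≠ edgeCell S j (2 + 6 * k + i)) → ρ OUT x = τ OUT x := by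
        intro x hx
        have h0 := hx 0; have h1 := hx 1; have h2 := hx 2; have h3 := hx 3; have h4 := hx 4
        have h5 := hx 5
        simp only [edgeCell, Fin.isValue, Fin.val_zero, Fin.val_one, Fin.val_two] at h0 h1 h2 h3 h4 h5
        simp only [edgeCell, hout, Function.update_apply]
        rw [if_neg, if_neg, if_neg, if_neg, if_neg, if_neg]
        · intro e; apply h0; rw [e]; push_cast; ring
        · intro e; apply h1; rw [e]; push_cast; ring
        · intro e; apply h2; rw [e]; push_cast; ring
        · intro e; apply h3; rw [e]; norm_num; ring
        · intro e; apply h4; rw [e]; norm_num; ring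
        · intro e; apply h5; rw [e]; norm_num; ring
      refine ⟨fun e he hej => ?_, fun x hne => ?_⟩
      · by_cases ej : e = j
        · subst ej
          intro i
          have : edgeCell S j (2 + 6 * k + i) = edgeCell S j (2 + 6 * k) + i := by
            simp only [edgeCell]; ring
          rw [this, hout]
          fin_cases i <;> simp
        · intro i
          rw [hx, h1 e he (by push_cast at hej; omega) i]
          intro i'
          have := i.2; have := i'.2
          exact edgeCell_ne ej (by omega) (by omega) (by omega) (by omega)
      · rw [hx x (hne j hjm), h2 x hne]
    · refine ⟨fun e he hej => ?_, fun x hne => ?_⟩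
      · have := h1 e he (by have := (Finset.mem_Ico.1 he).2; omega)
        intro i
        simpa [write_apply] using this i
      · simpa [write_apply] using h2 x hne
  · rintro τ - h
    simpa [P, write_apply] using h

theorem run_dirLoop (hS : σ SIZE 0 = S) (hm : σ IN 2 = m) (hmS : m ≤ S) :
    (∀ e ∈ Finset.Ico 0 m,
      dirLoop.run σ OUT (edgeCell S e 0) = (if 0 < σ FLOW (e * 4) then 1 else 0) ∧
      dirLoop.run σ OUT (edgeCell S e 1) = S) ∧ dirLoop.run σ OUT 0 = σ OUT 0 := by
  let P : ℕ → Store → Prop := fun j τ =>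
    (∀ e ∈ Finset.Ico 0 m, e < j → τ OUT (edgeCell S e 0) = (if 0 < σ FLOW (e * 4) then 1 else 0) ∧
      τ OUT (edgeCell S e 1) = S) ∧ τ OUT 0 = σ OUT 0
  suffices h : P S (dirLoop.run σ) from
    ⟨fun e he => h.1 e he (by have := (Finset.mem_Ico.1 he).2; omega), h.2⟩
  refine run_loop hS P (P S) ?_ ?_ ?_
  · refine ⟨fun e he h => ?_, rfl⟩
    have := (Finset.mem_Ico.1 he).1; push_cast at h; omega
  · rintro j hj τ fr ⟨h1, h2⟩
    have e1 : τ IN = σ IN := fr _ rfl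
    have e2 : τ SIZE = σ SIZE := fr _ rfl
    have e3 : τ FLOW = σ FLOW := fr _ rfl
    have c1 : (τ.write CTRB 0 j) CTRB 0 = j := by simp [write_apply]
    have c2 : (τ.write CTRB 0 j) IN 2 = m := by simp [write_apply, e1, hm]
    rw [run_when_lt]
    simp only [eval_var, eval_get, eval_two, c1, c2]
    split_ifs with c
    · obtain ⟨ρ, hρ⟩ : ∃ ρ, ρ = (block [setVar BASE (var CTRB * 2 + var CTRB * 6 * get SIZE 0 + 1),
        set OUT (var BASE) (lt 0 (get FLOW (var CTRB * 4))),
        set OUT (var BASE + 1) (get SIZE 0)]).run (τ.write CTRB 0 j) := ⟨_, rfl⟩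
      rw [← hρ]
      have hout : ρ OUT = Function.update (Function.update (τ OUT) (edgeCell S j 0)
          (if 0 < σ FLOW (j * 4) then 1 else 0)) (edgeCell S j 1) S := by
        have a0 : edgeCell S j 0 = j * 2 + j * 6 * S + 1 := by simp only [edgeCell]; ring
        have a1 : edgeCell S j 1 = j * 2 + j * 6 * S + 1 + 1 := by simp only [edgeCell]
        rw [a0, a1, hρ]
        simp [run_block_cons, run_block_nil, run_set, run_setVar, write_apply, e2, e3, hS]
      refine ⟨fun e he hej => ?_, ?_⟩
      · by_cases ej : e = j
        · subst ej
          rw [hout, Function.update_self, Function.update_of_ne (edgeCell_inj (by decide)),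
            Function.update_self]
          exact ⟨rfl, rfl⟩
        · have := h1 e he (by push_cast at hej; omega)
          rw [hout]
          rw [Function.update_of_ne (edgeCell_ne ej _ _ _ _),
            Function.update_of_ne (edgeCell_ne ej _ _ _ _),
            Function.update_of_ne (edgeCell_ne ej _ _ _ _),
            Function.update_of_ne (edgeCell_ne ej _ _ _ _)]
          · exact this
          all_goals omega
      · have h0 : ∀ i, 0 ≤ i → (0 : ℤ) ≠ edgeCell S j i := by
          intro i hi
          have : (0 : ℤ) ≤ j * 6 * S := by positivity
          simp only [edgeCell]; omega
        rw [hout, Function.update_of_ne (h0 _ (by decide)), Function.update_of_ne (h0 _ (by decide)),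
          h2]
    · refine ⟨fun e he hej => ?_, ?_⟩
      · have := h1 e he (by have := (Finset.mem_Ico.1 he).2; omega)
        simpa [write_apply] using this
      · simpa [write_apply] using h2
  · rintro τ - h
    simpa [P, write_apply] using h

theorem run_clearLoop (hS : σ SIZE 0 = S) : ∀ e ∈ Finset.Ico 0 (S : ℤ),
    (loop CTRB (block [Prog.set START (var CTRB) 0, Prog.set AMOUNT (var CTRB) 0])).run σ AMOUNT e
      = 0 := by
  let P : ℕ → Store → Prop := fun j τ => ∀ u ∈ Finset.Ico 0 (j : ℤ), τ AMOUNT u = 0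
  refine run_loop hS P (P S) ?_ ?_ ?_
  · intro u hu; simp at hu
  · intro j hj τ fr hτ u hu
    simp only [run_block_cons, run_block_nil, run_set, eval_var, eval_zero, write_apply,
      Function.update_self, if_true, if_false, Nat.reduceEqDiff]
    by_cases e : u = j
    · simp [e]
    · rw [Function.update_of_ne e]
      refine hτ u ?_
      simp only [Finset.mem_Ico] at hu ⊢; push_cast at hu; omega
  · intro τ _ hτ u hu
    simpa [write_apply] using hτ u hu

theorem run_round (hA : IsArcSystem S tl hd rv) (h : HasArcs S tl hd rv co σ)
    (hr : σ IN 1 = r) (hrS : r ∈ Finset.Ico 0 (S : ℤ)) (hm : σ IN 2 = m) (hmS : m ≤ S)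
    (hf : IsSplittable S tl hd rv r pi (σ FLOW)) {k : ℕ} (hk : σ CTRA 0 = k) (hkS : k < S) :
    ∃ (a : ℕ → ℤ) (L : ℕ) (d : ℤ), IsSplit S tl hd rv r (σ FLOW) a L d (round.run σ FLOW) ∧
      (∀ e ∈ Finset.Ico 0 m, ∃ st am, IsRecord m (σ TIME) a L d e st am ∧
        HoldsPiece S (round.run σ OUT) e k ![st, σ TDENOM 0,
          st - ∑ i ∈ Finset.range L, σ TIME (a i), σ TDENOM 0, am, σ RDENOM 0]) ∧
      ∀ x, (∀ e ∈ Finset.Ico 0 m, ∀ i : Fin 6, x ≠ edgeCell S e (2 + 6 * k + i)) →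
        round.run σ OUT x = σ OUT x := by
  simp only [round, run_block_cons, run_block_nil]
  obtain ⟨σ₁, h₁⟩ : ∃ ρ, ρ = nextLoops.run σ := ⟨_, rfl⟩
  obtain ⟨σ₂, h₂⟩ : ∃ ρ, ρ = (loop CTRB
    (block [Prog.set START (var CTRB) 0, Prog.set AMOUNT (var CTRB) 0])).run σ₁ := ⟨_, rfl⟩
  obtain ⟨σ₃, h₃⟩ : ∃ ρ, ρ = measureWalk.run σ₂ := ⟨_, rfl⟩
  obtain ⟨σ₄, h₄⟩ : ∃ ρ, ρ = removeWalk.run σ₃ := ⟨_, rfl⟩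
  obtain ⟨σ₅, h₅⟩ : ∃ ρ, ρ = pieceLoop.run σ₄ := ⟨_, rfl⟩
  rw [← h₁, ← h₂, ← h₃, ← h₄, ← h₅]
  have f1 : ∀ a, _ → σ₁ a = σ a := fun a h => h₁ ▸ Prog.run_frame (p := nextLoops) (a := a) h σ
  have f2 : ∀ a, _ → σ₂ a = σ₁ a := fun a h => h₂ ▸ Prog.run_frame (p := loop CTRB
    (block [Prog.set START (var CTRB) 0, Prog.set AMOUNT (var CTRB) 0])) (a := a) h σ₁
  have f3 : ∀ a, _ → σ₃ a = σ₂ a := fun a h => h₃ ▸ Prog.run_frame (p := measureWalk) (a := a) h σ₂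
  have f4 : ∀ a, _ → σ₄ a = σ₃ a := fun a h => h₄ ▸ Prog.run_frame (p := removeWalk) (a := a) h σ₃
  have f5 : ∀ a, _ → σ₅ a = σ₄ a := fun a h => h₅ ▸ Prog.run_frame (p := pieceLoop) (a := a) h σ₄
  have g2 : ∀ a, _ → _ → σ₂ a = σ a := fun a h h' => (f2 a h).trans (f1 a h')
  have g3 : ∀ a, _ → _ → _ → σ₃ a = σ a := fun a h0 h h' => (f3 a h0).trans (g2 a h h')
  have g4 : ∀ a, _ → _ → _ → _ → σ₄ a = σ a := fun a i h0 h h' => (f4 a i).trans (g3 a h0 h h')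
  have A2 : HasArcs S tl hd rv co σ₂ := h.congr (g2 _ rfl rfl) (g2 _ rfl rfl) (g2 _ rfl rfl)
    (g2 _ rfl rfl) (g2 _ rfl rfl)
  have A3 : HasArcs S tl hd rv co σ₃ := h.congr (g3 _ rfl rfl rfl) (g3 _ rfl rfl rfl)
    (g3 _ rfl rfl rfl) (g3 _ rfl rfl rfl) (g3 _ rfl rfl rfl)
  have F2 : σ₂ FLOW = σ FLOW := g2 _ rfl rfl
  have F3 : σ₃ FLOW = σ FLOW := g3 _ rfl rfl rfl
  have N3 : σ₃ NEXT = σ₂ NEXT := f3 _ rfl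
  have T2 : σ₂ TIME = σ TIME := g2 _ rfl rfl
  have T3 : σ₃ TIME = σ TIME := g3 _ rfl rfl rfl
  have hnx := run_nextLoops h
  rw [← h₁, ← f2 NEXT rfl] at hnx
  obtain ⟨w, L, hw⟩ := exists_returnWalk hA hf hrS hnx
  have hw2 : IsReturnWalk S tl hd r (σ₂ FLOW) (σ₂ NEXT) w L := by rw [F2]; exact hw
  have hw3 : IsReturnWalk S tl hd r (σ₃ FLOW) (σ₃ NEXT) w L := by rw [F3, N3]; exact hw
  obtain ⟨m1, m2, m3⟩ := run_measureWalk A2 (by rw [g2 _ rfl rfl, hr]) hw2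
  rw [← h₃, F2] at m3
  rw [← h₃, T2] at m1
  rw [← h₃, F2] at m2
  have hclear := run_clearLoop (σ := σ₁) (S := S) (by rw [f1 _ rfl, h.size])
  rw [← h₂, ← f3 AMOUNT rfl] at hclear
  obtain ⟨r1, r2⟩ := run_removeWalk hA A3 (by rw [g3 _ rfl rfl rfl, hr])
    (by rw [g3 _ rfl rfl rfl, hm]) hw3 hmS hclear
  rw [← h₄, F3, N3] at r1
  rw [← h₄, N3, T3] at r2
  obtain ⟨p1, p2⟩ := run_pieceLoop (σ := σ₄) (S := S) (m := m) (k := k)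
    (by rw [g4 _ rfl rfl rfl rfl, h.size]) (by rw [g4 _ rfl rfl rfl rfl, hm]) hmS
    (by rw [g4 _ rfl rfl rfl rfl, hk]) hkS
  rw [← h₅, g4 TDENOM rfl rfl rfl rfl, g4 RDENOM rfl rfl rfl rfl, f4 TOTAL rfl, m1] at p1
  rw [← h₅, g4 OUT rfl rfl rfl rfl] at p2
  -- If there is no walk, `DELTA` is not meaningful, and the amount is taken to be zero.
  refine ⟨fun i => σ₂ NEXT (w i), L, if 0 < L then σ₃ DELTA 0 else 0, ⟨hw.path, ?_, ?_, ?_, ?_⟩,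
    fun e he => ⟨_, _, ?_, p1 e he⟩, p2⟩
  · split_ifs with hL
    · obtain ⟨i, hi, e⟩ := m3 hL
      rw [← e]; exact (hw.path.pos i hi).le
    · exact le_rfl
  · intro i hi
    rw [if_pos (by omega)]; exact m2 i hi
  · intro b hb
    rw [f5 _ rfl, r1 b hb]
    by_cases hL : 0 < L
    · rw [if_pos hL]
    · obtain rfl : L = 0 := by omega
      simp
  · intro hex
    have hL := hw.progress hex
    rw [if_pos hL]; exact m3 hL
  · have := r2 e he
    by_cases hL : 0 < L
    · rw [if_pos hL]; exact this
    · obtain rfl : L = 0 := by omega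
      rcases this with ⟨i, hi, _⟩ | h
      · omega
      · exact .inr h

/-- The output of the algorithm: the directions of the edges and a flow that is split into the
paths with the arcs `a k 0, …, a k (L k - 1)`. -/
theorem run_output (hA : IsArcSystem S tl hd rv) (h : HasArcs S tl hd rv co σ)
    (hr : σ IN 1 = r) (hrS : r ∈ Finset.Ico 0 (S : ℤ)) (hm : σ IN 2 = m) (hmS : m ≤ S)
    (hf : IsSplittable S tl hd rv r pi (σ FLOW)) :
    ∃ (f : ℕ → ℤ → ℤ) (a : ℕ → ℕ → ℤ) (L : ℕ → ℕ) (d : ℕ → ℤ), f 0 = σ FLOW ∧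
      (∀ k < S, IsSplit S tl hd rv r (f k) (a k) (L k) (d k) (f (k + 1))) ∧
      output.run σ OUT 0 = m * 2 + m * 6 * S ∧
      ∀ e ∈ Finset.Ico 0 m,
        output.run σ OUT (edgeCell S e 0) = (if 0 < σ FLOW (e * 4) then 1 else 0) ∧
        output.run σ OUT (edgeCell S e 1) = S ∧
        ∀ k < S, ∃ st am, IsRecord m (σ TIME) (a k) (L k) (d k) e st am ∧
          HoldsPiece S (output.run σ OUT) e k ![st, σ TDENOM 0,
            st - ∑ i ∈ Finset.range (L k), σ TIME (a k i), σ TDENOM 0, am,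
            if σ DENOM 0 * σ IN 3 * 2 = 0 then 1 else σ DENOM 0 * σ IN 3 * 2] := by
  set RD := if σ DENOM 0 * σ IN 3 * 2 = 0 then 1 else σ DENOM 0 * σ IN 3 * 2 with hRD
  obtain ⟨σ₁, h₁⟩ : ∃ ρ, ρ = (block [setVar RDENOM (var DENOM * get IN 3 * 2),
    when (eq (var RDENOM) 0) (setVar RDENOM 1),
    Prog.set OUT 0 (get IN 2 * 2 + get IN 2 * 6 * get SIZE 0)]).run σ := ⟨_, rfl⟩
  obtain ⟨σ₂, h₂⟩ : ∃ ρ, ρ = dirLoop.run σ₁ := ⟨_, rfl⟩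
  have hrun : output.run σ = (loop CTRA round).run σ₂ := by
    rw [h₂, h₁]; simp only [output, run_block_cons, run_block_nil]
  have f1 : ∀ a, _ → σ₁ a = σ a := fun a h => h₁ ▸ Prog.run_frame
    (p := block [setVar RDENOM (var DENOM * get IN 3 * 2),
    when (eq (var RDENOM) 0) (setVar RDENOM 1),
    Prog.set OUT 0 (get IN 2 * 2 + get IN 2 * 6 * get SIZE 0)]) (a := a) h σ
  have f2 : ∀ a, _ → σ₂ a = σ₁ a := fun a h => h₂ ▸ Prog.run_frame (p := dirLoop) (a := a) h σ₁
  have g2 : ∀ a, _ → _ → σ₂ a = σ a := fun a h h' => (f2 a h).trans (f1 a h')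
  have out1 : σ₁ OUT 0 = m * 2 + m * 6 * S ∧ σ₁ RDENOM 0 = RD := by
    rw [h₁, hRD]
    simp only [run_block_cons, run_block_nil, run_setVar, run_when_eq]
    by_cases c : σ DENOM 0 * σ IN 3 * 2 = 0
    · simp [c, run_set, write_apply, hm, h.size, Expr.eval]
    · simp [c, run_set, write_apply, hm, h.size]
  obtain ⟨d1, d2⟩ := run_dirLoop (σ := σ₁) (S := S) (m := m) (by rw [f1 _ rfl, h.size])
    (by rw [f1 _ rfl, hm]) hmS
  rw [← h₂, f1 FLOW rfl] at d1
  rw [← h₂, out1.1] at d2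
  -- The memory between the rounds is named, because the conclusion needs the whole sequence of
  -- circulations and not just an invariant.
  let s : ℕ → Store := loopState round.run CTRA σ₂
  have fr : ∀ k a, (loop CTRA round).writesTo a = false → s k a = σ₂ a := by
    intro k a ha
    simp only [writesTo, Bool.or_eq_false_iff, beq_eq_false_iff_ne] at ha
    induction k with
    | zero => rfl
    | succ k ih => rw [← ih]; simp only [s, loopState]
                   rw [run_frame ha.2, write_of_ne _ _ _ ha.1.symm]
  have step : ∀ k < S, IsSplittable S tl hd rv r pi (s k FLOW) →
      ∃ (a : ℕ → ℤ) (L : ℕ) (d : ℤ), IsSplit S tl hd rv r (s k FLOW) a L d (s (k + 1) FLOW) ∧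
      (∀ e ∈ Finset.Ico 0 m, ∃ st am, IsRecord m (σ TIME) a L d e st am ∧
        HoldsPiece S (s (k + 1) OUT) e k ![st, σ TDENOM 0,
          st - ∑ i ∈ Finset.range L, σ TIME (a i), σ TDENOM 0, am, RD]) ∧
      ∀ x, (∀ e ∈ Finset.Ico 0 m, ∀ i : Fin 6, x ≠ edgeCell S e (2 + 6 * k + i)) →
        s (k + 1) OUT x = s k OUT x := by
    intro k hk hfk
    have w : ∀ x, x ≠ CTRA → (s k).write CTRA 0 k x = s k x := fun x hx => write_of_ne _ _ _ hx
    have w' : ∀ x, x ≠ CTRA → (loop CTRA round).writesTo x = false →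
        (s k).write CTRA 0 k x = σ₂ x := fun x hx hx' => (w x hx).trans (fr k x hx')
    have := run_round (σ := (s k).write CTRA 0 k) hA
      (h.congr ((w' _ (by decide) rfl).trans (g2 _ rfl rfl))
        ((w' _ (by decide) rfl).trans (g2 _ rfl rfl))
        ((w' _ (by decide) rfl).trans (g2 _ rfl rfl))
        ((w' _ (by decide) rfl).trans (g2 _ rfl rfl))
        ((w' _ (by decide) rfl).trans (g2 _ rfl rfl)))
      (by rw [w' _ (by decide) rfl, g2 _ rfl rfl, hr]) hrS
      (by rw [w' _ (by decide) rfl, g2 _ rfl rfl, hm]) hmS (by rw [w _ (by decide)]; exact hfk)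
      (k := k) (by simp [write_apply]) hk
    rw [w FLOW (by decide), w OUT (by decide), w' TIME (by decide) rfl, w' TDENOM (by decide) rfl,
      w' RDENOM (by decide) rfl, g2 TIME rfl rfl, g2 TDENOM rfl rfl, f2 RDENOM rfl, out1.2] at this
    exact this
  have spl : ∀ k ≤ S, IsSplittable S tl hd rv r pi (s k FLOW) := by
    intro k
    induction k with
    | zero => intro _; change IsSplittable S tl hd rv r pi (σ₂ FLOW); rw [g2 _ rfl rfl]; exact hf
    | succ k ih =>
      intro hk
      obtain ⟨a, L, d, h1, -⟩ := step k (by omega) (ih (by omega))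
      exact h1.isSplittable hA (ih (by omega))
  choose a L d h1 h2 h3 using fun k : Fin S => step k k.2 (spl k k.2.le)
  -- A round writes only the cells of its own pieces, so headers and the pieces of earlier rounds
  -- survive to the end.
  have keep : ∀ k ≤ S, ∀ k' ≤ k, ∀ x, (∀ j, k' ≤ j → j < k → ∀ e ∈ Finset.Ico 0 m, ∀ i : Fin 6,
      x ≠ edgeCell S e (2 + 6 * j + i)) → s k OUT x = s k' OUT x := by
    intro k
    induction k with
    | zero => intro _ k' hk' x _; rw [Nat.le_zero.1 hk']
    | succ k ih =>
      intro hk k' hk' x hx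
      rcases hk'.eq_or_lt with rfl | hlt
      · rfl
      · rw [h3 ⟨k, hk⟩ x (hx k (by omega) (by omega)), ih (by omega) k' (by omega) x
          fun j hj hj' => hx j hj (by omega)]
  have hfin : ∀ x, output.run σ OUT x = s S OUT x := by
    intro x
    have : (σ₂ 2 0).toNat = S := by rw [g2 2 rfl rfl, h.size]; simp
    rw [hrun]
    simp only [Prog.run, this]
    rw [write_of_ne _ _ _ (by decide)]
  refine ⟨fun k => s k FLOW, fun k => if hk : k < S then a ⟨k, hk⟩ else fun _ => 0,
    fun k => if hk : k < S then L ⟨k, hk⟩ else 0, fun k => if hk : k < S then d ⟨k, hk⟩ else 0,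
    g2 _ rfl rfl, fun k hk => ?_, ?_, fun e he => ⟨?_, ?_, fun k hk => ?_⟩⟩
  · simp only [dif_pos hk]; exact h1 ⟨k, hk⟩
  · rw [hfin, keep S le_rfl 0 (by omega) 0, ← d2]
    · rfl
    · intro j _ hj e he i
      have h0 := (Finset.mem_Ico.1 he).1
      have : 0 ≤ e * 6 * S := by positivity
      simp only [edgeCell]; omega
  · rw [hfin, keep S le_rfl 0 (by omega), ← (d1 e he).1]
    · rfl
    · intro j _ hj e' he' i
      have := i.2
      by_cases ee : e = e'
      · subst ee; exact edgeCell_inj (by omega)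
      · exact edgeCell_ne ee (by omega) (by omega) (by omega) (by omega)
  · rw [hfin, keep S le_rfl 0 (by omega), ← (d1 e he).2]
    · rfl
    · intro j _ hj e' he' i
      have := i.2
      by_cases ee : e = e'
      · subst ee; exact edgeCell_inj (by omega)
      · exact edgeCell_ne ee (by omega) (by omega) (by omega) (by omega)
  · obtain ⟨st, am, i1, i2⟩ := h2 ⟨k, hk⟩ e he
    simp only [dif_pos hk]
    refine ⟨st, am, i1, fun i => ?_⟩
    rw [hfin, keep S le_rfl (k + 1) (by omega)]
    · exact i2 i
    · intro j hj hj' e' he' i'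
      have := i.2; have := i'.2
      by_cases ee : e = e'
      · subst ee; exact edgeCell_inj (by omega)
      · exact edgeCell_ne ee (by omega) (by omega) (by omega) (by omega)

end
end RAM

theorem List.getElem?_flatten_ofFn {α : Type*} {c : ℕ} :
    ∀ {n : ℕ} (g : Fin n → List α), (∀ i, (g i).length = c) → ∀ (i : Fin n) {j : ℕ}, j < c →
      (List.ofFn g).flatten[(i : ℕ) * c + j]? = (g i)[j]?
  | 0, _, _, i, _, _ => i.elim0
  | n + 1, g, hg, i, j, hj => by
    rw [List.ofFn_succ, List.flatten_cons]
    refine Fin.cases ?_ (fun i => ?_) i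
    · rw [List.getElem?_append_left (by simp [hg, hj])]
      simp
    · have e : (i.succ : ℕ) * c + j = c + (i * c + j) := by simp [add_mul]; ring
      rw [e, List.getElem?_append_right (by rw [hg]; omega), hg, Nat.add_sub_cancel_left]
      exact List.getElem?_flatten_ofFn _ (fun i => hg _) i hj

theorem List.length_flatten_ofFn {α : Type*} {c n : ℕ} (g : Fin n → List α)
    (hg : ∀ i, (g i).length = c) : (List.ofFn g).flatten.length = n * c := by
  simp [List.length_flatten, List.map_ofFn, Function.comp_def, hg]

/-! ### The input array and its bounds -/

namespace RAM

theorem posProd_pos (z : ℤ → ℤ) (S : ℕ) : 0 < posProd z S :=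
  Finset.prod_pos fun j _ => by split_ifs <;> omega

theorem dvd_posProd {z : ℤ → ℤ} {S k : ℕ} (hk : k < S) (h : 0 < z (k + 1)) :
    z (k + 1) ∣ posProd z S := by
  have := Finset.dvd_prod_of_mem (fun j : ℕ => if 0 < z (j + 1) then z (j + 1) else 1)
    (Finset.mem_range.2 hk)
  rwa [if_pos h] at this

/-- Each entry is less than two to its bit length, and bit lengths add up to the input size. -/
theorem posProd_inputStore_le (l : List ℤ) (k : ℕ) :
    posProd (inputStore l 0) k ≤ 2 ^ inputSize (l.take k) := by
  induction k with
  | zero => simp [posProd, inputSize]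
  | succ k ih =>
    rw [posProd, Finset.prod_range_succ]
    by_cases hk : k < l.length
    · rw [inputSize_take_succ l hk, pow_add, inputStore_zero_succ _ hk]
      refine mul_le_mul ih ?_ (by split_ifs <;> omega) (by positivity)
      have h1 := natAbs_lt_two_pow_bits l[k]
      have h2 : 2 ^ (bits l[k] - 1) ≤ 2 ^ bits l[k] := Nat.pow_le_pow_right (by norm_num) (by omega)
      have h3 : l[k].natAbs < 2 ^ bits l[k] := by omega
      have h4 : (l[k].natAbs : ℤ) < 2 ^ bits l[k] := by exact_mod_cast h3
      split_ifs <;> omega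
    · rw [inputStore_zero_of_length_le _ (by omega), if_neg (by omega), mul_one,
        List.take_of_length_le (by omega)]
      rwa [List.take_of_length_le (by omega)] at ih

/-- The array `z` holds the instance `I`, whose size is `S`. -/
structure IsInput (I : RatInstance) (S : ℕ) (z : ℤ → ℤ) : Prop where
  nodes : z 1 = I.n
  edges : z 2 = I.m
  time_num : z 3 = I.horizon.num
  time_den : z 4 = I.horizon.den
  bal_num (v : Fin I.n) : z ((v : ℕ) * 2 + 5) = (I.balance v).num
  bal_den (v : Fin I.n) : z ((v : ℕ) * 2 + 6) = (I.balance v).den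
  end_one (e : Fin I.m) : z (I.n * 2 + (e : ℕ) * 6 + 5) = (I.end₁ e : ℕ)
  end_two (e : Fin I.m) : z (I.n * 2 + (e : ℕ) * 6 + 6) = (I.end₂ e : ℕ)
  cap_num (e : Fin I.m) : z (I.n * 2 + (e : ℕ) * 6 + 7) = (I.cap e).num
  cap_den (e : Fin I.m) : z (I.n * 2 + (e : ℕ) * 6 + 8) = (I.cap e).den
  transit_num (e : Fin I.m) : z (I.n * 2 + (e : ℕ) * 6 + 9) = (I.transit e).num
  transit_den (e : Fin I.m) : z (I.n * 2 + (e : ℕ) * 6 + 10) = (I.transit e).den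
  size : 4 + I.n * 2 + I.m * 6 ≤ S
  entry_lt (x : ℤ) : z x < 2 ^ S ∧ -z x < 2 ^ S
  prod_le : posProd z S ≤ 2 ^ S

theorem isInput_code (I : RatInstance) :
    IsInput I (inputSize I.code) (inputStore I.code 0) := by
  set l₁ := (List.ofFn fun v => (I.balance v).code).flatten with hl₁
  set l₂ := (List.ofFn fun e =>
        [((I.end₁ e : ℕ) : ℤ), ((I.end₂ e : ℕ) : ℤ)]
          ++ (I.cap e).code ++ (I.transit e).code).flatten with hl₂
  have len₁ : l₁.length = I.n * 2 := List.length_flatten_ofFn _ fun _ => rfl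
  have len₂ : l₂.length = I.m * 6 := List.length_flatten_ofFn _ fun _ => rfl
  have hc : I.code = [(I.n : ℤ), (I.m : ℤ), I.horizon.num, I.horizon.den] ++ (l₁ ++ l₂) := by
    simp [RatInstance.code, hl₁, hl₂, Fraction.code]
  have len : I.code.length = 4 + I.n * 2 + I.m * 6 := by
    rw [hc]; simp only [List.length_append, len₁, len₂, List.length_cons, List.length_nil]; omega
  have get : ∀ (k : ℕ) (y : ℤ), I.code[k]? = some y → inputStore I.code 0 ((k : ℤ) + 1) = y := by
    intro k y hy
    obtain ⟨hk, e⟩ := List.getElem?_eq_some_iff.1 hy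
    rw [inputStore_zero_succ _ hk, e]
  have get₁ : ∀ (v : Fin I.n) (j : ℕ) (y : ℤ), j < 2 → (I.balance v).code[j]? = some y →
      inputStore I.code 0 ((v : ℕ) * 2 + (5 + j : ℕ)) = y := by
    intro v j y hj hy
    have hv := v.2
    rw [← get (4 + (v * 2 + j)) y ?_]
    · congr 1; push_cast; ring
    · rw [hc, List.getElem?_append_right (by simp), List.getElem?_append_left (by simp [len₁]; omega)]
      rw [show 4 + ((v : ℕ) * 2 + j) - [(I.n : ℤ), (I.m : ℤ), I.horizon.num, I.horizon.den].length
        = v * 2 + j by simp, hl₁]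
      rw [List.getElem?_flatten_ofFn (c := 2) _ (fun _ => rfl) v hj, hy]
  have get₂ : ∀ (e : Fin I.m) (j : ℕ) (y : ℤ), j < 6 →
      ([((I.end₁ e : ℕ) : ℤ), ((I.end₂ e : ℕ) : ℤ)]
          ++ (I.cap e).code ++ (I.transit e).code)[j]? = some y →
      inputStore I.code 0 (I.n * 2 + (e : ℕ) * 6 + (5 + j : ℕ)) = y := by
    intro e j y hj hy
    have he := e.2
    rw [← get (4 + (I.n * 2 + (e * 6 + j))) y ?_]
    · congr 1; push_cast; ring
    · rw [hc, List.getElem?_append_right (by simp), List.getElem?_append_right (by simp [len₁])]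
      rw [show 4 + (I.n * 2 + ((e : ℕ) * 6 + j)) -
        [(I.n : ℤ), (I.m : ℤ), I.horizon.num, I.horizon.den].length - l₁.length
        = e * 6 + j by simp [len₁], hl₂]
      rw [List.getElem?_flatten_ofFn (c := 6) _ (fun _ => rfl) e hj, hy]
  have hb : ∀ x, (inputStore I.code 0 x).natAbs < 2 ^ inputSize I.code := by
    intro x
    have h1 := natAbs_lt_two_pow_bits (inputStore I.code 0 x)
    have h2 := bits_inputStore_le I.code 0 x
    exact h1.trans_le (Nat.pow_le_pow_right (by norm_num) (by omega))
  refine ⟨get 0 _ (by rw [hc]; rfl), get 1 _ (by rw [hc]; rfl), get 2 _ (by rw [hc]; rfl),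
    get 3 _ (by rw [hc]; rfl), fun v => get₁ v 0 _ (by decide) rfl, fun v => get₁ v 1 _ (by decide) rfl,
    fun e => get₂ e 0 _ (by decide) rfl, fun e => get₂ e 1 _ (by decide) rfl,
    fun e => get₂ e 2 _ (by decide) rfl, fun e => get₂ e 3 _ (by decide) rfl,
    fun e => get₂ e 4 _ (by decide) rfl, fun e => get₂ e 5 _ (by decide) rfl,
    by rw [← len]; exact length_le_inputSize _, fun x => ?_, ?_⟩
  · have h := hb x
    have h' : ((inputStore I.code 0 x).natAbs : ℤ) < 2 ^ inputSize I.code := by exact_mod_cast h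
    omega
  · refine (posProd_inputStore_le _ _).trans (pow_le_pow_right₀ (by norm_num) (inputSize_take_le _ _))

end RAM

/-! ### The arc system of an instance -/

namespace RAM

section

variable {I : RatInstance} {S : ℕ} {z : ℤ → ℤ}

/-- The arcs of an edge and of a node, and the unused numbers. -/
theorem arc_cases (I : RatInstance) {b : ℤ} (hb : b ∈ Finset.Ico 0 (S : ℤ)) :
    (∃ (e : Fin I.m) (k : ℕ), k < 4 ∧ b = (e : ℕ) * 4 + k) ∨
    (∃ (v : Fin I.n) (k : ℕ), k < 2 ∧ b = I.m * 4 + (v : ℕ) * 2 + k) ∨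
    (I.m : ℤ) * 4 + I.n * 2 ≤ b := by
  obtain ⟨h0, -⟩ := Finset.mem_Ico.1 hb
  obtain ⟨b, rfl⟩ := Int.eq_ofNat_of_zero_le h0
  by_cases h1 : b < I.m * 4
  · exact .inl ⟨⟨b / 4, by omega⟩, b % 4, by omega, by push_cast; omega⟩
  · by_cases h2 : b < I.m * 4 + I.n * 2
    · exact .inr (.inl ⟨⟨(b - I.m * 4) / 2, by omega⟩, (b - I.m * 4) % 2, by omega, by
      push_cast; omega⟩)
    · exact .inr (.inr (by omega))

/-- An enumeration of the sums over all arcs. -/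
theorem IsInput.sum_arcs (h : IsInput I S z) {M : Type*} [AddCommMonoid M] (g : ℤ → M)
    (hg : ∀ b : ℤ, (I.m : ℤ) * 4 + I.n * 2 ≤ b → b < S → g b = 0) :
    ∑ b ∈ Finset.Ico 0 (S : ℤ), g b =
      ∑ e : Fin I.m, (g ((e : ℕ) * 4) + g ((e : ℕ) * 4 + 1) + g ((e : ℕ) * 4 + 2) +
        g ((e : ℕ) * 4 + 3)) +
      ∑ v : Fin I.n, (g (I.m * 4 + (v : ℕ) * 2) + g (I.m * 4 + (v : ℕ) * 2 + 1)) := by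
  have e1 : ∀ k : ℕ, ∑ j ∈ Finset.range (k * 4), g j =
      ∑ e : Fin k, (g ((e : ℕ) * 4) + g ((e : ℕ) * 4 + 1) + g ((e : ℕ) * 4 + 2) +
        g ((e : ℕ) * 4 + 3)) := by
    intro k
    induction k with
    | zero => simp
    | succ k ih =>
      rw [Fin.sum_univ_castSucc, show (k + 1) * 4 = k * 4 + 1 + 1 + 1 + 1 by ring,
        Finset.sum_range_succ, Finset.sum_range_succ, Finset.sum_range_succ, Finset.sum_range_succ, ih]
      simp only [Fin.val_castSucc, Fin.val_last]
      push_cast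
      simp only [add_assoc]
  have e2 : ∀ k : ℕ, ∑ j ∈ Finset.range (k * 2), g ((I.m : ℤ) * 4 + j) =
      ∑ v : Fin k, (g (I.m * 4 + (v : ℕ) * 2) + g (I.m * 4 + (v : ℕ) * 2 + 1)) := by
    intro k
    induction k with
    | zero => simp
    | succ k ih =>
      rw [Fin.sum_univ_castSucc, show (k + 1) * 2 = k * 2 + 1 + 1 by ring,
        Finset.sum_range_succ, Finset.sum_range_succ, ih]
      simp only [Fin.val_castSucc, Fin.val_last]
      push_cast
      simp only [add_assoc]
  have e0 : ∑ b ∈ Finset.Ico 0 (S : ℤ), g b = ∑ j ∈ Finset.range S, g j := by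
    refine (Finset.sum_nbij' (fun j : ℕ => (j : ℤ)) Int.toNat ?_ ?_ ?_ ?_ ?_).symm
    · intro j hj; simpa using hj
    · intro b hb; simp at hb ⊢; omega
    · intro j _; simp
    · intro b hb; simp at hb ⊢; omega
    · intro j _; rfl
  have := h.size
  rw [e0, ← Finset.sum_range_add_sum_Ico _ (show I.m * 4 + I.n * 2 ≤ S by omega),
    Finset.sum_range_add, e1]
  push_cast
  rw [e2, Finset.sum_eq_zero (s := Finset.Ico _ _), add_zero]
  intro j hj
  have := Finset.mem_Ico.1 hj
  exact hg j (by omega) (by omega)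

theorem IsInput.arcBase_edge (h : IsInput I S z) (e : Fin I.m) {k : ℤ} (h0 : 0 ≤ k) (hk : k < 4) :
    arcBase z ((e : ℕ) * 4 + k) = I.n * 2 + (e : ℕ) * 6 + 5 := by
  have := e.2
  rw [arcBase, h.edges, h.nodes, if_pos (by omega)]
  have : (((e : ℕ) : ℤ) * 4 + k) / 4 = (e : ℕ) := by omega
  rw [this]

theorem IsInput.arcBase_node (h : IsInput I S z) (v : Fin I.n) {k : ℤ} (h0 : 0 ≤ k) (hk : k < 2) :
    arcBase z (I.m * 4 + (v : ℕ) * 2 + k) = (v : ℕ) * 2 + 5 := by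
  rw [arcBase, h.edges, if_neg (by omega)]
  omega

/-- The capacity of the arcs of an edge. -/
def edgeCap (I : RatInstance) (D : ℤ) (e : Fin I.m) : ℤ :=
  D / (I.cap e).den * (I.cap e).num * I.horizon.num

/-- The transit time of the arcs of an edge. -/
def edgeTime (I : RatInstance) (K : ℤ) (e : Fin I.m) : ℤ :=
  K / (I.transit e).den * (I.transit e).num

/-- The capacity of the arcs of a node, with the sign of the balance. -/
def nodeCap (I : RatInstance) (D : ℤ) (v : Fin I.n) : ℤ :=
  D / (I.balance v).den * (I.balance v).num * I.horizon.den

/-- The time bonus for reaching a sink. -/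
def sinkTime (I : RatInstance) (K : ℤ) : ℤ := K / I.horizon.den * I.horizon.num * 2

theorem IsInput.edge_arcs (h : IsInput I S z) (e : Fin I.m) {k : ℤ} (hk : k = 0 ∨ k = 1 ∨ k = 2 ∨ k = 3)
    (D K : ℤ) :
    arcTail z ((e : ℕ) * 4 + k) = (if k = 1 ∨ k = 2 then ((I.end₂ e : ℕ) : ℤ) else (I.end₁ e : ℕ)) ∧
    arcHead z ((e : ℕ) * 4 + k) = (if k = 1 ∨ k = 2 then ((I.end₁ e : ℕ) : ℤ) else (I.end₂ e : ℕ)) ∧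
    arcRev z ((e : ℕ) * 4 + k) =
      (if k = 0 ∨ k = 2 then ((e : ℕ) * 4 + k + 1 : ℤ) else (e : ℕ) * 4 + k - 1) ∧
    arcCap z D ((e : ℕ) * 4 + k) = (if k = 0 ∨ k = 2 then edgeCap I D e else 0) ∧
    arcTime z K ((e : ℕ) * 4 + k) = (if k = 0 ∨ k = 2 then edgeTime I K e else -edgeTime I K e) ∧
    arcCost z K ((e : ℕ) * 4 + k) =
      (if k = 0 ∨ k = 2 then edgeTime I K e + 1 else -edgeTime I K e - 1) := by
  have he := e.2
  have hb := h.arcBase_edge e (k := k) (by omega) (by omega)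
  have c1 : ((e : ℕ) : ℤ) * 4 + k < z 2 * 4 := by rw [h.edges]; omega
  have c2 : ((e : ℕ) : ℤ) * 4 + k < z 2 * 4 + z 1 * 2 := by rw [h.nodes]; omega
  have c3 : (((e : ℕ) : ℤ) * 4 + k) / 4 = (e : ℕ) := by omega
  have c4 : ((e : ℕ) : ℤ) * 4 + k - (((e : ℕ) : ℤ) * 4 + k) / 2 * 2 = 0 ↔ k = 0 ∨ k = 2 := by omega
  have c5 : (((e : ℕ) : ℤ) * 4 + k - ((e : ℕ) : ℤ) * 4 + 1) / 2 = 1 ↔ k = 1 ∨ k = 2 := by omega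
  simp only [arcTail, arcHead, arcCap, arcTime, arcCost, if_pos c1, hb, c3, c4, c5, add_assoc _ (5 : ℤ),
    Int.reduceAdd, h.end_one, h.end_two, h.cap_num, h.cap_den, h.transit_num, h.transit_den, h.time_num]
  refine ⟨trivial, trivial, ?_, rfl, rfl, ?_⟩
  · rw [arcRev, if_pos c2]
    split_ifs <;> omega
  · simp only [edgeTime]
    split_ifs <;> ring

theorem IsInput.node_arcs (h : IsInput I S z) (v : Fin I.n) {k : ℤ} (hk : k = 0 ∨ k = 1) (D K : ℤ) :
    arcTail z (I.m * 4 + (v : ℕ) * 2 + k) =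
      (if (0 < (I.balance v).num ↔ k = 0) then (I.n : ℤ) else (v : ℕ)) ∧
    arcHead z (I.m * 4 + (v : ℕ) * 2 + k) =
      (if (0 < (I.balance v).num ↔ k = 0) then ((v : ℕ) : ℤ) else I.n) ∧
    arcRev z (I.m * 4 + (v : ℕ) * 2 + k) =
      (if k = 0 then (I.m * 4 + (v : ℕ) * 2 + k + 1 : ℤ) else I.m * 4 + (v : ℕ) * 2 + k - 1) ∧
    arcCap z D (I.m * 4 + (v : ℕ) * 2 + k) =
      (if k = 0 then if 0 < (I.balance v).num then nodeCap I D v else -nodeCap I D v else 0) ∧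
    arcTime z K (I.m * 4 + (v : ℕ) * 2 + k) = (if (I.balance v).num < 1 then
      if k = 0 then -sinkTime I K else sinkTime I K else 0) ∧
    arcCost z K (I.m * 4 + (v : ℕ) * 2 + k) = (if (I.balance v).num < 1 then
      if k = 0 then -sinkTime I K else sinkTime I K else 0) := by
  have hv := v.2
  have hb := h.arcBase_node v (k := k) (by omega) (by omega)
  have c1 : ¬ (I.m * 4 + ((v : ℕ) : ℤ) * 2 + k < z 2 * 4) := by rw [h.edges]; omega
  have c2 : I.m * 4 + ((v : ℕ) : ℤ) * 2 + k < z 2 * 4 + I.n * 2 := by rw [h.edges]; omega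
  have c3 : (I.m * 4 + ((v : ℕ) : ℤ) * 2 + k - z 2 * 4) / 2 = (v : ℕ) := by rw [h.edges]; omega
  have c4 : I.m * 4 + ((v : ℕ) : ℤ) * 2 + k - (I.m * 4 + ((v : ℕ) : ℤ) * 2 + k) / 2 * 2 = k := by omega
  have c5 : (if 0 < (I.balance v).num then (1 : ℤ) else 0) = 1 - k ↔
      (0 < (I.balance v).num ↔ k = 0) := by
    by_cases c : 0 < (I.balance v).num <;> simp [c] <;> omega
  simp only [arcTail, arcHead, arcCap, arcTime, arcCost, arcRev, if_neg c1, if_pos c2, hb, c3, c4, h.bal_num,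
    c5, add_assoc _ (5 : ℤ), Int.reduceAdd, h.bal_den, h.time_num, h.time_den, h.nodes, add_zero]
  refine ⟨trivial, trivial, ?_, rfl, rfl, rfl⟩
  split_ifs <;> omega

theorem IsInput.unused_arcs (h : IsInput I S z) {b : ℤ} (hb : (I.m : ℤ) * 4 + I.n * 2 ≤ b) (D K : ℤ) :
    arcTail z b = 0 ∧ arcHead z b = 0 ∧ arcRev z b = b ∧ arcCap z D b = 0 ∧ arcTime z K b = 0 ∧
      arcCost z K b = 0 := by
  have c1 : ¬ (b < z 2 * 4) := by rw [h.edges]; omega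
  have c2 : ¬ (b < z 2 * 4 + z 1 * 2) := by rw [h.nodes, h.edges]; omega
  simp [arcTail, arcHead, arcRev, arcCap, arcTime, arcCost, c1, c2]

theorem IsInput.isArcSystem (h : IsInput I S z) :
    IsArcSystem S (arcTail z) (arcHead z) (arcRev z) := by
  have hS := h.size
  have key : ∀ b ∈ Finset.Ico 0 (S : ℤ), arcTail z b ∈ Finset.Ico 0 (S : ℤ) ∧
      arcRev z b ∈ Finset.Ico 0 (S : ℤ) ∧ arcRev z (arcRev z b) = b ∧
      arcTail z (arcRev z b) = arcHead z b := by
    intro b hb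
    rcases arc_cases I hb with ⟨e, k, hk, rfl⟩ | ⟨v, k, hk, rfl⟩ | hb'
    · have := e.2; have := (I.end₁ e).2; have := (I.end₂ e).2
      obtain ⟨t0, h0, r0, -⟩ := h.edge_arcs e (k := 0) (by simp) 0 0
      obtain ⟨t1, h1, r1, -⟩ := h.edge_arcs e (k := 1) (by simp) 0 0
      obtain ⟨t2, h2, r2, -⟩ := h.edge_arcs e (k := 2) (by simp) 0 0
      obtain ⟨t3, h3, r3, -⟩ := h.edge_arcs e (k := 3) (by simp) 0 0
      norm_num [add_assoc, add_sub_assoc] at t0 t1 t2 t3 h0 h1 h2 h3 r0 r1 r2 r3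
      interval_cases k <;> simp [*] <;> omega
    · have := v.2
      obtain ⟨t0, h0, r0, -⟩ := h.node_arcs v (k := 0) (by simp) 0 0
      obtain ⟨t1, h1, r1, -⟩ := h.node_arcs v (k := 1) (by simp) 0 0
      norm_num [add_assoc, add_sub_assoc] at t0 t1 h0 h1 r0 r1
      by_cases c : 0 < (I.balance v).num <;> interval_cases k <;>
        simp [*, add_assoc] <;> omega
    · obtain ⟨t, h1, r, -⟩ := h.unused_arcs hb' 0 0
      rw [t, r, r, t, h1]
      exact ⟨by simp; omega, hb, rfl, rfl⟩
  exact ⟨fun b hb => (key b hb).1, fun b hb => (key b hb).2.1, fun b hb => (key b hb).2.2.1,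
    fun b hb => (key b hb).2.2.2⟩

theorem IsInput.arcCost_rev (h : IsInput I S z) (K : ℤ) :
    ∀ b ∈ Finset.Ico 0 (S : ℤ), arcCost z K (arcRev z b) = -arcCost z K b := by
  intro b hb
  rcases arc_cases I hb with ⟨e, k, hk, rfl⟩ | ⟨v, k, hk, rfl⟩ | hb'
  · obtain ⟨-, -, r0, -, -, c0⟩ := h.edge_arcs e (k := 0) (by simp) 0 K
    obtain ⟨-, -, r1, -, -, c1⟩ := h.edge_arcs e (k := 1) (by simp) 0 K
    obtain ⟨-, -, r2, -, -, c2⟩ := h.edge_arcs e (k := 2) (by simp) 0 K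
    obtain ⟨-, -, r3, -, -, c3⟩ := h.edge_arcs e (k := 3) (by simp) 0 K
    norm_num [add_assoc, add_sub_assoc] at r0 r1 r2 r3 c0 c1 c2 c3
    interval_cases k <;> simp [*] <;> ring
  · obtain ⟨-, -, r0, -, -, c0⟩ := h.node_arcs v (k := 0) (by simp) 0 K
    obtain ⟨-, -, r1, -, -, c1⟩ := h.node_arcs v (k := 1) (by simp) 0 K
    norm_num [add_assoc, add_sub_assoc] at r0 r1 c0 c1
    interval_cases k <;> simp [*, add_assoc] <;> split_ifs <;> simp
  · obtain ⟨t, h1, r, -, -, c⟩ := h.unused_arcs hb' 0 K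
    rw [r, c, neg_zero]

theorem Fraction.num_nonneg {q : Fraction} (h : 0 ≤ q.val) : 0 ≤ q.num := by
  have := q.den_pos
  by_contra hn
  have h1 : (q.num : ℝ) < 0 := by exact_mod_cast not_le.1 hn
  have h2 : (0 : ℝ) < q.den := by exact_mod_cast this
  have := div_neg_of_neg_of_pos h1 h2
  simp only [Fraction.val] at h
  linarith

/-- Denominators are positive entries of the input, hence factors of the product. -/
theorem IsInput.den_dvd (h : IsInput I S z) :
    I.horizon.den ∣ posProd z S ∧ (∀ v, (I.balance v).den ∣ posProd z S) ∧
    (∀ e, (I.cap e).den ∣ posProd z S) ∧ ∀ e, (I.transit e).den ∣ posProd z S := by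
  have hS := h.size
  have key : ∀ (k : ℕ) (y x : ℤ), z x = y → k < S → x = k + 1 → 0 < y → y ∣ posProd z S := by
    rintro k _ x rfl hk rfl hy; exact dvd_posProd hk hy
  refine ⟨?_, fun v => ?_, fun e => ?_, fun e => ?_⟩
  · exact key 3 _ _ h.time_den (by omega) (by norm_num) I.horizon.den_pos
  · exact key (v * 2 + 5) _ _ (h.bal_den v) (by omega) (by push_cast; ring) (I.balance v).den_pos
  · exact key (I.n * 2 + e * 6 + 7) _ _ (h.cap_den e) (by omega) (by push_cast; ring) (I.cap e).den_pos
  · exact key (I.n * 2 + e * 6 + 9) _ _ (h.transit_den e) (by omega) (by push_cast; ring)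
      (I.transit e).den_pos

/-- A capacity is a product of three factors of size at most `2 ^ S`, and `3 * S ≤ S * S` because
the input has at least four entries. -/
theorem IsInput.arcCap_bounds (h : IsInput I S z) : ∀ b ∈ Finset.Ico 0 (S : ℤ),
    0 ≤ arcCap z (posProd z S) b ∧ arcCap z (posProd z S) b < 2 ^ (S * S) := by
  have hS := h.size
  have hD := posProd_pos z S
  have hbig : (2 : ℤ) ^ S * 2 ^ S * 2 ^ S ≤ 2 ^ (S * S) := by
    rw [← pow_add, ← pow_add]
    exact pow_le_pow_right₀ (by norm_num) (by nlinarith)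
  have h2 : (0 : ℤ) < 2 ^ S := by positivity
  have bound : ∀ d x y : ℤ, 0 < d → 0 ≤ x → 0 ≤ y → x < 2 ^ S → y < 2 ^ S →
      0 ≤ posProd z S / d * x * y ∧ posProd z S / d * x * y < 2 ^ (S * S) := by
    intro d x y hd hx hy hx' hy'
    have q0 : 0 ≤ posProd z S / d := Int.ediv_nonneg hD.le hd.le
    have q1 : posProd z S / d ≤ 2 ^ S := (Int.ediv_le_self _ hD.le).trans h.prod_le
    refine ⟨by positivity, ?_⟩
    have h3 : posProd z S / d * x * y ≤ 2 ^ S * x * y := by gcongr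
    have h4 : 2 ^ S * x * y < 2 ^ S * 2 ^ S * 2 ^ S := by
      rcases hx.eq_or_lt with rfl | hx0
      · simp only [mul_zero, zero_mul]; positivity
      · calc (2 : ℤ) ^ S * x * y < 2 ^ S * x * 2 ^ S := by gcongr
          _ ≤ _ := by gcongr
    omega
  intro b hb
  rcases arc_cases I hb with ⟨e, k, hk, rfl⟩ | ⟨v, k, hk, rfl⟩ | hb'
  · obtain ⟨-, -, -, c, -, -⟩ := h.edge_arcs e (k := k) (by omega) (posProd z S) 0
    rw [c]
    split_ifs
    · exact bound _ _ _ (I.cap e).den_pos (Fraction.num_nonneg (I.cap_nonneg e))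
        (Fraction.num_nonneg I.horizon_nonneg) (by rw [← h.cap_num]; exact (h.entry_lt _).1)
        (by rw [← h.time_num]; exact (h.entry_lt _).1)
    · exact ⟨le_rfl, by positivity⟩
  · obtain ⟨-, -, -, c, -, -⟩ := h.node_arcs v (k := k) (by omega) (posProd z S) 0
    rw [c]
    split_ifs with h1 h2
    · exact bound _ _ _ (I.balance v).den_pos h2.le I.horizon.den_pos.le
        (by rw [← h.bal_num]; exact (h.entry_lt _).1) (by rw [← h.time_den]; exact (h.entry_lt _).1)
    · have := bound _ (-(I.balance v).num) I.horizon.den (I.balance v).den_pos (by omega)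
        I.horizon.den_pos.le (by rw [← h.bal_num]; exact (h.entry_lt _).2)
        (by rw [← h.time_den]; exact (h.entry_lt _).1)
      rwa [mul_neg, neg_mul] at this
    · exact ⟨le_rfl, by positivity⟩
  · rw [(h.unused_arcs hb' _ 0).2.2.2.1]
    exact ⟨le_rfl, by positivity⟩

end
end RAM

/-! ### Flows over time along paths -/

namespace DirectedNetwork

variable {V E : Type*} [Fintype V]

/-- The time at which a path with the given edges reaches its `i`-th node. -/
noncomputable def arrival (D : DirectedNetwork V E) (edge : ℕ → E) (i : ℕ) : ℝ :=
  ∑ j ∈ Finset.range i, D.transit (edge j)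

/-- The length of the time interval in which flow can be sent along a path. -/
noncomputable def duration (D : DirectedNetwork V E) (T : ℝ) (edge : ℕ → E) (L : ℕ) : ℝ :=
  max 0 (T - D.arrival edge L)

/-- The edges `edge 0, …, edge (L - 1)` form a walk through `node 0, …, node L`. -/
def IsWalk (D : DirectedNetwork V E) (edge : ℕ → E) (node : ℕ → V) (L : ℕ) : Prop :=
  ∀ i < L, D.tail (edge i) = node i ∧ D.head (edge i) = node (i + 1)

open Classical in
/-- Flow of rate `1` along a path, sent as long as it arrives before time `T`. -/
noncomputable def pathRate (D : DirectedNetwork V E) (T : ℝ) (edge : ℕ → E) (L : ℕ) (e : E) (θ : ℝ) :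
    ℝ :=
  ∑ i ∈ Finset.range L, if edge i = e then
    (Set.Ico (D.arrival edge i) (D.arrival edge i + D.duration T edge L)).indicator (fun _ => 1) θ
  else 0

end DirectedNetwork

/-- The amount of flow of rate `1` during `[p, p + W)` that has been sent by time `θ`. -/
noncomputable def sentBy (W p θ : ℝ) : ℝ := max 0 (min W (θ - p))

theorem sentBy_nonneg (W p θ : ℝ) : 0 ≤ sentBy W p θ := le_max_left _ _

theorem sentBy_le {W : ℝ} (h : 0 ≤ W) (p θ : ℝ) : sentBy W p θ ≤ W := max_le h (min_le_left _ _)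

theorem integrable_window (p q c : ℝ) :
    MeasureTheory.Integrable ((Set.Ico p q).indicator fun _ : ℝ => c) :=
  (MeasureTheory.integrable_indicator_iff measurableSet_Ico).2
    (MeasureTheory.integrableOn_const (by simp))

theorem integral_window {p : ℝ} (hp : 0 ≤ p) (W θ : ℝ) :
    ∫ ξ in (0 : ℝ)..θ, (Set.Ico p (p + W)).indicator (fun _ => (1 : ℝ)) ξ = sentBy W p θ := by
  have neg : ∀ θ ≤ p, ∫ ξ in (0 : ℝ)..θ, (Set.Ico p (p + W)).indicator (fun _ => (1 : ℝ)) ξ = 0 := by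
    intro θ hθ
    rw [intervalIntegral.integral_zero_ae]
    have : ∀ᵐ x : ℝ, x ≠ p := by simp [MeasureTheory.ae_iff, MeasureTheory.measure_singleton]
    filter_upwards [this] with x hx h
    refine Set.indicator_of_notMem (fun h' => ?_) _
    have h1 := (Set.mem_uIoc.1 h)
    have h2 := h'.1
    rcases h1 with h1 | h1
    · exact hx (le_antisymm (h1.2.trans hθ) h2)
    · exact hx (le_antisymm (h1.2.trans hp) h2)
  rcases le_or_gt θ p with h | h
  · rw [neg θ h, sentBy, max_eq_left]
    exact (min_le_right _ _).trans (by linarith)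
  · have hi : ∀ a b, IntervalIntegrable ((Set.Ico p (p + W)).indicator fun _ => (1 : ℝ))
        MeasureTheory.volume a b := fun a b => (integrable_window p (p + W) 1).intervalIntegrable
    rw [← intervalIntegral.integral_add_adjacent_intervals (hi 0 p) (hi p θ), neg p le_rfl, zero_add,
      intervalIntegral.integral_of_le h.le, ← MeasureTheory.integral_Ico_eq_integral_Ioc,
      MeasureTheory.setIntegral_indicator measurableSet_Ico, Set.Ico_inter_Ico]
    simp [sentBy]
    rw [max_comm, min_comm θ, ← min_sub_sub_right, add_sub_cancel_left]

namespace DirectedNetwork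

variable {V E : Type*} [Fintype V]

theorem arrival_nonneg (D : DirectedNetwork V E) (edge : ℕ → E) (i : ℕ) : 0 ≤ D.arrival edge i :=
  Finset.sum_nonneg fun _ _ => D.transit_nonneg _

theorem arrival_mono (D : DirectedNetwork V E) (edge : ℕ → E) {i j : ℕ} (h : i ≤ j) :
    D.arrival edge i ≤ D.arrival edge j :=
  Finset.sum_le_sum_of_subset_of_nonneg (Finset.range_mono h) fun _ _ _ => D.transit_nonneg _

theorem arrival_succ (D : DirectedNetwork V E) (edge : ℕ → E) (i : ℕ) :
    D.arrival edge (i + 1) = D.arrival edge i + D.transit (edge i) := Finset.sum_range_succ _ _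

theorem duration_nonneg (D : DirectedNetwork V E) (T : ℝ) (edge : ℕ → E) (L : ℕ) :
    0 ≤ D.duration T edge L := le_max_left _ _

theorem duration_le (D : DirectedNetwork V E) {T : ℝ} (hT : 0 ≤ T) (edge : ℕ → E) (L : ℕ) :
    D.duration T edge L ≤ T := by
  have := D.arrival_nonneg edge L
  exact max_le hT (by linarith)

open Classical in
theorem pathRate_nonneg (D : DirectedNetwork V E) (T : ℝ) (edge : ℕ → E) (L : ℕ) (e : E) (θ : ℝ) :
    0 ≤ D.pathRate T edge L e θ := by
  refine Finset.sum_nonneg fun i _ => ?_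
  split_ifs
  · exact Set.indicator_nonneg (fun _ _ => zero_le_one) _
  · exact le_rfl

open Classical in
theorem pathRate_le (D : DirectedNetwork V E) (T : ℝ) (edge : ℕ → E) (L : ℕ) (e : E) (θ : ℝ) :
    D.pathRate T edge L e θ ≤ ∑ i ∈ Finset.range L, if edge i = e then 1 else 0 := by
  refine Finset.sum_le_sum fun i _ => ?_
  split_ifs
  · exact Set.indicator_le_self' (fun _ _ => zero_le_one) _
  · exact le_rfl

/-- Flow that enters an edge of the path within its window leaves the whole path before `T`, and the
rest of the path takes nonnegative time, so it leaves this edge before `T` as well. -/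
theorem pathRate_eq_zero (D : DirectedNetwork V E) {T : ℝ} {edge : ℕ → E} {L : ℕ} {e : E}
    {θ : ℝ} (h : θ < 0 ∨ T - D.transit e ≤ θ) : D.pathRate T edge L e θ = 0 := by
  refine Finset.sum_eq_zero fun i hi => ?_
  split_ifs with he
  · refine Set.indicator_of_notMem (fun hθ => ?_) _
    obtain ⟨h1, h2⟩ := hθ
    have h3 := D.arrival_nonneg edge i
    have h4 := D.arrival_mono edge (Nat.succ_le_of_lt (Finset.mem_range.1 hi))
    rw [Nat.succ_eq_add_one, arrival_succ, he] at h4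
    simp only [duration] at h2
    rcases max_cases 0 (T - D.arrival edge L) with h5 | h5 <;> rcases h with h | h <;> linarith
  · rfl

theorem integrable_pathRate (D : DirectedNetwork V E) (T : ℝ) (edge : ℕ → E) (L : ℕ) (e : E) :
    MeasureTheory.Integrable (D.pathRate T edge L e) := by
  refine MeasureTheory.integrable_finsetSum _ fun i _ => ?_
  split_ifs
  · exact integrable_window _ _ _
  · exact MeasureTheory.integrable_zero _ _ _

open Classical in
theorem integral_pathRate (D : DirectedNetwork V E) (T : ℝ) (edge : ℕ → E) (L : ℕ) (e : E) (θ : ℝ) :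
    ∫ ξ in (0 : ℝ)..θ, D.pathRate T edge L e ξ = ∑ i ∈ Finset.range L,
      if edge i = e then sentBy (D.duration T edge L) (D.arrival edge i) θ else 0 := by
  simp only [pathRate]
  rw [intervalIntegral.integral_finsetSum]
  · refine Finset.sum_congr rfl fun i _ => ?_
    split_ifs
    · exact integral_window (D.arrival_nonneg edge i) _ θ
    · simp
  · intro i _
    split_ifs
    · exact (integrable_window _ _ _).intervalIntegrable
    · simp

variable [Fintype E]

open Classical in
-- What leaves a node along the path is what has arrived there, at the same time; the contributions
-- of the edges telescope and only the two ends of the path remain.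
theorem excess_pathRate (D : DirectedNetwork V E) (T : ℝ) {edge : ℕ → E} {node : ℕ → V} {L : ℕ}
    (h : D.IsWalk edge node L) (v : V) (θ : ℝ) :
    D.excess (D.pathRate T edge L) v θ =
      (if node L = v then sentBy (D.duration T edge L) (D.arrival edge L) θ else 0) -
      if node 0 = v then sentBy (D.duration T edge L) 0 θ else 0 := by
  simp only [excess, integral_pathRate]
  rw [Finset.sum_comm, Finset.sum_comm (s := Finset.univ.filter _), ← Finset.sum_sub_distrib]
  set g : ℕ → ℝ := fun i =>
    if node i = v then sentBy (D.duration T edge L) (D.arrival edge i) θ else 0 with hg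
  have : ∀ i ∈ Finset.range L, g (i + 1) - g i =
      (∑ e with D.head e = v, if edge i = e then
        sentBy (D.duration T edge L) (D.arrival edge i) (θ - D.transit e) else 0) -
      ∑ e with D.tail e = v, if edge i = e then
        sentBy (D.duration T edge L) (D.arrival edge i) θ else 0 := by
    intro i hi
    obtain ⟨h1, h2⟩ := h i (Finset.mem_range.1 hi)
    rw [Finset.sum_filter, Finset.sum_filter, Finset.sum_eq_single_of_mem (edge i) (Finset.mem_univ _),
      Finset.sum_eq_single_of_mem (edge i) (Finset.mem_univ _), h1, h2]
    · simp only [hg, if_true, arrival_succ, sentBy]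
      congr 2
      rw [sub_sub, add_comm (D.transit _)]
    · intro e _ he; rw [if_neg (c := edge i = e) (Ne.symm he)]; simp
    · intro e _ he; rw [if_neg (c := edge i = e) (Ne.symm he)]; simp
  rw [← Finset.sum_congr rfl this, Finset.sum_range_sub]
  simp [hg, arrival]

/-- Flow sent along several paths. -/
noncomputable def pathsRate {ι : Type*} (D : DirectedNetwork V E) (T : ℝ) (s : Finset ι)
    (edge : ι → ℕ → E) (L : ι → ℕ) (δ : ι → ℝ) (e : E) (θ : ℝ) : ℝ :=
  ∑ k ∈ s, δ k * D.pathRate T (edge k) (L k) e θ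

theorem excess_pathsRate {ι : Type*} (D : DirectedNetwork V E) (T : ℝ) (s : Finset ι)
    (edge : ι → ℕ → E) (L : ι → ℕ) (δ : ι → ℝ) (v : V) (θ : ℝ) :
    D.excess (D.pathsRate T s edge L δ) v θ =
      ∑ k ∈ s, δ k * D.excess (D.pathRate T (edge k) (L k)) v θ := by
  classical
  have : ∀ e θ, ∫ ξ in (0 : ℝ)..θ, D.pathsRate T s edge L δ e ξ =
      ∑ k ∈ s, δ k * ∫ ξ in (0 : ℝ)..θ, D.pathRate T (edge k) (L k) e ξ := by
    intro e θ
    simp only [pathsRate]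
    rw [intervalIntegral.integral_finsetSum]
    · simp only [intervalIntegral.integral_const_mul]
    · intro k _
      exact ((D.integrable_pathRate T _ _ e).const_mul _).intervalIntegrable
  simp only [excess, this, mul_sub, Finset.mul_sum, Finset.sum_sub_distrib]
  rw [Finset.sum_comm, Finset.sum_comm (s := Finset.univ.filter _)]

open Classical in
/-- Flow that is sent along paths from the sources to the sinks is a flow over time. -/
theorem isFlowOverTime_pathsRate {ι : Type*} (D : DirectedNetwork V E) {T : ℝ} (hT : 0 ≤ T)
    (s : Finset ι) (edge : ι → ℕ → E) (node : ι → ℕ → V) (L : ι → ℕ) (δ : ι → ℝ)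
    (hδ : ∀ k ∈ s, 0 ≤ δ k) (hw : ∀ k ∈ s, D.IsWalk (edge k) (node k) (L k))
    (hsource : ∀ k ∈ s, 0 < D.balance (node k 0)) (hsink : ∀ k ∈ s, D.balance (node k (L k)) < 0)
    (hcap : ∀ e, ((∑ k ∈ s, δ k * ∑ i ∈ Finset.range (L k), if edge k i = e then 1 else 0 : ℝ) : EReal)
      ≤ D.cap e)
    (hsupply : ∀ v, 0 < D.balance v → T * ∑ k ∈ s with node k 0 = v, δ k ≤ D.balance v)
    (hdemand : ∀ v, D.balance v < 0 → T * ∑ k ∈ s with node k (L k) = v, δ k ≤ -D.balance v) :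
    D.IsFlowOverTime T (D.pathsRate T s edge L δ) ∧
      D.value T (D.pathsRate T s edge L δ) = ∑ k ∈ s, δ k * D.duration T (edge k) (L k) := by
  have ex : ∀ v θ, D.excess (D.pathsRate T s edge L δ) v θ =
      (∑ k ∈ s with node k (L k) = v, δ k *
        sentBy (D.duration T (edge k) (L k)) (D.arrival (edge k) (L k)) θ) -
      ∑ k ∈ s with node k 0 = v, δ k * sentBy (D.duration T (edge k) (L k)) 0 θ := by
    intro v θ
    rw [excess_pathsRate, Finset.sum_filter, Finset.sum_filter, ← Finset.sum_sub_distrib]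
    refine Finset.sum_congr rfl fun k hk => ?_
    rw [D.excess_pathRate T (hw k hk), mul_sub]
    congr 1 <;> split_ifs <;> simp
  have noStart : ∀ v, D.balance v ≤ 0 → s.filter (fun k => node k 0 = v) = ∅ := by
    intro v hv
    refine Finset.filter_eq_empty_iff.2 fun k hk e => ?_
    have := hsource k hk; rw [e] at this; linarith
  have noEnd : ∀ v, 0 ≤ D.balance v → s.filter (fun k => node k (L k) = v) = ∅ := by
    intro v hv
    refine Finset.filter_eq_empty_iff.2 fun k hk e => ?_
    have := hsink k hk; rw [e] at this; linarith
  have bd : ∀ (t : Finset ι) (p : ι → ℝ) (θ : ℝ), t ⊆ s →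
      0 ≤ ∑ k ∈ t, δ k * sentBy (D.duration T (edge k) (L k)) (p k) θ ∧
      ∑ k ∈ t, δ k * sentBy (D.duration T (edge k) (L k)) (p k) θ ≤ T * ∑ k ∈ t, δ k := by
    intro t p θ ht
    refine ⟨Finset.sum_nonneg fun k hk => mul_nonneg (hδ k (ht hk)) (sentBy_nonneg _ _ _), ?_⟩
    rw [Finset.mul_sum]
    refine Finset.sum_le_sum fun k hk => ?_
    rw [mul_comm T]
    exact mul_le_mul_of_nonneg_left ((sentBy_le (D.duration_nonneg _ _ _) _ _).trans
      (D.duration_le hT _ _)) (hδ k (ht hk))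
  have zero : ∀ e θ, θ < 0 ∨ T - D.transit e ≤ θ → D.pathsRate T s edge L δ e θ = 0 := by
    intro e θ h
    exact Finset.sum_eq_zero fun k _ => by rw [D.pathRate_eq_zero h, mul_zero]
  refine ⟨⟨fun e => ?_, fun e θ => ?_, fun e θ h => ?_, fun e θ h => zero e θ (.inr h), fun e θ _ => ?_,
    fun v hv => ?_, fun v hv θ _ => ?_, fun v hv θ _ => ?_, fun v hv θ _ => ?_⟩, ?_⟩
  · exact MeasureTheory.integrable_finsetSum _ fun k _ => (D.integrable_pathRate T _ _ e).const_mul _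
  · exact Finset.sum_nonneg fun k hk => mul_nonneg (hδ k hk) (D.pathRate_nonneg _ _ _ _ _)
  · refine zero e θ ?_
    simp only [Set.mem_Ico, not_and, not_lt] at h
    rcases lt_or_ge θ 0 with h0 | h0
    · exact .inl h0
    · have := D.transit_nonneg e; have := h h0; exact .inr (by linarith)
  · refine le_trans ?_ (hcap e)
    exact_mod_cast Finset.sum_le_sum fun k hk =>
      mul_le_mul_of_nonneg_left (D.pathRate_le _ _ _ _ _) (hδ k hk)
  · rw [ex, noStart v hv.le, noEnd v hv.ge]; simp
  · rw [ex, noStart v hv.le, noEnd v hv.ge]; simp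
  · rw [ex, noEnd v hv.le, Finset.sum_empty, zero_sub]
    have := bd _ (fun _ => 0) θ (Finset.filter_subset (fun k => node k 0 = v) s)
    have := hsupply v hv
    constructor <;> linarith
  · rw [ex, noStart v hv.le, Finset.sum_empty, sub_zero]
    have := bd _ (fun k => D.arrival (edge k) (L k)) θ
      (Finset.filter_subset (fun k => node k (L k) = v) s)
    have := hdemand v hv
    constructor <;> linarith
  · rw [value]
    have : ∀ v ∈ Finset.univ.filter (fun v => D.balance v < 0),
        D.excess (D.pathsRate T s edge L δ) v T =
          ∑ k ∈ s with node k (L k) = v, δ k * D.duration T (edge k) (L k) := by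
      intro v hv
      rw [ex, noStart v (Finset.mem_filter.1 hv).2.le, Finset.sum_empty, sub_zero]
      refine Finset.sum_congr rfl fun k _ => ?_
      congr 1
      -- By time `T` the whole window has arrived at the last node, or the window is empty because
      -- the path takes too long.
      rw [sentBy]
      simp only [duration]
      rcases max_cases 0 (T - D.arrival (edge k) (L k)) with h | h
      · rw [h.1, max_eq_left ((min_le_left _ _))]
      · rw [h.1, min_self, h.1]
    rw [Finset.sum_congr rfl this]
    refine Finset.sum_fiberwise_of_maps_to (g := fun k => node k (L k)) (fun k hk => ?_) _
    simpa using hsink k hk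

end DirectedNetwork

/-! ### Averaging a flow over time -/

theorem ArcKind.sum_univ {M : Type*} [AddCommMonoid M] (g : ArcKind → M) :
    ∑ k, g k = g .enter₁ + g .enter₂ + g .cross + g .leave₁ + g .leave₂ := by
  have : (Finset.univ : Finset ArcKind) = {.enter₁, .enter₂, .cross, .leave₁, .leave₂} := rfl
  rw [this]
  simp [add_assoc]

namespace DirectedNetwork.IsFlowOverTime

variable {V E : Type*} [Fintype V] [Fintype E] {D : DirectedNetwork V E} {T : ℝ} {f : E → ℝ → ℝ}

theorem integral_late (h : D.IsFlowOverTime T f) (e : E) {θ : ℝ} (hθ : T - D.transit e ≤ θ) :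
    ∫ ξ in (0 : ℝ)..θ, f e ξ = ∫ ξ in (0 : ℝ)..T, f e ξ := by
  have hi : ∀ a b, IntervalIntegrable (f e) MeasureTheory.volume a b :=
    fun a b => (h.integrable e).intervalIntegrable
  have h0 : ∫ ξ in T..θ, f e ξ = 0 := by
    rw [intervalIntegral.integral_zero_ae]
    refine Filter.Eventually.of_forall fun x hx => h.zero_late e x ?_
    have h0 := D.transit_nonneg e
    rcases Set.mem_uIoc.1 hx with hx | hx <;> linarith
  rw [← intervalIntegral.integral_add_adjacent_intervals (hi 0 T) (hi T θ), h0, add_zero]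

theorem integral_early (h : D.IsFlowOverTime T f) (e : E) {θ : ℝ} (hθ : θ ≤ 0) :
    ∫ ξ in (0 : ℝ)..θ, f e ξ = 0 := by
  rw [intervalIntegral.integral_zero_ae]
  have : ∀ᵐ x : ℝ, x ≠ 0 := by simp [MeasureTheory.ae_iff, MeasureTheory.measure_singleton]
  filter_upwards [this] with x hx hx'
  refine h.zero_outside e x fun h' => ?_
  rcases Set.mem_uIoc.1 hx' with h1 | h1
  · linarith [h1.1, h1.2]
  · exact hx (le_antisymm h1.2 h'.1)

theorem continuous_integral (h : D.IsFlowOverTime T f) (e : E) :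
    Continuous fun θ => ∫ ξ in (0 : ℝ)..θ, f e ξ :=
  intervalIntegral.continuous_primitive (fun _ _ => (h.integrable e).intervalIntegrable) 0

theorem continuous_excess (h : D.IsFlowOverTime T f) (v : V) : Continuous (D.excess f v) := by
  unfold DirectedNetwork.excess
  refine .sub (continuous_finsetSum _ fun e _ => ?_) (continuous_finsetSum _ fun e _ => ?_)
  · exact (h.continuous_integral e).comp (continuous_id.sub continuous_const)
  · exact h.continuous_integral e

theorem integral_nonneg (h : D.IsFlowOverTime T f) (hT : 0 ≤ T) (e : E) :
    0 ≤ ∫ ξ in (0 : ℝ)..T, f e ξ :=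
  intervalIntegral.integral_nonneg hT fun x _ => h.nonneg e x

open Classical in
theorem excess_horizon (h : D.IsFlowOverTime T f) (v : V) :
    D.excess f v T = (∑ e with D.head e = v, ∫ ξ in (0 : ℝ)..T, f e ξ) -
        ∑ e with D.tail e = v, ∫ ξ in (0 : ℝ)..T, f e ξ := by
  rw [DirectedNetwork.excess]
  congr 1
  exact Finset.sum_congr rfl fun e _ => h.integral_late e le_rfl

/-- The constraints hold before time `T` only. Continuity of the excess extends them to `T`, except
for `T = 0`, where the excess is zero anyway. -/
theorem excess_horizon_mem (h : D.IsFlowOverTime T f) (hT : 0 ≤ T) {v : V} {a b : ℝ} (ha : a ≤ 0)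
    (hb : 0 ≤ b) (hmem : ∀ θ ∈ Set.Ico 0 T, a ≤ D.excess f v θ ∧ D.excess f v θ ≤ b) :
    a ≤ D.excess f v T ∧ D.excess f v T ≤ b := by
  rcases hT.eq_or_lt with rfl | hT
  · have : D.excess f v 0 = 0 := by
      rw [DirectedNetwork.excess]
      rw [Finset.sum_eq_zero, Finset.sum_eq_zero, sub_zero]
      · intro e _; simp
      · intro e _; exact h.integral_early e (by have := D.transit_nonneg e; linarith)
    rw [this]; exact ⟨ha, hb⟩
  · have ht : Filter.Tendsto (D.excess f v) (nhdsWithin T (Set.Iio T)) (nhds (D.excess f v T)) :=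
      (h.continuous_excess v).continuousAt.mono_left nhdsWithin_le_nhds
    have hev : ∀ᶠ θ in nhdsWithin T (Set.Iio T), θ ∈ Set.Ico 0 T :=
      Filter.mem_of_superset (Ioo_mem_nhdsLT hT) Set.Ioo_subset_Ico_self
    exact ⟨ge_of_tendsto ht (hev.mono fun θ hθ => (hmem θ hθ).1),
      le_of_tendsto ht (hev.mono fun θ hθ => (hmem θ hθ).2)⟩

/-- What has left its tail but not yet reached its head is in transit; the total excess is minus
that amount. -/
theorem sum_excess (f : E → ℝ → ℝ) (θ : ℝ) : ∑ v, D.excess f v θ =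
    ∑ e, ((∫ ξ in (0 : ℝ)..(θ - D.transit e), f e ξ) - ∫ ξ in (0 : ℝ)..θ, f e ξ) := by
  simp only [DirectedNetwork.excess, Finset.sum_sub_distrib]
  classical
  congr 1
  · exact Finset.sum_fiberwise _ D.head _
  · exact Finset.sum_fiberwise _ D.tail _

theorem neg_supply_le_excess (h : D.IsFlowOverTime T f) {θ : ℝ} (hθ : θ ∈ Set.Ico 0 T) (v : V) :
    -max 0 (D.balance v) ≤ D.excess f v θ := by
  rcases lt_trichotomy (D.balance v) 0 with hv | hv | hv
  · rw [max_eq_left hv.le, neg_zero]; exact (h.excess_sink v hv θ hθ).1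
  · rw [max_eq_left hv.le, neg_zero]; exact h.excess_inner v hv θ hθ
  · rw [max_eq_right hv.le]; exact (h.excess_source v hv θ hθ).2

/-- The average amount of flow on the edges is at most the total supply. -/
theorem sum_transit_mul_le (h : D.IsFlowOverTime T f) (hT : 0 ≤ T) :
    ∑ e, D.transit e * ∫ ξ in (0 : ℝ)..T, f e ξ ≤ (∑ v, max 0 (D.balance v)) * T := by
  set F : E → ℝ → ℝ := fun e θ => ∫ ξ in (0 : ℝ)..θ, f e ξ with hF
  have hc : ∀ e, Continuous (F e) := h.continuous_integral
  have hi : ∀ e a b, IntervalIntegrable (F e) MeasureTheory.volume a b :=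
    fun e a b => (hc e).intervalIntegrable a b
  have hc' : ∀ e, Continuous fun θ => F e (θ - D.transit e) :=
    fun e => (hc e).comp (continuous_id.sub continuous_const)
  -- The integrand is the amount of flow inside `e`. After shifting the second term, only the
  -- integrals of `F e` over two intervals of length `τ_e` remain: near `T` it has its final value,
  -- before `0` it vanishes.
  have key : ∀ e, ∫ θ in (0 : ℝ)..T, (F e θ - F e (θ - D.transit e)) =
      D.transit e * ∫ ξ in (0 : ℝ)..T, f e ξ := by
    intro e
    rw [intervalIntegral.integral_sub (hi e 0 T) ((hc' e).intervalIntegrable 0 T),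
      intervalIntegral.integral_comp_sub_right (fun x => F e x)]
    have e1 : ∫ θ in (T - D.transit e)..T, F e θ = D.transit e * ∫ ξ in (0 : ℝ)..T, f e ξ := by
      have : ∀ θ ∈ Set.uIcc (T - D.transit e) T, F e θ = ∫ ξ in (0 : ℝ)..T, f e ξ := by
        intro θ hθ
        rw [Set.uIcc_of_le (by have := D.transit_nonneg e; linarith)] at hθ
        exact h.integral_late e hθ.1
      rw [intervalIntegral.integral_congr this]
      simp
    have e2 : ∫ θ in (0 - D.transit e)..0, F e θ = 0 := by
      have : ∀ θ ∈ Set.uIcc (0 - D.transit e) 0, F e θ = 0 := by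
        intro θ hθ
        rw [Set.uIcc_of_le (by have := D.transit_nonneg e; linarith)] at hθ
        exact h.integral_early e hθ.2
      rw [intervalIntegral.integral_congr this]
      simp
    have s1 := intervalIntegral.integral_add_adjacent_intervals (hi e (0 - D.transit e) 0)
      (hi e 0 T)
    have s2 := intervalIntegral.integral_add_adjacent_intervals (hi e (0 - D.transit e) (T - D.transit e))
      (hi e (T - D.transit e) T)
    linarith
  simp only [← key]
  rw [← intervalIntegral.integral_finsetSum]
  · have hb : ∫ θ in (0 : ℝ)..T, ∑ e, (F e θ - F e (θ - D.transit e)) ≤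
        ∫ _ in (0 : ℝ)..T, ∑ v, max 0 (D.balance v) := by
      refine intervalIntegral.integral_mono_on_of_le_Ioo hT ?_ ?_ ?_
      · exact (continuous_finsetSum _ fun e _ => (hc e).sub (hc' e)).intervalIntegrable 0 T
      · exact intervalIntegrable_const
      · intro θ hθ
        have hθ' : θ ∈ Set.Ico 0 T := ⟨hθ.1.le, hθ.2⟩
        have h1 := sum_excess (D := D) f θ
        have h2 : ∑ v, -max 0 (D.balance v) ≤ ∑ v, D.excess f v θ :=
          Finset.sum_le_sum fun v _ => h.neg_supply_le_excess hθ' v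
        have h3 : ∑ e, (F e θ - F e (θ - D.transit e)) = -∑ v, D.excess f v θ := by
          rw [h1, ← Finset.sum_neg_distrib]
          exact Finset.sum_congr rfl fun e _ => by rw [neg_sub]
        rw [h3]
        rw [Finset.sum_neg_distrib] at h2
        linarith
    refine hb.trans (le_of_eq ?_)
    rw [intervalIntegral.integral_const, sub_zero, smul_eq_mul, mul_comm]
  · intro e _
    exact ((hc e).sub (hc' e)).intervalIntegrable 0 T

/-- If the value is the total supply, then all supplies and demands are satisfied. -/
theorem excess_horizon_eq (h : D.IsFlowOverTime T f) (hT : 0 ≤ T)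
    (hval : D.value T f = ∑ v, max 0 (D.balance v)) (v : V) : D.excess f v T = -D.balance v := by
  have hlow : ∀ v, 0 ≤ D.balance v → -D.balance v ≤ D.excess f v T := by
    intro v hv
    rcases hv.eq_or_lt with hv | hv
    · rw [h.excess_inner_final v hv.symm, ← hv, neg_zero]
    · exact (h.excess_horizon_mem hT (a := -D.balance v) (b := 0) (by linarith) le_rfl
        fun θ hθ => ⟨(h.excess_source v hv θ hθ).2, (h.excess_source v hv θ hθ).1⟩).1
  have hup : ∀ v, D.balance v < 0 → D.excess f v T ≤ -D.balance v := by
    intro v hv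
    exact (h.excess_horizon_mem hT (a := 0) (b := -D.balance v) le_rfl (by linarith)
      fun θ hθ => h.excess_sink v hv θ hθ).2
  have hsum : ∑ v, D.excess f v T = 0 := by
    rw [sum_excess]
    exact Finset.sum_eq_zero fun e _ => by rw [h.integral_late e le_rfl, sub_self]
  have hbal := D.balance_sum
  have hsplit : ∀ g : V → ℝ, ∑ v, g v = ∑ v with D.balance v < 0, g v +
      ∑ v with ¬ D.balance v < 0, g v :=
    fun g => (Finset.sum_filter_add_sum_filter_not _ _ _).symm
  have hB : ∑ v, max 0 (D.balance v) = ∑ v with ¬ D.balance v < 0, D.balance v := by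
    rw [hsplit, Finset.sum_eq_zero, zero_add]
    · exact Finset.sum_congr rfl fun v hv => max_eq_right (not_lt.1 (Finset.mem_filter.1 hv).2)
    · intro v hv; exact max_eq_left (Finset.mem_filter.1 hv).2.le
  rw [hB, DirectedNetwork.value] at hval
  rw [hsplit] at hsum hbal
  -- The value attains its upper bound, so nonnegative slacks add up to zero and each of them
  -- vanishes.
  have e1 : ∑ v with D.balance v < 0, (-D.balance v - D.excess f v T) = 0 := by
    rw [Finset.sum_sub_distrib, Finset.sum_neg_distrib]; linarith
  have e2 : ∑ v with ¬ D.balance v < 0, (D.excess f v T + D.balance v) = 0 := by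
    rw [Finset.sum_add_distrib]; linarith
  by_cases hv : D.balance v < 0
  · have := (Finset.sum_eq_zero_iff_of_nonneg fun v hv => by
      have := hup v (Finset.mem_filter.1 hv).2; linarith).1 e1 v (by simpa using hv)
    linarith
  · have := (Finset.sum_eq_zero_iff_of_nonneg fun v hv => by
      have := hlow v (not_lt.1 (Finset.mem_filter.1 hv).2); linarith).1 e2 v (by simpa using hv)
    linarith

end DirectedNetwork.IsFlowOverTime

namespace UndirectedNetwork

variable {V E : Type*} [Fintype V]

theorem supply_eq_sum_max (N : UndirectedNetwork V E) :
    N.supply = ∑ v, max 0 (N.balance v) := by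
  rw [supply, Finset.sum_filter]
  refine Finset.sum_congr rfl fun v _ => ?_
  split_ifs with h
  · exact (max_eq_right h.le).symm
  · exact (max_eq_left (not_lt.1 h)).symm

variable [Fintype E]

open Classical in
/-- The amounts of flow on the edges form a static flow that satisfies all supplies and demands. -/
theorem SupplySendable.exists_static {N : UndirectedNetwork V E} {T : ℝ} (hT : 0 ≤ T)
    (h : N.SupplySendable T) : ∃ g : E → ℝ, (∀ e, |g e| ≤ N.cap e * T) ∧
      ∑ e, N.transit e * |g e| ≤ N.supply * T ∧
      ∀ v, (∑ e with N.end₁ e = v, g e) - ∑ e with N.end₂ e = v, g e = N.balance v := by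
  obtain ⟨f, hf, hval⟩ := h
  have hB : ∑ v, max 0 (N.expand.balance v) = N.supply := by
    rw [supply_eq_sum_max, Fintype.sum_sum_type]
    simp [expand]
  set X : E × ArcKind → ℝ := fun a => ∫ ξ in (0 : ℝ)..T, f a ξ with hX
  have X0 : ∀ a, 0 ≤ X a := hf.integral_nonneg hT
  have ex : ∀ v, ∑ a, ((if N.expand.head a = v then X a else 0) -
      (if N.expand.tail a = v then X a else 0)) = -N.expand.balance v := by
    intro v
    rw [← hf.excess_horizon_eq hT (hval.trans hB.symm) v, hf.excess_horizon, Finset.sum_sub_distrib,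
      Finset.sum_filter, Finset.sum_filter]
    congr 1 <;> exact Finset.sum_congr rfl fun a _ => by congr
  have ex1 : ∀ e, X (e, .enter₁) + X (e, .enter₂) = X (e, .cross) := by
    intro e
    have := ex (.inr (.inl e))
    rw [Fintype.sum_prod_type, Finset.sum_eq_single_of_mem e (Finset.mem_univ _)] at this
    · simp [ArcKind.sum_univ, expand] at this; linarith
    · intro e' _ he; simp [ArcKind.sum_univ, expand, he]
  have ex2 : ∀ e, X (e, .cross) = X (e, .leave₁) + X (e, .leave₂) := by
    intro e
    have := ex (.inr (.inr e))
    rw [Fintype.sum_prod_type, Finset.sum_eq_single_of_mem e (Finset.mem_univ _)] at this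
    · simp [ArcKind.sum_univ, expand] at this; linarith
    · intro e' _ he; simp [ArcKind.sum_univ, expand, he]
  -- Both amounts are nonnegative and at most the amount that crosses, by conservation at the two
  -- new nodes.
  have hg : ∀ e, |X (e, .enter₁) - X (e, .leave₁)| ≤ X (e, .cross) := by
    intro e
    have := ex1 e; have := ex2 e
    have := X0 (e, .enter₁); have := X0 (e, .enter₂); have := X0 (e, .leave₁)
    have := X0 (e, .leave₂)
    rw [abs_le]; constructor <;> linarith
  -- The net amount sent from the first end point: flow that returns to the end point where it
  -- entered cancels, and so do opposite directions.
  refine ⟨fun e => X (e, .enter₁) - X (e, .leave₁), fun e => (hg e).trans ?_, ?_, fun v => ?_⟩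
  · have hle : ∫ ξ in (0 : ℝ)..T, f (e, .cross) ξ ≤ ∫ _ in (0 : ℝ)..T, N.cap e := by
      refine intervalIntegral.integral_mono_on_of_le_Ioo hT (hf.integrable _).intervalIntegrable
        intervalIntegrable_const fun θ hθ => ?_
      have := hf.capacity (e, .cross) θ ⟨hθ.1.le, hθ.2⟩
      exact EReal.coe_le_coe_iff.1 this
    rw [intervalIntegral.integral_const, sub_zero, smul_eq_mul] at hle
    linarith
  · have := hf.sum_transit_mul_le hT
    rw [hB, Fintype.sum_prod_type] at this
    refine le_trans (Finset.sum_le_sum fun e _ => ?_) this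
    rw [ArcKind.sum_univ]
    simp only [expand, zero_mul, zero_add, add_zero]
    exact mul_le_mul_of_nonneg_left (hg e) (N.transit_nonneg e)
  · have := ex (.inl v)
    rw [Fintype.sum_prod_type] at this
    simp only [ArcKind.sum_univ, expand, Sum.inl.injEq, reduceCtorEq, if_false, sub_zero, zero_sub,
      Sum.elim_inl] at this
    rw [Finset.sum_filter, Finset.sum_filter, ← Finset.sum_sub_distrib, ← neg_inj, ← this,
      ← Finset.sum_neg_distrib]
    refine Finset.sum_congr rfl fun e _ => ?_
    have := ex1 e; have := ex2 e
    split_ifs <;> linarith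

/-- For `T = 0` the bound `u_e T` forces the static flow to vanish, and the balances with it. This
settles the case in which rates `δ / (2T)` make no sense. -/
theorem SupplySendable.supply_eq_zero {N : UndirectedNetwork V E} (h : N.SupplySendable 0) :
    N.supply = 0 := by
  obtain ⟨g, hcap, -, hbal⟩ := h.exists_static le_rfl
  have hg0 : ∀ e, g e = 0 := fun e => abs_nonpos_iff.1 (by simpa using hcap e)
  rw [supply_eq_sum_max]
  refine Finset.sum_eq_zero fun v _ => ?_
  rw [← hbal v]; simp [hg0]

end UndirectedNetwork

/-! ### Path decomposition of static flows -/

section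

variable {V E : Type*} {tail head : E → V}

theorem exists_walk_of_reflTransGen [Nonempty E] {P : E → Prop} {u w : V}
    (h : Relation.ReflTransGen (fun a b => ∃ e, P e ∧ tail e = a ∧ head e = b) u w) :
    ∃ (L : ℕ) (edge : ℕ → E) (node : ℕ → V), node 0 = u ∧ node L = w ∧
      ∀ i < L, P (edge i) ∧ tail (edge i) = node i ∧ head (edge i) = node (i + 1) := by
  induction h with
  | refl => exact ⟨0, fun _ => Classical.arbitrary E, fun _ => u, rfl, rfl, fun i hi => by omega⟩
  | @tail a b _ hab ih =>
    obtain ⟨L, edge, node, h0, hL, hs⟩ := ih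
    obtain ⟨e, he, he1, he2⟩ := hab
    refine ⟨L + 1, fun i => if i < L then edge i else e, fun i => if i ≤ L then node i else b,
      by simpa using h0, by simp, fun i hi => ?_⟩
    by_cases hiL : i < L
    · have : i ≤ L := hiL.le
      simpa [hiL, this, Nat.succ_le_of_lt hiL] using hs i hiL
    · obtain rfl : i = L := by omega
      simp [he, he1, he2, hL]

open Classical in
/-- How often a walk uses an edge. -/
noncomputable def walkCount (edge : ℕ → E) (L : ℕ) (e : E) : ℝ :=
  ∑ i ∈ Finset.range L, if edge i = e then 1 else 0

theorem walkCount_pos {edge : ℕ → E} {L i : ℕ} (hi : i < L) : 0 < walkCount edge L (edge i) :=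
  Finset.sum_pos' (fun _ _ => by split_ifs <;> norm_num) ⟨i, Finset.mem_range.2 hi, by simp⟩

theorem exists_of_walkCount_ne_zero {edge : ℕ → E} {L : ℕ} {e : E} (h : walkCount edge L e ≠ 0) :
    ∃ i < L, edge i = e := by
  obtain ⟨i, hi, h⟩ := Finset.exists_ne_zero_of_sum_ne_zero h
  refine ⟨i, Finset.mem_range.1 hi, ?_⟩
  by_contra hne
  simp [hne] at h

theorem sum_mul_walkCount [Fintype E] (c : E → ℝ) (edge : ℕ → E) (L : ℕ) :
    ∑ e, c e * walkCount edge L e = ∑ i ∈ Finset.range L, c (edge i) := by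
  simp only [walkCount, Finset.mul_sum]
  rw [Finset.sum_comm]
  refine Finset.sum_congr rfl fun i _ => ?_
  rw [Finset.sum_eq_single_of_mem (edge i) (Finset.mem_univ _)]
  · simp
  · intro e _ he; simp [Ne.symm he]

open Classical in
theorem walkCount_net [Fintype E] {edge : ℕ → E} {node : ℕ → V} {L : ℕ}
    (h : ∀ i < L, tail (edge i) = node i ∧ head (edge i) = node (i + 1)) (v : V) :
    (∑ e with tail e = v, walkCount edge L e) - ∑ e with head e = v, walkCount edge L e =
      (if node 0 = v then 1 else 0) - if node L = v then 1 else 0 := by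
  have e1 := sum_mul_walkCount (fun e => (if tail e = v then (1 : ℝ) else 0)) edge L
  have e2 := sum_mul_walkCount (fun e => (if head e = v then (1 : ℝ) else 0)) edge L
  simp only [ite_mul, one_mul, zero_mul] at e1 e2
  rw [Finset.sum_filter, Finset.sum_filter, e1, e2, ← Finset.sum_sub_distrib]
  refine (Finset.sum_congr rfl fun i hi => ?_).trans
    (Finset.sum_range_sub' (fun i => if node i = v then (1 : ℝ) else 0) L)
  obtain ⟨h1, h2⟩ := h i (Finset.mem_range.1 hi)
  rw [h1, h2]

open Classical in
/-- From a node with positive supply a node with demand can be reached along edges with flow. -/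
theorem exists_reachable_sink [Fintype V] [Fintype E] {x : E → ℝ} {b : V → ℝ} (hx : ∀ e, 0 ≤ x e)
    (hb : ∀ v, (∑ e with tail e = v, x e) - ∑ e with head e = v, x e = b v) {u : V} (hu : 0 < b u) :
    ∃ w, b w < 0 ∧
      Relation.ReflTransGen (fun a c => ∃ e, 0 < x e ∧ tail e = a ∧ head e = c) u w := by
  by_contra! hno
  set r := fun a c => ∃ e, 0 < x e ∧ tail e = a ∧ head e = c
  -- If no demand is reachable, the reachable set has positive total balance, although no flow
  -- leaves it.
  set R : Finset V := Finset.univ.filter fun w => Relation.ReflTransGen r u w with hR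
  have mem : ∀ w, w ∈ R ↔ Relation.ReflTransGen r u w := by simp [hR]
  have pos : 0 < ∑ v ∈ R, b v := by
    refine Finset.sum_pos' (fun w hw => ?_) ⟨u, (mem u).2 .refl, hu⟩
    exact not_lt.1 fun h => hno w h ((mem w).1 hw)
  have e1 : ∑ v ∈ R, b v = ∑ e, ((if tail e ∈ R then x e else 0) - if head e ∈ R then x e else 0) := by
    rw [Finset.sum_congr rfl fun v _ => (hb v).symm, Finset.sum_sub_distrib, Finset.sum_sub_distrib]
    have aux : ∀ t : E → V, ∑ v ∈ R, ∑ e with t e = v, x e = ∑ e, if t e ∈ R then x e else 0 := by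
      intro t
      simp only [Finset.sum_filter]
      rw [Finset.sum_comm]
      exact Finset.sum_congr rfl fun e _ => by simp
    rw [aux, aux]
  have : ∑ v ∈ R, b v ≤ 0 := by
    rw [e1]
    refine Finset.sum_nonpos fun e _ => ?_
    by_cases h1 : tail e ∈ R
    · rcases (hx e).eq_or_lt with h | h
      · simp [← h]
      · have : head e ∈ R := (mem _).2 (((mem _).1 h1).tail ⟨e, h, rfl, rfl⟩)
        simp [h1, this]
    · have := hx e
      rw [if_neg h1]; split_ifs <;> linarith
  linarith

open Classical in
/-- A static flow contains paths that satisfy all supplies and demands. -/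
theorem exists_paths [Fintype V] [Fintype E] : ∀ (n : ℕ) (x : E → ℝ) (b : V → ℝ), (∀ e, 0 ≤ x e) →
    (∀ v, (∑ e with tail e = v, x e) - ∑ e with head e = v, x e = b v) →
    (Finset.univ.filter fun e => x e ≠ 0).card + (Finset.univ.filter fun v => b v ≠ 0).card ≤ n →
    ∃ (ι : Type) (_ : Fintype ι) (edge : ι → ℕ → E) (node : ι → ℕ → V) (L : ι → ℕ) (δ : ι → ℝ),
      (∀ k, 0 < δ k) ∧
      (∀ k, ∀ i < L k, tail (edge k i) = node k i ∧ head (edge k i) = node k (i + 1)) ∧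
      (∀ e, ∑ k, δ k * walkCount (edge k) (L k) e ≤ x e) ∧
      (∀ v, ∑ k, (if node k 0 = v then δ k else 0) = max 0 (b v)) ∧
      ∀ v, ∑ k, (if node k (L k) = v then δ k else 0) = max 0 (-b v) := by
  intro n
  induction n with
  | zero =>
    intro x b hx hb hn
    have : ∀ v, b v = 0 := by
      intro v
      by_contra hv
      have : 0 < (Finset.univ.filter fun v => b v ≠ 0).card :=
        Finset.card_pos.2 ⟨v, by simpa using hv⟩
      omega
    exact ⟨Empty, inferInstance, fun k => k.elim, fun k => k.elim, fun k => k.elim, fun k => k.elim,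
      fun k => k.elim, fun k => k.elim, fun e => by simpa using hx e, fun v => by simp [this],
      fun v => by simp [this]⟩
  | succ n ih =>
    intro x b hx hb hn
    by_cases hzero : ∀ v, b v = 0
    · exact ⟨Empty, inferInstance, fun k => k.elim, fun k => k.elim, fun k => k.elim,
        fun k => k.elim, fun k => k.elim, fun k => k.elim, fun e => by simpa using hx e,
        fun v => by simp [hzero], fun v => by simp [hzero]⟩
    have hsum : ∑ v, b v = 0 := by
      rw [Finset.sum_congr rfl fun v _ => (hb v).symm, Finset.sum_sub_distrib, sub_eq_zero]
      exact (Finset.sum_fiberwise _ tail _).trans (Finset.sum_fiberwise _ head _).symm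
    push Not at hzero
    obtain ⟨v₀, hv₀⟩ := hzero
    obtain ⟨u, -, hu⟩ := Finset.exists_pos_of_sum_zero_of_exists_nonzero b hsum
      ⟨v₀, Finset.mem_univ _, hv₀⟩
    obtain ⟨w, hw, hreach⟩ := exists_reachable_sink hx hb hu
    have hE : Nonempty E := by
      by_contra hE
      rw [not_nonempty_iff] at hE
      have := hb u
      simp at this
      linarith
    obtain ⟨L, edge, node, h0, hL, hs⟩ := exists_walk_of_reflTransGen hreach
    have hLpos : 0 < L := by
      rcases Nat.eq_zero_or_pos L with rfl | h
      · rw [h0] at hL; rw [hL] at hu; linarith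
      · exact h
    have huw : u ≠ w := by rintro rfl; linarith
    -- The walk may use an edge several times, so the bottleneck is the flow divided by the
    -- multiplicity.
    obtain ⟨i₀, hi₀, hmin⟩ := Finset.exists_min_image (Finset.range L)
      (fun i => x (edge i) / walkCount edge L (edge i)) ⟨0, Finset.mem_range.2 hLpos⟩
    have hi₀ := Finset.mem_range.1 hi₀
    set d := min (min (b u) (-b w)) (x (edge i₀) / walkCount edge L (edge i₀)) with hd
    have d1 : d ≤ b u := (min_le_left _ _).trans (min_le_left _ _)
    have d2 : d ≤ -b w := (min_le_left _ _).trans (min_le_right _ _)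
    have d3 : ∀ i < L, d * walkCount edge L (edge i) ≤ x (edge i) := by
      intro i hi
      rw [← le_div_iff₀ (walkCount_pos hi)]
      exact (min_le_right _ _).trans (hmin i (Finset.mem_range.2 hi))
    have d0 : 0 < d := lt_min (lt_min hu (by linarith))
      (div_pos (hs i₀ hi₀).1 (walkCount_pos hi₀))
    set x' : E → ℝ := fun e => x e - d * walkCount edge L e with hx'
    set b' : V → ℝ := fun v => b v - d * ((if u = v then 1 else 0) - if w = v then 1 else 0) with hb'
    have xz : ∀ e, x e = 0 → x' e = 0 := by
      intro e he
      have : walkCount edge L e = 0 := by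
        by_contra hne
        obtain ⟨i, hi, rfl⟩ := exists_of_walkCount_ne_zero hne
        have := (hs i hi).1; linarith
      simp [hx', he, this]
    have bz : ∀ v, b v = 0 → b' v = 0 := by
      intro v hv
      have h1 : u ≠ v := by rintro rfl; linarith
      have h2 : w ≠ v := by rintro rfl; linarith
      simp [hb', hv, h1, h2]
    have subx : (Finset.univ.filter fun e => x' e ≠ 0) ⊆ Finset.univ.filter fun e => x e ≠ 0 := by
      intro e he
      simp only [Finset.mem_filter, Finset.mem_univ, true_and] at he ⊢
      exact fun h => he (xz e h)
    have subb : (Finset.univ.filter fun v => b' v ≠ 0) ⊆ Finset.univ.filter fun v => b v ≠ 0 := by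
      intro e he
      simp only [Finset.mem_filter, Finset.mem_univ, true_and] at he ⊢
      exact fun h => he (bz e h)
    have bu : b' u = b u - d := by simp [hb', huw.symm]
    have bw : b' w = b w + d := by simp [hb', huw]
    -- The amount `d` attains one of its three bounds, so it settles the source, settles the sink,
    -- or exhausts an edge, while no zero becomes nonzero.
    have hcard : (Finset.univ.filter fun e => x' e ≠ 0).card +
        (Finset.univ.filter fun v => b' v ≠ 0).card ≤ n := by
      have c1 := Finset.card_le_card subx
      have c2 := Finset.card_le_card subb
      rcases min_choice (min (b u) (-b w)) (x (edge i₀) / walkCount edge L (edge i₀)) with h | h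
      · have : (Finset.univ.filter fun v => b' v ≠ 0).card <
            (Finset.univ.filter fun v => b v ≠ 0).card := by
          rcases min_choice (b u) (-b w) with h' | h'
          · refine Finset.card_lt_card ⟨subb, fun hc => ?_⟩
            have := hc (show u ∈ _ by simpa using hu.ne')
            simp only [Finset.mem_filter, Finset.mem_univ, true_and] at this
            exact this (by rw [bu, hd, h, h', sub_self])
          · refine Finset.card_lt_card ⟨subb, fun hc => ?_⟩
            have := hc (show w ∈ _ by simpa using hw.ne)
            simp only [Finset.mem_filter, Finset.mem_univ, true_and] at this
            exact this (by rw [bw, hd, h, h', add_neg_cancel])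
        omega
      · have : (Finset.univ.filter fun e => x' e ≠ 0).card <
            (Finset.univ.filter fun e => x e ≠ 0).card := by
          refine Finset.card_lt_card ⟨subx, fun hc => ?_⟩
          have := hc (show edge i₀ ∈ _ by simpa using (hs i₀ hi₀).1.ne')
          simp only [Finset.mem_filter, Finset.mem_univ, true_and] at this
          refine this ?_
          have := walkCount_pos (edge := edge) hi₀
          simp only [hx', hd, h]
          field_simp
          ring
        omega
    have hx'0 : ∀ e, 0 ≤ x' e := by
      intro e
      by_cases hc : walkCount edge L e = 0
      · simpa [hx', hc] using hx e
      · obtain ⟨i, hi, rfl⟩ := exists_of_walkCount_ne_zero hc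
        have := d3 i hi
        simp only [hx']; linarith
    have hb'0 : ∀ v, (∑ e with tail e = v, x' e) - ∑ e with head e = v, x' e = b' v := by
      intro v
      have := walkCount_net (fun i hi => (hs i hi).2) v
      rw [h0, hL] at this
      simp only [hx', hb', Finset.sum_sub_distrib, ← Finset.mul_sum, ← hb v, ← this]
      ring
    obtain ⟨ι, hι, edge', node', L', δ', p1, p2, p3, p4, p5⟩ := ih x' b' hx'0 hb'0 hcard
    refine ⟨Option ι, inferInstance, fun k => k.elim edge edge', fun k => k.elim node node',
      fun k => k.elim L L', fun k => k.elim d δ', ?_, ?_, fun e => ?_, fun v => ?_, fun v => ?_⟩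
    · rintro (_ | k)
      · exact d0
      · exact p1 k
    · rintro (_ | k)
      · exact fun i hi => (hs i hi).2
      · exact p2 k
    · have := p3 e
      simp only [Fintype.sum_option, Option.elim, hx'] at this ⊢
      linarith
    · rw [Fintype.sum_option]
      change (if node 0 = v then d else 0) + ∑ k, (if node' k 0 = v then δ' k else 0) = _
      rw [p4, h0]
      by_cases e1 : u = v
      · subst e1
        rw [if_pos rfl, bu, max_eq_right (by linarith), max_eq_right hu.le]; ring
      · rw [if_neg e1, zero_add]
        by_cases e2 : w = v
        · subst e2
          rw [bw, max_eq_left (by linarith), max_eq_left hw.le]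
        · simp [hb', e1, e2]
    · rw [Fintype.sum_option]
      change (if node L = v then d else 0) + ∑ k, (if node' k (L' k) = v then δ' k else 0) = _
      rw [p5, hL]
      by_cases e1 : w = v
      · subst e1
        rw [if_pos rfl, bw, max_eq_right (by linarith), max_eq_right (by linarith)]; ring
      · rw [if_neg e1, zero_add]
        by_cases e2 : u = v
        · subst e2
          rw [bu, max_eq_left (by linarith), max_eq_left (by linarith)]
        · simp [hb', e1, e2]

end

/-! ### Existence of the orientation and the flow over time -/

namespace UndirectedNetwork

variable {V E : Type*} [Fintype V] [Fintype E]

/-- The paths carry `B` units with average transit time at most `T`. Sent at constant rate with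
horizon `2T`, a path loses the fraction `τ(P) / (2T)` of its amount, which is one half on average at
most. -/
theorem exists_sendsHalfInDouble (N : UndirectedNetwork V E) {T : ℝ} (hT : 0 ≤ T)
    (h : N.SupplySendable T) : ∃ (o : E → Bool) (f : E → ℝ → ℝ), N.SendsHalfInDouble T o f := by
  classical
  obtain ⟨g, hcap, htime, hbal⟩ := h.exists_static hT
  set o : E → Bool := fun e => decide (0 ≤ g e) with ho
  have hnet : ∀ v, (∑ e with (N.orient o).tail e = v, |g e|) -
      ∑ e with (N.orient o).head e = v, |g e| = N.balance v := by
    intro v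
    rw [← hbal v]
    simp only [Finset.sum_filter, ← Finset.sum_sub_distrib]
    refine Finset.sum_congr rfl fun e _ => ?_
    by_cases hg : 0 ≤ g e
    · simp [orient, ho, hg, abs_of_nonneg hg]
    · simp only [orient, ho, hg, decide_false, Bool.false_eq_true, if_false, abs_of_neg (not_le.1 hg)]
      split_ifs <;> ring
  obtain ⟨ι, hι, edge, node, L, δ, p1, p2, p3, p4, p5⟩ :=
    exists_paths (tail := (N.orient o).tail) (head := (N.orient o).head) _ (fun e => |g e|) N.balance
      (fun e => abs_nonneg _) (fun v => by convert hnet v) le_rfl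
  have start : ∀ v, ∑ k with node k 0 = v, δ k = max 0 (N.balance v) := by
    intro v; rw [Finset.sum_filter, ← p4 v]
  have finish : ∀ v, ∑ k with node k (L k) = v, δ k = max 0 (-N.balance v) := by
    intro v; rw [Finset.sum_filter, ← p5 v]
  -- Only an inequality, because division by zero gives zero rates for `T = 0`.
  have scale : ∀ s : Finset ι, 2 * T * ∑ k ∈ s, δ k / (2 * T) ≤ ∑ k ∈ s, δ k := by
    intro s
    rw [← Finset.sum_div]
    rcases hT.eq_or_lt with h | h
    · rw [← h]; simpa using Finset.sum_nonneg fun k _ => (p1 k).le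
    · rw [mul_div_cancel₀ _ (by positivity)]
  have key := (N.orient o).isFlowOverTime_pathsRate (T := 2 * T) (by positivity) Finset.univ edge node L
    (fun k => δ k / (2 * T)) (fun k _ => div_nonneg (p1 k).le (by positivity)) (fun k _ => p2 k)
    (fun k _ => ?_) (fun k _ => ?_) (fun e => ?_) (fun v hv => ?_) (fun v hv => ?_)
  · refine ⟨o, _, key.1, ?_⟩
    rw [key.2]
    have hsum : ∑ k, δ k = N.supply := by
      rw [supply_eq_sum_max, ← Finset.sum_congr rfl fun v _ => start v]
      exact (Finset.sum_fiberwise Finset.univ (fun k => node k 0) δ).symm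
    have hcost : ∑ k, δ k * (N.orient o).arrival (edge k) (L k) ≤ N.supply * T := by
      refine le_trans ?_ htime
      have : ∀ k, δ k * (N.orient o).arrival (edge k) (L k) =
          ∑ e, N.transit e * (δ k * walkCount (edge k) (L k) e) := by
        intro k
        have := sum_mul_walkCount N.transit (edge k) (L k)
        simp only [DirectedNetwork.arrival, orient]
        rw [← this, Finset.mul_sum]
        exact Finset.sum_congr rfl fun e _ => by ring
      simp only [this]
      rw [Finset.sum_comm]
      simp only [← Finset.mul_sum]
      exact Finset.sum_le_sum fun e _ => mul_le_mul_of_nonneg_left (p3 e) (N.transit_nonneg e)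
    rcases hT.eq_or_lt with h0 | h0
    · rw [← h0] at h
      rw [h.supply_eq_zero]
      simp [← h0]
    · have : ∀ k, δ k / (2 * T) * (2 * T - (N.orient o).arrival (edge k) (L k)) ≤
          δ k / (2 * T) * (N.orient o).duration (2 * T) (edge k) (L k) :=
        fun k => mul_le_mul_of_nonneg_left (le_max_right _ _) (div_nonneg (p1 k).le (by positivity))
      -- Paths longer than `2T` may be counted negatively; the bound on the average still suffices.
      refine le_trans ?_ (Finset.sum_le_sum fun k _ => this k)
      have e1 : ∑ k, δ k / (2 * T) * (2 * T - (N.orient o).arrival (edge k) (L k)) =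
          ∑ k, δ k - (∑ k, δ k * (N.orient o).arrival (edge k) (L k)) / (2 * T) := by
        rw [Finset.sum_div, ← Finset.sum_sub_distrib]
        refine Finset.sum_congr rfl fun k _ => ?_
        field_simp
      rw [e1, hsum]
      have : (∑ k, δ k * (N.orient o).arrival (edge k) (L k)) / (2 * T) ≤ N.supply / 2 := by
        rw [div_le_iff₀ (by positivity)]; linarith
      linarith
  · have h1 := Finset.single_le_sum (f := δ) (fun k _ => (p1 k).le)
      (show k ∈ Finset.univ.filter fun k' => node k' 0 = node k 0 by simp)
    rw [start] at h1
    by_contra hn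
    rw [max_eq_left (show N.balance (node k 0) ≤ 0 from not_lt.1 hn)] at h1
    linarith [p1 k]
  · have h1 := Finset.single_le_sum (f := δ) (fun k _ => (p1 k).le)
      (show k ∈ Finset.univ.filter fun k' => node k' (L k') = node k (L k) by simp)
    rw [finish] at h1
    by_contra hn
    rw [max_eq_left (by simpa [orient] using hn)] at h1
    linarith [p1 k]
  · refine EReal.coe_le_coe_iff.2 ?_
    have h1 : ∑ k, δ k / (2 * T) * walkCount (edge k) (L k) e ≤ |g e| / (2 * T) := by
      have : ∑ k, δ k / (2 * T) * walkCount (edge k) (L k) e =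
          (∑ k, δ k * walkCount (edge k) (L k) e) / (2 * T) := by
        rw [Finset.sum_div]; exact Finset.sum_congr rfl fun k _ => by ring
      rw [this]
      exact div_le_div_of_nonneg_right (p3 e) (by positivity)
    refine le_trans ?_ (h1.trans ?_)
    · refine le_of_eq (Finset.sum_congr rfl fun k _ => ?_)
      congr 1
    · rcases hT.eq_or_lt with h0 | h0
      · rw [← h0]; simpa using N.cap_nonneg e
      · rw [div_le_iff₀ (by positivity)]
        have := mul_nonneg (N.cap_nonneg e) hT
        linarith [hcap e]
  · refine (scale _).trans ?_
    have := start v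
    rw [max_eq_right (show 0 ≤ N.balance v from hv.le)] at this
    exact le_of_eq (by convert this; rfl)
  · refine (scale _).trans ?_
    have := finish v
    rw [max_eq_right (show 0 ≤ -N.balance v from neg_nonneg.2 (le_of_lt hv))] at this
    exact le_of_eq (by convert this; rfl)

end UndirectedNetwork

/-! ### The integral circulation problem and its optimal solutions -/

namespace RAM

open Finset

/-- Arrays that describe the arcs of the instance `I` with the encoding `z`. -/
structure IsEncoded (I : RatInstance) (S : ℕ) (z tl hd rv cc tm co : ℤ → ℤ) : Prop where
  input : IsInput I S z
  arcs : ∀ b ∈ Ico 0 (S : ℤ), tl b = arcTail z b ∧ hd b = arcHead z b ∧ rv b = arcRev z b ∧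
    cc b = arcCap z (posProd z S) b ∧ tm b = arcTime z (timeDenom z S) b ∧
    co b = arcCost z (timeDenom z S) b

/-- The number of the first arc of a node. -/
def nodeArc (I : RatInstance) (v : Fin I.n) : ℤ := I.m * 4 + (v : ℕ) * 2

/-- The number of the arc of the edge `e` that may carry positive flow in `f`. -/
def edgeArc (f : ℤ → ℤ) (e : ℤ) : ℤ := if 0 < f (e * 4) then e * 4 else e * 4 + 2

section

variable {I : RatInstance} {S : ℕ} {z tl hd rv cc tm co f pi : ℤ → ℤ}

theorem IsEncoded.isArcSystem (h : IsEncoded I S z tl hd rv cc tm co) : IsArcSystem S tl hd rv := by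
  have hA := h.input.isArcSystem
  refine ⟨fun b hb => ?_, fun b hb => ?_, fun b hb => ?_, fun b hb => ?_⟩ <;>
    obtain ⟨h1, h2, h3, -⟩ := h.arcs b hb
  · rw [h1]; exact hA.tl_mem b hb
  · rw [h3]; exact hA.rv_mem b hb
  · rw [h3, (h.arcs _ (hA.rv_mem b hb)).2.2.1]; exact hA.rv_rv b hb
  · rw [h3, (h.arcs _ (hA.rv_mem b hb)).1, h2]; exact hA.tl_rv b hb

theorem IsEncoded.cost_rev (h : IsEncoded I S z tl hd rv cc tm co) :
    ∀ b ∈ Ico 0 (S : ℤ), co (rv b) = -co b := by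
  intro b hb
  have hA := h.input.isArcSystem
  obtain ⟨-, -, h3, -, -, h4⟩ := h.arcs b hb
  rw [h3, (h.arcs _ (hA.rv_mem b hb)).2.2.2.2.2, h4]
  exact h.input.arcCost_rev _ b hb

theorem IsEncoded.cap_nonneg (h : IsEncoded I S z tl hd rv cc tm co) :
    ∀ b ∈ Ico 0 (S : ℤ), 0 ≤ cc b := by
  intro b hb
  rw [(h.arcs b hb).2.2.2.1]
  exact (h.input.arcCap_bounds b hb).1

theorem IsEncoded.edge_mem (h : IsEncoded I S z tl hd rv cc tm co) (e : Fin I.m) {k : ℤ} (h0 : 0 ≤ k)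
    (hk : k < 4) : ((e : ℕ) : ℤ) * 4 + k ∈ Ico 0 (S : ℤ) := by
  have := h.input.size; have := e.2
  rw [mem_Ico]; omega

theorem IsEncoded.node_mem (h : IsEncoded I S z tl hd rv cc tm co) (v : Fin I.n) {k : ℤ} (h0 : 0 ≤ k)
    (hk : k < 2) : nodeArc I v + k ∈ Ico 0 (S : ℤ) := by
  have := h.input.size; have := v.2
  rw [mem_Ico, nodeArc]; omega

theorem IsEncoded.edge (h : IsEncoded I S z tl hd rv cc tm co) (e : Fin I.m) {k : ℤ}
    (hk : k = 0 ∨ k = 1 ∨ k = 2 ∨ k = 3) :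
    tl ((e : ℕ) * 4 + k) = (if k = 1 ∨ k = 2 then ((I.end₂ e : ℕ) : ℤ) else (I.end₁ e : ℕ)) ∧
    hd ((e : ℕ) * 4 + k) = (if k = 1 ∨ k = 2 then ((I.end₁ e : ℕ) : ℤ) else (I.end₂ e : ℕ)) ∧
    rv ((e : ℕ) * 4 + k) =
      (if k = 0 ∨ k = 2 then ((e : ℕ) * 4 + k + 1 : ℤ) else (e : ℕ) * 4 + k - 1) ∧
    cc ((e : ℕ) * 4 + k) = (if k = 0 ∨ k = 2 then edgeCap I (posProd z S) e else 0) ∧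
    tm ((e : ℕ) * 4 + k) =
      (if k = 0 ∨ k = 2 then edgeTime I (timeDenom z S) e else -edgeTime I (timeDenom z S) e) ∧
    co ((e : ℕ) * 4 + k) =
      (if k = 0 ∨ k = 2 then edgeTime I (timeDenom z S) e + 1
        else -edgeTime I (timeDenom z S) e - 1) := by
  obtain ⟨h1, h2, h3, h4, h5, h6⟩ := h.arcs _ (h.edge_mem e (k := k) (by omega) (by omega))
  rw [h1, h2, h3, h4, h5, h6]
  exact h.input.edge_arcs e hk _ _

theorem IsEncoded.node (h : IsEncoded I S z tl hd rv cc tm co) (v : Fin I.n) {k : ℤ}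
    (hk : k = 0 ∨ k = 1) :
    tl (nodeArc I v + k) = (if (0 < (I.balance v).num ↔ k = 0) then (I.n : ℤ) else (v : ℕ)) ∧
    hd (nodeArc I v + k) = (if (0 < (I.balance v).num ↔ k = 0) then ((v : ℕ) : ℤ) else I.n) ∧
    rv (nodeArc I v + k) = (if k = 0 then nodeArc I v + k + 1 else nodeArc I v + k - 1) ∧
    cc (nodeArc I v + k) =
      (if k = 0 then if 0 < (I.balance v).num then nodeCap I (posProd z S) v
        else -nodeCap I (posProd z S) v else 0) ∧
    tm (nodeArc I v + k) = (if (I.balance v).num < 1 then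
      if k = 0 then -sinkTime I (timeDenom z S) else sinkTime I (timeDenom z S) else 0) ∧
    co (nodeArc I v + k) = (if (I.balance v).num < 1 then
      if k = 0 then -sinkTime I (timeDenom z S) else sinkTime I (timeDenom z S) else 0) := by
  obtain ⟨h1, h2, h3, h4, h5, h6⟩ := h.arcs _ (h.node_mem v (k := k) (by omega) (by omega))
  rw [h1, h2, h3, h4, h5, h6]
  exact h.input.node_arcs v hk _ _

theorem IsEncoded.cap_unused (h : IsEncoded I S z tl hd rv cc tm co) {b : ℤ} (hb : b ∈ Ico 0 (S : ℤ))
    (hb' : (I.m : ℤ) * 4 + I.n * 2 ≤ b) : cc b = 0 := by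
  rw [(h.arcs b hb).2.2.2.1]
  exact (h.input.unused_arcs hb' _ 0).2.2.2.1

theorem IsInput.timeDenom_eq (_ : IsInput I S z) (cc : ℤ → ℤ)
    (hc : ∀ b ∈ Ico 0 (S : ℤ), cc b = arcCap z (posProd z S) b) :
    timeDenom z S = (1 + ∑ b ∈ Ico 0 (S : ℤ), cc b) * posProd z S := by
  rw [timeDenom, sum_congr rfl hc]
  congr 2
  refine sum_nbij' (fun j : ℕ => (j : ℤ)) Int.toNat ?_ ?_ ?_ ?_ ?_
  · intro j hj; simpa using hj
  · intro b hb; simp at hb ⊢; omega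
  · intro j _; simp
  · intro b hb; simp at hb ⊢; omega
  · intro j _; rfl

theorem Fraction.ediv_mul_num {q : Fraction} {K : ℤ} (h : q.den ∣ K) :
    ((K / q.den * q.num : ℤ) : ℝ) = K * q.val := by
  obtain ⟨c, rfl⟩ := h
  have h0 : (q.den : ℝ) ≠ 0 := by exact_mod_cast q.den_pos.ne'
  rw [Int.mul_ediv_cancel_left _ q.den_pos.ne', Fraction.val]
  push_cast
  field_simp

theorem Fraction.val_pos_iff {q : Fraction} : 0 < q.val ↔ 0 < q.num := by
  have h0 : (0 : ℝ) < q.den := by exact_mod_cast q.den_pos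
  rw [Fraction.val, div_pos_iff_of_pos_right h0, Int.cast_pos]

theorem Fraction.val_neg_iff {q : Fraction} : q.val < 0 ↔ q.num < 0 := by
  have h0 : (0 : ℝ) < q.den := by exact_mod_cast q.den_pos
  rw [Fraction.val, div_lt_iff₀ h0, zero_mul]
  exact_mod_cast Iff.rfl

theorem IsEncoded.timeDenom_eq (h : IsEncoded I S z tl hd rv cc tm co) :
    timeDenom z S = (1 + ∑ b ∈ Ico 0 (S : ℤ), cc b) * posProd z S :=
  h.input.timeDenom_eq cc fun b hb => (h.arcs b hb).2.2.2.1

theorem IsEncoded.one_le_sum (h : IsEncoded I S z tl hd rv cc tm co) :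
    1 ≤ 1 + ∑ b ∈ Ico 0 (S : ℤ), cc b := by
  have := sum_nonneg h.cap_nonneg
  omega

theorem IsEncoded.timeDenom_pos (h : IsEncoded I S z tl hd rv cc tm co) : 0 < timeDenom z S := by
  rw [h.timeDenom_eq]
  have := h.one_le_sum
  exact mul_pos (by omega) (posProd_pos z S)

theorem IsEncoded.posProd_dvd (h : IsEncoded I S z tl hd rv cc tm co) :
    posProd z S ∣ timeDenom z S := by
  rw [h.timeDenom_eq]; exact dvd_mul_left _ _

theorem IsEncoded.edgeTime_nonneg (h : IsEncoded I S z tl hd rv cc tm co) (e : Fin I.m) :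
    0 ≤ edgeTime I (timeDenom z S) e :=
  mul_nonneg (Int.ediv_nonneg h.timeDenom_pos.le (I.transit e).den_pos.le)
    (Fraction.num_nonneg (I.transit_nonneg e))

theorem IsEncoded.edgeTime_eq (h : IsEncoded I S z tl hd rv cc tm co) (e : Fin I.m) :
    (edgeTime I (timeDenom z S) e : ℝ) = timeDenom z S * (I.transit e).val :=
  Fraction.ediv_mul_num ((h.input.den_dvd.2.2.2 e).trans h.posProd_dvd)

theorem IsEncoded.sinkTime_eq (h : IsEncoded I S z tl hd rv cc tm co) :
    (sinkTime I (timeDenom z S) : ℝ) = timeDenom z S * I.horizon.val * 2 := by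
  rw [sinkTime, Int.cast_mul, Fraction.ediv_mul_num (h.input.den_dvd.1.trans h.posProd_dvd)]
  norm_num

theorem IsEncoded.edgeCap_eq (h : IsEncoded I S z tl hd rv cc tm co) (e : Fin I.m) :
    (edgeCap I (posProd z S) e : ℝ) = posProd z S * (I.cap e).val * I.horizon.num := by
  rw [edgeCap, Int.cast_mul, Fraction.ediv_mul_num (h.input.den_dvd.2.2.1 e)]

theorem IsEncoded.nodeCap_eq (h : IsEncoded I S z tl hd rv cc tm co) (v : Fin I.n) :
    (nodeCap I (posProd z S) v : ℝ) = posProd z S * (I.balance v).val * I.horizon.den := by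
  rw [nodeCap, Int.cast_mul, Fraction.ediv_mul_num (h.input.den_dvd.2.1 v)]

/-! ### The arcs with positive flow -/

/-- The reverse arc has negative flow and nonnegative capacity, so it is residual and slackness
applies to it. -/
theorem IsEncoded.reducedCost_nonpos (h : IsEncoded I S z tl hd rv cc tm co)
    (hf : IsOptimal S tl hd rv co f cc pi) {b : ℤ} (hb : b ∈ Ico 0 (S : ℤ)) (hpos : 0 < f b) :
    reducedCost tl hd co pi b ≤ 0 := by
  have hA := h.isArcSystem
  have hb' := hA.rv_mem b hb
  have h1 := hf.slack _ hb' (by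
    have := h.cap_nonneg _ hb'
    rw [hf.anti b hb]; omega)
  rw [reducedCost_rv hA h.cost_rev pi hb] at h1
  omega

theorem IsEncoded.edge_zero (h : IsEncoded I S z tl hd rv cc tm co) (e : Fin I.m) :
    tl ((e : ℕ) * 4) = (I.end₁ e : ℕ) ∧ hd ((e : ℕ) * 4) = (I.end₂ e : ℕ) ∧
    rv ((e : ℕ) * 4) = (e : ℕ) * 4 + 1 ∧ cc ((e : ℕ) * 4) = edgeCap I (posProd z S) e ∧
    tm ((e : ℕ) * 4) = edgeTime I (timeDenom z S) e ∧
    co ((e : ℕ) * 4) = edgeTime I (timeDenom z S) e + 1 := by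
  have := h.edge e (k := 0) (by simp)
  simpa using this

theorem IsEncoded.edge_two (h : IsEncoded I S z tl hd rv cc tm co) (e : Fin I.m) :
    tl ((e : ℕ) * 4 + 2) = (I.end₂ e : ℕ) ∧ hd ((e : ℕ) * 4 + 2) = (I.end₁ e : ℕ) ∧
    rv ((e : ℕ) * 4 + 2) = (e : ℕ) * 4 + 2 + 1 ∧ cc ((e : ℕ) * 4 + 2) = edgeCap I (posProd z S) e ∧
    tm ((e : ℕ) * 4 + 2) = edgeTime I (timeDenom z S) e ∧
    co ((e : ℕ) * 4 + 2) = edgeTime I (timeDenom z S) e + 1 := by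
  have := h.edge e (k := 2) (by simp)
  simpa using this

theorem IsEncoded.nonneg_of_cap_rev (h : IsEncoded I S z tl hd rv cc tm co)
    (hf : IsOptimal S tl hd rv co f cc pi) {b : ℤ} (hb : b ∈ Ico 0 (S : ℤ)) (hc : cc (rv b) = 0) :
    0 ≤ f b := by
  have := hf.le _ (h.isArcSystem.rv_mem b hb)
  rw [hc, hf.anti b hb] at this
  omega

/-- Two antiparallel arcs with flow would have reduced costs of nonpositive sum; but prices cancel
in this sum, and each arc costs at least one. -/
theorem IsEncoded.not_both (h : IsEncoded I S z tl hd rv cc tm co)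
    (hf : IsOptimal S tl hd rv co f cc pi) (e : Fin I.m) (h0 : 0 < f ((e : ℕ) * 4)) :
    ¬ 0 < f ((e : ℕ) * 4 + 2) := by
  intro h2
  have m0 := h.edge_mem e (k := 0) le_rfl (by norm_num)
  rw [add_zero] at m0
  have r0 := h.reducedCost_nonpos hf m0 h0
  have r2 := h.reducedCost_nonpos hf (h.edge_mem e (k := 2) (by norm_num) (by norm_num)) h2
  obtain ⟨t0, d0, -, -, -, c0⟩ := h.edge_zero e
  obtain ⟨t2, d2, -, -, -, c2⟩ := h.edge_two e
  have := h.edgeTime_nonneg e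
  rw [reducedCost, t0, d0, c0] at r0
  rw [reducedCost, t2, d2, c2] at r2
  omega

theorem edgeArc_eq (f : ℤ → ℤ) (e : ℤ) : edgeArc f e = e * 4 ∨ edgeArc f e = e * 4 + 2 := by
  unfold edgeArc; split_ifs <;> simp

theorem IsEncoded.edgeArc_mem (h : IsEncoded I S z tl hd rv cc tm co) (e : Fin I.m) :
    edgeArc f (e : ℕ) ∈ Ico 0 (S : ℤ) := by
  rcases edgeArc_eq f (e : ℕ) with h' | h' <;> rw [h']
  · simpa using h.edge_mem e (k := 0) le_rfl (by norm_num)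
  · exact h.edge_mem e (by norm_num) (by norm_num)

/-- The orientation of the edges along the arcs with positive flow. -/
def direction (I : RatInstance) (f : ℤ → ℤ) (e : Fin I.m) : Bool := decide (0 < f ((e : ℕ) * 4))

theorem IsEncoded.edgeArc_props (h : IsEncoded I S z tl hd rv cc tm co)
    (hf : IsOptimal S tl hd rv co f cc pi) (e : Fin I.m) :
    tl (edgeArc f (e : ℕ)) = ((I.network.orient (direction I f)).tail e : ℕ) ∧
    hd (edgeArc f (e : ℕ)) = ((I.network.orient (direction I f)).head e : ℕ) ∧
    cc (edgeArc f (e : ℕ)) = edgeCap I (posProd z S) e ∧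
    tm (edgeArc f (e : ℕ)) = edgeTime I (timeDenom z S) e ∧
    co (edgeArc f (e : ℕ)) = edgeTime I (timeDenom z S) e + 1 ∧ 0 ≤ f (edgeArc f (e : ℕ)) := by
  have c3 : cc ((e : ℕ) * 4 + 2 + 1) = 0 := by
    have := (h.edge e (k := 3) (by simp)).2.2.2.1
    simpa [add_assoc] using this
  by_cases c : 0 < f ((e : ℕ) * 4)
  · obtain ⟨t0, d0, r0, c0, m0, o0⟩ := h.edge_zero e
    simp [edgeArc, direction, UndirectedNetwork.orient, RatInstance.network, *]
    omega
  · obtain ⟨t0, d0, r0, c0, m0, o0⟩ := h.edge_two e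
    have := h.nonneg_of_cap_rev hf (h.edge_mem e (k := 2) (by norm_num) (by norm_num)) (by rw [r0, c3])
    simp [edgeArc, direction, UndirectedNetwork.orient, RatInstance.network, *]

/-- Only one arc of each edge and the first arcs of the nodes have positive flow. -/
theorem IsEncoded.pos_cases (h : IsEncoded I S z tl hd rv cc tm co)
    (hf : IsOptimal S tl hd rv co f cc pi) {b : ℤ} (hb : b ∈ Ico 0 (S : ℤ)) (hpos : 0 < f b) :
    (∃ e : Fin I.m, b = edgeArc f (e : ℕ)) ∨ ∃ v : Fin I.n, b = nodeArc I v ∧ (I.balance v).num ≠ 0 := by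
  have hle := hf.le b hb
  rcases arc_cases I hb with ⟨e, k, hk, rfl⟩ | ⟨v, k, hk, rfl⟩ | hb'
  · refine .inl ⟨e, ?_⟩
    have hc := (h.edge e (k := k) (by omega)).2.2.2.1
    have h02 : k = 0 ∨ k = 2 := by
      by_contra hn
      rw [if_neg (by omega)] at hc
      omega
    rcases h02 with rfl | rfl
    · simp only [Nat.cast_zero, add_zero] at hpos ⊢
      rw [edgeArc, if_pos hpos]
    · rw [edgeArc, if_neg fun h0 => h.not_both hf e h0 (by simpa using hpos)]
      rfl
  · refine .inr ⟨v, ?_⟩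
    have hc := (h.node v (k := k) (by omega)).2.2.2.1
    rw [nodeArc] at hc
    have k0 : k = 0 := by
      by_contra hn
      rw [if_neg (by omega)] at hc
      omega
    subst k0
    refine ⟨by simp [nodeArc], fun hn => ?_⟩
    simp [nodeCap, hn] at hc
    simp [hc] at hle hpos
    omega
  · have := h.cap_unused hb hb'
    omega

theorem IsEncoded.node_zero (h : IsEncoded I S z tl hd rv cc tm co) (v : Fin I.n) :
    (0 < (I.balance v).num → tl (nodeArc I v) = I.n ∧ hd (nodeArc I v) = (v : ℕ) ∧
      cc (nodeArc I v) = nodeCap I (posProd z S) v ∧ tm (nodeArc I v) = 0 ∧ co (nodeArc I v) = 0) ∧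
    (¬ 0 < (I.balance v).num → tl (nodeArc I v) = (v : ℕ) ∧ hd (nodeArc I v) = I.n ∧
      cc (nodeArc I v) = -nodeCap I (posProd z S) v ∧
      tm (nodeArc I v) = -sinkTime I (timeDenom z S) ∧
      co (nodeArc I v) = -sinkTime I (timeDenom z S)) := by
  obtain ⟨h1, h2, -, h3, h4, h5⟩ := h.node v (k := 0) (by simp)
  rw [add_zero] at h1 h2 h3 h4 h5
  constructor <;> intro c
  · simp [h1, h2, h3, h4, h5, c, show ¬ (I.balance v).num < 1 by omega]
  · simp [h1, h2, h3, h4, h5, c, show (I.balance v).num < 1 by omega]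

/-- An edge arc with flow has positive cost but nonpositive reduced cost, so the price increases
from its tail to its head. All other arcs with flow have the root as an end. -/
theorem IsEncoded.isSplittable (h : IsEncoded I S z tl hd rv cc tm co)
    (hf : IsOptimal S tl hd rv co f cc pi) : IsSplittable S tl hd rv I.n pi f := by
  refine ⟨hf.anti, hf.conserve, fun b hb hpos ht hh => ?_⟩
  rcases h.pos_cases hf hb hpos with ⟨e, rfl⟩ | ⟨v, rfl, -⟩
  · have h1 := h.reducedCost_nonpos hf hb hpos
    have h2 := h.edgeTime_nonneg e
    rw [reducedCost, (h.edgeArc_props hf e).2.2.2.2.1] at h1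
    omega
  · by_cases c : 0 < (I.balance v).num
    · exact absurd ((h.node_zero v).1 c).1 ht
    · exact absurd ((h.node_zero v).2 c).2.1 hh

end
end RAM

/-! ### Cycles through the root as paths from sources to sinks -/

namespace RAM

open Finset

/-- The arcs `a 0, …, a (L - 1)` lead from the root to a source, then along edges in their
directions to a sink, and back to the root. -/
structure IsEdgePath (I : RatInstance) (f : ℤ → ℤ) (a : ℕ → ℤ) (L : ℕ) (edge : ℕ → Fin I.m)
    (node : ℕ → Fin I.n) (W : ℕ) : Prop where
  len : L = W + 2
  first : a 0 = nodeArc I (node 0)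
  last : a (W + 1) = nodeArc I (node W)
  mid : ∀ i < W, a (i + 1) = edgeArc f (edge i : ℕ)
  source : 0 < (I.balance (node 0)).num
  sink : (I.balance (node W)).num < 0
  walk : (I.network.orient (direction I f)).IsWalk edge node W

section

variable {I : RatInstance} {S : ℕ} {z tl hd rv cc tm co f pi g : ℤ → ℤ} {a : ℕ → ℤ} {L : ℕ}

/-- Edge arcs avoid the root. Hence the first arc belongs to a source and the last one to a sink,
and the arcs between, which avoid the root, belong to edges. -/
theorem IsEncoded.exists_isEdgePath (h : IsEncoded I S z tl hd rv cc tm co)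
    (hf : IsOptimal S tl hd rv co f cc pi) (hp : IsReturnPath S tl hd I.n g a L)
    (hg : ∀ i < L, 0 < f (a i)) (hL : 0 < L) : ∃ edge node W, IsEdgePath I f a L edge node W := by
  have tl_edge : ∀ e : Fin I.m, tl (edgeArc f (e : ℕ)) ≠ I.n := fun e => by
    rw [(h.edgeArc_props hf e).1]
    have := ((I.network.orient (direction I f)).tail e).2
    omega
  have hd_edge : ∀ e : Fin I.m, hd (edgeArc f (e : ℕ)) ≠ I.n := fun e => by
    rw [(h.edgeArc_props hf e).2.1]
    have := ((I.network.orient (direction I f)).head e).2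
    omega
  have leave : ∀ i < L, tl (a i) = I.n → ∃ v : Fin I.n, a i = nodeArc I v ∧ 0 < (I.balance v).num := by
    intro i hi ht
    rcases h.pos_cases hf (hp.mem i hi) (hg i hi) with ⟨e, he⟩ | ⟨v, hv, -⟩
    · rw [he] at ht; exact absurd ht (tl_edge e)
    · refine ⟨v, hv, by_contra fun c => ?_⟩
      rw [hv, ((h.node_zero v).2 c).1] at ht
      have := v.2; omega
  have arrive : ∀ i < L, hd (a i) = I.n → ∃ v : Fin I.n, a i = nodeArc I v ∧ (I.balance v).num < 0 := by
    intro i hi ht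
    rcases h.pos_cases hf (hp.mem i hi) (hg i hi) with ⟨e, he⟩ | ⟨v, hv, hv'⟩
    · rw [he] at ht; exact absurd ht (hd_edge e)
    · refine ⟨v, hv, by_contra fun c => ?_⟩
      rw [hv, ((h.node_zero v).1 (by omega)).2.1] at ht
      have := v.2; omega
  obtain ⟨v₀, a0, b0⟩ := leave 0 hL (hp.start hL)
  obtain ⟨v₁, a1, b1⟩ := arrive (L - 1) (by omega) (hp.finish hL)
  have hd0 : hd (a 0) = (v₀ : ℕ) := by rw [a0, ((h.node_zero v₀).1 b0).2.1]
  have tl1 : tl (a (L - 1)) = (v₁ : ℕ) := by rw [a1, ((h.node_zero v₁).2 (by omega)).1]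
  have ne : ∀ v w : Fin I.n, ((v : ℕ) : ℤ) = (w : ℕ) → v = w := fun v w e => by
    ext; exact_mod_cast e
  obtain ⟨W, rfl⟩ : ∃ W, L = W + 2 := by
    refine ⟨L - 2, ?_⟩
    by_contra hn
    have : L = 1 := by omega
    subst this
    have := hp.finish hL
    rw [Nat.sub_self, hd0] at this
    have := v₀.2; omega
  rw [show W + 2 - 1 = W + 1 by omega] at a1 tl1
  have mid : ∀ i < W, ∃ e : Fin I.m, a (i + 1) = edgeArc f (e : ℕ) := by
    intro i hi
    rcases h.pos_cases hf (hp.mem (i + 1) (by omega)) (hg (i + 1) (by omega)) with he | ⟨v, hv, -⟩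
    · exact he
    · exfalso
      have h1 := hp.inner i (by omega)
      have h2 := hp.inner (i + 1) (by omega)
      rw [hp.next i (by omega)] at h1
      rw [hv] at h1 h2
      by_cases c : 0 < (I.balance v).num
      · exact h1 ((h.node_zero v).1 c).1
      · exact h2 ((h.node_zero v).2 c).2.1
  -- A node cannot be both source and sink, so there is at least one edge, which also serves as
  -- default value beyond the end of the path.
  have hW : 0 < W := by
    rcases Nat.eq_zero_or_pos W with rfl | hW
    · have h1 := hp.next 0 (by omega)
      rw [hd0, tl1] at h1
      rw [ne _ _ h1] at b0
      omega
    · exact hW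
  obtain ⟨e₀, -⟩ := mid 0 hW
  have : ∀ i, ∃ e : Fin I.m, i < W → a (i + 1) = edgeArc f (e : ℕ) := fun i =>
    if hi : i < W then (mid i hi).imp fun _ he _ => he else ⟨e₀, fun h' => absurd h' hi⟩
  choose edge hedge using this
  set N := I.network.orient (direction I f) with hN
  have tlm : ∀ i < W, tl (a (i + 1)) = (N.tail (edge i) : ℕ) := fun i hi => by
    rw [hedge i hi, (h.edgeArc_props hf _).1]
  have hdm : ∀ i < W, hd (a (i + 1)) = (N.head (edge i) : ℕ) := fun i hi => by
    rw [hedge i hi, (h.edgeArc_props hf _).2.1]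
  let node : ℕ → Fin I.n := fun i => if i < W then N.tail (edge i) else v₁
  have n0 : node 0 = v₀ := by
    have h1 := hp.next 0 (by omega)
    rw [hd0, tlm 0 hW] at h1
    simp only [node, if_pos hW]
    exact (ne _ _ h1).symm
  have n1 : node W = v₁ := if_neg (lt_irrefl _)
  refine ⟨edge, node, W, rfl, by rw [n0, a0], by rw [n1, a1], hedge, by rwa [n0], by rwa [n1],
    fun i hi => ⟨(if_pos hi).symm, ?_⟩⟩
  have h1 := hp.next (i + 1) (by omega)
  rw [hdm i hi] at h1
  by_cases hi' : i + 1 < W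
  · rw [tlm _ hi'] at h1
    simp only [node, if_pos hi']
    exact ne _ _ h1
  · have : i + 1 = W := by omega
    rw [this, tl1] at h1
    rw [this, n1]
    exact ne _ _ h1

variable {edge : ℕ → Fin I.m} {node : ℕ → Fin I.n} {W : ℕ}

/-- The arc from the root to the source takes no time, whence the shift of the index by one. -/
theorem IsEncoded.sum_time (h : IsEncoded I S z tl hd rv cc tm co)
    (hf : IsOptimal S tl hd rv co f cc pi) (hP : IsEdgePath I f a L edge node W) {i : ℕ} (hi : i ≤ W) :
    ((∑ j ∈ range (i + 1), tm (a j) : ℤ) : ℝ) =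
      timeDenom z S * (I.network.orient (direction I f)).arrival edge i := by
  rw [Finset.sum_range_succ', hP.first, ((h.node_zero _).1 hP.source).2.2.2.1, add_zero,
    DirectedNetwork.arrival, Finset.mul_sum, Int.cast_sum]
  refine sum_congr rfl fun j hj => ?_
  rw [hP.mid j (by have := mem_range.1 hj; omega), (h.edgeArc_props hf _).2.2.2.1, h.edgeTime_eq]
  rfl

/-- The last arc contributes the bonus `-2T`, so the total is minus the length of the sending
window, as long as that is not empty. -/
theorem IsEncoded.sum_time_total (h : IsEncoded I S z tl hd rv cc tm co)
    (hf : IsOptimal S tl hd rv co f cc pi) (hP : IsEdgePath I f a L edge node W) :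
    ((∑ j ∈ range L, tm (a j) : ℤ) : ℝ) =
      timeDenom z S * ((I.network.orient (direction I f)).arrival edge W - 2 * I.horizon.val) := by
  have hs := hP.sink
  rw [hP.len, Finset.sum_range_succ, Int.cast_add, h.sum_time hf hP le_rfl, hP.last,
    ((h.node_zero _).2 (by omega)).2.2.2.1, Int.cast_neg, h.sinkTime_eq]
  ring

theorem IsEdgePath.edge_inj (hP : IsEdgePath I f a L edge node W)
    (hinj : ∀ i < L, ∀ j < L, a i = a j → i = j) {i j : ℕ} (hi : i < W) (hj : j < W)
    (he : edge i = edge j) : i = j := by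
  have hl := hP.len
  have := hinj (i + 1) (by omega) (j + 1) (by omega) (by rw [hP.mid i hi, hP.mid j hj, he])
  omega

theorem IsEdgePath.edge_eq_iff (hP : IsEdgePath I f a L edge node W) {i : ℕ} (hi : i < L) (e : Fin I.m) :
    (a i < I.m * 4 ∧ a i / 4 = (e : ℕ)) ↔ ∃ j < W, i = j + 1 ∧ edge j = e := by
  have hl := hP.len
  constructor
  · rintro ⟨h1, h2⟩
    have hlow : ∀ v : Fin I.n, ¬ nodeArc I v < I.m * 4 := fun v => by rw [nodeArc]; omega
    rcases Nat.eq_zero_or_pos i with rfl | h0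
    · rw [hP.first] at h1; exact absurd h1 (hlow _)
    · by_cases hlast : i = W + 1
      · rw [hlast, hP.last] at h1; exact absurd h1 (hlow _)
      · refine ⟨i - 1, by omega, by omega, ?_⟩
        have := hP.mid (i - 1) (by omega)
        rw [show i - 1 + 1 = i by omega] at this
        ext
        rcases edgeArc_eq f (edge (i - 1) : ℕ) with h' | h' <;> omega
  · rintro ⟨j, hj, rfl, rfl⟩
    have := (edge j).2
    rw [hP.mid j hj]
    rcases edgeArc_eq f (edge j : ℕ) with h' | h' <;> omega

end
end RAM

/-! ### Cost comparison with the averaged flow -/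

open Finset in
/-- The cost of a circulation is twice the cost of its positive part. -/
theorem sum_cost_eq_two_mul {S : ℤ} {tl hd rv co f : ℤ → ℤ} (hA : IsArcSystem S tl hd rv)
    (hco : ∀ b ∈ Ico 0 S, co (rv b) = -co b) (hf : ∀ b ∈ Ico 0 S, f (rv b) = -f b) :
    ∑ b ∈ Ico 0 S, co b * f b = 2 * ∑ b ∈ Ico 0 S with 0 < f b, co b * f b := by
  have h1 : ∀ b ∈ Ico 0 S, co b * f b =
      (if 0 < f b then co b * f b else 0) + if 0 < f (rv b) then co (rv b) * f (rv b) else 0 := by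
    intro b hb
    rw [hco b hb, hf b hb]
    rcases lt_trichotomy (f b) 0 with h | h | h
    · simp [h, h.not_gt]
    · simp [h]
    · simp [h, h.not_gt]
  rw [sum_congr rfl h1, sum_add_distrib, sum_rv hA fun b => if 0 < f b then co b * f b else 0,
    sum_filter]
  ring

namespace RAM

open Finset

/-- A function on the arcs with prescribed values on the first, the second and the following arcs of
edges and nodes. -/
theorem exists_arcFun (I : RatInstance) (x y : Fin I.m → ℝ) (w : Fin I.n → ℝ) :
    ∃ g : ℤ → ℝ, (∀ e : Fin I.m, g ((e : ℕ) * 4) = x e ∧ g ((e : ℕ) * 4 + 1) = -x e ∧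
        g ((e : ℕ) * 4 + 2) = y e ∧ g ((e : ℕ) * 4 + 3) = -y e) ∧
      (∀ v, g (nodeArc I v) = w v ∧ g (nodeArc I v + 1) = -w v) ∧
      ∀ b : ℤ, (I.m : ℤ) * 4 + I.n * 2 ≤ b → g b = 0 := by
  let E : ℤ → ℝ → ℝ → ℝ := fun b p q =>
    if b % 4 = 0 then p else if b % 4 = 1 then -p else if b % 4 = 2 then q else -q
  refine ⟨fun b => if h : (b / 4).toNat < I.m then E b (x ⟨_, h⟩) (y ⟨_, h⟩) else
    if h : ((b - I.m * 4) / 2).toNat < I.n then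
      if (b - I.m * 4) % 2 = 0 then w ⟨_, h⟩ else -w ⟨_, h⟩ else 0, fun e => ?_, fun v => ?_,
    fun b hb => ?_⟩
  · have he := e.2
    have key : ∀ k : ℤ, 0 ≤ k → k < 4 → ((((e : ℕ) : ℤ) * 4 + k) / 4).toNat = e ∧
        (((e : ℕ) : ℤ) * 4 + k) % 4 = k := fun k _ _ => by omega
    have k1 := key 1 (by norm_num) (by norm_num)
    have k2 := key 2 (by norm_num) (by norm_num)
    have k3 := key 3 (by norm_num) (by norm_num)
    simp [k1, k2, k3, E]
  · have hv := v.2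
    have key : ∀ k : ℤ, 0 ≤ k → k < 2 → ¬ ((nodeArc I v + k) / 4).toNat < I.m ∧
        ((nodeArc I v + k - I.m * 4) / 2).toNat = v ∧ (nodeArc I v + k - I.m * 4) % 2 = k :=
      fun k _ _ => by rw [nodeArc]; omega
    have k0 := key 0 (by norm_num) (by norm_num)
    rw [add_zero] at k0
    have k1 := key 1 (by norm_num) (by norm_num)
    simp only [k0, k1]
    simp
  · have h1 : ¬ (b / 4).toNat < I.m := by omega
    have h2 : ¬ ((b - I.m * 4) / 2).toNat < I.n := by omega
    simp [h1, h2]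

section

variable {I : RatInstance} {S : ℕ} {z tl hd rv cc tm co f pi : ℤ → ℤ}

theorem IsEncoded.edge_one (h : IsEncoded I S z tl hd rv cc tm co) (e : Fin I.m) :
    tl ((e : ℕ) * 4 + 1) = (I.end₂ e : ℕ) ∧ rv ((e : ℕ) * 4 + 1) = (e : ℕ) * 4 ∧
    cc ((e : ℕ) * 4 + 1) = 0 ∧ co ((e : ℕ) * 4 + 1) = -(edgeTime I (timeDenom z S) e + 1) := by
  obtain ⟨h1, -, h2, h3, -, h4⟩ := h.edge e (k := 1) (by simp)
  norm_num at h1 h2 h3 h4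
  exact ⟨h1, h2, h3, by rw [h4]; ring⟩

theorem IsEncoded.edge_three (h : IsEncoded I S z tl hd rv cc tm co) (e : Fin I.m) :
    tl ((e : ℕ) * 4 + 3) = (I.end₁ e : ℕ) ∧ rv ((e : ℕ) * 4 + 3) = (e : ℕ) * 4 + 2 ∧
    cc ((e : ℕ) * 4 + 3) = 0 ∧ co ((e : ℕ) * 4 + 3) = -(edgeTime I (timeDenom z S) e + 1) := by
  obtain ⟨h1, -, h2, h3, -, h4⟩ := h.edge e (k := 3) (by simp)
  norm_num [add_sub_assoc] at h1 h2 h3 h4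
  exact ⟨h1, h2, h3, by rw [h4]; ring⟩

/-- A static flow that satisfies all supplies and demands defines a circulation, which bounds the
cost of an optimal one. -/
theorem IsEncoded.cost_le (h : IsEncoded I S z tl hd rv cc tm co)
    (hf : IsOptimal S tl hd rv co f cc pi) (G : Fin I.m → ℝ)
    (hG : ∀ e, |G e| ≤ edgeCap I (posProd z S) e)
    (hbal : ∀ v, (∑ e, if I.end₁ e = v then G e else 0) - (∑ e, if I.end₂ e = v then G e else 0) =
      nodeCap I (posProd z S) v) :
    ((∑ b ∈ Ico 0 (S : ℤ) with 0 < f b, co b * f b : ℤ) : ℝ) ≤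
      ∑ e, ((edgeTime I (timeDenom z S) e : ℝ) + 1) * |G e| + sinkTime I (timeDenom z S) *
        ∑ v, if 0 < (I.balance v).num then 0 else (nodeCap I (posProd z S) v : ℝ) := by
  set C : Fin I.n → ℝ := fun v => nodeCap I (posProd z S) v with hC
  -- The positive part of `G` goes on the forward arc, the negative part on the backward arc, and
  -- all arcs between root and nodes are saturated.
  obtain ⟨g, ge, gv, g0⟩ := exists_arcFun I (fun e => max 0 (G e)) (fun e => max 0 (-G e))
    (fun v => if 0 < (I.balance v).num then C v else -C v)
  have sum_all : ∀ t : ℤ → ℝ, ∑ b ∈ Ico 0 (S : ℤ), t b * g b =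
      ∑ e : Fin I.m, ((t ((e : ℕ) * 4) - t ((e : ℕ) * 4 + 1)) * max 0 (G e) +
        (t ((e : ℕ) * 4 + 2) - t ((e : ℕ) * 4 + 3)) * max 0 (-G e)) +
      ∑ v : Fin I.n, (t (nodeArc I v) - t (nodeArc I v + 1)) *
        (if 0 < (I.balance v).num then C v else -C v) := by
    intro t
    rw [h.input.sum_arcs _ fun b hb _ => by rw [g0 b hb, mul_zero]]
    congr 1
    · refine sum_congr rfl fun e _ => ?_
      rw [(ge e).1, (ge e).2.1, (ge e).2.2.1, (ge e).2.2.2]; ring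
    · refine sum_congr rfl fun v _ => ?_
      have := gv v
      rw [nodeArc] at this ⊢
      rw [this.1, this.2]; ring
  -- This is conservation at the root.
  have hsumC : ∑ v, C v = 0 := by
    simp only [hC, h.nodeCap_eq, ← Finset.sum_mul, ← Finset.mul_sum]
    rw [I.balance_sum]; ring
  have anti : ∀ b ∈ Ico 0 (S : ℤ), g (rv b) = -g b := by
    intro b hb
    rcases arc_cases I hb with ⟨e, k, hk, rfl⟩ | ⟨v, k, hk, rfl⟩ | hb'
    · have r0 := (h.edge_zero e).2.2.1
      have r1 := (h.edge_one e).2.1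
      have r2 := (h.edge_two e).2.2.1
      have r3 := (h.edge_three e).2.1
      obtain ⟨g0, g1, g2, g3⟩ := ge e
      interval_cases k <;> simp [r0, r1, r2, r3, g0, g1, g2, g3, add_assoc]
    · have r0 := (h.node v (k := 0) (by simp)).2.2.1
      have r1 := (h.node v (k := 1) (by simp)).2.2.1
      obtain ⟨g0, g1⟩ := gv v
      rw [nodeArc] at r0 r1 g0 g1
      norm_num at r0 r1
      interval_cases k <;> simp [r0, r1, g0, g1]
    · rw [(h.arcs b hb).2.2.1, (h.input.unused_arcs hb' 0 0).2.2.1, g0 b hb', neg_zero]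
  have le : ∀ b ∈ Ico 0 (S : ℤ), g b ≤ cc b := by
    intro b hb
    rcases arc_cases I hb with ⟨e, k, hk, rfl⟩ | ⟨v, k, hk, rfl⟩ | hb'
    · obtain ⟨g0, g1, g2, g3⟩ := ge e
      have c0 := (h.edge_zero e).2.2.2.1
      have c1 := (h.edge_one e).2.2.1
      have c2 := (h.edge_two e).2.2.2.1
      have c3 := (h.edge_three e).2.2.1
      have p1 := (abs_nonneg _).trans (hG e)
      have p2 := (le_abs_self _).trans (hG e)
      have p3 := (neg_le_abs _).trans (hG e)
      interval_cases k <;> simp [g0, g1, g2, g3, c0, c1, c2, c3, p1, p2, p3]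
    · have n0 := h.node_zero v
      have c1 := (h.node v (k := 1) (by simp)).2.2.2.1
      have p0 := h.cap_nonneg _ (h.node_mem v (k := 0) le_rfl (by norm_num))
      rw [add_zero] at p0
      obtain ⟨g0, g1⟩ := gv v
      have key : g (nodeArc I v) = cc (nodeArc I v) := by
        rw [g0]
        by_cases c : 0 < (I.balance v).num
        · rw [if_pos c, (n0.1 c).2.2.1]
        · rw [if_neg c, (n0.2 c).2.2.1]; simp [hC]
      have p0' : (0 : ℝ) ≤ cc (nodeArc I v) := by exact_mod_cast p0
      rw [← g0, key] at g1
      rw [nodeArc] at key g1 p0' c1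
      norm_num at c1
      interval_cases k
      · simp [key]
      · simp [g1, c1, p0']
    · rw [g0 b hb', h.cap_unused hb hb', Int.cast_zero]
  have cons : ∀ u, netOut S tl g u = 0 := by
    intro u
    have e1 : netOut S tl g u = ∑ b ∈ Ico 0 (S : ℤ), (if tl b = u then (1 : ℝ) else 0) * g b := by
      rw [netOut, sum_filter]
      exact sum_congr rfl fun b _ => by split_ifs <;> simp
    rw [e1, sum_all]
    have e2 : ∀ e : Fin I.m, ((if tl ((e : ℕ) * 4) = u then (1 : ℝ) else 0) -
        if tl ((e : ℕ) * 4 + 1) = u then 1 else 0) * max 0 (G e) +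
        ((if tl ((e : ℕ) * 4 + 2) = u then (1 : ℝ) else 0) -
        if tl ((e : ℕ) * 4 + 3) = u then 1 else 0) * max 0 (-G e) =
        (if ((I.end₁ e : ℕ) : ℤ) = u then G e else 0) -
          if ((I.end₂ e : ℕ) : ℤ) = u then G e else 0 := by
      intro e
      rw [(h.edge_zero e).1, (h.edge_one e).1, (h.edge_two e).1, (h.edge_three e).1]
      have : max 0 (G e) - max 0 (-G e) = G e := by
        rcases le_total 0 (G e) with h' | h'
        · rw [max_eq_right h', max_eq_left (by linarith)]; ring
        · rw [max_eq_left h', max_eq_right (by linarith)]; ring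
      split_ifs <;> linarith
    have e3 : ∀ v : Fin I.n, ((if tl (nodeArc I v) = u then (1 : ℝ) else 0) -
        if tl (nodeArc I v + 1) = u then 1 else 0) * (if 0 < (I.balance v).num then C v else -C v) =
        (if (I.n : ℤ) = u then C v else 0) - if ((v : ℕ) : ℤ) = u then C v else 0 := by
      intro v
      have t1 := (h.node v (k := 1) (by simp)).1
      by_cases c : 0 < (I.balance v).num
      · rw [((h.node_zero v).1 c).1, t1]
        simp only [c, if_true]
        norm_num
        split_ifs <;> ring
      · rw [((h.node_zero v).2 c).1, t1]
        simp only [c, if_false]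
        norm_num
        split_ifs <;> ring
    simp only [e2, e3, Finset.sum_sub_distrib]
    by_cases hu : ∃ v : Fin I.n, ((v : ℕ) : ℤ) = u
    · obtain ⟨v, rfl⟩ := hu
      have hv := v.2
      have inj : ∀ w : Fin I.n, ((w : ℕ) : ℤ) = (v : ℕ) ↔ w = v := fun w => by
        rw [Fin.ext_iff]; norm_cast
      simp only [inj, hbal v, show ¬ (I.n : ℤ) = (v : ℕ) by omega, if_false]
      simp [hC]
    · have hu' : ∀ v : Fin I.n, ¬ ((v : ℕ) : ℤ) = u := fun v hv => hu ⟨v, hv⟩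
      simp only [hu', if_false]
      split_ifs <;> simp [hsumC]
  have key := hf.cost_le h.isArcSystem h.cost_rev anti le cons
  have e4 := sum_cost_eq_two_mul h.isArcSystem h.cost_rev hf.anti
  have e5 : ∑ b ∈ Ico 0 (S : ℤ), (co b : ℝ) * f b =
      2 * ((∑ b ∈ Ico 0 (S : ℤ) with 0 < f b, co b * f b : ℤ) : ℝ) := by
    exact_mod_cast e4
  rw [e5, sum_all fun b => (co b : ℝ)] at key
  have e6 : ∀ e : Fin I.m, ((co ((e : ℕ) * 4) : ℝ) - co ((e : ℕ) * 4 + 1)) * max 0 (G e) +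
      ((co ((e : ℕ) * 4 + 2) : ℝ) - co ((e : ℕ) * 4 + 3)) * max 0 (-G e) =
      2 * (((edgeTime I (timeDenom z S) e : ℝ) + 1) * |G e|) := by
    intro e
    rw [(h.edge_zero e).2.2.2.2.2, (h.edge_one e).2.2.2, (h.edge_two e).2.2.2.2.2,
      (h.edge_three e).2.2.2]
    have : |G e| = max 0 (G e) + max 0 (-G e) := by
      rcases le_total 0 (G e) with h' | h'
      · rw [max_eq_right h', max_eq_left (by linarith), abs_of_nonneg h']; ring
      · rw [max_eq_left h', max_eq_right (by linarith), abs_of_nonpos h']; ring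
    rw [this]; push_cast; ring
  have e7 : ∀ v : Fin I.n, ((co (nodeArc I v) : ℝ) - co (nodeArc I v + 1)) *
      (if 0 < (I.balance v).num then C v else -C v) =
      2 * (sinkTime I (timeDenom z S) * if 0 < (I.balance v).num then 0 else C v) := by
    intro v
    have c1 := (h.node v (k := 1) (by simp)).2.2.2.2.2
    by_cases c : 0 < (I.balance v).num
    · rw [((h.node_zero v).1 c).2.2.2.2, c1]
      simp [c, show ¬ (I.balance v).num < 1 by omega]
    · rw [((h.node_zero v).2 c).2.2.2.2, c1]
      simp [c, show (I.balance v).num < 1 by omega]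
      ring
  simp only [e6, e7, ← Finset.mul_sum] at key
  linarith

/-- A bound on the total transit time of an optimal circulation. -/
theorem IsEncoded.sum_time_le (h : IsEncoded I S z tl hd rv cc tm co)
    (hf : IsOptimal S tl hd rv co f cc pi) (hs : I.network.SupplySendable I.horizon.val) :
    ((∑ b ∈ Ico 0 (S : ℤ) with 0 < f b, tm b * f b : ℤ) : ℝ) ≤
      -(timeDenom z S * I.horizon.num * (posProd z S * I.network.supply)) := by
  classical
  obtain ⟨g, hcap, htime, hbal⟩ := hs.exists_static I.horizon_nonneg
  set D := posProd z S with hD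
  set K := timeDenom z S with hK
  set Td := I.horizon.den with hTd
  have hD0 : (0 : ℝ) < D := by exact_mod_cast posProd_pos z S
  have hK0 : (0 : ℝ) < K := by exact_mod_cast h.timeDenom_pos
  have hTd0 : (0 : ℝ) < Td := by exact_mod_cast I.horizon.den_pos
  have hTT : I.horizon.val * Td = I.horizon.num := by
    rw [Fraction.val, div_mul_cancel₀ _ hTd0.ne']
  -- With the factor `Td` the bound `u_e T` becomes `D u_e` times the numerator of `T`, which is the
  -- integral edge capacity.
  set G : Fin I.m → ℝ := fun e => D * Td * g e with hG
  have absG : ∀ e, |G e| = D * Td * |g e| := fun e => by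
    rw [hG, abs_mul, abs_of_pos (mul_pos hD0 hTd0)]
  have hGcap : ∀ e, |G e| ≤ edgeCap I D e := by
    intro e
    have h1 : |g e| ≤ (I.cap e).val * I.horizon.val := hcap e
    rw [absG, h.edgeCap_eq, ← hTT]
    have := mul_le_mul_of_nonneg_left h1 (mul_pos hD0 hTd0).le
    linarith
  have hGbal : ∀ v, (∑ e, if I.end₁ e = v then G e else 0) -
      (∑ e, if I.end₂ e = v then G e else 0) = nodeCap I D v := by
    intro v
    have h1 : (∑ e with I.end₁ e = v, g e) - ∑ e with I.end₂ e = v, g e = (I.balance v).val := by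
      convert hbal v <;> rfl
    rw [h.nodeCap_eq, ← h1]
    simp only [← Finset.sum_filter, hG, ← Finset.mul_sum]
    ring
  have key := h.cost_le hf G hGcap hGbal
  have hsupply : ∑ v, (if 0 < (I.balance v).num then 0 else (nodeCap I D v : ℝ)) =
      -(D * Td * I.network.supply) := by
    have hcap' : ∀ v, (nodeCap I D v : ℝ) = D * (I.balance v).val * Td := h.nodeCap_eq
    have hsup : I.network.supply =
        ∑ v, if 0 < (I.balance v).val then (I.balance v).val else 0 := by
      rw [UndirectedNetwork.supply, Finset.sum_filter]; rfl
    have h1 : ∀ v, (if 0 < (I.balance v).num then 0 else (nodeCap I D v : ℝ)) =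
        D * Td * ((I.balance v).val - if 0 < (I.balance v).val then (I.balance v).val else 0) := by
      intro v
      simp only [hcap', Fraction.val_pos_iff]
      split_ifs <;> ring
    simp only [h1, ← Finset.mul_sum, Finset.sum_sub_distrib, I.balance_sum, ← hsup]
    ring
  -- The surcharges contribute `|G e|` each, which is bounded by the capacity of the edge.
  have htransit : ∑ e, ((edgeTime I K e : ℝ) + 1) * |G e| ≤
      K * (D * Td) * (I.network.supply * I.horizon.val) + ∑ e, (edgeCap I D e : ℝ) := by
    have h1 : ∀ e, ((edgeTime I K e : ℝ) + 1) * |G e| ≤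
        K * (D * Td) * ((I.transit e).val * |g e|) + edgeCap I D e := by
      intro e
      rw [add_mul, one_mul]
      refine add_le_add (le_of_eq ?_) (hGcap e)
      rw [h.edgeTime_eq, absG]; ring
    refine (Finset.sum_le_sum fun e _ => h1 e).trans ?_
    rw [Finset.sum_add_distrib, ← Finset.mul_sum]
    have := mul_le_mul_of_nonneg_left htime (mul_pos hK0 (mul_pos hD0 hTd0)).le
    have e1 : ∑ e, I.network.transit e * |g e| = ∑ e, (I.transit e).val * |g e| := rfl
    rw [e1] at this
    linarith
  obtain ⟨C, hC⟩ : ∃ C, C = ∑ b ∈ Ico 0 (S : ℤ), cc b := ⟨_, rfl⟩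
  have hcaps : ∑ e, (edgeCap I D e : ℝ) ≤ C := by
    have h1 : ∑ e, edgeCap I D e ≤ C := by
      rw [hC, h.input.sum_arcs cc fun b hb hb' => h.cap_unused
        (mem_Ico.2 ⟨by omega, hb'⟩) hb]
      refine le_add_of_le_of_nonneg (Finset.sum_le_sum fun e _ => ?_) (Finset.sum_nonneg fun v _ => ?_)
      · rw [(h.edge_zero e).2.2.2.1, (h.edge_one e).2.2.1, (h.edge_three e).2.2.1]
        have := h.cap_nonneg _ (h.edge_mem e (k := 2) (by norm_num) (by norm_num))
        linarith
      · have h0 := h.cap_nonneg _ (h.node_mem v (k := 0) (by norm_num) (by norm_num))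
        have h1 := h.cap_nonneg _ (h.node_mem v (k := 1) (by norm_num) (by norm_num))
        rw [nodeArc] at h0 h1
        rw [add_zero] at h0
        exact add_nonneg h0 h1
    exact_mod_cast h1
  rw [hsupply, h.sinkTime_eq] at key
  -- both sides are integral multiples of `C + 1`
  have hKC : K = (1 + C) * D := by rw [hC]; exact h.timeDenom_eq
  have hC1 : 0 < 1 + C := by rw [hC]; have := h.one_le_sum; omega
  have hdiv : ∀ q : Fraction, q.den ∣ D → K / q.den = (1 + C) * (D / q.den) := by
    intro q hq
    rw [hKC, Int.mul_ediv_assoc _ hq]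
  obtain ⟨x, hx⟩ : (1 + C) ∣ ∑ b ∈ Ico 0 (S : ℤ) with 0 < f b, tm b * f b := by
    refine Finset.dvd_sum fun b hb => Dvd.dvd.mul_right ?_ _
    obtain ⟨hb, hpos⟩ := mem_filter.1 hb
    rcases h.pos_cases hf hb hpos with ⟨e, rfl⟩ | ⟨v, rfl, -⟩
    · rw [(h.edgeArc_props hf e).2.2.2.1, edgeTime, hdiv _ (h.input.den_dvd.2.2.2 e), mul_assoc]
      exact dvd_mul_right _ _
    · by_cases c : 0 < (I.balance v).num
      · rw [((h.node_zero v).1 c).2.2.2.1]; exact dvd_zero _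
      · rw [((h.node_zero v).2 c).2.2.2.1, sinkTime, hdiv _ h.input.den_dvd.1, dvd_neg, mul_assoc,
          mul_assoc]
        exact dvd_mul_right _ _
  obtain ⟨y, hy⟩ : ∃ y : ℤ, (y : ℝ) = D * I.network.supply := by
    refine ⟨∑ v, if 0 < (I.balance v).num then D / (I.balance v).den * (I.balance v).num else 0, ?_⟩
    rw [UndirectedNetwork.supply, Finset.mul_sum, Finset.sum_filter, Int.cast_sum]
    refine sum_congr rfl fun v _ => ?_
    have : I.network.balance v = (I.balance v).val := rfl
    rw [this]
    simp only [Fraction.val_pos_iff]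
    split_ifs
    · exact Fraction.ediv_mul_num (h.input.den_dvd.2.1 v)
    · simp
  have hle : ∑ b ∈ Ico 0 (S : ℤ) with 0 < f b, tm b * f b ≤
      ∑ b ∈ Ico 0 (S : ℤ) with 0 < f b, co b * f b := by
    refine Finset.sum_le_sum fun b hb => ?_
    obtain ⟨hb, hpos⟩ := mem_filter.1 hb
    refine mul_le_mul_of_nonneg_right ?_ hpos.le
    rcases h.pos_cases hf hb hpos with ⟨e, rfl⟩ | ⟨v, rfl, -⟩
    · rw [(h.edgeArc_props hf e).2.2.2.1, (h.edgeArc_props hf e).2.2.2.2.1]; omega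
    · by_cases c : 0 < (I.balance v).num
      · rw [((h.node_zero v).1 c).2.2.2.1, ((h.node_zero v).1 c).2.2.2.2]
      · rw [((h.node_zero v).2 c).2.2.2.1, ((h.node_zero v).2 c).2.2.2.2]
  have hle' : ((∑ b ∈ Ico 0 (S : ℤ) with 0 < f b, tm b * f b : ℤ) : ℝ) ≤
      ((∑ b ∈ Ico 0 (S : ℤ) with 0 < f b, co b * f b : ℤ) : ℝ) := by exact_mod_cast hle
  have hfinal : ((∑ b ∈ Ico 0 (S : ℤ) with 0 < f b, tm b * f b : ℤ) : ℝ) ≤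
      -(K * I.horizon.num * y) + C := by
    have e1 : K * (D * Td) * (I.network.supply * I.horizon.val) = K * I.horizon.num * y := by
      rw [hy, ← hTT]; ring
    have e2 : K * I.horizon.val * 2 * -(D * Td * I.network.supply) = -(2 * (K * I.horizon.num * y)) := by
      rw [hy, ← hTT]; ring
    rw [e2] at key
    rw [e1] at htransit
    linarith
  rw [hx, hKC] at hfinal
  have hint : (1 + C) * x ≤ -((1 + C) * D * I.horizon.num * y) + C := by exact_mod_cast hfinal
  -- The two multiples of `1 + C` are compared with an error of `C`, less than one multiple, so the
  -- error disappears.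
  have hxy : x ≤ -(D * I.horizon.num * y) := by
    have : (1 + C) * (x + D * I.horizon.num * y) < (1 + C) * 1 := by linarith
    have := lt_of_mul_lt_mul_left this hC1.le
    omega
  have hres : (1 + C) * x ≤ -(K * I.horizon.num * y) := by
    rw [hKC]
    have := mul_le_mul_of_nonneg_left hxy hC1.le
    linarith
  rw [hx, ← hy]
  exact_mod_cast hres

end
end RAM

/-! ### From an optimal circulation to a flow over time -/

namespace RAM

open Finset

/-- The denominator of the rates. -/
def rateDenom (I : RatInstance) (D : ℤ) : ℤ :=
  if D * I.horizon.num * 2 = 0 then 1 else D * I.horizon.num * 2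

section

variable {I : RatInstance} {S : ℕ} {z tl hd rv cc tm co pi : ℤ → ℤ}

theorem rateDenom_pos (I : RatInstance) {D : ℤ} (hD : 0 < D) : 0 < rateDenom I D := by
  have := Fraction.num_nonneg I.horizon_nonneg
  unfold rateDenom
  split_ifs with h
  · norm_num
  · exact lt_of_le_of_ne (by positivity) (Ne.symm h)

theorem rateDenom_of_pos {D : ℤ} (hD : 0 < D) (hT : 0 < I.horizon.num) :
    rateDenom I D = D * I.horizon.num * 2 :=
  if_neg (by positivity)

/-- The rate functions that are written for a path. -/
theorem IsEncoded.indicator_eq {f : ℤ → ℤ} {a : ℕ → ℤ} {L : ℕ} {edge : ℕ → Fin I.m}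
    {node : ℕ → Fin I.n} {W : ℕ} (h : IsEncoded I S z tl hd rv cc tm co)
    (hf : IsOptimal S tl hd rv co f cc pi) (hP : IsEdgePath I f a L edge node W)
    (hinj : ∀ i < L, ∀ j < L, a i = a j → i = j) {d st am : ℤ} {e : Fin I.m}
    (hR : IsRecord I.m tm a L d (e : ℕ) st am) (c θ : ℝ) :
    (Set.Ico ((st : ℝ) / timeDenom z S)
      (((st - ∑ i ∈ range L, tm (a i) : ℤ) : ℝ) / timeDenom z S)).indicator
        (fun _ => (am : ℝ) / c) θ =
      d / c * (I.network.orient (direction I f)).pathRate (2 * I.horizon.val) edge W e θ := by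
  have hK : (timeDenom z S : ℝ) ≠ 0 := by exact_mod_cast h.timeDenom_pos.ne'
  set N := I.network.orient (direction I f) with hN
  have hl := hP.len
  rcases hR with ⟨i, hi, h1, h2, rfl, rfl⟩ | ⟨hn, rfl⟩
  · obtain ⟨j, hj, rfl, hje⟩ := (hP.edge_eq_iff hi e).1 ⟨h1, h2⟩
    have hrate : N.pathRate (2 * I.horizon.val) edge W e θ =
        (Set.Ico (N.arrival edge j)
          (N.arrival edge j + N.duration (2 * I.horizon.val) edge W)).indicator (fun _ => 1) θ :=
      (Finset.sum_eq_single_of_mem j (mem_range.2 hj) fun i hi hne => if_neg fun he =>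
        hne (hP.edge_inj hinj (mem_range.1 hi) hj (Eq.trans he hje.symm))).trans (if_pos hje)
    rw [Int.cast_sub, h.sum_time hf hP hj.le, h.sum_time_total hf hP, ← mul_sub,
      mul_div_cancel_left₀ _ hK, mul_div_cancel_left₀ _ hK, ← hN, hrate]
    -- For a path that takes longer than `2T` the finish precedes the start, and both windows are
    -- empty.
    have hwin : Set.Ico (N.arrival edge j)
        (N.arrival edge j - (N.arrival edge W - 2 * I.horizon.val)) =
        Set.Ico (N.arrival edge j) (N.arrival edge j + N.duration (2 * I.horizon.val) edge W) := by
      rcases le_total 0 (2 * I.horizon.val - N.arrival edge W) with h' | h'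
      · rw [DirectedNetwork.duration, max_eq_right h']; congr 1; ring
      · rw [DirectedNetwork.duration, max_eq_left h', Set.Ico_eq_empty (by linarith),
          Set.Ico_eq_empty (by linarith)]
    rw [hwin]
    by_cases hθ : θ ∈ Set.Ico (N.arrival edge j)
      (N.arrival edge j + N.duration (2 * I.horizon.val) edge W)
    · rw [Set.indicator_of_mem hθ, Set.indicator_of_mem hθ, mul_one]
    · rw [Set.indicator_of_notMem hθ, Set.indicator_of_notMem hθ, mul_zero]
  · have hrate : N.pathRate (2 * I.horizon.val) edge W e θ = 0 := by
      refine Finset.sum_eq_zero fun j hj => if_neg fun he => ?_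
      have hj := mem_range.1 hj
      obtain ⟨h1, h2⟩ := (hP.edge_eq_iff (i := j + 1) (by omega) e).2 ⟨j, hj, rfl, he⟩
      exact hn _ (by omega) h1 h2
    rw [hrate]
    simp

variable {f : ℕ → ℤ → ℤ} {a : ℕ → ℕ → ℤ} {L : ℕ → ℕ} {d : ℕ → ℤ}

/-- The paths into which an optimal circulation splits form a flow over time. -/
theorem IsEncoded.sendsHalfInDouble_pathsRate (h : IsEncoded I S z tl hd rv cc tm co)
    (hf : IsOptimal S tl hd rv co (f 0) cc pi)
    (hs : ∀ k < S, IsSplit S tl hd rv I.n (f k) (a k) (L k) (d k) (f (k + 1)))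
    (hsend : I.network.SupplySendable I.horizon.val)
    {edge : {k : Fin S // 0 < L k} → ℕ → Fin I.m} {node : {k : Fin S // 0 < L k} → ℕ → Fin I.n}
    {W : {k : Fin S // 0 < L k} → ℕ}
    (hP : ∀ k, IsEdgePath I (f 0) (a k.1) (L k.1) (edge k) (node k) (W k)) :
    I.network.SendsHalfInDouble I.horizon.val (direction I (f 0))
      ((I.network.orient (direction I (f 0))).pathsRate (2 * I.horizon.val) univ edge W
        fun k => (d k.1 : ℝ) / rateDenom I (posProd z S)) := by
  classical
  have hA := h.isArcSystem
  have hsp := h.isSplittable hf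
  set N := I.network.orient (direction I (f 0)) with hN
  set T := I.horizon.val with hT
  set D := posProd z S with hD
  have hD0 : 0 < D := posProd_pos z S
  have hD0' : (0 : ℝ) < D := by exact_mod_cast hD0
  have hTn := Fraction.num_nonneg I.horizon_nonneg
  have hTd0 : (0 : ℝ) < I.horizon.den := by exact_mod_cast I.horizon.den_pos
  have hTT : T * I.horizon.den = I.horizon.num := by
    rw [hT, Fraction.val, div_mul_cancel₀ _ hTd0.ne']
  have hRD : (0 : ℝ) < rateDenom I D := by exact_mod_cast rateDenom_pos I hD0
  have hRDT : 0 < I.horizon.num → (rateDenom I D : ℝ) = D * I.horizon.num * 2 := fun h' => by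
    rw [rateDenom_of_pos hD0 h']; push_cast; ring
  have hT0 : I.horizon.num = 0 → T = 0 := fun h' => by rw [hT, Fraction.val, h']; simp
  -- The paths that use an arc together remove at most its initial flow; capacities, supplies and
  -- demands all follow from this.
  have usage : ∀ b ∈ Ico 0 (S : ℤ), 0 ≤ f 0 b → ∀ s : Finset {k : Fin S // 0 < L k},
      (∀ k ∈ s, ∃ i < L k.1, a k.1 i = b) → ∑ k ∈ s, (d k.1 : ℝ) ≤ f 0 b := by
    intro b hb h0 s hsb
    obtain ⟨p1, p2⟩ := splits_sum hA hsp hs hb h0 S le_rfl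
    have hle : ∑ k ∈ s, d k.1 ≤ ∑ j ∈ range S, (if ∃ i < L j, a j i = b then d j else 0) := by
      let emb : {k : Fin S // 0 < L k} ↪ ℕ :=
        ⟨fun k => k.1, fun k k' e => Subtype.ext (Fin.ext e)⟩
      have e1 : ∑ k ∈ s, d k.1 = ∑ j ∈ s.map emb, (if ∃ i < L j, a j i = b then d j else 0) := by
        rw [Finset.sum_map]
        exact sum_congr rfl fun k hk => (if_pos (hsb k hk)).symm
      rw [e1]
      refine Finset.sum_le_sum_of_subset_of_nonneg ?_ fun j hj _ => ?_
      · intro j hj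
        obtain ⟨k, -, rfl⟩ := mem_map.1 hj
        exact mem_range.2 k.1.2
      · split_ifs
        · exact (hs j (mem_range.1 hj)).nonneg
        · exact le_rfl
    have : ∑ k ∈ s, d k.1 ≤ f 0 b := by omega
    exact_mod_cast this
  have usage_node : ∀ v, ∀ s : Finset {k : Fin S // 0 < L k},
      (∀ k ∈ s, ∃ i < L k.1, a k.1 i = nodeArc I v) →
      2 * T * ∑ k ∈ s, (d k.1 : ℝ) / rateDenom I D ≤ |(I.balance v).val| := by
    intro v s hs'
    rcases hTn.eq_or_lt with h0 | h0
    · rw [hT0 h0.symm]; simp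
    have hm := h.node_mem v (k := 0) le_rfl (by norm_num)
    rw [add_zero] at hm
    have hc : (cc (nodeArc I v) : ℝ) ≤ D * |(I.balance v).val| * I.horizon.den := by
      by_cases c : 0 < (I.balance v).num
      · rw [((h.node_zero v).1 c).2.2.1, h.nodeCap_eq, abs_of_pos (Fraction.val_pos_iff.2 c)]
      · rw [((h.node_zero v).2 c).2.2.1, Int.cast_neg, h.nodeCap_eq,
          abs_of_nonpos (not_lt.1 fun h' => c (Fraction.val_pos_iff.1 h'))]
        linarith
    have hr : cc (rv (nodeArc I v)) = 0 := by
      have r0 := (h.node v (k := 0) (by simp)).2.2.1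
      have c1 := (h.node v (k := 1) (by simp)).2.2.2.1
      rw [add_zero, if_pos rfl] at r0
      rw [r0, c1, if_neg (by norm_num)]
    have h1 := usage _ hm (h.nonneg_of_cap_rev hf hm hr) s hs'
    have h2 : (f 0 (nodeArc I v) : ℝ) ≤ cc (nodeArc I v) := by exact_mod_cast hf.le _ hm
    have h0' : (0 : ℝ) < I.horizon.num := by exact_mod_cast h0
    rw [← Finset.sum_div, hRDT h0, mul_div_assoc', div_le_iff₀ (by positivity), ← hTT]
    have hT' : 0 < T := by
      by_contra hn
      have := mul_nonpos_of_nonpos_of_nonneg (not_lt.1 hn) hTd0.le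
      rw [hTT] at this; linarith
    have h3 := mul_le_mul_of_nonneg_left (h1.trans (h2.trans hc)) hT'.le
    linarith
  have hlen : ∀ k, L k.1 = W k + 2 := fun k => (hP k).len
  have key := N.isFlowOverTime_pathsRate (T := 2 * T) (by have := I.horizon_nonneg; positivity) univ edge
    node W (fun k => (d k.1 : ℝ) / rateDenom I D)
    (fun k _ => div_nonneg (by exact_mod_cast (hs k.1 k.1.2).nonneg) hRD.le)
    (fun k _ => (hP k).walk) (fun k _ => Fraction.val_pos_iff.2 (hP k).source)
    (fun k _ => Fraction.val_neg_iff.2 (hP k).sink) (fun e => ?_) (fun v hv => ?_) (fun v hv => ?_)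
  · refine ⟨key.1, ?_⟩
    rw [key.2]
    rcases hTn.eq_or_lt with h0 | h0
    · have := hT0 h0.symm
      rw [this] at hsend
      rw [hsend.supply_eq_zero, zero_div]
      exact Finset.sum_nonneg fun k _ => mul_nonneg
        (div_nonneg (by exact_mod_cast (hs k.1 k.1.2).nonneg) hRD.le) (N.duration_nonneg _ _ _)
    · have hK : (0 : ℝ) < timeDenom z S := by exact_mod_cast h.timeDenom_pos
      have h0' : (0 : ℝ) < I.horizon.num := by exact_mod_cast h0
      -- The only negative times occur on arcs from nodes that are not sources into the root.
      have h1 := splits_cost_le hA hsp hs tm (by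
        intro b hb hpos hne
        rcases h.pos_cases hf hb hpos with ⟨e, rfl⟩ | ⟨v, rfl, -⟩
        · rw [(h.edgeArc_props hf e).2.2.2.1]; exact h.edgeTime_nonneg e
        · by_cases c : 0 < (I.balance v).num
          · rw [((h.node_zero v).1 c).2.2.2.1]
          · exact absurd ((h.node_zero v).2 c).2.1 hne)
      have h2 := h.sum_time_le hf hsend
      have h3 : ((∑ k ∈ range S, d k * ∑ i ∈ range (L k), tm (a k i) : ℤ) : ℝ) ≤
          -(timeDenom z S * I.horizon.num * (D * I.network.supply)) :=
        le_trans (by exact_mod_cast h1) h2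
      have h4 : ((∑ k ∈ range S, d k * ∑ i ∈ range (L k), tm (a k i) : ℤ) : ℝ) =
          timeDenom z S * ∑ k : {k : Fin S // 0 < L k},
            (d k.1 : ℝ) * (N.arrival (edge k) (W k) - 2 * T) := by
        rw [Finset.sum_range, Int.cast_sum, Finset.mul_sum,
          ← Finset.sum_filter_of_ne (p := fun k : Fin S => 0 < L k),
          Finset.sum_subtype (p := fun k : Fin S => 0 < L k) _ (by simp)]
        · refine sum_congr rfl fun k _ => ?_
          rw [Int.cast_mul, h.sum_time_total hf (hP k)]
          ring
        · intro k _ hne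
          by_contra hL
          rw [Nat.eq_zero_of_not_pos hL] at hne
          simp at hne
      rw [h4] at h3
      have h5 : ∑ k : {k : Fin S // 0 < L k}, (d k.1 : ℝ) * (N.arrival (edge k) (W k) - 2 * T) ≤
          -(I.horizon.num * (D * I.network.supply)) := by
        refine le_of_mul_le_mul_left ?_ hK
        linarith
      -- As in the existence proof, the positive part in the duration may be dropped.
      have h6 : ∀ k : {k : Fin S // 0 < L k},
          -((d k.1 : ℝ) * (N.arrival (edge k) (W k) - 2 * T)) / rateDenom I D ≤
          (d k.1 : ℝ) / rateDenom I D * N.duration (2 * T) (edge k) (W k) := by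
        intro k
        have hd0 : (0 : ℝ) ≤ (d k.1 : ℝ) / rateDenom I D :=
          div_nonneg (by exact_mod_cast (hs k.1 k.1.2).nonneg) hRD.le
        have := mul_le_mul_of_nonneg_left
          (le_max_right 0 (2 * T - N.arrival (edge k) (W k))) hd0
        refine le_trans (le_of_eq ?_) this
        ring
      refine le_trans ?_ (Finset.sum_le_sum fun k _ => h6 k)
      rw [← Finset.sum_div, Finset.sum_neg_distrib, le_div_iff₀ hRD, hRDT h0]
      linarith
  · refine EReal.coe_le_coe_iff.2 ?_
    have hb := h.edgeArc_props hf e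
    have e1 : ∀ k, (∑ i ∈ range (W k), if edge k i = e then (1 : ℝ) else 0) =
        if ∃ i < W k, edge k i = e then 1 else 0 := by
      intro k
      split_ifs with hex
      · obtain ⟨i, hi, he⟩ := hex
        rw [Finset.sum_eq_single_of_mem i (mem_range.2 hi), if_pos he]
        intro j hj hne
        exact if_neg fun he' => hne ((hP k).edge_inj (hs k.1 k.1.2).path.inj (mem_range.1 hj) hi
          (he'.trans he.symm))
      · exact Finset.sum_eq_zero fun i hi => if_neg fun he => hex ⟨i, mem_range.1 hi, he⟩
    have h1 := usage _ (h.edgeArc_mem e) hb.2.2.2.2.2 (univ.filter fun k => ∃ i < W k, edge k i = e) (by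
      intro k hk
      obtain ⟨i, hi, rfl⟩ := (mem_filter.1 hk).2
      exact ⟨i + 1, by rw [hlen k]; omega, (hP k).mid i hi⟩)
    have h2 : (f 0 (edgeArc (f 0) (e : ℕ)) : ℝ) ≤ D * (I.cap e).val * I.horizon.num := by
      rw [← h.edgeCap_eq, ← hb.2.2.1]
      exact_mod_cast hf.le _ (h.edgeArc_mem e)
    have h3 : ∑ k, (d k.1 : ℝ) / rateDenom I D *
        (∑ i ∈ range (W k), if edge k i = e then (1 : ℝ) else 0) =
        (∑ k with ∃ i < W k, edge k i = e, (d k.1 : ℝ)) / rateDenom I D := by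
      rw [Finset.sum_div, Finset.sum_filter]
      refine sum_congr rfl fun k _ => ?_
      rw [e1]; split_ifs <;> simp
    suffices h4 : (∑ k with ∃ i < W k, edge k i = e, (d k.1 : ℝ)) / rateDenom I D ≤ (I.cap e).val by
      refine le_trans (le_of_eq ?_) h4
      rw [← h3]
      refine sum_congr rfl fun k _ => ?_
      congr!
    rw [div_le_iff₀ hRD]
    refine h1.trans (h2.trans ?_)
    have hu : 0 ≤ (I.cap e).val := I.cap_nonneg e
    rcases hTn.eq_or_lt with h0 | h0
    · rw [← h0]; simpa using mul_nonneg hu hRD.le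
    · rw [hRDT h0]
      have h0' : (0 : ℝ) < I.horizon.num := by exact_mod_cast h0
      have := mul_nonneg (mul_nonneg hD0'.le hu) h0'.le
      linarith
  · have hu := usage_node v (univ.filter fun k => node k 0 = v) fun k hk => ⟨0, k.2, by
      rw [(hP k).first, (mem_filter.1 hk).2]⟩
    rw [abs_of_pos (show 0 < (I.balance v).val from hv)] at hu
    convert hu; rfl
  · have hu := usage_node v (univ.filter fun k => node k (W k) = v) fun k hk =>
      ⟨W k + 1, by rw [hlen k]; omega, by rw [(hP k).last, (mem_filter.1 hk).2]⟩
    rw [abs_of_neg (show (I.balance v).val < 0 from hv)] at hu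
    convert hu <;> rfl

end
end RAM

/-! ### Correctness of the output -/

namespace RAM

open Finset

/-- The output of a solution with the same number of pieces for all edges. -/
theorem holdsOutput_code {I : RatInstance} {S : ℕ} {σ : Store} {y : RatSolution I}
    (hlen : ∀ e, (y.pieces e).length = S) (h0 : σ OUT 0 = I.m * 2 + I.m * 6 * S)
    (hdir : ∀ e : Fin I.m, σ OUT (edgeCell S (e : ℕ) 0) = if y.dir e then 1 else 0)
    (hnum : ∀ e : Fin I.m, σ OUT (edgeCell S (e : ℕ) 1) = S)
    (hpiece : ∀ (e : Fin I.m) (k : ℕ) (hk : k < (y.pieces e).length) (i : ℕ) (x : ℤ),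
      (y.pieces e)[k].code[i]? = some x → σ OUT (edgeCell S (e : ℕ) (2 + 6 * k + i)) = x) :
    HoldsOutput σ y.code := by
  have code_len : ∀ p : Piece, p.code.length = 6 := fun _ => rfl
  set block : Fin I.m → List ℤ := fun e => [if y.dir e then 1 else 0, ((y.pieces e).length : ℤ)]
      ++ ((y.pieces e).map Piece.code).flatten with hblock
  have hofFn : ∀ e, (y.pieces e).map Piece.code =
      List.ofFn fun k : Fin (y.pieces e).length => (y.pieces e)[k].code :=
    fun e => List.ext_getElem (by simp) (by simp)
  have flat_len : ∀ e, ((y.pieces e).map Piece.code).flatten.length = S * 6 := by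
    intro e
    rw [hofFn, List.length_flatten_ofFn _ fun _ => code_len _, hlen]
  have block_len : ∀ e, (block e).length = 2 + 6 * S := by
    intro e
    simp only [hblock, List.length_append, List.length_cons, List.length_nil, flat_len]
    ring
  have hcode : y.code = (List.ofFn block).flatten := rfl
  have total : y.code.length = I.m * (2 + 6 * S) := by
    rw [hcode, List.length_flatten_ofFn _ block_len]
  refine ⟨by rw [total]; exact h0.trans (by push_cast; ring), fun k hk => ?_⟩
  rw [total] at hk
  have hpos : 0 < 2 + 6 * S := by omega
  -- All blocks have length `2 + 6 * S`, so quotient and remainder locate an output cell within the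
  -- block of its edge.
  set e : Fin I.m := ⟨k / (2 + 6 * S), (Nat.div_lt_iff_lt_mul hpos).2 hk⟩ with he
  set j := k % (2 + 6 * S) with hj
  have hjlt : j < 2 + 6 * S := Nat.mod_lt _ hpos
  have hk' : k = (e : ℕ) * (2 + 6 * S) + j := (Nat.div_add_mod' k _).symm
  have haddr : (k : ℤ) + 1 = edgeCell S (e : ℕ) j := by
    rw [edgeCell]
    conv_lhs => rw [hk']
    push_cast; ring
  obtain ⟨x, hx⟩ : ∃ x, (block e)[j]? = some x :=
    ⟨_, List.getElem?_eq_getElem (by rw [block_len]; exact hjlt)⟩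
  have hget : y.code[k]? = some x := by
    rw [hcode, hk', List.getElem?_flatten_ofFn block block_len e hjlt, hx]
  rw [haddr, (List.getElem?_eq_some_iff.1 hget).2]
  rcases lt_or_ge j 2 with h2 | h2
  · rw [hblock, List.getElem?_append_left (by simpa using h2)] at hx
    interval_cases j
    · simp only [List.getElem?_cons_zero, Option.some.injEq] at hx
      rw [← hx]; exact hdir e
    · simp only [List.getElem?_cons_succ, List.getElem?_cons_zero, Option.some.injEq] at hx
      rw [← hx, hlen]; exact hnum e
  · rw [hblock, List.getElem?_append_right (by simpa using h2)] at hx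
    have hq : (j - 2) / 6 < (y.pieces e).length := by rw [hlen]; omega
    rw [hofFn, show j - [if y.dir e then (1 : ℤ) else 0, ((y.pieces e).length : ℤ)].length =
      ((⟨(j - 2) / 6, hq⟩ : Fin (y.pieces e).length) : ℕ) * 6 + (j - 2) % 6 by simp; omega,
      List.getElem?_flatten_ofFn _ (fun _ => code_len _) _ (Nat.mod_lt _ (by norm_num))] at hx
    rw [← hpiece e _ hq _ x hx]
    congr 1
    simp only [edgeCell]
    omega

open Prog in
/-- The algorithm solves the problem. -/
theorem polyTimeSolvable_sendsHalfInDouble :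
    PolyTimeSolvable RatInstance.code (fun _ S => RatSolution.code S)
      (fun (I : RatInstance) (S : RatSolution I) =>
        I.network.SupplySendable I.horizon.val →
          I.network.SendsHalfInDouble I.horizon.val S.dir S.flow) := by
  refine polyTimeSolvable_of_prog main_tame fun I σ hin hsize hzero => ?_
  obtain ⟨S, hS⟩ : ∃ S, S = inputSize I.code := ⟨_, rfl⟩
  obtain ⟨z, hz⟩ : ∃ z, z = inputStore I.code 0 := ⟨_, rfl⟩
  have hI : IsInput I S z := by rw [hS, hz]; exact isInput_code I
  rw [← hz] at hin
  rw [← hS] at hsize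
  obtain ⟨σ₁, h₁⟩ : ∃ ρ, ρ = setup.run σ := ⟨_, rfl⟩
  obtain ⟨σ₂, h₂⟩ : ∃ ρ, ρ = solve.run σ₁ := ⟨_, rfl⟩
  have hrun : main.run σ = output.run σ₂ := by
    rw [h₂, h₁]; simp only [main, run_block_cons, run_block_nil]
  have f1 : ∀ a, _ → σ₁ a = σ a := fun a h => h₁ ▸ Prog.run_frame (p := setup) (a := a) h σ
  have f2 : ∀ a, _ → σ₂ a = σ₁ a := fun a h => h₂ ▸ Prog.run_frame (p := solve) (a := a) h σ₁
  obtain ⟨s1, s2, s3⟩ := run_setup hsize hin (by rw [hI.nodes]; positivity)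
    (fun a ha => hzero a (.inr ha))
  rw [← h₁] at s1 s2 s3
  have hE : IsEncoded I S z (σ₁ TAIL) (σ₁ HEAD) (σ₁ REV) (σ₁ CAPA) (σ₁ TIME) (σ₁ COST) := ⟨hI, s3⟩
  have hA := hE.isArcSystem
  have harcs : HasArcs S (σ₁ TAIL) (σ₁ HEAD) (σ₁ REV) (σ₁ COST) σ₁ :=
    ⟨by rw [f1 _ rfl, hsize], rfl, rfl, rfl, rfl⟩
  have hf := run_solve hA hE.cost_rev harcs (by rw [f1 _ rfl]; exact hzero _ (.inr (by decide)))
    (by rw [f1 _ rfl]; exact hzero _ (.inr (by decide)))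
    (by rw [f1 _ rfl]; exact hzero _ (.inr (by decide)))
    (fun b hb => by rw [(s3 b hb).2.2.2.1]; exact hI.arcCap_bounds b hb)
  rw [← h₂] at hf
  have hsz := hI.size
  have harcs₂ : HasArcs S (σ₁ TAIL) (σ₁ HEAD) (σ₁ REV) (σ₁ COST) σ₂ := by
    rw [h₂]; exact harcs.run rfl rfl rfl rfl rfl
  have hin₂ : σ₂ IN = z := by rw [f2 _ rfl, f1 _ rfl]; exact hin
  obtain ⟨f, a, L, d, hf0, hs, o0, oe⟩ := run_output (m := I.m) hA harcs₂ (by rw [hin₂, hI.nodes])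
    (mem_Ico.2 ⟨by positivity, by omega⟩) (by rw [hin₂, hI.edges]) (by omega) (hE.isSplittable hf)
  rw [f2 TIME rfl, f2 TDENOM rfl, f2 DENOM rfl, s1, s2, hin₂, hI.time_num] at oe
  rw [← hf0] at hf oe
  have oe' := fun e : Fin I.m => oe (e : ℕ) (mem_Ico.2 ⟨by positivity, by have := e.2; omega⟩)
  choose odir onum opiece using oe'
  choose st am hrec hpc using fun (e : Fin I.m) (k : Fin S) => opiece e k k.2
  have hK := hE.timeDenom_pos
  have hD : 0 < posProd z S := posProd_pos z S
  have hR := rateDenom_pos I hD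
  -- One piece per edge and round; edges that the path of the round avoids get the amount zero.
  let piece : Fin I.m → Fin S → Piece := fun e k =>
    ⟨⟨st e k, timeDenom z S, hK⟩, ⟨st e k - ∑ i ∈ range (L k), σ₁ TIME (a k i), timeDenom z S, hK⟩,
      ⟨am e k, rateDenom I (posProd z S), hR⟩⟩
  refine ⟨⟨direction I (f 0), fun e => List.ofFn (piece e)⟩, ?_, fun hsend => ?_⟩
  · rw [hrun]
    refine holdsOutput_code (S := S) (fun e => List.length_ofFn) o0 (fun e => ?_) onum ?_
    · rw [odir e]; simp [direction]
    · intro e k hk i x hx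
      have hk' : k < S := by simpa using hk
      simp only [List.getElem_ofFn] at hx
      obtain ⟨hi, hx⟩ := List.getElem?_eq_some_iff.1 hx
      have hi' : i < 6 := hi
      have := hpc e ⟨k, hk'⟩ ⟨i, hi'⟩
      refine this.trans ?_
      rw [← hx]
      interval_cases i <;> rfl
  · choose! edge node W hP using fun k : {k : Fin S // 0 < L k} =>
      hE.exists_isEdgePath hf (hs k.1 k.1.2).path
        (fun i hi => splits_pos hA (hE.isSplittable hf) hs k.1 k.1.2.le _
          ((hs k.1 k.1.2).path.mem i hi) ((hs k.1 k.1.2).path.pos i hi)) k.2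
    have key := hE.sendsHalfInDouble_pathsRate hf hs hsend hP
    convert key using 1
    funext e θ
    rw [DirectedNetwork.pathsRate]
    simp only [RatSolution.flow, List.map_ofFn, List.sum_ofFn, Function.comp]
    -- Rounds without a path have only pieces of rate zero, so they can be left out of the sum.
    rw [← Finset.sum_filter_of_ne (p := fun k : Fin S => 0 < L k),
      Finset.sum_subtype (p := fun k : Fin S => 0 < L k) _ (by simp)]
    · refine sum_congr rfl fun k _ => ?_
      exact hE.indicator_eq hf (hP k) (hs k.1 k.1.2).path.inj (hrec e k.1) _ θ
    · intro k _ hne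
      by_contra hL
      rcases hrec e k with ⟨i, hi, -⟩ | ⟨-, h0⟩
      · omega
      · refine hne ?_
        simp [piece, Piece.rateAt, Fraction.val, h0]

end RAM

theorem theorem5 :
    (∀ (V E : Type*) [Fintype V] [Fintype E] (N : UndirectedNetwork V E) (T : ℝ), 0 ≤ T →
      N.SupplySendable T →
        ∃ (o : E → Bool) (f : E → ℝ → ℝ), N.SendsHalfInDouble T o f) ∧
    RAM.PolyTimeSolvable RatInstance.code (fun _ S => RatSolution.code S)
      (fun (I : RatInstance) (S : RatSolution I) =>
        I.network.SupplySendable I.horizon.val →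
          I.network.SendsHalfInDouble I.horizon.val S.dir S.flow) :=
  ⟨fun _ _ _ _ N _ hT h => N.exists_sendsHalfInDouble hT h, RAM.polyTimeSolvable_sendsHalfInDouble⟩
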